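/- **Setting.** Let $d\ge 2$, $\nu_1,\nu_2,\eta>0$, and let $p$ satisfy $2\le p\le \min\{4,\frac{2d}{d-2}\}$ (with $\frac{2d}{d-2}=\infty$ for $d=2$) and $p\ne 4$ if $d=2$. Let $\chi$ be a smooth radial cut-off with values in $[0,1]$, $\chi=1$ on $|\xi|\le\frac34$, $\chi=0$ on $|\xi|\ge\frac43$, $\varphi(\xi)=\chi(\xi/2)-\chi(\xi)\ge0$; put $\dot S_k=\chi(2^{-k}D)$, $\dot\Delta_k=\varphi(2^{-k}D)$. $\mathcal S_h'$ is the space of tempered distributions $f$ with $\|\theta(\lambda D)f\|_{L^\infty}\to0$ as $\lambda\to\infty$ for all $\theta\in C_c^\infty(\mathbb R^d)$, and $\|f\|_{\dot B^s_{q,r}}=\big\|(2^{ks}\|\dot\Delta_kf\|_{L^q})_{k\in\mathbb Z}\big\|_{\ell^r}$ for $f\in\mathcal S'_h$. For an integer threshold $k_0$ put $f^\ell=\dot S_{k_0}f$, $$\|f\|^\ell_{\dot B^s_{q,1}}=\sum_{k\le k_0}2^{ks}\|\dot\Delta_kf\|_{L^q},\qquad \|f\|^h_{\dot B^s_{q,1}}=\sum_{k\ge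 k_0-1}2^{ks}\|\dot\Delta_kf\|_{L^q},$$ and let $\|\cdot\|^{\ell}_{\tilde L^\rho(a,b;\dot B^s_{q,1})}$, $\|\cdot\|^{h}_{\tilde L^\rho(a,b;\dot B^s_{q,1})}$ be the same sums with $\|\dot\Delta_kf\|_{L^q}$ replaced by $\|\dot\Delta_kf\|_{L^\rho(a,b;L^q)}$ (and $\tilde L^\rho_t=\tilde L^\rho(0,t)$). $\dot{\mathbf B}^{s}_{2,\infty}$ is the set of $f\in\dot B^{s}_{2,\infty}$ for which there are $M_0,M>0$ and integers $j_k\to-\infty$ with $|j_k-j_{k+1}|\le M$ and $2^{sj_k}\|\dot\Delta_{j_k}f\|_{L^2}\ge M_0$ for all $k\in\mathbb N$. Write $\langle t\rangle=\sqrt{1+t^2}$, $\sigma_0=\frac d2-\frac{2d}p$, $\Lambda=(-\Delta)^{1/2}$, and $\mathbb P$ for the Leray projector. Let $(u_L,\tau_L)$, with $\tau_L$ a symmetric $d\times d$ tensor, be a solution on $[0,\infty)\times\mathbb R^d$, weakly continuous in time with values in $\mathcal S_h'$, of $$\partial_tu+\nabla P=\nu_1\operatorname{div}\tau,\qquad \partial_t\tau-\eta\Delta\tau=\nu_2D(u),\qquad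 \operatorname{div}u=0,\qquad (u,\tau)|_{t=0}=(u_0,\tau_0),$$ where $D(u)=\frac12(\nabla u+(\nabla u)^\top)$, and put $$E_0=\|(u_0,\tau_0)\|^\ell_{\dot B^{d/2-1}_{2,1}}+\|u_0\|^h_{\dot B^{d/p+1}_{p,1}}+\|\tau_0\|^h_{\dot B^{d/p}_{p,1}},\qquad \|(u,\tau)\|_{\dot{\mathbb B}^\sigma_{2,p}}=\|(u,\tau)^\ell\|_{\dot B^\sigma_{2,1}}+\|(u,\tau)\|^h_{\dot B^{d/p+1}_{p,1}} .$$ **Proposition.** For every sufficiently large threshold $k_0$ (depending only on $d,p,\nu_1,\nu_2,\eta,\chi$) the following holds. (1) There are constants $C,A>0$, depending only on $d,p,\nu_1,\nu_2,\eta,\chi,k_0$, such that for every solution and every $t>0$ $$\|(u_L,\tau_L)\|^\ell_{\tilde L^\infty_t(\dot B^{d/2-1}_{2,1})}+\|(u_L,\tau_L)\|^\ell_{\tilde L^1_t(\dot B^{d/2+1}_{2,1})}+\|e^{Ct}(\nabla u_L,\tau_L)\|^h_{\tilde L^\infty_t(\dot B^{d/p}_{p,1})}+\|(u_L,\nabla\tau_L)\|^h_{\tilde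 L^1_t(\dot B^{d/p+1}_{p,1})}+\|e^{Ct}\tau_L\|^h_{\tilde L^\infty(1,t;\dot B^{d/p+2}_{p,1})}\le A\,E_0 .$$ (2) Let $E_0<\infty$, $\sigma_0\le\sigma_1<\frac d2-1$, $\sigma>\sigma_1$ and $t_L\ge0$. Then $$\|(u_L,\tau_L)^\ell(t)\|_{\dot B^\sigma_{2,1}}\lesssim\langle t\rangle^{-\frac12(\sigma-\sigma_1)},\quad t>t_L,$$ if and only if $(u_0,\tau_0)^\ell\in\dot B^{\sigma_1}_{2,\infty}$. If moreover $$\langle t\rangle^{-\frac12(\sigma-\sigma_1)}\lesssim\|(u_L,\tau_L)^\ell(t)\|_{\dot B^\sigma_{2,1}}\lesssim\langle t\rangle^{-\frac12(\sigma-\sigma_1)},\quad t>t_L,\qquad(*)$$ then $(u_0,\tau_0)^\ell\in\dot{\mathbf B}^{\sigma_1}_{2,\infty}$. Conversely, if $(u_0,\mathbb P\Lambda^{-1}\operatorname{div}\tau_0)^\ell\in\dot{\mathbf B}^{\sigma_1}_{2,\infty}$ and $\tau_0^\ell\in\dot B^{\sigma_1}_{2,\infty}$, then $(*)$ holds. (3)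 Let $\sigma>\sigma_1$ be real numbers, let $\|(u_0,\tau_0)\|^\ell_{\dot B^\sigma_{2,1}}$, $\|u_0\|^h_{\dot B^{d/p+1}_{p,1}}$ and $\|\tau_0\|^h_{\dot B^{d/p}_{p,1}}$ be finite, and let $t_L\ge0$; if $t_L=0$, let also $\|\tau_0\|^h_{\dot B^{d/p+1}_{p,1}}$ be finite. Then all assertions of (2) hold with $\|(u_L,\tau_L)^\ell(t)\|_{\dot B^\sigma_{2,1}}$ replaced by $\|(u_L,\tau_L)(t)\|_{\dot{\mathbb B}^\sigma_{2,p}}$. -/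

import Mathlib

open MeasureTheory Filter Topology Set
open scoped ENNReal SchwartzMap ContDiff LineDeriv Laplacian

noncomputable section

namespace OldroydB

/-- Euclidean space `ℝ^d`. -/
abbrev Sp (d : ℕ) := EuclideanSpace ℝ (Fin d)

/-- (Complex valued) tempered distributions on `ℝ^d`. -/
abbrev Dist (d : ℕ) := 𝓢'(Sp d, ℂ)

/-- The Fourier multiplier `m(D)`, in the convention `D = -i∇`: Mathlib's Fourier transform uses
the kernel `exp (-2πi x·ξ)`, so its frequency variable has to be multiplied by `2π`. -/
def mult {d : ℕ} (m : Sp d → ℂ) (f : Dist d) : Dist d :=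
  TemperedDistribution.fourierMultiplierCLM ℂ (fun ξ => m ((2 * Real.pi) • ξ)) f

/-- The partial derivative `∂_i`. -/
def pd {d : ℕ} (i : Fin d) (f : Dist d) : Dist d := ∂_{EuclideanSpace.single i (1 : ℝ)} f

/-- The `L^p` norm of a tempered distribution (`∞` if it is not a function in `L^p`). -/
def distLp {d : ℕ} (p : ℝ≥0∞) (f : Dist d) : ℝ≥0∞ :=
  ⨅ (g : Sp d → ℂ) (_ : MemLp g p volume ∧ ∀ φ : 𝓢(Sp d, ℂ), f φ = ∫ x, φ x * g x),
    eLpNorm g p volume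

/-- The space `𝓢'_h`: for every test function `θ`, `‖θ(lD) f‖_{L^∞} → 0` as `l → ∞`. -/
def IsSh {d : ℕ} (f : Dist d) : Prop :=
  ∀ θ : Sp d → ℂ, ContDiff ℝ ∞ θ → HasCompactSupport θ →
    Tendsto (fun l : ℝ => distLp ⊤ (mult (fun ξ => θ (l • ξ)) f)) atTop (𝓝 0)

/-! ### Littlewood-Paley theory and Besov norms -/

/-- The low-frequency cut-off `χ` of a Littlewood-Paley decomposition; the annulus function is
`φ(ξ) = χ(ξ/2) - χ(ξ)`. -/
structure IsCutoff {d : ℕ} (χ : Sp d → ℝ) : Prop where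
  smooth : ContDiff ℝ ∞ χ
  radial : ∀ ξ ζ : Sp d, ‖ξ‖ = ‖ζ‖ → χ ξ = χ ζ
  mem_unit : ∀ ξ, χ ξ ∈ Icc (0 : ℝ) 1
  eq_one : ∀ ξ : Sp d, ‖ξ‖ ≤ 3 / 4 → χ ξ = 1
  eq_zero : ∀ ξ : Sp d, 4 / 3 ≤ ‖ξ‖ → χ ξ = 0
  annulus_nonneg : ∀ ξ : Sp d, χ ξ ≤ χ ((2 : ℝ)⁻¹ • ξ)

section LP

variable {d : ℕ} {ι : Type} [Fintype ι]

/-- `Ṡ_k f = χ(2^{-k} D) f`; in particular `f^ℓ = Ṡ_{k₀} f`. -/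
def lowCut (χ : Sp d → ℝ) (k : ℤ) (f : ι → Dist d) : ι → Dist d :=
  fun i => mult (fun ξ => ((χ ((2 : ℝ) ^ (-k) • ξ) : ℝ) : ℂ)) (f i)

/-- The dyadic block `Δ̇_k f = φ(2^{-k} D) f` with `φ(ξ) = χ(ξ/2) - χ(ξ)`. -/
def block (χ : Sp d → ℝ) (k : ℤ) (f : Dist d) : Dist d :=
  mult (fun ξ =>
    ((χ ((2 : ℝ)⁻¹ • (2 : ℝ) ^ (-k) • ξ) - χ ((2 : ℝ) ^ (-k) • ξ) : ℝ) : ℂ)) f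

/-- `‖Δ̇_k f‖_{L^p}` for a tuple `f`, as the sum over the components. -/
def blockNorm (χ : Sp d → ℝ) (p : ℝ≥0∞) (k : ℤ) (f : ι → Dist d) : ℝ≥0∞ :=
  ∑ i, distLp p (block χ k (f i))

/-- `∑_{k ∈ S} 2^{ks} ‖Δ̇_k f‖_{L^p}`: the `Ḃ^s_{p,1}` norm for `S = univ`, its low-frequency part
for `S = Iic k₀` and its high-frequency part for `S = Ici (k₀ - 1)`. -/
def besovOne (χ : Sp d → ℝ) (S : Set ℤ) (s : ℝ) (p : ℝ≥0∞) (f : ι → Dist d) : ℝ≥0∞ :=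
  ∑' k : S, (2 : ℝ≥0∞) ^ (s * ((k : ℤ) : ℝ)) * blockNorm χ p k f

/-- The Chemin-Lerner norm
`∑_{k ∈ S} 2^{ks} ‖Δ̇_k f‖_{L^ρ(a,b;L^p)}`, with the same meaning of `S` as in `besovOne`. -/
def cheminLerner (χ : Sp d → ℝ) (S : Set ℤ) (ρ : ℝ≥0∞) (a b : ℝ) (s : ℝ) (p : ℝ≥0∞)
    (f : ℝ → ι → Dist d) : ℝ≥0∞ :=
  ∑' k : S, (2 : ℝ≥0∞) ^ (s * ((k : ℤ) : ℝ)) *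
    eLpNorm (fun t => blockNorm χ p k (f t)) ρ (volume.restrict (Ioo a b))

/-- `f ∈ Ḃ^s_{2,∞}`. -/
def MemBesovSup (χ : Sp d → ℝ) (s : ℝ) (f : ι → Dist d) : Prop :=
  (∀ i, IsSh (f i)) ∧
    (⨆ k : ℤ, (2 : ℝ≥0∞) ^ (s * (k : ℝ)) * blockNorm χ 2 k f) < ⊤

/-- `f` lies in the subset of `Ḃ^s_{2,∞}` of those elements for which `2^{sj} ‖Δ̇_j f‖_{L²}` is
bounded below along a sequence `j_k → -∞` with bounded gaps. -/
def MemBesovBold (χ : Sp d → ℝ) (s : ℝ) (f : ι → Dist d) : Prop :=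
  MemBesovSup χ s f ∧
    ∃ M₀ : ℝ, 0 < M₀ ∧ ∃ M : ℝ, 0 < M ∧ ∃ j : ℕ → ℤ, Tendsto j atTop atBot ∧
      (∀ k, |(j k : ℝ) - (j (k + 1) : ℝ)| ≤ M) ∧
      ∀ k, ENNReal.ofReal M₀ ≤ (2 : ℝ≥0∞) ^ (s * (j k : ℝ)) * blockNorm χ 2 (j k) f

/-- `t ↦ e^{Ct} f(t)`. -/
def expWeight (C : ℝ) (f : ℝ → ι → Dist d) : ℝ → ι → Dist d :=
  fun t i => ((Real.exp (C * t) : ℝ) : ℂ) • f t i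

end LP

/-! ### The linear system -/

section System

variable {d : ℕ}

/-- The entries of a tensor as a tuple. -/
def entries (τ : Fin d → Fin d → Dist d) : Fin d × Fin d → Dist d := fun a => τ a.1 a.2

/-- The pair `(u, τ)` as one tuple. -/
def pair (u : Fin d → Dist d) (τ : Fin d → Fin d → Dist d) : Fin d ⊕ (Fin d × Fin d) → Dist d :=
  Sum.elim u (entries τ)

/-- `(∇u)_{ij} = ∂_j u^i`. -/
def grad (u : Fin d → Dist d) : Fin d → Fin d → Dist d := fun i j => pd j (u i)

/-- `(∇τ)_{ijm} = ∂_m τ^{ij}`. -/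
def gradTensor (τ : Fin d → Fin d → Dist d) : (Fin d × Fin d) × Fin d → Dist d :=
  fun a => pd a.2 (τ a.1.1 a.1.2)

/-- `(u, τ)` solves, in the sense of tempered distributions,
`∂_t u + ∇P = ν₁ div τ`, `∂_t τ - η Δτ = ν₂ D(u)`, `div u = 0`, `(u, τ)|_{t=0} = (u₀, τ₀)`,
with `τ` symmetric, `u(t), τ(t) ∈ 𝓢'_h` and weak continuity in time on `[0, ∞)`. Values at
negative times are irrelevant. -/
structure IsSolution (ν₁ ν₂ η : ℝ) (u₀ : Fin d → Dist d) (τ₀ : Fin d → Fin d → Dist d)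
    (u : ℝ → Fin d → Dist d) (τ : ℝ → Fin d → Fin d → Dist d) : Prop where
  init_u : u 0 = u₀
  init_τ : τ 0 = τ₀
  sh_u : ∀ t, 0 ≤ t → ∀ i, IsSh (u t i)
  sh_τ : ∀ t, 0 ≤ t → ∀ i j, IsSh (τ t i j)
  symm : ∀ t, 0 ≤ t → ∀ i j, τ t i j = τ t j i
  div_free : ∀ t, 0 ≤ t → ∑ i, pd i (u t i) = 0
  cont_u : ∀ i (φ : 𝓢(Sp d, ℂ)), ContinuousOn (fun t => u t i φ) (Ici 0)
  cont_τ : ∀ i j (φ : 𝓢(Sp d, ℂ)), ContinuousOn (fun t => τ t i j φ) (Ici 0)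
  momentum : ∃ P : ℝ → Dist d, ∀ t, 0 < t → ∀ i (φ : 𝓢(Sp d, ℂ)),
    HasDerivAt (fun s => u s i φ)
      (((ν₁ : ℂ) • (∑ j, pd j (τ t i j)) - pd i (P t)) φ) t
  stress : ∀ t, 0 < t → ∀ i j (φ : 𝓢(Sp d, ℂ)),
    HasDerivAt (fun s => τ s i j φ)
      (((η : ℂ) • (Δ (τ t i j)) + ((ν₂ : ℂ) * 2⁻¹) • (pd j (u t i) + pd i (u t j))) φ) t

/-- The symbol `(δ_{il} - ξ_i ξ_l / |ξ|²) (i ξ_j / |ξ|)` of the `(l, j)` entry of the `i`-th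
component of `ℙ Λ^{-1} div`. -/
def lerayRieszSymbol (i l j : Fin d) (ξ : Sp d) : ℂ :=
  (((if i = l then (1 : ℝ) else 0) - ξ i * ξ l / ‖ξ‖ ^ 2 : ℝ) : ℂ) *
    (Complex.I * ((ξ j / ‖ξ‖ : ℝ) : ℂ))

/-- `Z = ℙ Λ^{-1} div τ`, where `[div τ]^l = ∂_j τ^{lj}`. The symbol is singular at the origin, so
the identity is required after localization to frequencies away from `0`; together with
`Z ∈ 𝓢'_h` this determines `Z`. -/
def IsLerayRieszDiv (τ : Fin d → Fin d → Dist d) (Z : Fin d → Dist d) : Prop :=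
  (∀ i, IsSh (Z i)) ∧
    ∀ ψ : Sp d → ℂ, ContDiff ℝ ∞ ψ → HasCompactSupport ψ → (0 : Sp d) ∉ tsupport ψ →
      ∀ i, mult ψ (Z i) = ∑ l, ∑ j, mult (fun ξ => ψ ξ * lerayRieszSymbol i l j ξ) (τ l j)

end System

/-! ### The functionals of the statement -/

/-- `2 ≤ p ≤ min {4, 2d/(d-2)}`, and `p ≠ 4` if `d = 2` (where `2d/(d-2)` is read as `∞`). -/
def Admissible (d : ℕ) (p : ℝ) : Prop :=
  2 ≤ p ∧ p ≤ 4 ∧ p * ((d : ℝ) - 2) ≤ 2 * d ∧ (d = 2 → p ≠ 4)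

section Functionals

variable {d : ℕ}

/-- `E₀ = ‖(u₀,τ₀)‖^ℓ_{Ḃ^{d/2-1}_{2,1}} + ‖u₀‖^h_{Ḃ^{d/p+1}_{p,1}} + ‖τ₀‖^h_{Ḃ^{d/p}_{p,1}}`. -/
def initialEnergy (χ : Sp d → ℝ) (k₀ : ℤ) (p : ℝ)
    (u₀ : Fin d → Dist d) (τ₀ : Fin d → Fin d → Dist d) : ℝ≥0∞ :=
  besovOne χ (Iic k₀) ((d : ℝ) / 2 - 1) 2 (pair u₀ τ₀) +
    besovOne χ (Ici (k₀ - 1)) ((d : ℝ) / p + 1) (ENNReal.ofReal p) u₀ +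
    besovOne χ (Ici (k₀ - 1)) ((d : ℝ) / p) (ENNReal.ofReal p) (entries τ₀)

/-- The critical energy on `(0, t)`, with high frequencies weighted by `e^{Ct}`. -/
def linearEnergy (χ : Sp d → ℝ) (k₀ : ℤ) (p C : ℝ)
    (u : ℝ → Fin d → Dist d) (τ : ℝ → Fin d → Fin d → Dist d) (t : ℝ) : ℝ≥0∞ :=
  cheminLerner χ (Iic k₀) ⊤ 0 t ((d : ℝ) / 2 - 1) 2 (fun s => pair (u s) (τ s)) +
    cheminLerner χ (Iic k₀) 1 0 t ((d : ℝ) / 2 + 1) 2 (fun s => pair (u s) (τ s)) +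
    cheminLerner χ (Ici (k₀ - 1)) ⊤ 0 t ((d : ℝ) / p) (ENNReal.ofReal p)
      (expWeight C (fun s => Sum.elim (entries (grad (u s))) (entries (τ s)))) +
    cheminLerner χ (Ici (k₀ - 1)) 1 0 t ((d : ℝ) / p + 1) (ENNReal.ofReal p)
      (fun s => Sum.elim (u s) (gradTensor (τ s))) +
    cheminLerner χ (Ici (k₀ - 1)) ⊤ 1 t ((d : ℝ) / p + 2) (ENNReal.ofReal p)
      (expWeight C (fun s => entries (τ s)))

/-- `‖(u,τ)^ℓ‖_{Ḃ^σ_{2,1}}`. -/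
def lowNorm (χ : Sp d → ℝ) (k₀ : ℤ) (σ : ℝ)
    (u : Fin d → Dist d) (τ : Fin d → Fin d → Dist d) : ℝ≥0∞ :=
  besovOne χ univ σ 2 (lowCut χ k₀ (pair u τ))

/-- The hybrid norm `‖(u,τ)^ℓ‖_{Ḃ^σ_{2,1}} + ‖(u,τ)‖^h_{Ḃ^{d/p+1}_{p,1}}`. -/
def hybridNorm (χ : Sp d → ℝ) (k₀ : ℤ) (p σ : ℝ)
    (u : Fin d → Dist d) (τ : Fin d → Fin d → Dist d) : ℝ≥0∞ :=
  lowNorm χ k₀ σ u τ +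
    besovOne χ (Ici (k₀ - 1)) ((d : ℝ) / p + 1) (ENNReal.ofReal p) (pair u τ)

end Functionals

/-- `⟨t⟩ = (1 + t²)^{1/2}`. -/
def bracket (t : ℝ) : ℝ := Real.sqrt (1 + t ^ 2)

/-- `N(t) ≲ ⟨t⟩^{-a}` for `t > T`. -/
def UpperDecay (N : ℝ → ℝ≥0∞) (a T : ℝ) : Prop :=
  ∃ A : ℝ, 0 < A ∧ ∀ t, T < t → N t ≤ ENNReal.ofReal (A * bracket t ^ (-a))

/-- `⟨t⟩^{-a} ≲ N(t)` for `t > T`. -/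
def LowerDecay (N : ℝ → ℝ≥0∞) (a T : ℝ) : Prop :=
  ∃ A : ℝ, 0 < A ∧ ∀ t, T < t → ENNReal.ofReal (A * bracket t ^ (-a)) ≤ N t

end OldroydB

end

/-! Localized to frequencies of size `2^k` and projected onto divergence-free fields, the system
loses its pressure, and `U = ψ(D)u`, `W = ℙ div ψ(D)τ` satisfy, component by component, `U' = ν₁W`,
`W' = -η|ξ|²W - (ν₂/2)|ξ|²U`, the damped oscillator `h'' + η|ξ|²h' + (ν₁ν₂/2)|ξ|²h = 0`. The rest of
the stress is simple: adding `∂_j(-Δ)⁻¹W_i + ∂_i(-Δ)⁻¹W_j` to the localized `τ_ij` cancels the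
source `D(u)` and leaves a heat flow. So each block of `(u, τ)` is governed by a 2×2 propagator and
a heat multiplier, and bounds on these symbols are all that is needed.

Solutions are only weakly continuous distributions, so the representation is proved by duality
(`sum_mult_flow_const`): if `∂_s H = HA`, then `s ↦ H(r - s, D)X(s)` is constant. Differentiating it
uses a Taylor remainder that is uniform on bounded families of Schwartz functions, by
Banach-Steinhaus. The propagator may run backward, so estimates hold in both time directions.

At low frequencies an energy with a cross term (hypocoercivity) makes the oscillator decay like
`e^{-c|ξ|²t}`, and the plain energy grows at most like `e^{c'|ξ|²t}` backward; Plancherel turns this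
into two-sided bounds on `L²` blocks (`exists_low_block`). At high frequencies the characteristic
roots are real and distinct, one close to `ν₁ν₂/(2η)`, the other of size `η|ξ|²`. In the variables
`2^{-k}ξ` and `4^{-k}` all amplitudes and exponents are smooth up to `4^{-k} = 0`, and compactness
yields `L¹` kernel bounds uniform in `k` and `t`, hence `L^p` block estimates (`exists_high_block`):
damping for `u`; for `τ`, a parabolic part and a damped part smaller by `4^{-k}`. Summation over `k`
is part (1).

For the decay, the low-frequency blocks obey `e^{-c'4^k t}n_k(0) ≲ n_k(t) ≲ e^{-c4^k t}n_k(0)`.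
Upper decay is equivalent to boundedness of `2^{σ₁k}n_k(0)`: sum in one direction, test at `t =
4^{-k}` in the other. Given the upper bound, lower decay at `t = 4^m` forces a large block at
bounded distance from `-m`; conversely one large block with `4^k t` of order one suffices. The
blocks of `ℙΛ⁻¹div τ₀` are controlled by those of `τ₀`, so a lower sequence for the former data
gives one for `(u₀, τ₀)`. High frequencies in the hybrid norm are an exponentially small
perturbation (`DyadicDecay.decay_characterization`). -/

namespace OldroydB
open FourierTransform

/-! ### Algebra of Fourier multipliers on tempered distributions -/

section MultCalculus

variable {d : ℕ}

/-- Precomposition of a symbol with multiplication by `2π`. -/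
noncomputable def dil (m : Sp d → ℂ) : Sp d → ℂ := fun ξ => m ((2 * Real.pi) • ξ)

theorem hasTemperateGrowth_dil {m : Sp d → ℂ} (hm : m.HasTemperateGrowth) :
    (dil m).HasTemperateGrowth := by
  have h : (fun ξ : Sp d => (2 * Real.pi) • ξ).HasTemperateGrowth := by fun_prop
  exact hm.comp h

theorem mult_apply (m : Sp d → ℂ) (f : Dist d) (φ : 𝓢(Sp d, ℂ)) :
    mult m f φ = f (𝓕 (SchwartzMap.smulLeftCLM ℂ (dil m) (𝓕⁻ φ))) := rfl

theorem mult_mult {m n : Sp d → ℂ} (hm : m.HasTemperateGrowth) (hn : n.HasTemperateGrowth)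
    (f : Dist d) : mult m (mult n f) = mult (fun ξ => m ξ * n ξ) f := by
  have := TemperedDistribution.fourierMultiplierCLM_fourierMultiplierCLM_apply
    (hasTemperateGrowth_dil hn) (hasTemperateGrowth_dil hm) f
  refine this.trans ?_
  rw [mul_comm]; rfl

theorem mult_comm {m n : Sp d → ℂ} (hm : m.HasTemperateGrowth) (hn : n.HasTemperateGrowth)
    (f : Dist d) : mult m (mult n f) = mult n (mult m f) := by
  rw [mult_mult hm hn, mult_mult hn hm]
  simp only [mul_comm]

theorem mult_add (m : Sp d → ℂ) (f g : Dist d) : mult m (f + g) = mult m f + mult m g :=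
  map_add _ _ _

theorem mult_sub (m : Sp d → ℂ) (f g : Dist d) : mult m (f - g) = mult m f - mult m g :=
  map_sub _ _ _

theorem mult_smul (m : Sp d → ℂ) (c : ℂ) (f : Dist d) : mult m (c • f) = c • mult m f :=
  map_smul _ _ _

theorem mult_zero (m : Sp d → ℂ) : mult m (0 : Dist d) = 0 := map_zero _

theorem mult_sum {ι : Type*} (s : Finset ι) (m : Sp d → ℂ) (f : ι → Dist d) :
    mult m (∑ i ∈ s, f i) = ∑ i ∈ s, mult m (f i) :=
  map_sum _ _ _

theorem sum_mult {ι : Type*} (s : Finset ι) {m : ι → Sp d → ℂ}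
    (hm : ∀ i, (m i).HasTemperateGrowth) (f : Dist d) :
    ∑ i ∈ s, mult (m i) f = mult (fun ξ => ∑ i ∈ s, m i ξ) f := by
  have := TemperedDistribution.fourierMultiplierCLM_sum (E := Sp d) ℂ
    (g := fun i => dil (m i)) (s := s) (fun i _ => hasTemperateGrowth_dil (hm i))
  have h2 := congrArg (fun L => L f) this
  simp only [sum_apply] at h2
  exact h2.symm

theorem mult_add_symbol {m n : Sp d → ℂ} (hm : m.HasTemperateGrowth) (hn : n.HasTemperateGrowth)
    (f : Dist d) : mult (fun ξ => m ξ + n ξ) f = mult m f + mult n f := by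
  ext φ
  have : dil (fun ξ => m ξ + n ξ) = dil m + dil n := rfl
  simp only [mult_apply, this, SchwartzMap.smulLeftCLM_add (hasTemperateGrowth_dil hm)
    (hasTemperateGrowth_dil hn), add_apply, FourierTransform.fourier_add, map_add]

theorem mult_const_mul {m : Sp d → ℂ} (hm : m.HasTemperateGrowth) (c : ℂ)
    (f : Dist d) : mult (fun ξ => c * m ξ) f = c • mult m f := by
  have := congrArg (fun L => L f)
    (TemperedDistribution.fourierMultiplierCLM_smul (F := ℂ) (hasTemperateGrowth_dil hm) c)
  exact this

theorem mult_zero_symbol (f : Dist d) : mult (fun _ => 0) f = 0 := by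
  have := congrArg (fun L => L f)
    (TemperedDistribution.fourierMultiplierCLM_const (E := Sp d) (F := ℂ) 0)
  refine this.trans ?_
  simp

theorem mult_one_symbol (f : Dist d) : mult (fun _ => 1) f = f := by
  have := congrArg (fun L => L f)
    (TemperedDistribution.fourierMultiplierCLM_const (E := Sp d) (F := ℂ) 1)
  refine this.trans ?_
  simp

/-- The symbol `iξ_j` of `∂_j`. -/
noncomputable def pdSymbol (j : Fin d) (ξ : Sp d) : ℂ := Complex.I * ((ξ j : ℝ) : ℂ)

theorem hasTemperateGrowth_coord (j : Fin d) :
    (fun ξ : Sp d => ((ξ j : ℝ) : ℂ)).HasTemperateGrowth := by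
  have : (fun ξ : Sp d => ξ j).HasTemperateGrowth :=
    (EuclideanSpace.proj j : Sp d →L[ℝ] ℝ).hasTemperateGrowth
  exact Function.HasTemperateGrowth.comp (g := Complex.ofReal) (by fun_prop) this

theorem hasTemperateGrowth_pdSymbol (j : Fin d) :
    (pdSymbol j : Sp d → ℂ).HasTemperateGrowth :=
  (Function.HasTemperateGrowth.const Complex.I).mul (hasTemperateGrowth_coord j)

theorem hasTemperateGrowth_normSq :
    (fun ξ : Sp d => ((‖ξ‖ ^ 2 : ℝ) : ℂ)).HasTemperateGrowth :=
  Function.HasTemperateGrowth.comp (g := Complex.ofReal) (by fun_prop) (Function.hasTemperateGrowth_norm_sq (H := Sp d))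

/-- The factor `2π` of the Fourier kernel cancels against the dilation built into `mult`, so the
symbol is `iξ_j` without constants. -/
theorem pd_eq_mult (j : Fin d) (f : Dist d) : pd j f = mult (pdSymbol j) f := by
  rw [pd, TemperedDistribution.lineDeriv_eq_fourierMultiplierCLM]
  have h : (fun ξ : Sp d => ((inner ℝ ξ (EuclideanSpace.single j (1 : ℝ)) : ℝ) : ℂ)).HasTemperateGrowth :=
    by fun_prop
  have := congrArg (fun L => L f)
    (TemperedDistribution.fourierMultiplierCLM_smul (F := ℂ) h (2 * Real.pi * Complex.I))
  refine this.symm.trans ?_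
  unfold mult
  congr 2
  ext ξ
  have hj : inner ℝ ξ (EuclideanSpace.single j (1 : ℝ)) = ξ j := by
    simp [EuclideanSpace.inner_single_right]
  simp [pdSymbol, hj]
  ring

theorem laplacian_eq_mult (f : Dist d) :
    Δ f = mult (fun ξ => -((‖ξ‖ ^ 2 : ℝ) : ℂ)) f := by
  rw [TemperedDistribution.laplacian_eq_fourierMultiplierCLM]
  have := congrArg (fun L => L f)
    (TemperedDistribution.fourierMultiplierCLM_smul (F := ℂ) (hasTemperateGrowth_normSq (d := d))
      (((-(2 * Real.pi) ^ 2 : ℝ)) : ℂ))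
  refine Eq.trans ?_ (this.symm.trans ?_)
  · exact (Complex.coe_smul (-(2 * Real.pi) ^ 2) (TemperedDistribution.fourierMultiplierCLM ℂ
      (fun x : Sp d => ((‖x‖ ^ 2 : ℝ) : ℂ)) f)).symm
  · unfold mult
    congr 2
    ext ξ
    simp [norm_smul, abs_of_pos Real.pi_pos]
    ring

/-- Smooth compactly supported symbols. -/
def IsTest (m : Sp d → ℂ) : Prop := ContDiff ℝ ∞ m ∧ HasCompactSupport m

theorem IsTest.tg {m : Sp d → ℂ} (h : IsTest m) : m.HasTemperateGrowth :=
  h.2.hasTemperateGrowth h.1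

end MultCalculus

/-! ### `L^p` norms of distributions and `L^p` bounds for multipliers -/

section LpNorm

variable {d : ℕ}

/-- The function `g ∈ L^p` represents the tempered distribution `f`. -/
def Represents (p : ℝ≥0∞) (f : Dist d) (g : Sp d → ℂ) : Prop :=
  MemLp g p volume ∧ ∀ φ : 𝓢(Sp d, ℂ), f φ = ∫ x, φ x * g x

theorem Represents.distLp_le {p : ℝ≥0∞} {f : Dist d} {g : Sp d → ℂ} (h : Represents p f g) :
    distLp p f ≤ eLpNorm g p volume :=
  iInf₂_le g h

theorem exists_represents {p : ℝ≥0∞} {f : Dist d} {c : ℝ≥0∞} (h : distLp p f < c) :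
    ∃ g, Represents p f g ∧ eLpNorm g p volume < c := by
  simp only [distLp, iInf_lt_iff] at h
  obtain ⟨g, hg, h⟩ := h
  exact ⟨g, hg, h⟩

theorem integrable_schwartz_mul {p : ℝ≥0∞} (hp : 1 ≤ p) {g : Sp d → ℂ} (hg : MemLp g p volume)
    (φ : 𝓢(Sp d, ℂ)) : Integrable (fun x => φ x * g x) := by
  have := ENNReal.HolderConjugate.inv_one_sub_inv' hp
  have h1 : MemLp (φ : Sp d → ℂ) ((1 - p⁻¹)⁻¹) volume := φ.memLp _ _
  exact MemLp.integrable_mul h1 hg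

theorem Represents.add {p : ℝ≥0∞} (hp : 1 ≤ p) {f₁ f₂ : Dist d} {g₁ g₂ : Sp d → ℂ}
    (h₁ : Represents p f₁ g₁) (h₂ : Represents p f₂ g₂) : Represents p (f₁ + f₂) (g₁ + g₂) := by
  refine ⟨h₁.1.add h₂.1, fun φ => ?_⟩
  have : (f₁ + f₂) φ = f₁ φ + f₂ φ := rfl
  rw [this, h₁.2, h₂.2, ← integral_add (integrable_schwartz_mul hp h₁.1 φ)
    (integrable_schwartz_mul hp h₂.1 φ)]
  simp [mul_add]

theorem distLp_add_le {p : ℝ≥0∞} (hp : 1 ≤ p) (f₁ f₂ : Dist d) :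
    distLp p (f₁ + f₂) ≤ distLp p f₁ + distLp p f₂ := by
  refine ENNReal.le_of_forall_pos_le_add fun ε hε h => ?_
  have h1 : distLp p f₁ < ⊤ := (le_add_right le_rfl).trans_lt h
  have h2 : distLp p f₂ < ⊤ := (le_add_left le_rfl).trans_lt h
  have hε' : (ε / 2 : ℝ≥0∞) ≠ 0 := by simp [hε.ne']
  obtain ⟨g₁, hg₁, hl₁⟩ := exists_represents (ENNReal.lt_add_right h1.ne hε')
  obtain ⟨g₂, hg₂, hl₂⟩ := exists_represents (ENNReal.lt_add_right h2.ne hε')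
  refine (hg₁.add hp hg₂).distLp_le.trans ((eLpNorm_add_le hg₁.1.1 hg₂.1.1 hp).trans ?_)
  refine (add_le_add hl₁.le hl₂.le).trans (le_of_eq ?_)
  rw [add_add_add_comm, ENNReal.add_halves]

theorem distLp_zero (p : ℝ≥0∞) : distLp p (0 : Dist d) = 0 := by
  refine le_antisymm ?_ zero_le
  refine (Represents.distLp_le (g := 0) ⟨MemLp.zero, fun φ => ?_⟩).trans (by simp)
  simp

theorem distLp_sum_le {p : ℝ≥0∞} (hp : 1 ≤ p) {ι : Type*} (s : Finset ι) (f : ι → Dist d) :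
    distLp p (∑ i ∈ s, f i) ≤ ∑ i ∈ s, distLp p (f i) := by
  classical
  induction s using Finset.induction_on with
  | empty => simp [distLp_zero]
  | insert a s ha ih =>
    rw [Finset.sum_insert ha, Finset.sum_insert ha]
    exact (distLp_add_le hp _ _).trans (add_le_add le_rfl ih)

theorem distLp_smul_le (p : ℝ≥0∞) (c : ℂ) (hc : c ≠ 0) (f : Dist d) :
    distLp p (c • f) ≤ ENNReal.ofReal ‖c‖ * distLp p f := by
  have hc' : ENNReal.ofReal ‖c‖ ≠ 0 := by simpa using hc
  rw [mul_comm, ← ENNReal.div_le_iff_le_mul (Or.inl hc') (Or.inl ENNReal.ofReal_ne_top)]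
  refine le_iInf₂ fun g hg => ?_
  rw [ENNReal.div_le_iff_le_mul (Or.inl hc') (Or.inl ENNReal.ofReal_ne_top), mul_comm]
  have : Represents p (c • f) (c • g) := by
    refine ⟨hg.1.const_smul c, fun φ => ?_⟩
    have : (c • f) φ = c * f φ := rfl
    rw [this, hg.2, ← integral_const_mul]
    congr 1; ext x; simp; ring
  refine this.distLp_le.trans ?_
  rw [eLpNorm_const_smul, ofReal_norm]

theorem distLp_neg_le (p : ℝ≥0∞) (f : Dist d) : distLp p (-f) ≤ distLp p f := by
  have := distLp_smul_le p (-1) (by simp) f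
  rw [neg_one_smul ℂ f] at this
  simpa using this

theorem distLp_sub_le {p : ℝ≥0∞} (hp : 1 ≤ p) (f₁ f₂ : Dist d) :
    distLp p (f₁ - f₂) ≤ distLp p f₁ + distLp p f₂ := by
  rw [sub_eq_add_neg]
  exact (distLp_add_le hp _ _).trans (add_le_add le_rfl (distLp_neg_le p f₂))

/-- The multiplier `m(D)` is bounded on `L^p` with constant `C`. -/
def LpB (p : ℝ≥0∞) (m : Sp d → ℂ) (C : ℝ) : Prop :=
  ∀ f : Dist d, distLp p (mult m f) ≤ ENNReal.ofReal C * distLp p f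

theorem LpB.mono {p : ℝ≥0∞} {m : Sp d → ℂ} {C C' : ℝ} (h : LpB p m C) (hC : C ≤ C') :
    LpB p m C' :=
  fun f => (h f).trans (by gcongr)

/-- A distribution without representative has norm `∞`, and `C > 0` keeps the right side infinite;
so only distributions given by functions have to be tested. -/
theorem LpB.of_represents {p : ℝ≥0∞} {m : Sp d → ℂ} {C : ℝ} (hC : 0 < C)
    (h : ∀ f g, Represents p f g →
      ∃ G, Represents p (mult m f) G ∧ eLpNorm G p volume ≤ ENNReal.ofReal C * eLpNorm g p volume) :
    LpB p m C := by
  intro f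
  have hc' : ENNReal.ofReal C ≠ 0 := by simpa using hC
  rw [mul_comm, ← ENNReal.div_le_iff_le_mul (Or.inl hc') (Or.inl ENNReal.ofReal_ne_top)]
  refine le_iInf₂ fun g hg => ?_
  rw [ENNReal.div_le_iff_le_mul (Or.inl hc') (Or.inl ENNReal.ofReal_ne_top), mul_comm]
  obtain ⟨G, hG, hl⟩ := h f g hg
  exact hG.distLp_le.trans hl

theorem LpB.add {p : ℝ≥0∞} (hp : 1 ≤ p) {m n : Sp d → ℂ} {C D : ℝ} (hC : 0 ≤ C) (hD : 0 ≤ D)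
    (hm : m.HasTemperateGrowth) (hn : n.HasTemperateGrowth) (h : LpB p m C) (h' : LpB p n D) :
    LpB p (fun ξ => m ξ + n ξ) (C + D) := by
  intro f
  rw [mult_add_symbol hm hn, ENNReal.ofReal_add hC hD, add_mul]
  exact (distLp_add_le hp _ _).trans (add_le_add (h f) (h' f))

theorem LpB.const_mul {p : ℝ≥0∞} {m : Sp d → ℂ} {C : ℝ} {c : ℂ} (hc : c ≠ 0)
    (hm : m.HasTemperateGrowth) (h : LpB p m C) :
    LpB p (fun ξ => c * m ξ) (‖c‖ * C) := by
  intro f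
  rw [mult_const_mul hm, ENNReal.ofReal_mul (norm_nonneg c), mul_assoc]
  exact (distLp_smul_le p c hc _).trans (by gcongr; exact h f)

end LpNorm

/-! ### Multipliers on `L²` -/

section Plancherel

variable {d : ℕ}

/-- By Plancherel a sup bound on the symbol is enough. Temperate growth only serves to identify the
product in `L²` with the distributional multiplier. -/
theorem lpB_two {m : Sp d → ℂ} {C : ℝ} (hC : 0 < C) (hm : m.HasTemperateGrowth)
    (hb : ∀ ξ, ‖m ξ‖ ≤ C) : LpB 2 m C := by
  refine LpB.of_represents hC fun f g hg => ?_
  have hdm : MemLp (dil m) ⊤ (volume : Measure (Sp d)) :=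
    memLp_top_of_bound (hasTemperateGrowth_dil hm).1.continuous.aestronglyMeasurable C
      (Eventually.of_forall fun ξ => hb _)
  set gL : Lp ℂ 2 (volume : Measure (Sp d)) := hg.1.toLp g with hgL
  have hf : f = (gL : 𝓢'(Sp d, ℂ)) := by
    ext φ
    rw [hg.2, Lp.toTemperedDistribution_apply]
    refine integral_congr_ae ?_
    filter_upwards [hg.1.coeFn_toLp] with x hx
    rw [hgL, hx, smul_eq_mul]
  set h : Lp ℂ 2 (volume : Measure (Sp d)) := (hdm.toLp _ : Lp ℂ ⊤ volume) • (𝓕 gL) with hh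
  have hmult : mult m f = ((𝓕⁻ h : Lp ℂ 2 (volume : Measure (Sp d))) : 𝓢'(Sp d, ℂ)) := by
    rw [← Lp.fourierInv_toTemperedDistribution_eq, hh,
      Lp.toTemperedDistribution_smul_eq (hasTemperateGrowth_dil hm) hdm, 
      ← Lp.fourier_toTemperedDistribution_eq, ← hf]
    rfl
  refine ⟨(𝓕⁻ h : Lp ℂ 2 (volume : Measure (Sp d))), ⟨Lp.memLp _, fun φ => ?_⟩, ?_⟩
  · rw [hmult, Lp.toTemperedDistribution_apply]
    rfl
  · have h1 : ‖(𝓕⁻ h : Lp ℂ 2 (volume : Measure (Sp d)))‖ = ‖h‖ := by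
      rw [← Lp.norm_fourier_eq (𝓕⁻ h), FourierTransform.fourier_fourierInv_eq]
    have h2 : ‖h‖ ≤ C * ‖gL‖ := by
      rw [← Lp.norm_fourier_eq gL]
      refine Lp.norm_le_mul_norm_of_ae_le_mul ?_
      filter_upwards [Lp.coeFn_lpSMul (r := 2) (hdm.toLp _ : Lp ℂ ⊤ volume) (𝓕 gL),
        hdm.coeFn_toLp] with x hx hx'
      rw [hx, Pi.smul_apply', hx', norm_smul]
      gcongr
      exact hb _
    rw [← h1, Lp.norm_def, Lp.norm_def] at h2
    have h3 := ENNReal.ofReal_le_ofReal h2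
    rw [ENNReal.ofReal_mul hC.le, ENNReal.ofReal_toReal (Lp.eLpNorm_ne_top _),
      ENNReal.ofReal_toReal (Lp.eLpNorm_ne_top _)] at h3
    refine h3.trans (le_of_eq ?_)
    rw [eLpNorm_congr_ae hg.1.coeFn_toLp]

end Plancherel

/-! ### Young's inequality with an integrable kernel -/

section Young

variable {d : ℕ}

/-- Hölder for the splitting `k = k^{1/q} k^{1/p}` moves the power `p` inside the integral at the
cost of `(∫ k)^{p/q}`; Tonelli then gives one more factor `∫ k`. -/
theorem lintegral_convolution_rpow_le {p : ℝ} (hp : 1 < p) {k g : Sp d → ℝ≥0∞}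
    (hk : Measurable k) (hg : Measurable g) :
    ∫⁻ x, (∫⁻ y, k (y - x) * g y) ^ p ≤ (∫⁻ y, k y) ^ p * ∫⁻ y, g y ^ p := by
  set q := p.conjExponent with hq
  have hpq : p.HolderConjugate q := Real.HolderConjugate.conjExponent hp
  have hp0 : 0 < p := by linarith
  set K := ∫⁻ y, k y with hK
  have hKx : ∀ x : Sp d, ∫⁻ y, k (y - x) = K := fun x => lintegral_sub_right_eq_self k x
  have hKy : ∀ y : Sp d, ∫⁻ x, k (y - x) = K := fun y => lintegral_sub_left_eq_self k y
  have h1 : ∀ x : Sp d, (∫⁻ y, k (y - x) * g y) ^ p ≤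
      K ^ (p / q) * ∫⁻ y, k (y - x) * g y ^ p := by
    intro x
    have hkx : Measurable fun y => k (y - x) := hk.comp (measurable_id.sub_const x)
    have := ENNReal.lintegral_mul_le_Lp_mul_Lq volume hpq.symm
      (f := fun y => k (y - x) ^ (1 / q)) (g := fun y => k (y - x) ^ (1 / p) * g y)
      (hkx.pow_const _).aemeasurable ((hkx.pow_const _).mul hg).aemeasurable
    have e1 : ∀ y, ((fun y => k (y - x) ^ (1 / q)) * fun y => k (y - x) ^ (1 / p) * g y) y
        = k (y - x) * g y := by
      intro y
      simp only [Pi.mul_apply]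
      rw [← mul_assoc, ← ENNReal.rpow_add_of_nonneg _ _ hpq.symm.one_div_nonneg hpq.one_div_nonneg]
      have : 1 / q + 1 / p = 1 := by
        have := hpq.inv_add_inv_eq_one; simp only [one_div]; linarith
      rw [this, ENNReal.rpow_one]
    have e2 : ∀ y, (k (y - x) ^ (1 / q)) ^ q = k (y - x) := by
      intro y
      rw [← ENNReal.rpow_mul, one_div_mul_cancel hpq.symm.ne_zero, ENNReal.rpow_one]
    have e3 : ∀ y, (k (y - x) ^ (1 / p) * g y) ^ p = k (y - x) * g y ^ p := by
      intro y
      rw [ENNReal.mul_rpow_of_nonneg _ _ hp0.le, ← ENNReal.rpow_mul,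
        one_div_mul_cancel hp0.ne', ENNReal.rpow_one]
    simp only [e1, e2, e3, hKx] at this
    have h2 := ENNReal.rpow_le_rpow this hp0.le
    rw [ENNReal.mul_rpow_of_nonneg _ _ hp0.le, ← ENNReal.rpow_mul, ← ENNReal.rpow_mul,
      one_div_mul_cancel hp0.ne', ENNReal.rpow_one] at h2
    convert h2 using 3
    ring
  have hmeas : Measurable (Function.uncurry fun x y : Sp d => k (y - x) * g y ^ p) :=
    (hk.comp (measurable_snd.sub measurable_fst)).mul ((hg.comp measurable_snd).pow_const p)
  calc ∫⁻ x, (∫⁻ y, k (y - x) * g y) ^ p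
      ≤ ∫⁻ x, K ^ (p / q) * ∫⁻ y, k (y - x) * g y ^ p := lintegral_mono h1
    _ = K ^ (p / q) * ∫⁻ x, ∫⁻ y, k (y - x) * g y ^ p :=
        lintegral_const_mul _ hmeas.lintegral_prod_right'
    _ = K ^ (p / q) * ∫⁻ y, ∫⁻ x, k (y - x) * g y ^ p := by
        rw [lintegral_lintegral_swap hmeas.aemeasurable]
    _ = K ^ (p / q) * ∫⁻ y, K * g y ^ p := by
        congr 1
        refine lintegral_congr fun y => ?_
        have hky : Measurable fun x => k (y - x) := hk.comp (measurable_const.sub measurable_id)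
        rw [lintegral_mul_const _ hky, hKy]
    _ = K ^ (p / q) * K * ∫⁻ y, g y ^ p := by
        rw [lintegral_const_mul _ (hg.pow_const p), mul_assoc]
    _ = K ^ p * ∫⁻ y, g y ^ p := by
        congr 1
        nth_rewrite 2 [← ENNReal.rpow_one K]
        rw [← ENNReal.rpow_add_of_nonneg _ _ (div_nonneg hp0.le hpq.symm.nonneg) zero_le_one]
        congr 1
        have := hpq.inv_add_inv_eq_one
        have hq0 := hpq.symm.ne_zero
        field_simp at this ⊢
        linarith

theorem eLpNorm_lintegral_convolution_le {p : ℝ} (hp : 1 < p) {k g : Sp d → ℝ≥0∞}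
    (hk : Measurable k) (hg : AEMeasurable g) :
    eLpNorm (fun x => ∫⁻ y, k (y - x) * g y) (ENNReal.ofReal p) volume ≤
      (∫⁻ y, k y) * eLpNorm g (ENNReal.ofReal p) volume := by
  have hp0 : 0 < p := by linarith
  obtain ⟨g', hg', hgg'⟩ := hg
  have e : (fun x => ∫⁻ y, k (y - x) * g y) = fun x => ∫⁻ y, k (y - x) * g' y := by
    ext x
    refine lintegral_congr_ae ?_
    filter_upwards [hgg'] with y hy
    rw [hy]
  rw [e, eLpNorm_congr_ae hgg', eLpNorm_eq_lintegral_rpow_enorm_toReal (by simpa using hp0)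
    ENNReal.ofReal_ne_top, eLpNorm_eq_lintegral_rpow_enorm_toReal (by simpa using hp0)
    ENNReal.ofReal_ne_top, ENNReal.toReal_ofReal hp0.le]
  simp only [enorm_eq_self]
  have := ENNReal.rpow_le_rpow (lintegral_convolution_rpow_le hp hk hg')
    (z := 1 / p) (by positivity)
  refine this.trans (le_of_eq ?_)
  rw [ENNReal.mul_rpow_of_nonneg _ _ (by positivity), ← ENNReal.rpow_mul,
    mul_one_div_cancel hp0.ne', ENNReal.rpow_one]

end Young

/-! ### `L^p` multipliers with integrable kernels -/

section Kernel

variable {d : ℕ}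

theorem IsTest.dil {m : Sp d → ℂ} (h : IsTest m) : IsTest (dil m) := by
  refine ⟨h.1.comp (by fun_prop), ?_⟩
  exact h.2.comp_homeomorph (Homeomorph.smulOfNeZero (2 * Real.pi) (by positivity))

/-- A smooth compactly supported function as a Schwartz function. -/
noncomputable def IsTest.toS {m : Sp d → ℂ} (h : IsTest m) : 𝓢(Sp d, ℂ) :=
  h.2.toSchwartzMap h.1

/-- The transposed multiplier acts on test functions by convolution with `𝓕 m`. -/
theorem fourier_smul_fourierInv_apply {M : Sp d → ℂ} (hM : IsTest M) (φ : 𝓢(Sp d, ℂ)) (y : Sp d) :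
    𝓕 (SchwartzMap.smulLeftCLM ℂ M (𝓕⁻ φ)) y = ∫ x, (𝓕 hM.toS) (y - x) * φ x := by
  set k : 𝓢(Sp d, ℂ) := 𝓕 hM.toS with hk
  set S : 𝓢(Sp d, ℂ) := SchwartzMap.convolution (ContinuousLinearMap.mul ℂ ℂ) k φ with hS
  have h1 : SchwartzMap.smulLeftCLM ℂ M (𝓕⁻ φ) = 𝓕⁻ S := by
    ext ξ
    have e : ∀ f : 𝓢(Sp d, ℂ), (𝓕⁻ f) ξ = (𝓕 f) (-ξ) := by
      intro f
      rw [SchwartzMap.fourierInv_coe, SchwartzMap.fourier_coe, Real.fourierInv_eq_fourier_neg]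
    rw [SchwartzMap.smulLeftCLM_apply_apply hM.tg, e S, hS, SchwartzMap.fourier_convolution]
    have hkξ : M ξ = (𝓕⁻ k) ξ := by
      rw [hk, FourierTransform.fourierInv_fourier_eq]; rfl
    rw [hkξ, e k, e φ]
    simp [SchwartzMap.pairing_apply_apply]
  rw [h1, FourierTransform.fourier_fourierInv_eq, hS, SchwartzMap.convolution_apply,
    MeasureTheory.convolution_eq_swap]
  simp

/-- The `L¹` norm of the kernel of `m(D)`. -/
noncomputable def kernelNorm (m : Sp d → ℂ) : ℝ := ∫ x, ‖𝓕 (dil m) x‖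

/-- The multiplier acts on a test function as convolution with `𝓕 (dil m)`; Fubini moves this
convolution onto the representative `g`, and Young's inequality bounds the resulting function `G`.
-/
theorem lpB_of_kernelNorm {p : ℝ} (hp : 1 < p) {m : Sp d → ℂ} (hm : IsTest m) {C : ℝ} (hC : 0 < C)
    (h : kernelNorm m ≤ C) : LpB (ENNReal.ofReal p) m C := by
  refine LpB.of_represents hC fun f g hg => ?_
  have hp1 : 1 ≤ ENNReal.ofReal p := by simpa using hp.le
  set k : 𝓢(Sp d, ℂ) := 𝓕 hm.dil.toS with hk
  have hkc : Continuous k := k.continuous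
  have hkm : Measurable fun y => ‖k y‖ₑ := hkc.measurable.enorm
  have hk1 : ∫⁻ y, ‖k y‖ₑ ≤ ENNReal.ofReal C := by
    have : ∫⁻ y, ‖k y‖ₑ = ENNReal.ofReal (kernelNorm m) := by
      rw [kernelNorm, ofReal_integral_norm_eq_lintegral_enorm]
      · rfl
      · exact k.integrable
    rw [this]
    exact ENNReal.ofReal_le_ofReal h
  set H : Sp d → ℝ≥0∞ := fun x => ∫⁻ y, ‖k (y - x)‖ₑ * ‖g y‖ₑ with hH
  have hHn : eLpNorm H (ENNReal.ofReal p) volume ≤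
      ENNReal.ofReal C * eLpNorm g (ENNReal.ofReal p) volume := by
    refine (eLpNorm_lintegral_convolution_le hp hkm hg.1.1.enorm).trans ?_
    rw [eLpNorm_enorm]
    gcongr
  set G : Sp d → ℂ := fun x => ∫ y, k (y - x) * g y with hG
  have hGH : ∀ x, ‖G x‖ₑ ≤ H x := by
    intro x
    refine (enorm_integral_le_lintegral_enorm _).trans (le_of_eq ?_)
    simp [hH, enorm_mul]
  have hmeas : AEStronglyMeasurable (fun q : Sp d × Sp d => k (q.2 - q.1) * g q.2)
      (volume.prod volume) :=
    (hkc.comp (continuous_snd.sub continuous_fst)).aestronglyMeasurable.mul hg.1.1.comp_snd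
  have hGm : AEStronglyMeasurable G volume := hmeas.integral_prod_right'
  have hGn : eLpNorm G (ENNReal.ofReal p) volume ≤
      ENNReal.ofReal C * eLpNorm g (ENNReal.ofReal p) volume :=
    (eLpNorm_mono_enorm (by simpa using hGH)).trans hHn
  refine ⟨G, ⟨⟨hGm, hGn.trans_lt (ENNReal.mul_lt_top ENNReal.ofReal_lt_top hg.1.2)⟩, fun φ => ?_⟩,
    hGn⟩
  have hmeas2 : AEStronglyMeasurable (fun q : Sp d × Sp d => φ q.1 * (k (q.2 - q.1) * g q.2))
      (volume.prod volume) :=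
    (φ.continuous.comp continuous_fst).aestronglyMeasurable.mul hmeas
  have hHm : AEMeasurable H volume :=
    (AEMeasurable.mul (hkm.comp (measurable_snd.sub measurable_fst)).aemeasurable
      hg.1.1.comp_snd.enorm : AEMeasurable (fun q : Sp d × Sp d => ‖k (q.2 - q.1)‖ₑ * ‖g q.2‖ₑ)
        (volume.prod volume)).lintegral_prod_right'
  -- Absolute integrability for Fubini: `φ ∈ L^q` is paired with the majorant `H ∈ L^p`.
  have hint : Integrable (fun q : Sp d × Sp d => φ q.1 * (k (q.2 - q.1) * g q.2))
      (volume.prod volume) := by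
    refine ⟨hmeas2, ?_⟩
    rw [HasFiniteIntegral, lintegral_prod _ hmeas2.enorm]
    have e : ∀ x, ∫⁻ y, ‖φ x * (k (y - x) * g y)‖ₑ = ‖φ x‖ₑ * H x := by
      intro x
      simp only [enorm_mul, hH]
      rw [lintegral_const_mul']
      exact enorm_ne_top
    simp only [e]
    have hpq : p.HolderConjugate p.conjExponent := Real.HolderConjugate.conjExponent hp
    refine (ENNReal.lintegral_mul_le_Lp_mul_Lq volume hpq.symm
      φ.continuous.measurable.enorm.aemeasurable hHm).trans_lt ?_
    refine ENNReal.mul_lt_top ?_ ?_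
    · have := (φ.memLp (ENNReal.ofReal p.conjExponent) volume).2
      rw [eLpNorm_eq_lintegral_rpow_enorm_toReal (by simpa using hpq.symm.pos)
        ENNReal.ofReal_ne_top, ENNReal.toReal_ofReal hpq.symm.nonneg] at this
      exact this
    · have := hHn.trans_lt (ENNReal.mul_lt_top ENNReal.ofReal_lt_top hg.1.2)
      rw [eLpNorm_eq_lintegral_rpow_enorm_toReal (by simpa using hpq.pos)
        ENNReal.ofReal_ne_top, ENNReal.toReal_ofReal hpq.nonneg] at this
      exact this
  rw [mult_apply, hg.2]
  have e1 : ∀ y, 𝓕 (SchwartzMap.smulLeftCLM ℂ (OldroydB.dil m) (𝓕⁻ φ)) y * g y =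
      ∫ x, φ x * (k (y - x) * g y) := by
    intro y
    rw [fourier_smul_fourierInv_apply hm.dil φ y, ← integral_mul_const]
    congr 1; ext x; ring
  simp only [e1, hG]
  rw [← integral_integral_swap hint]
  refine integral_congr_ae (Eventually.of_forall fun x => ?_)
  simp only [integral_const_mul]

/-- Dilating the symbol by `l` turns the kernel `k` into `l^{-d} k(·/l)`, which has the same `L¹`
norm. Bounds at scale `2^k` thereby reduce to scale one. -/
theorem kernelNorm_comp_smul (m : Sp d → ℂ) {l : ℝ} (hl : 0 < l) :
    kernelNorm (fun ξ => m (l • ξ)) = kernelNorm m := by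
  have e : ∀ x, 𝓕 (dil fun ξ => m (l • ξ)) x = ((l ^ d)⁻¹ : ℝ) • 𝓕 (dil m) (l⁻¹ • x) := by
    intro x
    rw [Real.fourier_eq, Real.fourier_eq]
    have := Measure.integral_comp_smul (volume : Measure (Sp d))
      (fun v => Real.fourierChar (-(inner ℝ v (l⁻¹ • x))) • dil m v) l
    rw [finrank_euclideanSpace_fin, abs_of_pos (by positivity)] at this
    rw [← this]
    congr 1; ext v
    rw [inner_smul_left, inner_smul_right]
    simp only [dil, conj_trivial]
    rw [mul_inv_cancel_left₀ hl.ne', smul_comm]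
  simp only [kernelNorm, e, norm_smul]
  rw [integral_const_mul, Measure.integral_comp_smul (volume : Measure (Sp d))
    (fun x => ‖𝓕 (dil m) x‖) l⁻¹, finrank_euclideanSpace_fin, smul_eq_mul, ← mul_assoc]
  rw [Real.norm_of_nonneg (by positivity), inv_pow, inv_inv, abs_of_pos (by positivity),
    inv_mul_cancel₀ (by positivity), one_mul]

theorem IsTest.comp_smul {m : Sp d → ℂ} (h : IsTest m) {l : ℝ} (hl : l ≠ 0) :
    IsTest (fun ξ => m (l • ξ)) :=
  ⟨h.1.comp (by fun_prop), h.2.comp_homeomorph (Homeomorph.smulOfNeZero l hl)⟩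

theorem lpB_comp_smul {p : ℝ} (hp : 1 < p) {m : Sp d → ℂ} (hm : IsTest m) {C : ℝ} (hC : 0 < C)
    (h : kernelNorm m ≤ C) {l : ℝ} (hl : 0 < l) :
    LpB (ENNReal.ofReal p) (fun ξ => m (l • ξ)) C :=
  lpB_of_kernelNorm hp (hm.comp_smul hl.ne') hC ((kernelNorm_comp_smul m hl).trans_le h)

end Kernel

/-! ### Smooth families of functions: uniform derivative and Taylor bounds -/

section Families

variable {Q V : Type} [NormedAddCommGroup Q] [NormedSpace ℝ Q]
  [NormedAddCommGroup V] [NormedSpace ℝ V]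

theorem contDiffAt_partial_fderiv {W : Type} [NormedAddCommGroup W] [NormedSpace ℝ W]
    {H : Q × V → W} {q : Q × V} (h : ContDiffAt ℝ ∞ H q) :
    ContDiffAt ℝ ∞ (fun r : Q × V => fderiv ℝ (fun v => H (r.1, v)) r.2) q := by
  have h1 : ContDiffAt ℝ ∞ (Function.uncurry fun (r : Q × V) (v : V) => H (r.1, v)) (q, q.2) := by
    refine ContDiffAt.comp (g := H) (f := fun x : (Q × V) × V => (x.1.1, x.2)) (q, q.2) ?_
      (by fun_prop)
    simpa using h
  exact ContDiffAt.fderiv (f := fun (r : Q × V) (v : V) => H (r.1, v)) (g := fun r => r.2)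
    h1 contDiffAt_snd le_rfl

/-- The iterated derivatives in the second variable of a jointly smooth map are jointly smooth. -/
theorem contDiffAt_partial_iteratedFDeriv (n : ℕ) :
    ∀ {W : Type} [NormedAddCommGroup W] [NormedSpace ℝ W] {H : Q × V → W} {q : Q × V},
      ContDiffAt ℝ ∞ H q →
      ContDiffAt ℝ ∞ (fun r : Q × V => iteratedFDeriv ℝ n (fun v => H (r.1, v)) r.2) q := by
  induction n with
  | zero =>
    intro W _ _ H q h
    simp only [iteratedFDeriv_zero_eq_comp]
    exact (continuousMultilinearCurryFin0 ℝ V W).symm.contDiff.contDiffAt.comp q h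
  | succ n ih =>
    intro W _ _ H q h
    simp only [iteratedFDeriv_succ_eq_comp_right]
    exact (continuousMultilinearCurryRightEquiv' ℝ n V W).symm.contDiff.contDiffAt.comp q
      (ih (contDiffAt_partial_fderiv h))

/-- Uniform bounds for a compactly parametrized family. -/
theorem exists_bound_partial_iteratedFDeriv [ProperSpace V] {W : Type} [NormedAddCommGroup W]
    [NormedSpace ℝ W] {H : Q × V → W}
    {K : Set Q} (hK : IsCompact K) (h : ∀ q ∈ K, ∀ v, ContDiffAt ℝ ∞ H (q, v)) (R : ℝ) (n : ℕ) :
    ∃ C, ∀ q ∈ K, ∀ v, ‖v‖ ≤ R → ‖iteratedFDeriv ℝ n (fun v => H (q, v)) v‖ ≤ C := by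
  have hc : IsCompact (K ×ˢ Metric.closedBall (0 : V) R) := hK.prod (isCompact_closedBall 0 R)
  have hcont : ContinuousOn
      (fun r : Q × V => iteratedFDeriv ℝ n (fun v => H (r.1, v)) r.2)
      (K ×ˢ Metric.closedBall (0 : V) R) := fun r hr =>
    (contDiffAt_partial_iteratedFDeriv n (h r.1 hr.1 r.2)).continuousAt.continuousWithinAt
  obtain ⟨C, hC⟩ := hc.exists_bound_of_continuousOn hcont
  exact ⟨C, fun q hq v hv => hC (q, v) ⟨hq, by simpa using hv⟩⟩

/-- Differentiation in the parameter commutes with differentiation in the variable. -/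
theorem hasDerivAt_partial_iteratedFDeriv (n : ℕ) :
    ∀ {W : Type} [NormedAddCommGroup W] [NormedSpace ℝ W] {H : ℝ × V → W},
      ContDiff ℝ ∞ H → ∀ (s : ℝ) (v : V),
      HasDerivAt (fun s => iteratedFDeriv ℝ n (fun v => H (s, v)) v)
        (iteratedFDeriv ℝ n (fun v => fderiv ℝ H (s, v) (1, 0)) v) s := by
  induction n with
  | zero =>
    intro W _ _ H h s v
    simp only [iteratedFDeriv_zero_eq_comp]
    have h1 : HasDerivAt (fun s => H (s, v)) (fderiv ℝ H (s, v) (1, 0)) s := by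
      have h2 := ((h.differentiable (by simp)) (s, v)).hasFDerivAt
      exact h2.comp_hasDerivAt s ((hasDerivAt_id s).prodMk (hasDerivAt_const s v))
    exact (continuousMultilinearCurryFin0 ℝ V W).symm.toContinuousLinearEquiv.hasFDerivAt.comp_hasDerivAt s h1
  | succ n ih =>
    intro W _ _ H h s v
    simp only [iteratedFDeriv_succ_eq_comp_right]
    have hd : ContDiff ℝ ∞ (fderiv ℝ H) := h.fderiv_right (by simp)
    have e1 : ∀ (s : ℝ) (v : V), fderiv ℝ (fun v => H (s, v)) v =
        (fderiv ℝ H (s, v)).comp (ContinuousLinearMap.inr ℝ ℝ V) := by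
      intro s v
      exact (((h.differentiable (by simp)) (s, v)).hasFDerivAt.comp v
        (hasFDerivAt_prodMk_right s v)).fderiv
    have hH' : ContDiff ℝ ∞ (fun r : ℝ × V => (fderiv ℝ H r).comp
        (ContinuousLinearMap.inr ℝ ℝ V)) := hd.clm_comp contDiff_const
    have key := ih hH' s v
    -- Symmetry of the second derivative exchanges the parameter derivative with the derivative in
    -- `v`.
    have e2 : ∀ v, fderiv ℝ (fun r : ℝ × V => (fderiv ℝ H r).comp
        (ContinuousLinearMap.inr ℝ ℝ V)) (s, v) (1, 0) =
        fderiv ℝ (fun v => fderiv ℝ H (s, v) (1, 0)) v := by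
      intro v
      have hdd := ((hd.differentiable (by simp)) (s, v)).hasFDerivAt
      have h1 := ((ContinuousLinearMap.compL ℝ V (ℝ × V) W).flip
        (ContinuousLinearMap.inr ℝ ℝ V)).hasFDerivAt.comp (s, v) hdd
      have h2 := ((ContinuousLinearMap.apply ℝ W ((1, 0) : ℝ × V)).hasFDerivAt.comp (s, v) hdd).comp v
        (hasFDerivAt_prodMk_right s v)
      have h1' := h1.fderiv
      have h2' := h2.fderiv
      rw [show (fun r : ℝ × V => (fderiv ℝ H r).comp (ContinuousLinearMap.inr ℝ ℝ V)) =
        ((ContinuousLinearMap.compL ℝ V (ℝ × V) W).flip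
        (ContinuousLinearMap.inr ℝ ℝ V)) ∘ (fderiv ℝ H) from rfl, h1']
      rw [show (fun v => fderiv ℝ H (s, v) (1, 0)) =
        (((ContinuousLinearMap.apply ℝ W ((1, 0) : ℝ × V)) ∘ fderiv ℝ H) ∘ fun v => (s, v)) from rfl,
        h2']
      ext w
      have hsymm : IsSymmSndFDerivAt ℝ H (s, v) :=
        h.contDiffAt.isSymmSndFDerivAt (by
          rw [minSmoothness_of_isRCLikeNormedField]; exact WithTop.coe_le_coe.2 le_top)
      have := hsymm (1, 0) (0, w)
      simpa using this
    simp only [e2] at key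
    simp only [← e1] at key
    exact (continuousMultilinearCurryRightEquiv' ℝ n V W).symm.toContinuousLinearEquiv.hasFDerivAt.comp_hasDerivAt s key

/-- Second order Taylor bound in the parameter, uniformly for derivatives in the variable. -/
theorem exists_bound_taylor_partial [ProperSpace V] {W : Type} [NormedAddCommGroup W]
    [NormedSpace ℝ W] {H : ℝ × V → W} (h : ContDiff ℝ ∞ H) (r₀ T R : ℝ) (n : ℕ) :
    ∃ C, 0 ≤ C ∧ ∀ δ, |δ| ≤ T → ∀ v, ‖v‖ ≤ R →
      ‖iteratedFDeriv ℝ n (fun v => H (r₀ + δ, v) - H (r₀, v) -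
        δ • fderiv ℝ H (r₀, v) (1, 0)) v‖ ≤ C * δ ^ 2 := by
  set H1 : ℝ × V → W := fun r => fderiv ℝ H r (1, 0) with hH1
  have h1 : ContDiff ℝ ∞ H1 := (h.fderiv_right (by simp)).clm_apply contDiff_const
  set H2 : ℝ × V → W := fun r => fderiv ℝ H1 r (1, 0) with hH2
  have h2 : ContDiff ℝ ∞ H2 := (h1.fderiv_right (by simp)).clm_apply contDiff_const
  obtain ⟨C, hC⟩ := exists_bound_partial_iteratedFDeriv (K := Icc (r₀ - T) (r₀ + T))
    isCompact_Icc (fun q _ v => h2.contDiffAt (x := (q, v))) R n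
  refine ⟨max C 0, le_max_right _ _, fun δ hδ v hv => ?_⟩
  have hpart : ∀ {H : ℝ × V → W}, ContDiff ℝ ∞ H → ∀ s, ContDiff ℝ ∞ (fun v => H (s, v)) :=
    fun h s => h.comp (by fun_prop)
  set f : ℝ → _ := fun s => iteratedFDeriv ℝ n (fun v => H (s, v)) v with hf
  set f1 : ℝ → _ := fun s => iteratedFDeriv ℝ n (fun v => H1 (s, v)) v with hf1
  have hfd : ∀ s, HasDerivAt f (f1 s) s := fun s => hasDerivAt_partial_iteratedFDeriv n h s v
  have hf1d : ∀ s, HasDerivAt f1 (iteratedFDeriv ℝ n (fun v => H2 (s, v)) v) s :=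
    fun s => hasDerivAt_partial_iteratedFDeriv n h1 s v
  have e : iteratedFDeriv ℝ n (fun v => H (r₀ + δ, v) - H (r₀, v) - δ • H1 (r₀, v)) v =
      f (r₀ + δ) - f r₀ - δ • f1 r₀ := by
    have c1 : ContDiffAt ℝ n (fun v => H (r₀ + δ, v)) v :=
      (hpart h _).contDiffAt.of_le (by exact WithTop.coe_le_coe.2 le_top)
    have c2 : ContDiffAt ℝ n (fun v => H (r₀, v)) v :=
      (hpart h _).contDiffAt.of_le (by exact WithTop.coe_le_coe.2 le_top)
    have c3 : ContDiffAt ℝ n (fun v => H1 (r₀, v)) v :=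
      (hpart h1 _).contDiffAt.of_le (by exact WithTop.coe_le_coe.2 le_top)
    have c12 : ContDiffAt ℝ n ((fun v => H (r₀ + δ, v)) - fun v => H (r₀, v)) v := c1.sub c2
    have c3' : ContDiffAt ℝ n (δ • fun v => H1 (r₀, v)) v := c3.const_smul δ
    rw [show (fun v => H (r₀ + δ, v) - H (r₀, v) - δ • H1 (r₀, v)) =
      ((fun v => H (r₀ + δ, v)) - fun v => H (r₀, v)) - δ • fun v => H1 (r₀, v) from rfl,
      iteratedFDeriv_sub_apply c12 c3', iteratedFDeriv_sub_apply c1 c2,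
      iteratedFDeriv_const_smul_apply c3]
  rw [e]
  have hseg : ∀ s ∈ uIcc r₀ (r₀ + δ), |s - r₀| ≤ |δ| := by
    intro s hs
    have := abs_sub_left_of_mem_uIcc hs
    simpa using this
  have hseg' : ∀ s, |s - r₀| ≤ |δ| → s ∈ Icc (r₀ - T) (r₀ + T) := by
    intro s hs
    have := abs_le.1 (hs.trans hδ)
    constructor <;> linarith [this.1, this.2]
  -- Two mean value estimates: this one bounds the increment of the parameter derivative by `|δ|`;
  -- the next is applied to `f` minus its linear part and gains a second factor `|δ|`.
  have hb1 : ∀ s ∈ uIcc r₀ (r₀ + δ), ‖f1 s - f1 r₀‖ ≤ max C 0 * |δ| := by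
    intro s hs
    have := (convex_uIcc r₀ (r₀ + δ)).norm_image_sub_le_of_norm_hasDerivWithin_le
      (f := f1) (C := max C 0) (fun x _ => (hf1d x).hasDerivWithinAt)
      (fun x hx => (hC x (hseg' x (hseg x hx)) v hv).trans (le_max_left _ _))
      left_mem_uIcc hs
    exact this.trans (mul_le_mul_of_nonneg_left (by rw [Real.norm_eq_abs]; exact hseg s hs)
      (le_max_right _ _))
  have := (convex_uIcc r₀ (r₀ + δ)).norm_image_sub_le_of_norm_hasDerivWithin_le
      (f := fun s => f s - (s - r₀) • f1 r₀) (f' := fun s => f1 s - f1 r₀) (C := max C 0 * |δ|)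
      (fun x _ => by
        have := (HasDerivAt.fun_sub (hfd x) (((hasDerivAt_id x).sub_const r₀).smul_const (f1 r₀))).hasDerivWithinAt
          (s := uIcc r₀ (r₀ + δ))
        simpa using this)
      hb1 left_mem_uIcc right_mem_uIcc
  simp only [sub_self, zero_smul, sub_zero, add_sub_cancel_left, Real.norm_eq_abs] at this
  rw [sub_right_comm]
  refine this.trans (le_of_eq ?_)
  rw [mul_assoc, abs_mul_abs_self, sq]

end Families

/-! ### Uniform boundedness on bounded families of Schwartz functions -/

section UniformBoundedness

variable {V : Type} [NormedAddCommGroup V] [NormedSpace ℝ V] {ι : Type}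

/-- Absolutely convergent combinations of a bounded family of Schwartz functions. -/
theorem exists_schwartz_tsum (F : ι → 𝓢(V, ℂ))
    (hF : ∀ k n : ℕ, ∃ C, ∀ i x, ‖x‖ ^ k * ‖iteratedFDeriv ℝ n (F i) x‖ ≤ C) :
    ∃ J : lp (fun _ : ι => ℂ) 1 →L[ℂ] 𝓢(V, ℂ), ∀ a x, J a x = ∑' i, a i * F i x := by
  choose C hC using hF
  have hsum : ∀ a : lp (fun _ : ι => ℂ) 1, Summable fun i => ‖a i‖ := by
    intro a
    have := (lp.memℓp a).summable (by simp)
    simpa using this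
  have hnorm : ∀ a : lp (fun _ : ι => ℂ) 1, ∑' i, ‖a i‖ = ‖a‖ := by
    intro a
    rw [lp.norm_eq_tsum_rpow (by simp)]
    simp
  have hC' : ∀ k n i x, ‖x‖ ^ k * ‖iteratedFDeriv ℝ n (F i) x‖ ≤ |C k n| :=
    fun k n i x => (hC k n i x).trans (le_abs_self _)
  have hsm : ∀ (a : lp (fun _ : ι => ℂ) 1) (i : ι), ContDiff ℝ ∞ (fun x => a i * F i x) :=
    fun a i => contDiff_const.mul ((F i).smooth ⊤)
  have hder : ∀ (a : lp (fun _ : ι => ℂ) 1) (n : ℕ) (i : ι) (x : V),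
      ‖iteratedFDeriv ℝ n (fun x => a i * F i x) x‖ = ‖a i‖ * ‖iteratedFDeriv ℝ n (F i) x‖ := by
    intro a n i x
    have : (fun x => a i * F i x) = a i • (F i : V → ℂ) := rfl
    rw [this, iteratedFDeriv_const_smul_apply ((F i).smooth n).contDiffAt, norm_smul]
  have hbd : ∀ (a : lp (fun _ : ι => ℂ) 1) (n : ℕ) (i : ι) (x : V), (n : ℕ∞) ≤ ⊤ →
      ‖iteratedFDeriv ℝ n (fun x => a i * F i x) x‖ ≤ ‖a i‖ * |C 0 n| := by
    intro a n i x _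
    rw [hder]
    gcongr
    simpa using hC' 0 n i x
  have hsv : ∀ (a : lp (fun _ : ι => ℂ) 1) (n : ℕ), (n : ℕ∞) ≤ ⊤ →
      Summable fun i => ‖a i‖ * |C 0 n| := fun a n _ => (hsum a).mul_right _
  have hdecay : ∀ (a : lp (fun _ : ι => ℂ) 1) (k n : ℕ) (x : V),
      ‖x‖ ^ k * ‖iteratedFDeriv ℝ n (fun x => ∑' i, a i * F i x) x‖ ≤ |C k n| * ‖a‖ := by
    intro a k n x
    rw [iteratedFDeriv_tsum_apply (hsm a) (hsv a) (hbd a) le_top]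
    have hs : Summable fun i => ‖iteratedFDeriv ℝ n (fun x => a i * F i x) x‖ :=
      Summable.of_nonneg_of_le (fun _ => norm_nonneg _) (fun i => hbd a n i x le_top)
        (hsv a n le_top)
    calc _ ≤ ‖x‖ ^ k * ∑' i, ‖iteratedFDeriv ℝ n (fun x => a i * F i x) x‖ := by
          gcongr; exact norm_tsum_le_tsum_norm hs
      _ = ∑' i, ‖x‖ ^ k * ‖iteratedFDeriv ℝ n (fun x => a i * F i x) x‖ := tsum_mul_left.symm
      _ ≤ ∑' i, |C k n| * ‖a i‖ := by
          refine Summable.tsum_le_tsum (fun i => ?_) (hs.mul_left _) ((hsum a).mul_left _)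
          rw [hder, mul_left_comm, mul_comm]
          gcongr
          exact hC' k n i x
      _ = _ := by rw [tsum_mul_left, hnorm]
  have hpt : ∀ (a : lp (fun _ : ι => ℂ) 1) (x : V), Summable fun i => a i * F i x := by
    intro a x
    refine Summable.of_norm_bounded (hsv a 0 le_top) fun i => ?_
    have := hbd a 0 i x le_top
    simpa using this
  let J₀ : lp (fun _ : ι => ℂ) 1 →ₗ[ℂ] 𝓢(V, ℂ) :=
    { toFun := fun a => 
        { toFun := fun x => ∑' i, a i * F i x
          smooth' := contDiff_tsum (hsm a) (hsv a) (hbd a)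
          decay' := fun k n => ⟨_, hdecay a k n⟩ }
      map_add' := fun a b => by
        ext x
        have : ∑' i, (a + b) i * F i x = ∑' i, (a i * F i x + b i * F i x) :=
          tsum_congr fun i => by simp [add_mul]
        exact this.trans ((hpt a x).tsum_add (hpt b x))
      map_smul' := fun c a => by
        ext x
        have : ∑' i, (c • a) i * F i x = ∑' i, c * (a i * F i x) :=
          tsum_congr fun i => by simp [mul_assoc]
        exact this.trans tsum_mul_left }
  refine ⟨⟨J₀, ?_⟩, fun a x => rfl⟩
  refine WithSeminorms.continuous_normedSpace_dom _ (schwartz_withSeminorms ℂ V ℂ) J₀ fun kn => ?_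
  refine ⟨⟨|C kn.1 kn.2|, abs_nonneg _⟩, fun a => ?_⟩
  exact SchwartzMap.seminorm_le_bound ℂ kn.1 kn.2 (J₀ a)
    (mul_nonneg (abs_nonneg _) (apply_nonneg _ _)) (hdecay a kn.1 kn.2)

/-- A pointwise bounded family of tempered functionals is uniformly bounded on every bounded
family of Schwartz functions. -/
theorem exists_bound_of_pointwise_bounded {S : Type} (F : ι → 𝓢(V, ℂ))
    (hF : ∀ k n : ℕ, ∃ C, ∀ i x, ‖x‖ ^ k * ‖iteratedFDeriv ℝ n (F i) x‖ ≤ C)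
    (L : S → 𝓢(V, ℂ) →L[ℂ] ℂ) (hL : ∀ φ, ∃ C, ∀ s, ‖L s φ‖ ≤ C) :
    ∃ C, ∀ s i, ‖L s (F i)‖ ≤ C := by
  classical
  -- Banach-Steinhaus is applied on the Banach space `ℓ¹` of coefficients instead of the Schwartz
  -- space; unit vectors recover the individual `F i`.
  obtain ⟨J, hJ⟩ := exists_schwartz_tsum F hF
  obtain ⟨C, hC⟩ := banach_steinhaus (g := fun s => (L s).comp J) (fun a => hL (J a))
  refine ⟨C, fun s i => ?_⟩
  have h1 : J (lp.single 1 i (1 : ℂ)) = F i := by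
    ext x
    rw [hJ, tsum_eq_single i]
    · simp
    · intro j hj
      simp [lp.single_apply, hj]
  have := ((L s).comp J).le_of_opNorm_le (hC s) (lp.single 1 i (1 : ℂ))
  rw [lp.norm_single (by simp)] at this
  simpa [h1] using this

end UniformBoundedness

/-! ### Weak solutions of multiplier systems and their fundamental matrices -/

section WeakODE

variable {d : ℕ}

/-- The map `Ψ ↦ 𝓕 (Ψ 𝓕⁻ φ)`. -/
noncomputable def transposeMul (φ : 𝓢(Sp d, ℂ)) : 𝓢(Sp d, ℂ) →L[ℂ] 𝓢(Sp d, ℂ) :=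
  (fourierCLM ℂ 𝓢(Sp d, ℂ)).comp (SchwartzMap.smulLeftCLM ℂ (𝓕⁻ φ : 𝓢(Sp d, ℂ)))

/-- For fixed `φ` the symbol enters through one continuous linear map of Schwartz functions, so an
expansion of the symbol becomes an expansion of the pairing. -/
theorem mult_apply_eq_transposeMul {m : Sp d → ℂ} (hm : IsTest m) (f : Dist d) (φ : 𝓢(Sp d, ℂ)) :
    mult m f φ = f (transposeMul φ hm.dil.toS) := by
  rw [mult_apply]
  congr 1
  show _ = 𝓕 (SchwartzMap.smulLeftCLM ℂ (𝓕⁻ φ : 𝓢(Sp d, ℂ)) hm.dil.toS)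
  congr 1
  ext x
  rw [SchwartzMap.smulLeftCLM_apply_apply hm.dil.tg,
    SchwartzMap.smulLeftCLM_apply_apply (SchwartzMap.hasTemperateGrowth _)]
  exact mul_comm _ _

theorem isTest_slice {H : ℝ × Sp d → ℂ} (h : ContDiff ℝ ∞ H) {R : ℝ}
    (hR : ∀ s ξ, R ≤ ‖ξ‖ → H (s, ξ) = 0) (s : ℝ) : IsTest (fun ξ => H (s, ξ)) := by
  refine ⟨h.comp (by fun_prop), ?_⟩
  refine HasCompactSupport.intro (isCompact_closedBall (0 : Sp d) R) fun ξ hξ => hR s ξ ?_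
  simp only [Metric.mem_closedBall, dist_zero_right, not_le] at hξ
  exact hξ.le

theorem fderiv_apply_eq_zero_of_norm_ge {H : ℝ × Sp d → ℂ} (h : ContDiff ℝ ∞ H) {R : ℝ}
    (hR : ∀ s ξ, R ≤ ‖ξ‖ → H (s, ξ) = 0) (s : ℝ) (ξ : Sp d) (hξ : R ≤ ‖ξ‖) :
    fderiv ℝ H (s, ξ) (1, 0) = 0 := by
  have h2 := ((h.differentiable (by simp)) (s, ξ)).hasFDerivAt
  have h3 := h2.comp_hasDerivAt s ((hasDerivAt_id s).prodMk (hasDerivAt_const s ξ))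
  have h4 : HasDerivAt (H ∘ fun s => (id s, ξ)) 0 s := by
    have : (H ∘ fun s => (id s, ξ)) = fun _ => 0 := by ext s; exact hR s ξ hξ
    rw [this]; exact hasDerivAt_const s 0
  exact h3.unique h4

/-- First order expansion in time of `s ↦ ⟨H(r - s, D) X(s), φ⟩`. -/
theorem exists_bound_mult_expansion {X : ℝ → Dist d}
    (hX : ∀ φ : 𝓢(Sp d, ℂ), ContinuousOn (fun s => X s φ) (Ici 0))
    {H : ℝ × Sp d → ℂ} (h : ContDiff ℝ ∞ H) {R : ℝ} (hR : ∀ s ξ, R ≤ ‖ξ‖ → H (s, ξ) = 0)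
    (φ : 𝓢(Sp d, ℂ)) (r s₀ : ℝ) (hs₀ : 0 ≤ s₀) :
    ∃ C, ∀ s ∈ Icc 0 (s₀ + 1),
      ‖mult (fun ξ => H (r - s, ξ)) (X s) φ - mult (fun ξ => H (r - s₀, ξ)) (X s) φ -
        ((s₀ - s : ℝ) : ℂ) * mult (fun ξ => fderiv ℝ H (r - s₀, ξ) (1, 0)) (X s) φ‖ ≤
      C * (s - s₀) ^ 2 := by
  set r₀ := r - s₀
  have h1 : ContDiff ℝ ∞ fun q : ℝ × Sp d => fderiv ℝ H q (1, 0) :=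
    (h.fderiv_right (by simp)).clm_apply contDiff_const
  have hR1 := fderiv_apply_eq_zero_of_norm_ge h hR
  have t0 : ∀ s, IsTest (fun ξ => H (s, ξ)) := isTest_slice h hR
  have t1 : IsTest (fun ξ => fderiv ℝ H (r₀, ξ) (1, 0)) := isTest_slice h1 hR1 r₀
  -- `F δ` is the Taylor remainder of the symbol divided by `δ²`; the increment `δ = s₀ - s` stays
  -- in this range for `s ∈ [0, s₀ + 1]`. The family is bounded in every Schwartz seminorm, as the
  -- uniform boundedness principle requires.
  let ι := {δ : ℝ // δ ≠ 0 ∧ |δ| ≤ s₀ + 1}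
  let N : ℝ → 𝓢(Sp d, ℂ) := fun δ =>
    (t0 (r₀ + δ)).dil.toS - (t0 r₀).dil.toS - ((δ : ℝ) : ℂ) • t1.dil.toS
  let F : ι → 𝓢(Sp d, ℂ) := fun δ => (((δ.1 ^ 2)⁻¹ : ℝ) : ℂ) • N δ.1
  have hF : ∀ k n : ℕ, ∃ C, ∀ (i : ι) x, ‖x‖ ^ k * ‖iteratedFDeriv ℝ n (F i) x‖ ≤ C := by
    intro k n
    have hd : ContDiff ℝ ∞ fun q : ℝ × Sp d => H (q.1, (2 * Real.pi) • q.2) :=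
      h.comp (by fun_prop)
    obtain ⟨C, hC0, hC⟩ := exists_bound_taylor_partial hd r₀ (s₀ + 1) R n
    refine ⟨(max R 0) ^ k * C, fun i x => ?_⟩
    have hfd : ∀ v : Sp d, fderiv ℝ (fun q : ℝ × Sp d => H (q.1, (2 * Real.pi) • q.2)) (r₀, v) (1, 0)
        = fderiv ℝ H (r₀, (2 * Real.pi) • v) (1, 0) := by
      intro v
      have e1 := ((hd.differentiable (by simp)) (r₀, v)).hasFDerivAt.comp_hasDerivAt r₀
        ((hasDerivAt_id r₀).prodMk (hasDerivAt_const r₀ v))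
      have e2 := ((h.differentiable (by simp)) (r₀, (2 * Real.pi) • v)).hasFDerivAt.comp_hasDerivAt r₀
        ((hasDerivAt_id r₀).prodMk (hasDerivAt_const r₀ ((2 * Real.pi) • v)))
      exact e1.unique e2
    have eN : (N i.1 : Sp d → ℂ) = fun v =>
        (fun q : ℝ × Sp d => H (q.1, (2 * Real.pi) • q.2)) (r₀ + i.1, v) -
        (fun q : ℝ × Sp d => H (q.1, (2 * Real.pi) • q.2)) (r₀, v) -
        i.1 • fderiv ℝ (fun q : ℝ × Sp d => H (q.1, (2 * Real.pi) • q.2)) (r₀, v) (1, 0) := by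
      ext v
      rw [hfd v]
      rfl
    have eF : ‖iteratedFDeriv ℝ n (F i) x‖ = (i.1 ^ 2)⁻¹ * ‖iteratedFDeriv ℝ n (N i.1) x‖ := by
      have : (F i : Sp d → ℂ) = (((i.1 ^ 2)⁻¹ : ℝ) : ℂ) • (N i.1 : Sp d → ℂ) := rfl
      rw [this, iteratedFDeriv_const_smul_apply ((N i.1).smooth n).contDiffAt, norm_smul]
      congr 1
      simp
    have hi2 : (0 : ℝ) < i.1 ^ 2 := by have := i.2.1; positivity
    by_cases hx : ‖x‖ ≤ R
    · have hb := hC i.1 i.2.2 x hx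
      rw [← eN] at hb
      rw [eF]
      have : (i.1 ^ 2)⁻¹ * ‖iteratedFDeriv ℝ n (N i.1) x‖ ≤ C := by
        rw [inv_mul_le_iff₀ hi2, mul_comm]; exact hb
      have hx' : ‖x‖ ≤ max R 0 := hx.trans (le_max_left _ _)
      gcongr
    · have : iteratedFDeriv ℝ n (N i.1) x = 0 := by
        have hev : (N i.1 : Sp d → ℂ) =ᶠ[𝓝 x] fun _ => 0 := by
          have : ∀ᶠ v in 𝓝 x, R < ‖v‖ := (continuous_norm.tendsto x).eventually (lt_mem_nhds (not_le.1 hx))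
          filter_upwards [this] with v hv
          have hv' : R ≤ ‖(2 * Real.pi) • v‖ := by
            rw [norm_smul, Real.norm_of_nonneg (by positivity)]
            have : (1 : ℝ) ≤ 2 * Real.pi := by linarith [Real.pi_gt_three]
            nlinarith [norm_nonneg v]
          have a1 := hR (r₀ + i.1) _ hv'
          have a2 := hR r₀ _ hv'
          have a3 := hR1 r₀ _ hv'
          show H (r₀ + i.1, (2 * Real.pi) • v) - H (r₀, (2 * Real.pi) • v) -
            ((i.1 : ℝ) : ℂ) * fderiv ℝ H (r₀, (2 * Real.pi) • v) (1, 0) = 0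
          rw [a1, a2, a3]; simp
        rw [(hev.iteratedFDeriv ℝ n).eq_of_nhds]
        simp [iteratedFDeriv_fun_zero]
      rw [eF, this]
      simp only [norm_zero, mul_zero]
      positivity
  let L : Icc (0 : ℝ) (s₀ + 1) → 𝓢(Sp d, ℂ) →L[ℂ] ℂ := fun s =>
    ContinuousLinearMap.comp (X s.1 : 𝓢(Sp d, ℂ) →L[ℂ] ℂ) (transposeMul φ)
  -- Weak continuity on a compact time interval supplies the pointwise bound.
  obtain ⟨C, hC⟩ := exists_bound_of_pointwise_bounded F hF L (by
    intro ψ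
    obtain ⟨C, hC⟩ := (isCompact_Icc (a := (0 : ℝ)) (b := s₀ + 1)).exists_bound_of_continuousOn
      ((hX (transposeMul φ ψ)).mono fun s hs => hs.1)
    exact ⟨C, fun s => hC s.1 s.2⟩)
  refine ⟨C, fun s hs => ?_⟩
  have hmain : mult (fun ξ => H (r - s, ξ)) (X s) φ - mult (fun ξ => H (r₀, ξ)) (X s) φ -
        ((s₀ - s : ℝ) : ℂ) * mult (fun ξ => fderiv ℝ H (r₀, ξ) (1, 0)) (X s) φ =
      L ⟨s, hs⟩ (N (s₀ - s)) := by
    have e : r - s = r₀ + (s₀ - s) := by ring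
    rw [mult_apply_eq_transposeMul (t0 (r - s)), mult_apply_eq_transposeMul (t0 r₀),
      mult_apply_eq_transposeMul t1]
    simp only [N, map_sub, map_smul, e]
    rfl
  rw [hmain]
  by_cases hδ : s₀ - s = 0
  · have e0 : N (s₀ - s) = 0 := by
      ext v
      show H (r₀ + (s₀ - s), (2 * Real.pi) • v) - H (r₀, (2 * Real.pi) • v) -
            ((s₀ - s : ℝ) : ℂ) * fderiv ℝ H (r₀, (2 * Real.pi) • v) (1, 0) = 0
      rw [hδ]; simp
    have : s - s₀ = 0 := by linarith
    rw [e0, this]; simp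
  · have hl : |s₀ - s| ≤ s₀ + 1 := by
      rw [abs_le]; constructor <;> linarith [hs.1, hs.2]
    have hb := hC ⟨s, hs⟩ ⟨s₀ - s, hδ, hl⟩
    have eN : N (s₀ - s) = (((s₀ - s) ^ 2 : ℝ) : ℂ) • F ⟨s₀ - s, hδ, hl⟩ := by
      simp only [F]
      rw [smul_smul, ← Complex.ofReal_mul, mul_inv_cancel₀ (by positivity)]
      simp
    rw [eN, map_smul, norm_smul, mul_comm]
    have : ‖(((s₀ - s) ^ 2 : ℝ) : ℂ)‖ = (s - s₀) ^ 2 := by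
      rw [Complex.norm_real, Real.norm_of_nonneg (by positivity)]; ring
    rw [this]
    gcongr

theorem continuousOn_mult {X : ℝ → Dist d}
    (hX : ∀ φ : 𝓢(Sp d, ℂ), ContinuousOn (fun s => X s φ) (Ici 0)) (m : Sp d → ℂ)
    (φ : 𝓢(Sp d, ℂ)) : ContinuousOn (fun s => mult m (X s) φ) (Ici 0) :=
  hX _

/-- A product rule in which both the symbol and the distribution move. Since `X` is differentiable
only weakly, the symbol is first frozen to first order; the uniform remainder `O((s - s₀)²)` does
not contribute to the derivative. -/
theorem hasDerivAt_mult_flow {X : ℝ → Dist d}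
    (hX : ∀ φ : 𝓢(Sp d, ℂ), ContinuousOn (fun s => X s φ) (Ici 0))
    {H : ℝ × Sp d → ℂ} (h : ContDiff ℝ ∞ H) {R : ℝ} (hR : ∀ s ξ, R ≤ ‖ξ‖ → H (s, ξ) = 0)
    (φ : 𝓢(Sp d, ℂ)) (r s₀ : ℝ) (hs₀ : 0 < s₀) {Y : Dist d}
    (hY : ∀ φ : 𝓢(Sp d, ℂ), HasDerivAt (fun s => X s φ) (Y φ) s₀) :
    HasDerivAt (fun s => mult (fun ξ => H (r - s, ξ)) (X s) φ)
      (mult (fun ξ => H (r - s₀, ξ)) Y φ -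
        mult (fun ξ => fderiv ℝ H (r - s₀, ξ) (1, 0)) (X s₀) φ) s₀ := by
  obtain ⟨C, hC⟩ := exists_bound_mult_expansion hX h hR φ r s₀ hs₀.le
  set g₀ : ℝ → ℂ := fun s => mult (fun ξ => H (r - s₀, ξ)) (X s) φ with hg₀
  set g₁ : ℝ → ℂ := fun s => mult (fun ξ => fderiv ℝ H (r - s₀, ξ) (1, 0)) (X s) φ with hg₁
  set f : ℝ → ℂ := fun s => mult (fun ξ => H (r - s, ξ)) (X s) φ with hf
  set e : ℝ → ℂ := fun s => f s - g₀ s - ((s₀ - s : ℝ) : ℂ) * g₁ s with he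
  have d0 : HasDerivAt g₀ (mult (fun ξ => H (r - s₀, ξ)) Y φ) s₀ := hY _
  have d1 : HasDerivAt g₁ (mult (fun ξ => fderiv ℝ H (r - s₀, ξ) (1, 0)) Y φ) s₀ := hY _
  have dl : HasDerivAt (fun s : ℝ => ((s₀ - s : ℝ) : ℂ)) (-1) s₀ := by
    have := ((hasDerivAt_id s₀).const_sub s₀).ofReal_comp
    simpa using this
  have de : HasDerivAt e 0 s₀ := by
    have he0 : e s₀ = 0 := by simp [he, hf, hg₀]
    rw [hasDerivAt_iff_isLittleO]
    simp only [he0, smul_zero, sub_zero]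
    have h1 : e =O[𝓝 s₀] fun s => (s - s₀) ^ 2 := by
      refine Asymptotics.IsBigO.of_bound C ?_
      filter_upwards [Icc_mem_nhds hs₀ (by linarith : s₀ < s₀ + 1)] with s hs
      rw [Real.norm_of_nonneg (by positivity)]
      exact hC s hs
    refine h1.trans_isLittleO ?_
    have h2 : Tendsto (fun s : ℝ => s - s₀) (𝓝 s₀) (𝓝 0) := by
      have : Continuous fun s : ℝ => s - s₀ := by fun_prop
      simpa using this.tendsto s₀
    have h3 := (Asymptotics.isLittleO_pow_id (𝕜 := ℝ) (n := 2) (by norm_num)).comp_tendsto h2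
    exact h3
  have hsum := (d0.fun_add (dl.fun_mul d1)).fun_add de
  have ef : (fun s => g₀ s + ((s₀ - s : ℝ) : ℂ) * g₁ s + e s) = f := by
    ext s; simp only [he]; ring
  rw [ef] at hsum
  refine hsum.congr_deriv ?_
  simp only [hg₁, sub_self, Complex.ofReal_zero]
  ring

/-- The equations hold for positive times only; continuity at `0` is what connects the conservation
law to the initial data. -/
theorem continuousOn_mult_flow {X : ℝ → Dist d}
    (hX : ∀ φ : 𝓢(Sp d, ℂ), ContinuousOn (fun s => X s φ) (Ici 0))
    {H : ℝ × Sp d → ℂ} (h : ContDiff ℝ ∞ H) {R : ℝ} (hR : ∀ s ξ, R ≤ ‖ξ‖ → H (s, ξ) = 0)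
    (φ : 𝓢(Sp d, ℂ)) (r : ℝ) :
    ContinuousWithinAt (fun s => mult (fun ξ => H (r - s, ξ)) (X s) φ) (Ici 0) 0 := by
  obtain ⟨C, hC⟩ := exists_bound_mult_expansion hX h hR φ r 0 le_rfl
  set g₀ : ℝ → ℂ := fun s => mult (fun ξ => H (r - 0, ξ)) (X s) φ with hg₀
  set g₁ : ℝ → ℂ := fun s => mult (fun ξ => fderiv ℝ H (r - 0, ξ) (1, 0)) (X s) φ with hg₁
  set f : ℝ → ℂ := fun s => mult (fun ξ => H (r - s, ξ)) (X s) φ with hf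
  set e : ℝ → ℂ := fun s => f s - g₀ s - ((0 - s : ℝ) : ℂ) * g₁ s with he
  have d0 : ContinuousWithinAt g₀ (Ici 0) 0 := continuousOn_mult hX _ φ 0 self_mem_Ici
  have d1 : ContinuousWithinAt g₁ (Ici 0) 0 := continuousOn_mult hX _ φ 0 self_mem_Ici
  have dl : ContinuousWithinAt (fun s : ℝ => ((0 - s : ℝ) : ℂ)) (Ici 0) 0 := by
    have : Continuous fun s : ℝ => ((0 - s : ℝ) : ℂ) := by fun_prop
    exact this.continuousWithinAt
  have de : ContinuousWithinAt e (Ici 0) 0 := by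
    have he0 : e 0 = 0 := by simp [he, hf, hg₀]
    rw [ContinuousWithinAt, he0]
    refine squeeze_zero_norm' (a := fun s => C * (s - 0) ^ 2) ?_ ?_
    · have : Icc (0 : ℝ) (0 + 1) ∈ 𝓝[Ici 0] (0 : ℝ) :=
        Icc_mem_nhdsGE (by norm_num)
      filter_upwards [this] with s hs
      exact hC s hs
    · have : Continuous fun s : ℝ => C * (s - 0) ^ 2 := by fun_prop
      have := (this.tendsto 0).mono_left (nhdsWithin_le_nhds (s := Ici 0))
      simpa using this
  have hsum := (d0.add (dl.mul d1)).add de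
  refine hsum.congr (fun s _ => ?_) ?_
  · simp [he]; ring
  · simp [he]

/-- Solutions of a linear system of multiplier equations are transported by its (localized)
fundamental matrix. -/
theorem sum_mult_flow_const {I : Type} [Fintype I] {X : ℝ → I → Dist d} {A : I → I → Sp d → ℂ}
    (hA : ∀ a b, (A a b).HasTemperateGrowth)
    (hX : ∀ a (φ : 𝓢(Sp d, ℂ)), ContinuousOn (fun s => X s a φ) (Ici 0))
    (hX' : ∀ a t, 0 < t → ∀ φ : 𝓢(Sp d, ℂ),
      HasDerivAt (fun s => X s a φ) ((∑ b, mult (A a b) (X t b)) φ) t)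
    {H : I → I → ℝ × Sp d → ℂ} (h : ∀ a b, ContDiff ℝ ∞ (H a b)) {R : ℝ}
    (hR : ∀ a b s ξ, R ≤ ‖ξ‖ → H a b (s, ξ) = 0)
    (hH : ∀ a c s ξ, HasDerivAt (fun s => H a c (s, ξ)) (∑ b, H a b (s, ξ) * A b c ξ) s)
    (a : I) (r : ℝ) {T : ℝ} (hT : 0 ≤ T) :
    ∑ b, mult (fun ξ => H a b (r - T, ξ)) (X T b) = ∑ b, mult (fun ξ => H a b (r, ξ)) (X 0 b) := by
  have hfd : ∀ a c s ξ, fderiv ℝ (H a c) (s, ξ) (1, 0) = ∑ b, H a b (s, ξ) * A b c ξ := by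
    intro a c s ξ
    have h2 := (((h a c).differentiable (by simp)) (s, ξ)).hasFDerivAt.comp_hasDerivAt s
      ((hasDerivAt_id s).prodMk (hasDerivAt_const s ξ))
    exact h2.unique (hH a c s ξ)
  have tH : ∀ a b s, (fun ξ => H a b (s, ξ)).HasTemperateGrowth :=
    fun a b s => (isTest_slice (h a b) (hR a b) s).tg
  ext φ
  set F : ℝ → ℂ := fun s => ∑ b, mult (fun ξ => H a b (r - s, ξ)) (X s b) φ with hF
  have hderiv : ∀ s, 0 < s → HasDerivAt F 0 s := by
    intro s hs
    have h1 := HasDerivAt.fun_sum (u := Finset.univ) fun b _ =>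
      hasDerivAt_mult_flow (hX b) (h a b) (hR a b) φ r s hs (hX' b s hs)
    refine h1.congr_deriv ?_
    rw [Finset.sum_sub_distrib, sub_eq_zero]
    have e1 : ∀ b, mult (fun ξ => H a b (r - s, ξ)) (∑ c, mult (A b c) (X s c)) =
        ∑ c, mult (fun ξ => H a b (r - s, ξ) * A b c ξ) (X s c) := by
      intro b
      rw [mult_sum]
      exact Finset.sum_congr rfl fun c _ => mult_mult (tH a b _) (hA b c) _
    have e2 : ∀ c, mult (fun ξ => fderiv ℝ (H a c) (r - s, ξ) (1, 0)) (X s c) =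
        ∑ b, mult (fun ξ => H a b (r - s, ξ) * A b c ξ) (X s c) := by
      intro c
      simp only [hfd]
      exact (sum_mult _ (fun b => (tH a b _).mul (hA b c)) _).symm
    -- The two contributions cancel: differentiating `X` gives `HAX`, differentiating `H(r - s)`
    -- gives `-HAX`.
    have e3 : ∑ b, mult (fun ξ => H a b (r - s, ξ)) (∑ c, mult (A b c) (X s c)) =
        ∑ c, mult (fun ξ => fderiv ℝ (H a c) (r - s, ξ) (1, 0)) (X s c) := by
      simp only [e1, e2]
      exact Finset.sum_comm
    have := congrArg (fun f : Dist d => f φ) e3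
    simpa only [sum_apply] using this
  -- Constancy is first obtained on `[ε, T]`, then `ε → 0` by continuity at `0`.
  have hconst : ∀ ε, 0 < ε → ε ≤ T → F T = F ε := by
    intro ε hε hεT
    refine constant_of_has_deriv_right_zero (a := ε) (b := T) ?_ ?_ T ⟨hεT, le_rfl⟩
    · exact fun s hs => (hderiv s (hε.trans_le hs.1)).continuousAt.continuousWithinAt
    · exact fun s hs => (hderiv s (hε.trans_le hs.1)).hasDerivWithinAt
  have hcont0 : ContinuousWithinAt F (Ici 0) 0 := by
    have : ∀ b ∈ Finset.univ, ContinuousWithinAt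
        (fun s => mult (fun ξ => H a b (r - s, ξ)) (X s b) φ) (Ici 0) 0 :=
      fun b _ => continuousOn_mult_flow (hX b) (h a b) (hR a b) φ r
    exact tendsto_finsetSum _ this
  have hfin : F T = F 0 := by
    rcases hT.eq_or_lt with rfl | hT
    · rfl
    · have h1 : Tendsto F (𝓝[>] 0) (𝓝 (F 0)) := hcont0.mono_left (nhdsWithin_mono _ Ioi_subset_Ici_self)
      have h2 : Tendsto F (𝓝[>] 0) (𝓝 (F T)) := by
        refine tendsto_const_nhds.congr' ?_
        filter_upwards [Ioc_mem_nhdsGT hT] with ε hε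
        exact hconst ε hε.1 hε.2
      exact tendsto_nhds_unique h2 h1
  simp only [sum_apply]
  simpa [hF] using hfin

end WeakODE

/-! ### `L¹` kernel bounds uniform over compact families of symbols -/

section KernelFamilies

variable {d : ℕ} {Q : Type} [NormedAddCommGroup Q] [NormedSpace ℝ Q]

theorem kernelNorm_eq (m : Sp d → ℂ) : kernelNorm m = ∫ x, ‖𝓕 m x‖ := by
  rw [← kernelNorm_comp_smul m (l := (2 * Real.pi)⁻¹) (by positivity), kernelNorm]
  have : dil (fun ξ => m ((2 * Real.pi)⁻¹ • ξ)) = m := by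
    ext ξ
    simp only [dil]
    rw [smul_smul, inv_mul_cancel₀ (by positivity), one_smul]
  rw [this]

theorem kernelNorm_const_mul (c : ℂ) (m : Sp d → ℂ) :
    kernelNorm (fun ξ => c * m ξ) = ‖c‖ * kernelNorm m := by
  rw [kernelNorm_eq, kernelNorm_eq, ← integral_const_mul]
  congr 1; ext x
  rw [Real.fourier_eq, Real.fourier_eq, ← norm_mul, ← integral_const_mul]
  congr 2; ext v
  rw [mul_smul_comm]

/-- The `L¹` norm of the kernel is controlled by finitely many Schwartz seminorms. -/
theorem exists_kernelNorm_le_seminorm (d : ℕ) :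
    ∃ (s : Finset (ℕ × ℕ)) (C : ℝ), 0 ≤ C ∧ ∀ (m : Sp d → ℂ) (hm : IsTest m),
      kernelNorm m ≤ C * (s.sup (schwartzSeminormFamily ℂ (Sp d) ℂ)) hm.toS := by
  let T : 𝓢(Sp d, ℂ) →L[ℂ] Lp ℂ 1 (volume : Measure (Sp d)) :=
    (SchwartzMap.toLpCLM ℂ ℂ 1 volume).comp (fourierCLM ℂ 𝓢(Sp d, ℂ))
  let q : Seminorm ℂ 𝓢(Sp d, ℂ) := (normSeminorm ℂ (Lp ℂ 1 (volume : Measure (Sp d)))).comp T.toLinearMap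
  have hq : Continuous q := continuous_norm.comp T.continuous
  obtain ⟨s, C, -, hC⟩ := Seminorm.bound_of_continuous (schwartz_withSeminorms ℂ (Sp d) ℂ) q hq
  refine ⟨s, C, C.2, fun m hm => ?_⟩
  have h1 : q hm.toS = kernelNorm m := by
    show ‖(𝓕 hm.toS).toLp 1 volume‖ = _
    rw [kernelNorm_eq, L1.norm_eq_integral_norm]
    refine integral_congr_ae ?_
    filter_upwards [(𝓕 hm.toS).coeFn_toLp 1 volume] with x hx
    rw [hx]
    rfl
  rw [← h1]
  exact hC hm.toS

theorem isTest_of_contDiffAt {m : Sp d → ℂ} (h : ∀ v, ContDiffAt ℝ ∞ m v) {R : ℝ}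
    (hR : ∀ ξ, R ≤ ‖ξ‖ → m ξ = 0) : IsTest m := by
  refine ⟨contDiff_iff_contDiffAt.2 h, ?_⟩
  refine HasCompactSupport.intro (isCompact_closedBall (0 : Sp d) R) fun ξ hξ => hR ξ ?_
  simp only [Metric.mem_closedBall, dist_zero_right, not_le] at hξ
  exact hξ.le

/-- Kernels of a compactly parametrized smooth family of symbols are bounded in `L¹`. -/
theorem exists_kernelNorm_bound {K : Set Q} (hK : IsCompact K) {H : Q × Sp d → ℂ}
    (h : ∀ q ∈ K, ∀ v, ContDiffAt ℝ ∞ H (q, v)) {R : ℝ}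
    (hR : ∀ q ∈ K, ∀ ξ, R ≤ ‖ξ‖ → H (q, ξ) = 0) :
    ∃ C, 0 < C ∧ ∀ q ∈ K, IsTest (fun ξ => H (q, ξ)) ∧ kernelNorm (fun ξ => H (q, ξ)) ≤ C := by
  have ht : ∀ q ∈ K, IsTest (fun ξ => H (q, ξ)) := fun q hq =>
    isTest_of_contDiffAt (fun v => (h q hq v).comp v (by fun_prop)) (hR q hq)
  obtain ⟨s, C, hC0, hC⟩ := exists_kernelNorm_le_seminorm d
  choose B hB using fun n => exists_bound_partial_iteratedFDeriv hK h R n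
  set M : ℝ := ∑ kn ∈ s, (max R 0) ^ kn.1 * |B kn.2| with hM
  have hM0 : 0 ≤ M := Finset.sum_nonneg fun kn _ => by positivity
  refine ⟨C * M + 1, by positivity, fun q hq => ⟨ht q hq, ?_⟩⟩
  have h1 : (s.sup (schwartzSeminormFamily ℂ (Sp d) ℂ)) (ht q hq).toS ≤ M := by
    refine Seminorm.finset_sup_apply_le hM0 fun kn hkn => ?_
    have h2 : (max R 0) ^ kn.1 * |B kn.2| ≤ M :=
      Finset.single_le_sum (f := fun kn : ℕ × ℕ => (max R 0) ^ kn.1 * |B kn.2|)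
        (fun kn _ => by positivity) hkn
    refine le_trans (SchwartzMap.seminorm_le_bound ℂ kn.1 kn.2 _ (by positivity) fun x => ?_) h2
    have e : ((ht q hq).toS : Sp d → ℂ) = fun ξ => H (q, ξ) := rfl
    rw [e]
    by_cases hx : ‖x‖ ≤ R
    · have hb := (hB kn.2 q hq x hx).trans (le_abs_self _)
      have hx' : ‖x‖ ≤ max R 0 := hx.trans (le_max_left _ _)
      gcongr
    · have hev : (fun ξ => H (q, ξ)) =ᶠ[𝓝 x] fun _ => 0 := by
        have : ∀ᶠ v in 𝓝 x, R < ‖v‖ :=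
          (continuous_norm.tendsto x).eventually (lt_mem_nhds (not_le.1 hx))
        filter_upwards [this] with v hv using hR q hq v hv.le
      rw [(hev.iteratedFDeriv ℝ kn.2).eq_of_nhds]
      simp only [iteratedFDeriv_fun_zero, Pi.zero_apply, norm_zero, mul_zero]
      positivity
  calc kernelNorm (fun ξ => H (q, ξ)) ≤ C * _ := hC _ (ht q hq)
    _ ≤ C * M := by gcongr
    _ ≤ C * M + 1 := by linarith

/-- Off the support of `ψ` the product vanishes near the point, so `a` may be singular there. This
admits quotients and square roots that make sense only on an annulus. -/
theorem contDiffAt_cutoff_mul {ψ : Sp d → ℂ} (hψ : ContDiff ℝ ∞ ψ) {a : Q × Sp d → ℂ} {q : Q}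
    {v : Sp d} (h : v ∈ tsupport ψ → ContDiffAt ℝ ∞ a (q, v)) :
    ContDiffAt ℝ ∞ (fun r : Q × Sp d => ψ r.2 * a r) (q, v) := by
  by_cases hv : v ∈ tsupport ψ
  · exact (hψ.contDiffAt.comp (q, v) contDiffAt_snd).mul (h hv)
  · have h0 : ∀ᶠ w in 𝓝 v, ψ w = 0 := by
      have := (isClosed_tsupport ψ).isOpen_compl.mem_nhds hv
      filter_upwards [this] with w hw using image_eq_zero_of_notMem_tsupport hw
    have h1 : ∀ᶠ r : Q × Sp d in 𝓝 (q, v), ψ r.2 * a r = 0 := by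
      have : Tendsto (fun r : Q × Sp d => r.2) (𝓝 (q, v)) (𝓝 v) := continuous_snd.tendsto (q, v)
      filter_upwards [this.eventually h0] with r hr
      rw [hr, zero_mul]
    exact (contDiffAt_const (c := (0 : ℂ))).congr_of_eventuallyEq h1

theorem IsTest.exists_radius {ψ : Sp d → ℂ} (hψ : IsTest ψ) :
    ∃ R : ℝ, ∀ ξ, R ≤ ‖ξ‖ → ψ ξ = 0 := by
  obtain ⟨R, hR⟩ := hψ.2.isCompact.isBounded.subset_closedBall (0 : Sp d)
  refine ⟨R + 1, fun ξ hξ => image_eq_zero_of_notMem_tsupport fun h => ?_⟩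
  have := hR h
  simp at this
  linarith

theorem exists_kernelNorm_bound_cutoff {K : Set Q} (hK : IsCompact K) {ψ : Sp d → ℂ}
    (hψ : IsTest ψ) {a : Q × Sp d → ℂ}
    (h : ∀ q ∈ K, ∀ v ∈ tsupport ψ, ContDiffAt ℝ ∞ a (q, v)) :
    ∃ C, 0 < C ∧ ∀ q ∈ K, IsTest (fun ξ => ψ ξ * a (q, ξ)) ∧
      kernelNorm (fun ξ => ψ ξ * a (q, ξ)) ≤ C := by
  obtain ⟨R, hR⟩ := hψ.exists_radius
  exact exists_kernelNorm_bound hK (H := fun r => ψ r.2 * a r)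
    (fun q hq v => contDiffAt_cutoff_mul hψ.1 (h q hq v)) (R := R)
    (fun q _ ξ hξ => by simp [hR ξ hξ])

/-- Exponential decay of the kernels of `A e^{-sg}` localized to a region where `g > c`. -/
theorem exists_kernelNorm_exp_bound {K : Set Q} (hK : IsCompact K) {ψ : Sp d → ℂ}
    (hψ : IsTest ψ) {A g : Q × Sp d → ℝ} {c : ℝ}
    (hA : ∀ q ∈ K, ∀ v ∈ tsupport ψ, ContDiffAt ℝ ∞ A (q, v))
    (h : ∀ q ∈ K, ∀ v ∈ tsupport ψ, ContDiffAt ℝ ∞ g (q, v))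
    (hg : ∀ q ∈ K, ∀ v ∈ tsupport ψ, c < g (q, v)) :
    ∃ C, 0 < C ∧ ∀ q ∈ K, ∀ s, 0 ≤ s →
      IsTest (fun ξ => ψ ξ * ((A (q, ξ) * Real.exp (-s * g (q, ξ)) : ℝ) : ℂ)) ∧
      kernelNorm (fun ξ => ψ ξ * ((A (q, ξ) * Real.exp (-s * g (q, ξ)) : ℝ) : ℂ)) ≤ C * Real.exp (-c * s) := by
  have hK' : IsCompact (Icc (0 : ℝ) 1 ×ˢ K) := isCompact_Icc.prod hK
  have hsnd : ∀ (s : ℝ) (q : Q) (v : Sp d), ContDiffAt ℝ ∞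
      (fun r : (ℝ × Q) × Sp d => (r.1.2, r.2)) ((s, q), v) := fun s q v => by fun_prop
  have hgc : ∀ (s : ℝ), ∀ q ∈ K, ∀ v ∈ tsupport ψ, ContDiffAt ℝ ∞
      (fun r : (ℝ × Q) × Sp d => g (r.1.2, r.2)) ((s, q), v) := fun s q hq v hv =>
    ContDiffAt.comp ((s, q), v) (g := g) (f := fun r : (ℝ × Q) × Sp d => (r.1.2, r.2))
      (h q hq v hv) (hsnd s q v)
  have hAc : ∀ (s : ℝ), ∀ q ∈ K, ∀ v ∈ tsupport ψ, ContDiffAt ℝ ∞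
      (fun r : (ℝ × Q) × Sp d => A (r.1.2, r.2)) ((s, q), v) := fun s q hq v hv =>
    ContDiffAt.comp ((s, q), v) (g := A) (f := fun r : (ℝ × Q) × Sp d => (r.1.2, r.2))
      (hA q hq v hv) (hsnd s q v)
  have hs1 : ∀ (s : ℝ) (q : Q) (v : Sp d), ContDiffAt ℝ ∞
      (fun r : (ℝ × Q) × Sp d => r.1.1) ((s, q), v) := fun s q v => by fun_prop
  have hofReal : ContDiff ℝ ∞ (fun x : ℝ => (x : ℂ)) := Complex.ofRealCLM.contDiff
  -- The factor `e^{-cs}` is taken out. For `s ≤ 1` the remaining `e^{-s(g - c)}` is a smooth family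
  -- over the compact interval `[0, 1]`.
  obtain ⟨C₁, hC₁, H₁⟩ := exists_kernelNorm_bound_cutoff hK' hψ
    (a := fun r : (ℝ × Q) × Sp d => ((A (r.1.2, r.2) * Real.exp (-r.1.1 * (g (r.1.2, r.2) - c)) : ℝ) : ℂ))
    (fun q hq v hv => hofReal.contDiffAt.comp _ ((hAc q.1 q.2 hq.2 v hv).mul <|
      Real.contDiff_exp.contDiffAt.comp _
      ((hs1 q.1 q.2 v).neg.mul ((hgc q.1 q.2 hq.2 v hv).sub contDiffAt_const))))
  -- For `s ≥ 1` the parameter is `x = 1/s`: `expNegInvGlue (x / (g - c))` equals `e^{-s(g - c)}`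
  -- and is smooth up to `x = 0`, which compactifies the time axis. The division uses that `g > c`
  -- is strict.
  obtain ⟨C₂, hC₂, H₂⟩ := exists_kernelNorm_bound_cutoff hK' hψ
    (a := fun r : (ℝ × Q) × Sp d => ((A (r.1.2, r.2) * expNegInvGlue (r.1.1 / (g (r.1.2, r.2) - c)) : ℝ) : ℂ))
    (fun q hq v hv => hofReal.contDiffAt.comp _ ((hAc q.1 q.2 hq.2 v hv).mul <|
      (expNegInvGlue.contDiff (n := ⊤)).contDiffAt.comp _
      ((hs1 q.1 q.2 v).div ((hgc q.1 q.2 hq.2 v hv).sub contDiffAt_const)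
        (sub_ne_zero.2 (hg q.2 hq.2 v hv).ne'))))
  refine ⟨max C₁ C₂, lt_max_of_lt_left hC₁, fun q hq s hs => ?_⟩
  have key : ∀ m : Sp d → ℂ, IsTest m → kernelNorm m ≤ max C₁ C₂ →
      (∀ ξ, ψ ξ * ((A (q, ξ) * Real.exp (-s * g (q, ξ)) : ℝ) : ℂ) = ((Real.exp (-c * s) : ℝ) : ℂ) * m ξ) →
      IsTest (fun ξ => ψ ξ * ((A (q, ξ) * Real.exp (-s * g (q, ξ)) : ℝ) : ℂ)) ∧
      kernelNorm (fun ξ => ψ ξ * ((A (q, ξ) * Real.exp (-s * g (q, ξ)) : ℝ) : ℂ)) ≤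
        max C₁ C₂ * Real.exp (-c * s) := by
    intro m hm hmn he
    simp only [he]
    refine ⟨⟨contDiff_const.mul hm.1, hm.2.mul_left⟩, ?_⟩
    rw [kernelNorm_const_mul, Complex.norm_real, Real.norm_of_nonneg (Real.exp_nonneg _), mul_comm]
    gcongr
  rcases le_total s 1 with hs' | hs'
  · obtain ⟨h1, h2⟩ := H₁ (s, q) ⟨⟨hs, hs'⟩, hq⟩
    refine key _ h1 (h2.trans (le_max_left _ _)) fun ξ => ?_
    rw [mul_left_comm, ← Complex.ofReal_mul, mul_left_comm, ← Real.exp_add]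
    congr 4
    ring
  · have hs0 : 0 < s := by linarith
    obtain ⟨h1, h2⟩ := H₂ (1 / s, q) ⟨⟨by positivity, by rw [div_le_one hs0]; exact hs'⟩, hq⟩
    refine key _ h1 (h2.trans (le_max_right _ _)) fun ξ => ?_
    by_cases hξ : ξ ∈ tsupport ψ
    · have hpos : 0 < g (q, ξ) - c := sub_pos.2 (hg q hq ξ hξ)
      rw [mul_left_comm, expNegInvGlue, if_neg (by simpa using by positivity), ← Complex.ofReal_mul,
        mul_left_comm, ← Real.exp_add]
      congr 4
      field_simp
      ring
    · simp [image_eq_zero_of_notMem_tsupport hξ]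

end KernelFamilies

/-! ### Enlarged annular cut-offs and homogeneous symbols -/

section Cutoffs

variable {d : ℕ}

/-- A cut-off to the annulus `3/16 ≤ |ξ| ≤ 16/3`, equal to `1` on `1/3 ≤ |ξ| ≤ 3`. -/
noncomputable def fat (χ : Sp d → ℝ) (ξ : Sp d) : ℂ :=
  ((χ ((4 : ℝ)⁻¹ • ξ) - χ ((4 : ℝ) • ξ) : ℝ) : ℂ)

/-- The cut-off `fat` at scale `2^k`. -/
noncomputable def fatk (χ : Sp d → ℝ) (k : ℤ) (ξ : Sp d) : ℂ := fat χ ((2 : ℝ) ^ (-k) • ξ)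

variable {χ : Sp d → ℝ}

theorem fat_eq_zero_of_le (hχ : IsCutoff χ) {ξ : Sp d} (h : ‖ξ‖ ≤ 3 / 16) : fat χ ξ = 0 := by
  rw [fat, hχ.eq_one, hχ.eq_one]
  · simp
  · rw [norm_smul, Real.norm_of_nonneg (by norm_num)]; linarith
  · rw [norm_smul, Real.norm_of_nonneg (by norm_num)]; linarith

theorem fat_eq_zero_of_ge (hχ : IsCutoff χ) {ξ : Sp d} (h : 16 / 3 ≤ ‖ξ‖) : fat χ ξ = 0 := by
  rw [fat, hχ.eq_zero, hχ.eq_zero]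
  · simp
  · rw [norm_smul, Real.norm_of_nonneg (by norm_num)]; linarith
  · rw [norm_smul, Real.norm_of_nonneg (by norm_num)]; linarith

theorem fat_eq_one (hχ : IsCutoff χ) {ξ : Sp d} (h : 1 / 3 ≤ ‖ξ‖) (h' : ‖ξ‖ ≤ 3) :
    fat χ ξ = 1 := by
  rw [fat, hχ.eq_one, hχ.eq_zero]
  · simp
  · rw [norm_smul, Real.norm_of_nonneg (by norm_num)]; linarith
  · rw [norm_smul, Real.norm_of_nonneg (by norm_num)]; linarith

theorem norm_fat_le (hχ : IsCutoff χ) (ξ : Sp d) : ‖fat χ ξ‖ ≤ 1 := by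
  rw [fat, Complex.norm_real, Real.norm_eq_abs, abs_le]
  have h1 := hχ.mem_unit ((4 : ℝ)⁻¹ • ξ)
  have h2 := hχ.mem_unit ((4 : ℝ) • ξ)
  constructor <;> linarith [h1.1, h1.2, h2.1, h2.2]

theorem isTest_fat (hχ : IsCutoff χ) : IsTest (fat χ) := by
  refine isTest_of_contDiffAt (R := 16 / 3) (fun v => ?_) fun ξ h => fat_eq_zero_of_ge hχ h
  have h1 : ContDiff ℝ ∞ fun ξ : Sp d => χ ((4 : ℝ)⁻¹ • ξ) - χ ((4 : ℝ) • ξ) :=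
    (hχ.smooth.comp (by fun_prop)).sub (hχ.smooth.comp (by fun_prop))
  exact (Complex.ofRealCLM.contDiff.comp h1).contDiffAt

theorem norm_of_mem_tsupport_fat (hχ : IsCutoff χ) {ξ : Sp d} (h : ξ ∈ tsupport (fat χ)) :
    3 / 16 ≤ ‖ξ‖ ∧ ‖ξ‖ ≤ 16 / 3 := by
  have hc : IsClosed {ξ : Sp d | 3 / 16 ≤ ‖ξ‖ ∧ ‖ξ‖ ≤ 16 / 3} :=
    (isClosed_le continuous_const continuous_norm).inter (isClosed_le continuous_norm continuous_const)
  refine closure_minimal (fun ζ hζ => ?_) hc h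
  by_contra hn
  simp only [mem_ofPred_eq, not_and_or, not_le] at hn
  rcases hn with hn | hn
  · exact hζ (fat_eq_zero_of_le hχ hn.le)
  · exact hζ (fat_eq_zero_of_ge hχ hn.le)

theorem ne_zero_of_mem_tsupport_fat (hχ : IsCutoff χ) {ξ : Sp d} (h : ξ ∈ tsupport (fat χ)) :
    ξ ≠ 0 := by
  rintro rfl
  have := (norm_of_mem_tsupport_fat hχ h).1
  norm_num at this

theorem isTest_fatk (hχ : IsCutoff χ) (k : ℤ) : IsTest (fatk χ k) :=
  (isTest_fat hχ).comp_smul (by positivity)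

theorem norm_fatk_le (hχ : IsCutoff χ) (k : ℤ) (ξ : Sp d) : ‖fatk χ k ξ‖ ≤ 1 := norm_fat_le hχ _

theorem norm_of_fatk_ne_zero (hχ : IsCutoff χ) {k : ℤ} {ξ : Sp d} (h : fatk χ k ξ ≠ 0) :
    3 / 16 * (2 : ℝ) ^ k ≤ ‖ξ‖ ∧ ‖ξ‖ ≤ 16 / 3 * (2 : ℝ) ^ k := by
  have h1 := norm_of_mem_tsupport_fat hχ (subset_tsupport _ h)
  rw [norm_smul, Real.norm_of_nonneg (by positivity), zpow_neg] at h1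
  have h2 : (0 : ℝ) < 2 ^ k := by positivity
  rw [inv_mul_eq_div, le_div_iff₀ h2, div_le_iff₀ h2] at h1
  exact h1

theorem fatk_eq_zero_of_ge (hχ : IsCutoff χ) {k : ℤ} {ξ : Sp d} (h : 16 / 3 * (2 : ℝ) ^ k ≤ ‖ξ‖) :
    fatk χ k ξ = 0 := by
  refine fat_eq_zero_of_ge hχ ?_
  rw [norm_smul, Real.norm_of_nonneg (by positivity), zpow_neg, inv_mul_eq_div,
    le_div_iff₀ (by positivity)]
  exact h

/-- The kernels of a homogeneous symbol, localized at frequencies of size `2^k`. -/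
theorem exists_lpB_homogeneous (hχ : IsCutoff χ) {a : Sp d → ℂ} (n : ℤ)
    (ha : ∀ ξ, ξ ≠ 0 → ContDiffAt ℝ ∞ a ξ)
    (hh : ∀ (l : ℝ), 0 < l → ∀ ξ, a (l • ξ) = ((l ^ n : ℝ) : ℂ) * a ξ) :
    ∃ C, 0 < C ∧ ∀ k : ℤ, IsTest (fun ξ => fatk χ k ξ * a ξ) ∧ ∀ p : ℝ, 1 < p →
      LpB (ENNReal.ofReal p) (fun ξ => fatk χ k ξ * a ξ) (C * ((2 : ℝ) ^ k) ^ n) := by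
  -- A single symbol: `{0} ⊆ ℝ` is a dummy parameter set.
  obtain ⟨C, hC, h⟩ := exists_kernelNorm_bound_cutoff (Q := ℝ) (K := {0}) isCompact_singleton
    (isTest_fat hχ) (a := fun r => a r.2)
    (fun q _ v hv => (ha v (ne_zero_of_mem_tsupport_fat hχ hv)).comp (q, v) contDiffAt_snd)
  obtain ⟨h1, h2⟩ := h 0 rfl
  refine ⟨C, hC, fun k => ?_⟩
  have e : (fun ξ => fatk χ k ξ * a ξ) = fun ξ : Sp d => ((((2 : ℝ) ^ k) ^ n : ℝ) : ℂ) *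
      (fun ζ => fat χ ζ * a ζ) ((2 : ℝ) ^ (-k) • ξ) := by
    ext ξ
    have : a ξ = ((((2 : ℝ) ^ k) ^ n : ℝ) : ℂ) * a ((2 : ℝ) ^ (-k) • ξ) := by
      rw [← hh _ (by positivity), smul_smul, zpow_neg, mul_inv_cancel₀ (by positivity), one_smul]
    rw [this, fatk]
    ring
  have ht : IsTest (fun ξ : Sp d => (fun ζ => fat χ ζ * a ζ) ((2 : ℝ) ^ (-k) • ξ)) :=
    h1.comp_smul (by positivity)
  rw [e]
  refine ⟨⟨contDiff_const.mul ht.1, ht.2.mul_left⟩, fun p hp => ?_⟩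
  have hb := (lpB_comp_smul hp h1 hC h2 (l := (2 : ℝ) ^ (-k)) (by positivity)).const_mul
    (c := ((((2 : ℝ) ^ k) ^ n : ℝ) : ℂ)) (Complex.ofReal_ne_zero.2 (by positivity)) ht.tg
  refine hb.mono (le_of_eq ?_)
  rw [Complex.norm_real, Real.norm_of_nonneg (by positivity), mul_comm]

end Cutoffs

/-! ### Symbols of the Leray projector and of `∂_j(-Δ)⁻¹` -/

section Symbols

variable {d : ℕ}

/-- The symbol of the Leray projector. -/
noncomputable def projSymbol (i l : Fin d) (ξ : Sp d) : ℂ :=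
  (((if i = l then (1 : ℝ) else 0) - ξ i * ξ l / ‖ξ‖ ^ 2 : ℝ) : ℂ)

/-- The symbol of `∂_j (-Δ)⁻¹`. -/
noncomputable def invSymbol (j : Fin d) (ξ : Sp d) : ℂ :=
  Complex.I * ((ξ j / ‖ξ‖ ^ 2 : ℝ) : ℂ)

theorem contDiff_coord (j : Fin d) : ContDiff ℝ ∞ (fun ξ : Sp d => ξ j) :=
  (EuclideanSpace.proj j : Sp d →L[ℝ] ℝ).contDiff

theorem contDiff_ofReal_comp {f : Sp d → ℝ} {ξ : Sp d} (h : ContDiffAt ℝ ∞ f ξ) :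
    ContDiffAt ℝ ∞ (fun ξ => ((f ξ : ℝ) : ℂ)) ξ :=
  Complex.ofRealCLM.contDiff.contDiffAt.comp ξ h

theorem contDiffAt_projSymbol (i l : Fin d) {ξ : Sp d} (h : ξ ≠ 0) :
    ContDiffAt ℝ ∞ (projSymbol i l) ξ := by
  refine contDiff_ofReal_comp (contDiffAt_const.sub (((contDiff_coord i).mul
    (contDiff_coord l)).contDiffAt.div (contDiff_norm_sq ℝ).contDiffAt ?_))
  have := norm_pos_iff.2 h
  positivity

theorem contDiffAt_pdSymbol (j : Fin d) (ξ : Sp d) : ContDiffAt ℝ ∞ (pdSymbol j) ξ :=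
  contDiffAt_const.mul (contDiff_ofReal_comp (contDiff_coord j).contDiffAt)

theorem contDiffAt_invSymbol (j : Fin d) {ξ : Sp d} (h : ξ ≠ 0) :
    ContDiffAt ℝ ∞ (invSymbol j) ξ := by
  refine contDiffAt_const.mul (contDiff_ofReal_comp
    ((contDiff_coord j).contDiffAt.div (contDiff_norm_sq ℝ).contDiffAt ?_))
  have := norm_pos_iff.2 h
  positivity

theorem projSymbol_smul (i l : Fin d) {c : ℝ} (hc : 0 < c) (ξ : Sp d) :
    projSymbol i l (c • ξ) = projSymbol i l ξ := by
  simp only [projSymbol, PiLp.smul_apply, smul_eq_mul, norm_smul, Real.norm_of_nonneg hc.le]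
  congr 2
  have := hc.ne'
  rw [mul_pow, show c * ξ i * (c * ξ l) = c ^ 2 * (ξ i * ξ l) by ring,
    mul_div_mul_left _ _ (by positivity)]

theorem pdSymbol_smul (j : Fin d) (c : ℝ) (ξ : Sp d) :
    pdSymbol j (c • ξ) = (c : ℂ) * pdSymbol j ξ := by
  simp [pdSymbol]; ring

theorem invSymbol_smul (j : Fin d) {c : ℝ} (hc : 0 < c) (ξ : Sp d) :
    invSymbol j (c • ξ) = ((c ^ (-1 : ℤ) : ℝ) : ℂ) * invSymbol j ξ := by
  simp only [invSymbol, PiLp.smul_apply, smul_eq_mul, norm_smul, Real.norm_of_nonneg hc.le]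
  rw [mul_left_comm, ← Complex.ofReal_mul]
  congr 2
  have := hc.ne'
  rw [mul_pow, sq c, mul_assoc, mul_div_mul_left _ _ this, zpow_neg_one]
  rw [mul_comm c, div_mul_eq_div_div, inv_mul_eq_div]

theorem sum_coord_sq (ξ : Sp d) : ∑ l, ξ l * ξ l = ‖ξ‖ ^ 2 := by
  rw [EuclideanSpace.real_norm_sq_eq]
  simp [sq]

/-- The Leray projector annihilates gradients. This removes the pressure and, later, one half of
`D(u)`. -/
theorem sum_projSymbol_mul_pdSymbol (i : Fin d) (ξ : Sp d) :
    ∑ l, projSymbol i l ξ * pdSymbol l ξ = 0 := by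
  have h : ∑ l, ((if i = l then (1 : ℝ) else 0) - ξ i * ξ l / ‖ξ‖ ^ 2) * ξ l = 0 := by
    simp only [sub_mul, Finset.sum_sub_distrib, ite_mul, one_mul, zero_mul, Finset.sum_ite_eq,
      Finset.mem_univ, if_true]
    have : ∀ l, ξ i * ξ l / ‖ξ‖ ^ 2 * ξ l = ξ i / ‖ξ‖ ^ 2 * (ξ l * ξ l) := fun l => by ring
    simp only [this]
    rw [← Finset.mul_sum, sum_coord_sq]
    by_cases h0 : ξ = 0
    · simp [h0]
    · have := norm_pos_iff.2 h0
      field_simp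
      ring
  have e : ∑ l, projSymbol i l ξ * pdSymbol l ξ = Complex.I *
      ((∑ l, ((if i = l then (1 : ℝ) else 0) - ξ i * ξ l / ‖ξ‖ ^ 2) * ξ l : ℝ) : ℂ) := by
    rw [Complex.ofReal_sum, Finset.mul_sum]
    refine Finset.sum_congr rfl fun l _ => ?_
    simp only [projSymbol, pdSymbol, Complex.ofReal_mul]
    ring
  rw [e, h]; simp

theorem sum_pdSymbol_sq (ξ : Sp d) :
    ∑ j, pdSymbol j ξ * pdSymbol j ξ = -((‖ξ‖ ^ 2 : ℝ) : ℂ) := by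
  rw [← sum_coord_sq, Complex.ofReal_sum, ← Finset.sum_neg_distrib]
  refine Finset.sum_congr rfl fun j _ => ?_
  simp only [pdSymbol, Complex.ofReal_mul]
  linear_combination ((ξ j : ℝ) : ℂ) * ((ξ j : ℝ) : ℂ) * Complex.I_mul_I

theorem invSymbol_mul_normSq (j : Fin d) (ξ : Sp d) :
    invSymbol j ξ * ((‖ξ‖ ^ 2 : ℝ) : ℂ) = pdSymbol j ξ := by
  rw [invSymbol, pdSymbol, mul_assoc, ← Complex.ofReal_mul]
  congr 2
  by_cases h0 : ξ = 0
  · simp [h0]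
  · have := norm_pos_iff.2 h0
    field_simp

/-- The projector is the identity plus an operator applied to the divergence; hence it fixes
divergence-free fields. -/
theorem projSymbol_eq (i l : Fin d) (ξ : Sp d) :
    projSymbol i l ξ = (if i = l then 1 else 0) + invSymbol i ξ * pdSymbol l ξ := by
  simp only [projSymbol, invSymbol, pdSymbol]
  have : Complex.I * ((ξ i / ‖ξ‖ ^ 2 : ℝ) : ℂ) * (Complex.I * ((ξ l : ℝ) : ℂ)) =
      -(((ξ i * ξ l / ‖ξ‖ ^ 2 : ℝ)) : ℂ) := by
    rw [show ξ i * ξ l / ‖ξ‖ ^ 2 = ξ i / ‖ξ‖ ^ 2 * ξ l by ring, Complex.ofReal_mul]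
    linear_combination ((ξ i / ‖ξ‖ ^ 2 : ℝ) : ℂ) * ((ξ l : ℝ) : ℂ) * Complex.I_mul_I
  rw [this]
  split_ifs <;> simp [sub_eq_add_neg]

end Symbols

/-! ### Weak time derivatives and weak continuity -/

section WeakDeriv

variable {d : ℕ}

/-- `X` has the weak time derivative `Y` at time `t`. -/
def WeakDeriv (X : ℝ → Dist d) (Y : Dist d) (t : ℝ) : Prop :=
  ∀ φ : 𝓢(Sp d, ℂ), HasDerivAt (fun s => X s φ) (Y φ) t

/-- `X` is weakly continuous on `[0, ∞)`. -/
def WeakCont (X : ℝ → Dist d) : Prop :=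
  ∀ φ : 𝓢(Sp d, ℂ), ContinuousOn (fun s => X s φ) (Ici 0)

theorem WeakDeriv.mult {X : ℝ → Dist d} {Y : Dist d} {t : ℝ} (h : WeakDeriv X Y t)
    (m : Sp d → ℂ) : WeakDeriv (fun s => mult m (X s)) (mult m Y) t := fun _ => h _

theorem WeakDeriv.add {X X' : ℝ → Dist d} {Y Y' : Dist d} {t : ℝ} (h : WeakDeriv X Y t)
    (h' : WeakDeriv X' Y' t) : WeakDeriv (fun s => X s + X' s) (Y + Y') t :=
  fun φ => (h φ).fun_add (h' φ)

theorem WeakDeriv.sum {ι : Type*} {s : Finset ι} {X : ι → ℝ → Dist d} {Y : ι → Dist d} {t : ℝ}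
    (h : ∀ i, WeakDeriv (X i) (Y i) t) :
    WeakDeriv (fun r => ∑ i ∈ s, X i r) (∑ i ∈ s, Y i) t := by
  intro φ
  simp only [sum_apply]
  exact HasDerivAt.fun_sum fun i _ => h i φ

theorem WeakDeriv.congr {X X' : ℝ → Dist d} {Y : Dist d} {t : ℝ} (ht : 0 < t)
    (h : WeakDeriv X Y t) (he : ∀ s, 0 ≤ s → X' s = X s) : WeakDeriv X' Y t := by
  intro φ
  refine (h φ).congr_of_eventuallyEq ?_
  filter_upwards [lt_mem_nhds ht] with s hs
  rw [he s hs.le]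

theorem WeakCont.mult {X : ℝ → Dist d} (h : WeakCont X) (m : Sp d → ℂ) :
    WeakCont (fun s => mult m (X s)) := fun _ => h _

theorem WeakCont.add {X X' : ℝ → Dist d} (h : WeakCont X) (h' : WeakCont X') :
    WeakCont (fun s => X s + X' s) :=
  fun φ => (h φ).add (h' φ)

theorem WeakCont.sum {ι : Type*} {s : Finset ι} {X : ι → ℝ → Dist d} (h : ∀ i, WeakCont (X i)) :
    WeakCont (fun r => ∑ i ∈ s, X i r) := by
  intro φ
  simp only [sum_apply]
  exact continuousOn_finsetSum _ fun i _ => h i φ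

end WeakDeriv

/-! ### Reduction to an oscillator and a heat equation -/

section Reduction

variable {d : ℕ}

theorem tg_mul {m n : Sp d → ℂ} (hm : m.HasTemperateGrowth) (hn : n.HasTemperateGrowth) :
    (fun ξ => m ξ * n ξ).HasTemperateGrowth := hm.mul hn

theorem tg_neg_normSq (c : ℝ) :
    (fun ξ : Sp d => -((c * ‖ξ‖ ^ 2 : ℝ) : ℂ)).HasTemperateGrowth := by
  have e : (fun ξ : Sp d => -((c * ‖ξ‖ ^ 2 : ℝ) : ℂ)) =
      fun ξ => (-(c : ℂ)) * ((‖ξ‖ ^ 2 : ℝ) : ℂ) := by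
    ext ξ; push_cast; ring
  rw [e]
  exact tg_mul (Function.HasTemperateGrowth.const _) hasTemperateGrowth_normSq

theorem smul_sum_dist {ι : Type*} (s : Finset ι) (c : ℂ) (f : ι → Dist d) :
    ∑ i ∈ s, c • f i = c • ∑ i ∈ s, f i := by
  ext φ
  simp only [sum_apply, smul_apply, Finset.smul_sum]

/-- The symbol of `ℙ div` localized to an annulus. -/
noncomputable def divSym (χ : Sp d → ℝ) (k : ℤ) (i l j : Fin d) (ξ : Sp d) : ℂ :=
  fatk χ k ξ * (projSymbol i l ξ * pdSymbol j ξ)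

/-- The symbol of `∂_j (-Δ)⁻¹` localized to an annulus. -/
noncomputable def invSym (χ : Sp d → ℝ) (k : ℤ) (j : Fin d) (ξ : Sp d) : ℂ :=
  fatk χ k ξ * invSymbol j ξ

/-- `ℙ div T` for `T` localized to an annulus. -/
noncomputable def projDiv (χ : Sp d → ℝ) (k : ℤ) (T : Fin d → Fin d → Dist d) (i : Fin d) : Dist d :=
  ∑ l, ∑ j, mult (divSym χ k i l j) (T l j)

/-- The part of the localized tensor `T` that solves a pure heat equation. -/
noncomputable def heatPart (χ : Sp d → ℝ) (k : ℤ) (T : Fin d → Fin d → Dist d) (i j : Fin d) : Dist d :=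
  T i j + mult (invSym χ k j) (projDiv χ k T i) + mult (invSym χ k i) (projDiv χ k T j)

variable {χ : Sp d → ℝ} (hχ : IsCutoff χ)
include hχ

/-- `fatk` vanishes near the origin, so a symbol singular only there becomes a test function. -/
theorem isTest_fatk_mul (k : ℤ) {a : Sp d → ℂ} (ha : ∀ ξ, ξ ≠ 0 → ContDiffAt ℝ ∞ a ξ) :
    IsTest (fun ξ => fatk χ k ξ * a ξ) := by
  refine isTest_of_contDiffAt (R := 16 / 3 * (2 : ℝ) ^ k) (fun v => ?_)
    fun ξ h => by rw [fatk_eq_zero_of_ge hχ h, zero_mul]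
  by_cases hv : v = 0
  · have h0 : (fun ξ => fatk χ k ξ * a ξ) =ᶠ[𝓝 v] fun _ => 0 := by
      subst hv
      have : ∀ᶠ w : Sp d in 𝓝 0, ‖w‖ < 3 / 16 * (2 : ℝ) ^ k := by
        have := (continuous_norm (E := Sp d)).tendsto 0
        rw [norm_zero] at this
        exact this.eventually (gt_mem_nhds (by positivity))
      filter_upwards [this] with w hw
      have : fatk χ k w = 0 := by
        by_contra hn
        exact absurd (norm_of_fatk_ne_zero hχ hn).1 (not_le.2 hw)
      rw [this, zero_mul]
    exact contDiffAt_const.congr_of_eventuallyEq h0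
  · exact (isTest_fatk hχ k).1.contDiffAt.mul (ha v hv)

theorem isTest_divSym (k : ℤ) (i l j : Fin d) : IsTest (divSym χ k i l j) :=
  isTest_fatk_mul hχ k fun ξ h => (contDiffAt_projSymbol i l h).mul (contDiffAt_pdSymbol j ξ)

theorem isTest_invSym (k : ℤ) (j : Fin d) : IsTest (invSym χ k j) :=
  isTest_fatk_mul hχ k fun _ h => contDiffAt_invSymbol j h

theorem isTest_mul_of_fatk {ψ : Sp d → ℂ} (hψ : IsTest ψ) {k : ℤ}
    (hf : ∀ ξ, fatk χ k ξ * ψ ξ = ψ ξ) {a : Sp d → ℂ} (ha : ∀ ξ, ξ ≠ 0 → ContDiffAt ℝ ∞ a ξ) :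
    IsTest (fun ξ => ψ ξ * a ξ) := by
  have h1 := isTest_fatk_mul hχ k ha
  have e : (fun ξ => ψ ξ * a ξ) = fun ξ => ψ ξ * (fatk χ k ξ * a ξ) := by
    ext ξ; linear_combination (-a ξ) * hf ξ
  rw [e]
  exact ⟨hψ.1.mul h1.1, hψ.2.mul_right⟩

theorem mult_fatk_mul_block {ψ : Sp d → ℂ} (hψ : IsTest ψ) {k : ℤ}
    (hf : ∀ ξ, fatk χ k ξ * ψ ξ = ψ ξ) {a : Sp d → ℂ} (ha : ∀ ξ, ξ ≠ 0 → ContDiffAt ℝ ∞ a ξ)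
    (f : Dist d) : mult (fun ξ => fatk χ k ξ * a ξ) (mult ψ f) = mult (fun ξ => ψ ξ * a ξ) f := by
  rw [mult_mult (isTest_fatk_mul hχ k ha).tg hψ.tg]
  congr 1
  ext ξ
  linear_combination a ξ * hf ξ

theorem mult_fatk_mul_block' {ψ : Sp d → ℂ} (hψ : IsTest ψ) {k : ℤ}
    (hf : ∀ ξ, fatk χ k ξ * ψ ξ = ψ ξ) {a : Sp d → ℂ} (ha : ∀ ξ, ξ ≠ 0 → ContDiffAt ℝ ∞ a ξ)
    (ha' : a.HasTemperateGrowth) (f : Dist d) :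
    mult (fun ξ => fatk χ k ξ * a ξ) (mult ψ f) = mult a (mult ψ f) := by
  rw [mult_fatk_mul_block hχ hψ hf ha, mult_mult ha' hψ.tg]
  simp only [mul_comm]

theorem mult_fatk_block {ψ : Sp d → ℂ} (hψ : IsTest ψ) {k : ℤ}
    (hf : ∀ ξ, fatk χ k ξ * ψ ξ = ψ ξ) (f : Dist d) :
    mult (fatk χ k) (mult ψ f) = mult ψ f := by
  rw [mult_mult (isTest_fatk hχ k).tg hψ.tg]
  simp only [hf]

theorem mult_fatk_projDiv {ψ : Sp d → ℂ} (hψ : IsTest ψ) {k : ℤ}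
    (hf : ∀ ξ, fatk χ k ξ * ψ ξ = ψ ξ) (τ : Fin d → Fin d → Dist d) (i : Fin d) :
    mult (fatk χ k) (projDiv χ k (fun l j => mult ψ (τ l j)) i) =
      projDiv χ k (fun l j => mult ψ (τ l j)) i := by
  simp only [projDiv, mult_sum]
  refine Finset.sum_congr rfl fun l _ => Finset.sum_congr rfl fun j _ => ?_
  rw [mult_comm (isTest_fatk hχ k).tg (isTest_divSym hχ k i l j).tg, mult_fatk_block hχ hψ hf]

theorem mult_fatk_heatPart {ψ : Sp d → ℂ} (hψ : IsTest ψ) {k : ℤ}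
    (hf : ∀ ξ, fatk χ k ξ * ψ ξ = ψ ξ) (τ : Fin d → Fin d → Dist d) (i j : Fin d) :
    mult (fatk χ k) (heatPart χ k (fun l j => mult ψ (τ l j)) i j) =
      heatPart χ k (fun l j => mult ψ (τ l j)) i j := by
  simp only [heatPart, mult_add]
  rw [mult_comm (isTest_fatk hχ k).tg (isTest_invSym hχ k j).tg,
    mult_comm (isTest_fatk hχ k).tg (isTest_invSym hχ k i).tg, mult_fatk_block hχ hψ hf,
    mult_fatk_projDiv hχ hψ hf, mult_fatk_projDiv hχ hψ hf]

/-- The localized velocity is invariant under the Leray projector. -/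
theorem block_eq_sum_proj {ψ : Sp d → ℂ} (hψ : IsTest ψ) {k : ℤ}
    (hf : ∀ ξ, fatk χ k ξ * ψ ξ = ψ ξ) {u : Fin d → Dist d} (hdiv : ∑ i, pd i (u i) = 0)
    (i : Fin d) : mult ψ (u i) = ∑ l, mult (fun ξ => ψ ξ * projSymbol i l ξ) (u l) := by
  have hq : IsTest (fun ξ => ψ ξ * invSymbol i ξ) :=
    isTest_mul_of_fatk hχ hψ hf fun _ h => contDiffAt_invSymbol i h
  have e : ∀ l, mult (fun ξ => ψ ξ * projSymbol i l ξ) (u l) =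
      (if i = l then mult ψ (u l) else 0) + mult (fun ξ => ψ ξ * invSymbol i ξ) (pd l (u l)) := by
    intro l
    rw [pd_eq_mult, mult_mult hq.tg (hasTemperateGrowth_pdSymbol l)]
    have ht2 : (fun ξ : Sp d => ψ ξ * invSymbol i ξ * pdSymbol l ξ).HasTemperateGrowth :=
      tg_mul hq.tg (hasTemperateGrowth_pdSymbol l)
    by_cases hil : i = l
    · rw [if_pos hil, ← mult_add_symbol hψ.tg ht2]
      congr 1; ext ξ
      rw [projSymbol_eq, if_pos hil]; ring
    · rw [if_neg hil, zero_add]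
      congr 1; ext ξ
      rw [projSymbol_eq, if_neg hil]; ring
  simp only [e]
  rw [Finset.sum_add_distrib, ← mult_sum, hdiv, mult_zero, add_zero]
  simp

variable {ν₁ ν₂ η : ℝ} {u₀ : Fin d → Dist d} {τ₀ : Fin d → Fin d → Dist d}
  {u : ℝ → Fin d → Dist d} {τ : ℝ → Fin d → Fin d → Dist d}
  (hs : IsSolution ν₁ ν₂ η u₀ τ₀ u τ)
include hs

/-- Testing the momentum equation with `ψ(D)ℙ` instead of `ψ(D)` leaves the velocity unchanged,
because it is divergence free, and eliminates `P`, about whose time dependence nothing is known. -/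
theorem weakDeriv_velocity {ψ : Sp d → ℂ} (hψ : IsTest ψ) {k : ℤ}
    (hf : ∀ ξ, fatk χ k ξ * ψ ξ = ψ ξ) (i : Fin d) {t : ℝ} (ht : 0 < t) :
    WeakDeriv (fun s => mult ψ (u s i))
      ((ν₁ : ℂ) • projDiv χ k (fun l j => mult ψ (τ t l j)) i) t := by
  obtain ⟨P, hP⟩ := hs.momentum
  have h1 : WeakDeriv (fun s => ∑ l, mult (fun ξ => ψ ξ * projSymbol i l ξ) (u s l))
      (∑ l, mult (fun ξ => ψ ξ * projSymbol i l ξ)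
        ((ν₁ : ℂ) • (∑ j, pd j (τ t l j)) - pd l (P t))) t :=
    WeakDeriv.sum fun l => WeakDeriv.mult (X := fun s => u s l) (hP t ht l) _
  have hp : ∀ l, IsTest (fun ξ => ψ ξ * projSymbol i l ξ) := fun l =>
    isTest_mul_of_fatk hχ hψ hf fun _ h => contDiffAt_projSymbol i l h
  have e : ∑ l, mult (fun ξ => ψ ξ * projSymbol i l ξ)
        ((ν₁ : ℂ) • (∑ j, pd j (τ t l j)) - pd l (P t)) =
      (ν₁ : ℂ) • projDiv χ k (fun l j => mult ψ (τ t l j)) i := by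
    simp only [mult_sub, mult_smul, mult_sum, Finset.sum_sub_distrib, pd_eq_mult]
    have e2 : ∑ l, mult (fun ξ => ψ ξ * projSymbol i l ξ) (mult (pdSymbol l) (P t)) = 0 := by
      have : ∀ l, mult (fun ξ => ψ ξ * projSymbol i l ξ) (mult (pdSymbol l) (P t)) =
          mult (fun ξ => ψ ξ * projSymbol i l ξ * pdSymbol l ξ) (P t) :=
        fun l => mult_mult (hp l).tg (hasTemperateGrowth_pdSymbol l) _
      simp only [this]
      rw [sum_mult _ fun l => tg_mul (hp l).tg (hasTemperateGrowth_pdSymbol l)]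
      have h0 : (fun ξ : Sp d => ∑ l, ψ ξ * projSymbol i l ξ * pdSymbol l ξ) = fun _ => 0 := by
        ext ξ
        simp only [mul_assoc]
        rw [← Finset.mul_sum, sum_projSymbol_mul_pdSymbol, mul_zero]
      rw [h0, mult_zero_symbol]
    rw [e2, sub_zero, smul_sum_dist]
    refine congrArg (fun f : Dist d => (ν₁ : ℂ) • f) ?_
    simp only [projDiv]
    refine Finset.sum_congr rfl fun l _ => Finset.sum_congr rfl fun j _ => ?_
    rw [mult_mult (hp l).tg (hasTemperateGrowth_pdSymbol j)]
    have := mult_fatk_mul_block hχ hψ hf (a := fun ξ => projSymbol i l ξ * pdSymbol j ξ)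
      (fun ξ h => (contDiffAt_projSymbol i l h).mul (contDiffAt_pdSymbol j ξ)) (τ t l j)
    refine Eq.trans ?_ this.symm
    simp only [mul_assoc]
  rw [e] at h1
  exact h1.congr ht fun s hs' => block_eq_sum_proj hχ hψ hf (hs.div_free s hs') i

omit hχ in
theorem weakDeriv_stress {ψ : Sp d → ℂ} (hψ : IsTest ψ) (i j : Fin d) {t : ℝ} (ht : 0 < t) :
    WeakDeriv (fun s => mult ψ (τ s i j))
      (mult (fun ξ => -((η * ‖ξ‖ ^ 2 : ℝ) : ℂ)) (mult ψ (τ t i j)) +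
        ((ν₂ : ℂ) * 2⁻¹) • (mult (pdSymbol j) (mult ψ (u t i)) +
          mult (pdSymbol i) (mult ψ (u t j)))) t := by
  have h1 := WeakDeriv.mult (X := fun s => τ s i j) (hs.stress t ht i j) ψ
  have htn : (fun ξ : Sp d => -((‖ξ‖ ^ 2 : ℝ) : ℂ)).HasTemperateGrowth := hasTemperateGrowth_normSq.neg
  have e : mult (fun ξ : Sp d => -((η * ‖ξ‖ ^ 2 : ℝ) : ℂ)) (mult ψ (τ t i j)) =
      (η : ℂ) • mult ψ (Δ (τ t i j)) := by
    rw [laplacian_eq_mult, mult_comm hψ.tg htn, ← mult_const_mul htn]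
    congr 1; ext ξ; push_cast; ring
  rw [e]
  simp only [mult_add, mult_smul] at h1
  simp only [pd_eq_mult] at h1
  rw [mult_comm hψ.tg (hasTemperateGrowth_pdSymbol j),
    mult_comm hψ.tg (hasTemperateGrowth_pdSymbol i)] at h1
  exact h1

/-- The divergence of the source contains `∂_l div u`, annihilated by the projector as a gradient,
and `Δu^l`, on which the projector acts as the identity. Hence the equation for `W = ℙ div τ`
involves only `W` and `u`. -/
theorem weakDeriv_projDiv {ψ : Sp d → ℂ} (hψ : IsTest ψ) {k : ℤ}
    (hf : ∀ ξ, fatk χ k ξ * ψ ξ = ψ ξ) (i : Fin d) {t : ℝ} (ht : 0 < t) :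
    WeakDeriv (fun s => projDiv χ k (fun l j => mult ψ (τ s l j)) i)
      (mult (fun ξ => -((η * ‖ξ‖ ^ 2 : ℝ) : ℂ)) (projDiv χ k (fun l j => mult ψ (τ t l j)) i) +
        mult (fun ξ => -((ν₂ / 2 * ‖ξ‖ ^ 2 : ℝ) : ℂ)) (mult ψ (u t i))) t := by
  have h1 : WeakDeriv (fun s => projDiv χ k (fun l j => mult ψ (τ s l j)) i) _ t :=
    WeakDeriv.sum fun l => WeakDeriv.sum fun j =>
      (weakDeriv_stress hs hψ l j ht).mult (divSym χ k i l j)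
  have tdiv : ∀ l j, (divSym χ k i l j).HasTemperateGrowth := fun l j => (isTest_divSym hχ k i l j).tg
  have tη := tg_neg_normSq (d := d) η
  have htn : (fun ξ : Sp d => -((‖ξ‖ ^ 2 : ℝ) : ℂ)).HasTemperateGrowth := hasTemperateGrowth_normSq.neg
  have tp := fun j : Fin d => hasTemperateGrowth_pdSymbol j
  refine (congrArg (fun Y => WeakDeriv _ Y t) ?_).mpr h1
  simp only [mult_add, mult_smul, Finset.sum_add_distrib]
  refine congrArg₂ (· + ·) ?_ ?_
  · simp only [projDiv, mult_sum]
    refine Finset.sum_congr rfl fun l _ => Finset.sum_congr rfl fun j _ => ?_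
    exact mult_comm tη (tdiv l j) _
  · have e2 : ∑ l, ∑ j, mult (divSym χ k i l j) (mult (pdSymbol l) (mult ψ (u t j))) = 0 := by
      rw [Finset.sum_comm]
      refine Finset.sum_eq_zero fun j _ => ?_
      have : ∀ l, mult (divSym χ k i l j) (mult (pdSymbol l) (mult ψ (u t j))) =
          mult (fun ξ => divSym χ k i l j ξ * pdSymbol l ξ) (mult ψ (u t j)) :=
        fun l => mult_mult (tdiv l j) (tp l) _
      simp only [this]
      rw [sum_mult _ fun l => tg_mul (tdiv l j) (tp l)]
      have h0 : (fun ξ : Sp d => ∑ l, divSym χ k i l j ξ * pdSymbol l ξ) = fun _ => 0 := by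
        ext ξ
        have : ∀ l, divSym χ k i l j ξ * pdSymbol l ξ =
            fatk χ k ξ * pdSymbol j ξ * (projSymbol i l ξ * pdSymbol l ξ) := fun l => by
          simp only [divSym]; ring
        simp only [this]
        rw [← Finset.mul_sum, sum_projSymbol_mul_pdSymbol, mul_zero]
      rw [h0, mult_zero_symbol]
    have e1 : ∑ l, ∑ j, mult (divSym χ k i l j) (mult (pdSymbol j) (mult ψ (u t l))) =
        mult (fun ξ => -((‖ξ‖ ^ 2 : ℝ) : ℂ)) (mult ψ (u t i)) := by
      have hl : ∀ l, ∑ j, mult (divSym χ k i l j) (mult (pdSymbol j) (mult ψ (u t l))) =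
          mult (fun ξ => -((‖ξ‖ ^ 2 : ℝ) : ℂ)) (mult (fun ξ => ψ ξ * projSymbol i l ξ) (u t l)) := by
        intro l
        have : ∀ j, mult (divSym χ k i l j) (mult (pdSymbol j) (mult ψ (u t l))) =
            mult (fun ξ => divSym χ k i l j ξ * pdSymbol j ξ) (mult ψ (u t l)) :=
          fun j => mult_mult (tdiv l j) (tp j) _
        simp only [this]
        rw [sum_mult _ fun j => tg_mul (tdiv l j) (tp j)]
        rw [← mult_fatk_mul_block hχ hψ hf (a := projSymbol i l)
          (fun ξ h => contDiffAt_projSymbol i l h),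
          mult_mult htn (isTest_fatk_mul hχ k fun ξ h => contDiffAt_projSymbol i l h).tg]
        congr 1
        ext ξ
        have : ∀ j, divSym χ k i l j ξ * pdSymbol j ξ =
            fatk χ k ξ * projSymbol i l ξ * (pdSymbol j ξ * pdSymbol j ξ) := fun j => by
          simp only [divSym]; ring
        simp only [this]
        rw [← Finset.mul_sum, sum_pdSymbol_sq]
        ring
      simp only [hl]
      rw [← mult_sum, ← block_eq_sum_proj hχ hψ hf (hs.div_free t ht.le) i]
    simp only [smul_sum_dist, Finset.sum_add_distrib]
    rw [e1, e2, add_zero, ← mult_const_mul htn]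
    congr 1; ext ξ; push_cast; ring

theorem weakDeriv_heatPart {ψ : Sp d → ℂ} (hψ : IsTest ψ) {k : ℤ}
    (hf : ∀ ξ, fatk χ k ξ * ψ ξ = ψ ξ) (i j : Fin d) {t : ℝ} (ht : 0 < t) :
    WeakDeriv (fun s => heatPart χ k (fun l j => mult ψ (τ s l j)) i j)
      (mult (fun ξ => -((η * ‖ξ‖ ^ 2 : ℝ) : ℂ))
        (heatPart χ k (fun l j => mult ψ (τ t l j)) i j)) t := by
  have h1 : WeakDeriv (fun s => heatPart χ k (fun l j => mult ψ (τ s l j)) i j) _ t :=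
    ((weakDeriv_stress hs hψ i j ht).add
      ((weakDeriv_projDiv hχ hs hψ hf i ht).mult (invSym χ k j))).add
      ((weakDeriv_projDiv hχ hs hψ hf j ht).mult (invSym χ k i))
  have tη := tg_neg_normSq (d := d) η
  have tν := tg_neg_normSq (d := d) (ν₂ / 2)
  have ti := fun j : Fin d => (isTest_invSym hχ k j).tg
  -- `∂_j(-Δ)⁻¹` turns the source `(ν₂/2)Δu^i` into `-(ν₂/2)∂_j u^i`; the two correction terms thus
  -- cancel the two halves of `ν₂D(u)`.
  have key : ∀ i j : Fin d, mult (invSym χ k j) (mult (fun ξ => -((ν₂ / 2 * ‖ξ‖ ^ 2 : ℝ) : ℂ))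
      (mult ψ (u t i))) = (-((ν₂ : ℂ) * 2⁻¹)) • mult (pdSymbol j) (mult ψ (u t i)) := by
    intro i j
    rw [mult_mult (ti j) tν, ← mult_fatk_mul_block' hχ hψ hf
      (fun ξ _ => contDiffAt_pdSymbol j ξ) (hasTemperateGrowth_pdSymbol j),
      ← mult_const_mul (isTest_fatk_mul hχ k fun ξ _ => contDiffAt_pdSymbol j ξ).tg]
    congr 1; ext ξ
    rw [← invSymbol_mul_normSq, invSym]
    push_cast; ring
  refine (congrArg (fun Y => WeakDeriv _ Y t) ?_).mpr h1
  simp only [heatPart, mult_add, key]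
  rw [mult_comm tη (ti j), mult_comm tη (ti i)]
  ext φ
  simp only [add_apply, smul_apply, smul_eq_mul]
  ring

omit hχ in
theorem weakCont_velocity (ψ : Sp d → ℂ) (i : Fin d) : WeakCont (fun s => mult ψ (u s i)) :=
  WeakCont.mult (X := fun s => u s i) (hs.cont_u i) ψ

omit hχ in
theorem weakCont_projDiv (ψ : Sp d → ℂ) (k : ℤ) (i : Fin d) :
    WeakCont (fun s => projDiv χ k (fun l j => mult ψ (τ s l j)) i) :=
  WeakCont.sum fun l => WeakCont.sum fun j =>
    (WeakCont.mult (X := fun s => τ s l j) (hs.cont_τ l j) ψ).mult _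

omit hχ in
theorem weakCont_heatPart (ψ : Sp d → ℂ) (k : ℤ) (i j : Fin d) :
    WeakCont (fun s => heatPart χ k (fun l j => mult ψ (τ s l j)) i j) :=
  ((WeakCont.mult (X := fun s => τ s i j) (hs.cont_τ i j) ψ).add
    ((weakCont_projDiv hs ψ k i).mult _)).add ((weakCont_projDiv hs ψ k j).mult _)

end Reduction

/-! ### Propagators of the localized system -/

section Flow

variable {d : ℕ}

/-- `h₀` is the solution of `h'' + η|ξ|² h' + c|ξ|² h = 0`, `h(0) = 0`, `h'(0) = ψ`, with time
derivative `h₁`; both are smooth and supported in a fixed ball of frequencies. -/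
structure IsFund (η c : ℝ) (ψ : Sp d → ℂ) (h₀ h₁ : ℝ × Sp d → ℂ) : Prop where
  smooth₀ : ContDiff ℝ ∞ h₀
  smooth₁ : ContDiff ℝ ∞ h₁
  supp : ∃ R, ∀ s ξ, R ≤ ‖ξ‖ → h₀ (s, ξ) = 0 ∧ h₁ (s, ξ) = 0
  deriv₀ : ∀ s ξ, HasDerivAt (fun s => h₀ (s, ξ)) (h₁ (s, ξ)) s
  deriv₁ : ∀ s ξ, HasDerivAt (fun s => h₁ (s, ξ))
    (-((η * ‖ξ‖ ^ 2 : ℝ) : ℂ) * h₁ (s, ξ) - ((c * ‖ξ‖ ^ 2 : ℝ) : ℂ) * h₀ (s, ξ)) s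
  init₀ : ∀ ξ, h₀ (0, ξ) = 0
  init₁ : ∀ ξ, h₁ (0, ξ) = ψ ξ

/-- The entries of the propagator of `U' = ν₁ W`, `W' = -η|ξ|² W - (ν₂/2)|ξ|² U`. -/
noncomputable def propSym (ν₁ ν₂ η : ℝ) (h₀ h₁ : ℝ × Sp d → ℂ) : Bool → Bool → ℝ × Sp d → ℂ
  | false, false => fun q => h₁ q + ((η * ‖q.2‖ ^ 2 : ℝ) : ℂ) * h₀ q
  | false, true => fun q => (ν₁ : ℂ) * h₀ q
  | true, false => fun q => -((ν₂ / 2 * ‖q.2‖ ^ 2 : ℝ) : ℂ) * h₀ q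
  | true, true => h₁

/-- The matrix of symbols of the system for `U`, `W`. -/
noncomputable def genSym (ν₁ ν₂ η : ℝ) : Bool → Bool → Sp d → ℂ
  | false, false => fun _ => 0
  | false, true => fun _ => (ν₁ : ℂ)
  | true, false => fun ξ => -((ν₂ / 2 * ‖ξ‖ ^ 2 : ℝ) : ℂ)
  | true, true => fun ξ => -((η * ‖ξ‖ ^ 2 : ℝ) : ℂ)

theorem contDiff_ofReal_normSq (c : ℝ) :
    ContDiff ℝ ∞ fun q : ℝ × Sp d => ((c * ‖q.2‖ ^ 2 : ℝ) : ℂ) := by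
  have h : ContDiff ℝ ∞ fun q : ℝ × Sp d => c * ‖q.2‖ ^ 2 :=
    contDiff_const.mul ((contDiff_norm_sq ℝ).comp contDiff_snd)
  exact Complex.ofRealCLM.contDiff.comp h

theorem IsFund.contDiff_propSym {ν₁ ν₂ η c : ℝ} {ψ : Sp d → ℂ} {h₀ h₁ : ℝ × Sp d → ℂ}
    (h : IsFund η c ψ h₀ h₁) (a b : Bool) : ContDiff ℝ ∞ (propSym ν₁ ν₂ η h₀ h₁ a b) := by
  match a, b with
  | false, false => exact h.smooth₁.add ((contDiff_ofReal_normSq η).mul h.smooth₀)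
  | false, true => exact contDiff_const.mul h.smooth₀
  | true, false => exact (contDiff_ofReal_normSq (ν₂ / 2)).neg.mul h.smooth₀
  | true, true => exact h.smooth₁

theorem IsFund.propSym_supp {η c : ℝ} {ψ : Sp d → ℂ} {h₀ h₁ : ℝ × Sp d → ℂ}
    (h : IsFund η c ψ h₀ h₁) (ν₁ ν₂ : ℝ) :
    ∃ R, ∀ a b s ξ, R ≤ ‖ξ‖ → propSym ν₁ ν₂ η h₀ h₁ a b (s, ξ) = 0 := by
  obtain ⟨R, hR⟩ := h.supp
  refine ⟨R, fun a b s ξ hξ => ?_⟩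
  obtain ⟨e0, e1⟩ := hR s ξ hξ
  match a, b with
  | false, false => simp [propSym, e0, e1]
  | false, true => simp [propSym, e0]
  | true, false => simp [propSym, e0]
  | true, true => simp [propSym, e1]

theorem IsFund.isTest_propSym {ν₁ ν₂ η c : ℝ} {ψ : Sp d → ℂ} {h₀ h₁ : ℝ × Sp d → ℂ}
    (h : IsFund η c ψ h₀ h₁) (a b : Bool) (s : ℝ) :
    IsTest (fun ξ => propSym ν₁ ν₂ η h₀ h₁ a b (s, ξ)) := by
  obtain ⟨R, hR⟩ := h.propSym_supp ν₁ ν₂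
  exact isTest_slice (h.contDiff_propSym a b) (hR a b) s

theorem IsFund.propSym_deriv {ν₁ ν₂ η : ℝ} {ψ : Sp d → ℂ} {h₀ h₁ : ℝ × Sp d → ℂ}
    (h : IsFund η (ν₁ * ν₂ / 2) ψ h₀ h₁) (a c : Bool) (s : ℝ) (ξ : Sp d) :
    HasDerivAt (fun s => propSym ν₁ ν₂ η h₀ h₁ a c (s, ξ))
      (∑ b, propSym ν₁ ν₂ η h₀ h₁ a b (s, ξ) * genSym ν₁ ν₂ η b c ξ) s := by
  have d0 := h.deriv₀ s ξ
  have d1 := h.deriv₁ s ξ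
  match a, c with
  | false, false =>
    refine (d1.fun_add (d0.const_mul (((η * ‖ξ‖ ^ 2 : ℝ) : ℂ)))).congr_deriv ?_
    simp [propSym, genSym]; ring
  | false, true =>
    refine (d0.const_mul (ν₁ : ℂ)).congr_deriv ?_
    simp [propSym, genSym]; ring
  | true, false =>
    refine (d0.const_mul (-((ν₂ / 2 * ‖ξ‖ ^ 2 : ℝ) : ℂ))).congr_deriv ?_
    simp [propSym, genSym]; ring
  | true, true =>
    refine d1.congr_deriv ?_
    simp [propSym, genSym]; ring

theorem tg_genSym (ν₁ ν₂ η : ℝ) (a b : Bool) : (genSym (d := d) ν₁ ν₂ η a b).HasTemperateGrowth := by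
  match a, b with
  | false, false => exact Function.HasTemperateGrowth.const _
  | false, true => exact Function.HasTemperateGrowth.const _
  | true, false => exact tg_neg_normSq _
  | true, true => exact tg_neg_normSq _

/-- The pair `(f, g)` is mapped to `(f', g')` by the propagator at time `r`. -/
def Propagates (ν₁ ν₂ η : ℝ) (h₀ h₁ : ℝ × Sp d → ℂ) (r : ℝ) (f g f' g' : Dist d) : Prop :=
  f' = mult (fun ξ => propSym ν₁ ν₂ η h₀ h₁ false false (r, ξ)) f +
      mult (fun ξ => propSym ν₁ ν₂ η h₀ h₁ false true (r, ξ)) g ∧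
    g' = mult (fun ξ => propSym ν₁ ν₂ η h₀ h₁ true false (r, ξ)) f +
      mult (fun ξ => propSym ν₁ ν₂ η h₀ h₁ true true (r, ξ)) g

/-- The localized heat symbol. -/
noncomputable def heatSym (χ : Sp d → ℝ) (k : ℤ) (η : ℝ) (q : ℝ × Sp d) : ℂ :=
  fatk χ k q.2 * ((Real.exp (-q.1 * (η * ‖q.2‖ ^ 2)) : ℝ) : ℂ)

theorem contDiff_heatSym {χ : Sp d → ℝ} (hχ : IsCutoff χ) (k : ℤ) (η : ℝ) : ContDiff ℝ ∞ (heatSym χ k η) := by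
  refine ((isTest_fatk hχ k).1.comp contDiff_snd).mul (Complex.ofRealCLM.contDiff.comp
    (Real.contDiff_exp.comp (contDiff_fst.neg.mul (contDiff_const.mul
      ((contDiff_norm_sq ℝ).comp contDiff_snd)))))

theorem isTest_heatSym {χ : Sp d → ℝ} (hχ : IsCutoff χ) (k : ℤ) (η s : ℝ) : IsTest (fun ξ => heatSym χ k η (s, ξ)) :=
  isTest_slice (contDiff_heatSym hχ k η) (R := 16 / 3 * (2 : ℝ) ^ k)
    (fun s ξ h => by simp [heatSym, fatk_eq_zero_of_ge hχ h]) s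

variable {χ : Sp d → ℝ} (hχ : IsCutoff χ)
  {ν₁ ν₂ η : ℝ} {u₀ : Fin d → Dist d} {τ₀ : Fin d → Fin d → Dist d}
  {u : ℝ → Fin d → Dist d} {τ : ℝ → Fin d → Fin d → Dist d}
  (hs : IsSolution ν₁ ν₂ η u₀ τ₀ u τ)
include hχ hs

/-- The conserved quantity with `r = T` expresses the state at `T` by the data; with `r = 0` it
expresses the data by the state at `T`. -/
theorem propagates_aux {ψ : Sp d → ℂ} (hψ : IsTest ψ) {k : ℤ}
    (hf : ∀ ξ, fatk χ k ξ * ψ ξ = ψ ξ) {h₀ h₁ : ℝ × Sp d → ℂ}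
    (hh : IsFund η (ν₁ * ν₂ / 2) (fatk χ k) h₀ h₁) (i : Fin d) {T : ℝ} (hT : 0 ≤ T) :
    Propagates ν₁ ν₂ η h₀ h₁ T
        (mult ψ (u 0 i)) (projDiv χ k (fun l j => mult ψ (τ 0 l j)) i)
        (mult ψ (u T i)) (projDiv χ k (fun l j => mult ψ (τ T l j)) i) ∧
      Propagates ν₁ ν₂ η h₀ h₁ (-T)
        (mult ψ (u T i)) (projDiv χ k (fun l j => mult ψ (τ T l j)) i)
        (mult ψ (u 0 i)) (projDiv χ k (fun l j => mult ψ (τ 0 l j)) i) := by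
  let X : ℝ → Bool → Dist d := fun s b =>
    bif b then projDiv χ k (fun l j => mult ψ (τ s l j)) i else mult ψ (u s i)
  have hX : ∀ a (φ : 𝓢(Sp d, ℂ)), ContinuousOn (fun s => X s a φ) (Ici 0) := by
    intro a
    match a with
    | false => exact weakCont_velocity hs ψ i
    | true => exact weakCont_projDiv hs ψ k i
  have hX' : ∀ a t, 0 < t → ∀ φ : 𝓢(Sp d, ℂ),
      HasDerivAt (fun s => X s a φ) ((∑ b, mult (genSym ν₁ ν₂ η a b) (X t b)) φ) t := by
    intro a t ht
    match a with
    | false =>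
      have h1 := weakDeriv_velocity hχ hs hψ hf i ht
      have e : ∑ b, mult (genSym ν₁ ν₂ η false b) (X t b) =
          (ν₁ : ℂ) • projDiv χ k (fun l j => mult ψ (τ t l j)) i := by
        rw [Fintype.sum_bool]
        have e1 : mult (genSym ν₁ ν₂ η false false) (X t false) = 0 := mult_zero_symbol _
        have e2 : mult (genSym ν₁ ν₂ η false true) (X t true) = (ν₁ : ℂ) • X t true := by
          have := mult_const_mul (d := d) (m := fun _ => 1) (Function.HasTemperateGrowth.const 1)
            (ν₁ : ℂ) (X t true)
          rw [mult_one_symbol] at this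
          simpa [genSym] using this
        rw [e1, e2, add_zero]
        rfl
      rw [e]; exact h1
    | true =>
      have h1 := weakDeriv_projDiv hχ hs hψ hf i ht
      rw [Fintype.sum_bool]
      exact h1
  obtain ⟨R, hR⟩ := hh.propSym_supp ν₁ ν₂
  have key := fun a r => sum_mult_flow_const (tg_genSym ν₁ ν₂ η) hX hX'
    (hh.contDiff_propSym) hR hh.propSym_deriv a r hT
  -- At propagator time `0` the matrix is the cut-off times the identity, which fixes localized
  -- distributions.
  have hinit : ∀ s a, 0 ≤ s →
      ∑ b, mult (fun ξ => propSym ν₁ ν₂ η h₀ h₁ a b (0, ξ)) (X s b) = X s a := by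
    intro s a hs'
    rw [Fintype.sum_bool]
    match a with
    | false =>
      simp only [propSym, hh.init₀, hh.init₁, mul_zero, add_zero, mult_zero_symbol, zero_add]
      exact mult_fatk_block hχ hψ hf _
    | true =>
      simp only [propSym, hh.init₀, hh.init₁, mul_zero, mult_zero_symbol, add_zero]
      exact mult_fatk_projDiv hχ hψ hf _ i
  have k1 := fun a => key a T
  have k2 := fun a => key a 0
  simp only [sub_self, hinit T _ hT] at k1
  simp only [zero_sub, hinit 0 _ le_rfl] at k2
  simp only [Fintype.sum_bool] at k1 k2
  refine ⟨⟨?_, ?_⟩, ⟨?_, ?_⟩⟩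
  · rw [add_comm]; exact k1 false
  · rw [add_comm]; exact k1 true
  · rw [add_comm]; exact (k2 false).symm
  · rw [add_comm]; exact (k2 true).symm

theorem heat_aux {ψ : Sp d → ℂ} (hψ : IsTest ψ) {k : ℤ}
    (hf : ∀ ξ, fatk χ k ξ * ψ ξ = ψ ξ) (i j : Fin d) {T : ℝ} (hT : 0 ≤ T) :
    heatPart χ k (fun l j => mult ψ (τ T l j)) i j =
        mult (fun ξ => heatSym χ k η (T, ξ)) (heatPart χ k (fun l j => mult ψ (τ 0 l j)) i j) ∧
      heatPart χ k (fun l j => mult ψ (τ 0 l j)) i j =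
        mult (fun ξ => heatSym χ k η (-T, ξ)) (heatPart χ k (fun l j => mult ψ (τ T l j)) i j) := by
  let X : ℝ → Unit → Dist d := fun s _ => heatPart χ k (fun l j => mult ψ (τ s l j)) i j
  have key := fun r => sum_mult_flow_const (I := Unit) (X := X)
    (A := fun _ _ ξ => -((η * ‖ξ‖ ^ 2 : ℝ) : ℂ)) (fun _ _ => tg_neg_normSq η)
    (fun _ => weakCont_heatPart hs ψ k i j)
    (fun _ t ht => by
      intro φ
      have := weakDeriv_heatPart hχ hs hψ hf i j ht φ
      simp only [Finset.univ_unique, Finset.sum_singleton]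
      exact this)
    (H := fun _ _ => heatSym χ k η) (fun _ _ => contDiff_heatSym hχ k η)
    (R := 16 / 3 * (2 : ℝ) ^ k)
    (fun _ _ s ξ h => by simp [heatSym, fatk_eq_zero_of_ge hχ h])
    (fun _ _ s ξ => by
      have h1 : HasDerivAt (fun s : ℝ => Real.exp (-s * (η * ‖ξ‖ ^ 2)))
          (Real.exp (-s * (η * ‖ξ‖ ^ 2)) * (-1 * (η * ‖ξ‖ ^ 2))) s :=
        ((hasDerivAt_neg s).mul_const _).exp
      refine (h1.ofReal_comp.const_mul (fatk χ k ξ)).congr_deriv ?_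
      simp [heatSym]; ring) () r hT
  have h0 : (fun ξ => heatSym χ k η (0, ξ)) = fatk χ k := by
    ext ξ; simp [heatSym]
  constructor
  · have := key T
    simp only [sub_self, Finset.univ_unique, Finset.sum_singleton, h0] at this
    rw [← this]
    exact (mult_fatk_heatPart hχ hψ hf _ i j).symm
  · have := key 0
    simp only [zero_sub, Finset.univ_unique, Finset.sum_singleton, h0] at this
    rw [this]
    exact (mult_fatk_heatPart hχ hψ hf _ i j).symm

end Flow

/-! ### Energy estimates for the damped oscillator -/

section Oscillator

/-- `x' = y`, `y' = -cρ x - ηρ y`, `x(0) = 0`, `y(0) = 1`. -/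
structure IsOscillator (c η ρ : ℝ) (x y : ℝ → ℝ) : Prop where
  deriv₀ : ∀ t, HasDerivAt x (y t) t
  deriv₁ : ∀ t, HasDerivAt y (-(η * ρ) * y t - c * ρ * x t) t
  init₀ : x 0 = 0
  init₁ : y 0 = 1

/-- The solution is a matrix exponential whose generator is affine in `ρ`, so it is jointly smooth
in `(t, ρ)`, with no case distinction at the discriminant. As `ρ = |ξ|²` later, it is also smooth in
`ξ`. -/
theorem exists_oscillator (c η : ℝ) :
    ∃ x y : ℝ × ℝ → ℝ, ContDiff ℝ ∞ x ∧ ContDiff ℝ ∞ y ∧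
      ∀ ρ, IsOscillator c η ρ (fun t => x (t, ρ)) (fun t => y (t, ρ)) := by
  let B₀ : (ℝ × ℝ) →L[ℝ] (ℝ × ℝ) := (ContinuousLinearMap.snd ℝ ℝ ℝ).prod 0
  let B₁ : (ℝ × ℝ) →L[ℝ] (ℝ × ℝ) := (0 : (ℝ × ℝ) →L[ℝ] ℝ).prod
    (-(c • ContinuousLinearMap.fst ℝ ℝ ℝ) - η • ContinuousLinearMap.snd ℝ ℝ ℝ)
  let Φ : ℝ × ℝ → ℝ × ℝ := fun q => NormedSpace.exp (q.1 • (B₀ + q.2 • B₁)) (0, 1)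
  have hexp : ContDiff ℝ ∞ (NormedSpace.exp : ((ℝ × ℝ) →L[ℝ] (ℝ × ℝ)) → _) :=
    contDiff_iff_contDiffAt.2 fun A => (NormedSpace.exp_analytic (𝕂 := ℝ) A).contDiffAt
  have hΦ : ContDiff ℝ ∞ Φ := by
    have h1 : ContDiff ℝ ∞ fun q : ℝ × ℝ => q.1 • (B₀ + q.2 • B₁) := by fun_prop
    exact (hexp.comp h1).clm_apply contDiff_const
  have hd : ∀ ρ t, HasDerivAt (fun t => Φ (t, ρ)) ((B₀ + ρ • B₁) (Φ (t, ρ))) t := by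
    intro ρ t
    have h := hasDerivAt_exp_smul_const' (𝕂 := ℝ) (B₀ + ρ • B₁) t
    have := h.clm_apply (hasDerivAt_const t ((0 : ℝ), (1 : ℝ)))
    simpa [Φ] using this
  refine ⟨fun q => (Φ q).1, fun q => (Φ q).2, contDiff_fst.comp hΦ, contDiff_snd.comp hΦ,
    fun ρ => ⟨fun t => ?_, fun t => ?_, by simp [Φ], by simp [Φ]⟩⟩
  · refine ((hasFDerivAt_fst (𝕜 := ℝ)).comp_hasDerivAt t (hd ρ t)).congr_deriv ?_
    simp [B₀, B₁]
  · refine ((hasFDerivAt_snd (𝕜 := ℝ)).comp_hasDerivAt t (hd ρ t)).congr_deriv ?_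
    simp [B₀, B₁]; ring

/-- The energy has derivative `-2ηρy²`. Multiplied by `e^{2ηρs}` it becomes nondecreasing, because
only a nonnegative multiple of `x²` is left in the derivative. -/
theorem IsOscillator.energy_backward {c η ρ : ℝ} {x y : ℝ → ℝ} (h : IsOscillator c η ρ x y)
    (hc : 0 ≤ c) (hη : 0 ≤ η) {t : ℝ} (ht : 0 ≤ t) :
    c * ρ * x (-t) ^ 2 + y (-t) ^ 2 ≤ Real.exp (2 * η * ρ * t) := by
  let f : ℝ → ℝ := fun s => Real.exp (2 * η * ρ * s) * (c * ρ * x s ^ 2 + y s ^ 2)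
  have hf : ∀ s, HasDerivAt f (Real.exp (2 * η * ρ * s) * (2 * η * c * (ρ * x s) ^ 2)) s := by
    intro s
    have h1 : HasDerivAt (fun s => Real.exp (2 * η * ρ * s))
        (Real.exp (2 * η * ρ * s) * (2 * η * ρ * 1)) s :=
      ((hasDerivAt_id s).const_mul _).exp
    have h2 := (((h.deriv₀ s).pow 2).const_mul (c * ρ)).add ((h.deriv₁ s).pow 2)
    refine (h1.mul h2).congr_deriv ?_
    simp; ring
  have hm : Monotone f := monotone_of_hasDerivAt_nonneg hf fun s => by
    simp only [Pi.zero_apply]; positivity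
  have := hm (show -t ≤ 0 by linarith)
  simp only [f, h.init₀, h.init₁] at this
  norm_num at this
  have h3 : Real.exp (2 * η * ρ * t) * Real.exp (-(2 * η * ρ * t)) = 1 := by
    rw [← Real.exp_add]; simp
  calc c * ρ * x (-t) ^ 2 + y (-t) ^ 2
      = Real.exp (2 * η * ρ * t) *
        (Real.exp (-(2 * η * ρ * t)) * (c * ρ * x (-t) ^ 2 + y (-t) ^ 2)) := by
        rw [← mul_assoc, h3, one_mul]
    _ ≤ Real.exp (2 * η * ρ * t) * 1 := by gcongr
    _ = _ := mul_one _

/-- The friction dissipates `y` alone. The cross term `ερxy` transfers dissipation to `x` at the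
cost of terms absorbed for small `ε`; boundedness of `ρ` makes one `ε` work for all frequencies. -/
theorem exists_energy_decay {c η R : ℝ} (hc : 0 < c) (hη : 0 < η) (hR : 0 ≤ R) :
    ∃ μ, 0 < μ ∧ ∀ ρ x y, 0 ≤ ρ → ρ ≤ R → IsOscillator c η ρ x y → ∀ t, 0 ≤ t →
      c * ρ * x t ^ 2 + y t ^ 2 ≤ 2 * Real.exp (-(μ * ρ * t)) := by
  -- The first bound on `ε` absorbs the errors in `y²` into half of `2ηρy²`. The other two give `ε²ρ
  -- ≤ c`, so that the cross term is at most half of the energy.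
  obtain ⟨ε, hε, hε1, hε2, hε3⟩ : ∃ ε : ℝ, 0 < ε ∧ ε * (1 + η ^ 2 * R / (2 * c)) ≤ η ∧
      ε ≤ 1 ∧ ε * R ≤ c := by
    refine ⟨min (η / (1 + η ^ 2 * R / (2 * c))) (c / (c + R)), by positivity, ?_, ?_, ?_⟩
    · rw [← le_div_iff₀ (by positivity)]; exact min_le_left _ _
    · exact (min_le_right _ _).trans (div_le_one_of_le₀ (by linarith) (by positivity))
    · refine (mul_le_mul_of_nonneg_right (min_le_right _ _) hR).trans ?_
      rw [div_mul_eq_mul_div, div_le_iff₀ (by positivity)]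
      nlinarith
  -- After absorption at least `ηρy² + (ε/2)cρ²x²` of dissipation remains.
  set m := min η (ε / 2) with hm
  have hm0 : 0 < m := by positivity
  -- The factor `2/3` comes from `L ≤ (3/2)·energy`, and the final constant `2` from `energy ≤ 2L`.
  refine ⟨2 / 3 * m, by positivity, fun ρ x y hρ hρR h t ht => ?_⟩
  have hsq : ε ^ 2 * ρ ≤ c := by nlinarith [mul_le_mul_of_nonneg_left hρR hε.le]
  have hcross : ∀ s, |ε * ρ * (x s * y s)| ≤ (c * ρ * x s ^ 2 + y s ^ 2) / 2 := by
    intro s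
    have h1 : (ε * ρ * x s) ^ 2 ≤ c * ρ * x s ^ 2 := by
      have : (ε * ρ * x s) ^ 2 = ε ^ 2 * ρ * (ρ * x s ^ 2) := by ring
      rw [this, mul_assoc c]
      gcongr
    rw [abs_le]
    constructor <;> nlinarith [sq_nonneg (ε * ρ * x s + y s), sq_nonneg (ε * ρ * x s - y s)]
  let L : ℝ → ℝ := fun s => c * ρ * x s ^ 2 + y s ^ 2 + ε * ρ * (x s * y s)
  let f : ℝ → ℝ := fun s => Real.exp (2 / 3 * m * ρ * s) * L s
  let L' : ℝ → ℝ := fun s => -(2 * η * ρ) * y s ^ 2 + ε * ρ * y s ^ 2 - ε * c * ρ ^ 2 * x s ^ 2 -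
    ε * η * ρ ^ 2 * (x s * y s)
  have hL : ∀ s, HasDerivAt L (L' s) s := by
    intro s
    have h2 := ((((h.deriv₀ s).pow 2).const_mul (c * ρ)).add ((h.deriv₁ s).pow 2)).add
      (((h.deriv₀ s).mul (h.deriv₁ s)).const_mul (ε * ρ))
    refine h2.congr_deriv ?_
    simp [L']; ring
  have hL' : ∀ s, L' s ≤ -(m * ρ) * (c * ρ * x s ^ 2 + y s ^ 2) := by
    intro s
    have h1 : -(ε * η * ρ ^ 2 * (x s * y s)) ≤
        ε * c * ρ ^ 2 / 2 * x s ^ 2 + ε * η ^ 2 * ρ ^ 2 / (2 * c) * y s ^ 2 := by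
      have : ε * c * ρ ^ 2 / 2 * x s ^ 2 + ε * η ^ 2 * ρ ^ 2 / (2 * c) * y s ^ 2 +
          ε * η * ρ ^ 2 * (x s * y s) = ε * ρ ^ 2 / (2 * c) * (c * x s + η * y s) ^ 2 := by
        field_simp; ring
      have h2 : 0 ≤ ε * ρ ^ 2 / (2 * c) * (c * x s + η * y s) ^ 2 := by positivity
      linarith
    have h3 : ε * ρ + ε * η ^ 2 * ρ ^ 2 / (2 * c) ≤ η * ρ := by
      have : ε * ρ + ε * η ^ 2 * ρ ^ 2 / (2 * c) = ρ * (ε * (1 + η ^ 2 * ρ / (2 * c))) := by ring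
      rw [this, mul_comm η]
      refine mul_le_mul_of_nonneg_left (le_trans ?_ hε1) hρ
      gcongr
    have h4 : m * ρ * y s ^ 2 ≤ η * ρ * y s ^ 2 := by gcongr; exact min_le_left _ _
    have h5 : m * ρ * (c * ρ * x s ^ 2) ≤ ε / 2 * ρ * (c * ρ * x s ^ 2) := by
      gcongr; exact min_le_right _ _
    have h6 := mul_le_mul_of_nonneg_right h3 (sq_nonneg (y s))
    simp only [L']
    nlinarith
  have hf : ∀ s, HasDerivAt f (Real.exp (2 / 3 * m * ρ * s) * (2 / 3 * m * ρ * L s + L' s)) s := by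
    intro s
    have h1 : HasDerivAt (fun s => Real.exp (2 / 3 * m * ρ * s))
        (Real.exp (2 / 3 * m * ρ * s) * (2 / 3 * m * ρ * 1)) s :=
      ((hasDerivAt_id s).const_mul _).exp
    refine (h1.mul (hL s)).congr_deriv ?_
    ring
  have hanti : Antitone f := antitone_of_hasDerivAt_nonpos hf fun s => by
    refine mul_nonpos_of_nonneg_of_nonpos (Real.exp_pos _).le ?_
    have h1 : L s ≤ 3 / 2 * (c * ρ * x s ^ 2 + y s ^ 2) := by
      simp only [L]; linarith [(abs_le.1 (hcross s)).2]
    have h2 := mul_le_mul_of_nonneg_left h1 (show 0 ≤ 2 / 3 * m * ρ by positivity)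
    linarith [hL' s]
  have h0 := hanti ht
  simp only [f, L, h.init₀, h.init₁] at h0
  norm_num at h0
  have h1 : (c * ρ * x t ^ 2 + y t ^ 2) / 2 ≤ L t := by
    simp only [L]; linarith [(abs_le.1 (hcross t)).1]
  have h3 : Real.exp (-(2 / 3 * m * ρ * t)) * Real.exp (2 / 3 * m * ρ * t) = 1 := by
    rw [← Real.exp_add]; simp
  have h4 : L t ≤ Real.exp (-(2 / 3 * m * ρ * t)) := by
    calc L t = Real.exp (-(2 / 3 * m * ρ * t)) * (Real.exp (2 / 3 * m * ρ * t) * L t) := by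
          rw [← mul_assoc, h3, one_mul]
      _ ≤ Real.exp (-(2 / 3 * m * ρ * t)) * 1 := by gcongr
      _ = _ := mul_one _
  linarith

end Oscillator

/-! ### The propagator at low frequencies, in `L²` -/

section LowFrequency

variable {d : ℕ} {χ : Sp d → ℝ}

theorem IsOscillator.isFund (hχ : IsCutoff χ) (k : ℤ) {c η : ℝ} {x y : ℝ × ℝ → ℝ}
    (hx : ContDiff ℝ ∞ x) (hy : ContDiff ℝ ∞ y)
    (h : ∀ ρ, IsOscillator c η ρ (fun t => x (t, ρ)) (fun t => y (t, ρ))) :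
    IsFund η c (fatk χ k) (fun q => fatk χ k q.2 * ((x (q.1, ‖q.2‖ ^ 2) : ℝ) : ℂ))
      (fun q => fatk χ k q.2 * ((y (q.1, ‖q.2‖ ^ 2) : ℝ) : ℂ)) where
  smooth₀ := ((isTest_fatk hχ k).1.comp contDiff_snd).mul (Complex.ofRealCLM.contDiff.comp
    (hx.comp (contDiff_fst.prodMk ((contDiff_norm_sq ℝ).comp contDiff_snd))))
  smooth₁ := ((isTest_fatk hχ k).1.comp contDiff_snd).mul (Complex.ofRealCLM.contDiff.comp
    (hy.comp (contDiff_fst.prodMk ((contDiff_norm_sq ℝ).comp contDiff_snd))))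
  supp := ⟨16 / 3 * (2 : ℝ) ^ k, fun s ξ hξ => by simp [fatk_eq_zero_of_ge hχ hξ]⟩
  deriv₀ s ξ := ((h (‖ξ‖ ^ 2)).deriv₀ s).ofReal_comp.const_mul (fatk χ k ξ)
  deriv₁ s ξ := by
    refine (((h (‖ξ‖ ^ 2)).deriv₁ s).ofReal_comp.const_mul (fatk χ k ξ)).congr_deriv ?_
    push_cast; ring
  init₀ ξ := by simp [(h (‖ξ‖ ^ 2)).init₀]
  init₁ ξ := by simp [(h (‖ξ‖ ^ 2)).init₁]

/-- The order in frequency of the entries of the propagator at low frequencies. -/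
def propOrder : Bool → Bool → ℤ
  | false, true => -1
  | true, false => 1
  | _, _ => 0

/-- An energy bound for the oscillator bounds the entries of the propagator. -/
theorem exists_lpB_propSym_of_energy (hχ : IsCutoff χ) {ν₁ ν₂ η : ℝ} (hν₁ : 0 < ν₁) (hν₂ : 0 < ν₂)
    (hη : 0 < η) (k₀ : ℤ) : ∃ C, 0 < C ∧ ∀ k ≤ k₀, ∀ h₀ h₁ : ℝ × Sp d → ℂ,
      IsFund η (ν₁ * ν₂ / 2) (fatk χ k) h₀ h₁ → ∀ (r G : ℝ), 0 < G →
      (∀ ξ, (h₀ (r, ξ) = 0 ∧ h₁ (r, ξ) = 0) ∨ fatk χ k ξ ≠ 0 ∧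
        ν₁ * ν₂ / 2 * (‖ξ‖ * ‖h₀ (r, ξ)‖) ^ 2 + ‖h₁ (r, ξ)‖ ^ 2 ≤ G ^ 2) →
      ∀ a b, LpB 2 (fun ξ => propSym ν₁ ν₂ η h₀ h₁ a b (r, ξ))
        (C * ((2 : ℝ) ^ k) ^ propOrder a b * G) := by
  set w := √(ν₁ * ν₂ / 2) with hw
  have hw0 : 0 < w := by positivity
  have hw2 : w ^ 2 = ν₁ * ν₂ / 2 := Real.sq_sqrt (by positivity)
  set R := 16 / 3 * (2 : ℝ) ^ k₀ with hR
  have hR0 : 0 < R := by positivity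
  set C := 1 + η * R / w + ν₁ * (16 / 3) / w + ν₂ / 2 * (16 / 3) / w with hC
  have hC0 : 0 < C := by positivity
  have hC1 : 1 + η * R / w ≤ C := by
    have : 0 ≤ ν₁ * (16 / 3) / w + ν₂ / 2 * (16 / 3) / w := by positivity
    rw [hC]; linarith
  have hC2 : ν₁ * (16 / 3) / w ≤ C := by
    have : 0 ≤ 1 + η * R / w + ν₂ / 2 * (16 / 3) / w := by positivity
    rw [hC]; linarith
  have hC3 : ν₂ / 2 * (16 / 3) / w ≤ C := by
    have : 0 ≤ 1 + η * R / w + ν₁ * (16 / 3) / w := by positivity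
    rw [hC]; linarith
  have hC4 : 1 ≤ C := by
    have : 0 ≤ η * R / w := by positivity
    linarith
  refine ⟨C, hC0, fun k hk h₀ h₁ hf r G hG hb a b => ?_⟩
  have h2k : (0 : ℝ) < 2 ^ k := by positivity
  refine lpB_two (by positivity) (hf.isTest_propSym a b r).tg fun ξ => ?_
  rcases hb ξ with ⟨e0, e1⟩ | ⟨hn, hb⟩
  · have : propSym ν₁ ν₂ η h₀ h₁ a b (r, ξ) = 0 := by
      match a, b with
      | false, false => simp [propSym, e0, e1]
      | false, true => simp [propSym, e0]
      | true, false => simp [propSym, e0]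
      | true, true => simp [propSym, e1]
    rw [this, norm_zero]; positivity
  obtain ⟨n1, n2⟩ := norm_of_fatk_ne_zero hχ hn
  have nR : ‖ξ‖ ≤ R := n2.trans (by rw [hR]; gcongr; norm_num)
  have b1 : ‖h₁ (r, ξ)‖ ≤ G := by
    refine (pow_le_pow_iff_left₀ (by positivity) hG.le two_ne_zero).1 ?_
    have : 0 ≤ ν₁ * ν₂ / 2 * (‖ξ‖ * ‖h₀ (r, ξ)‖) ^ 2 := by positivity
    linarith
  have b0 : ‖ξ‖ * ‖h₀ (r, ξ)‖ ≤ G / w := by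
    rw [le_div_iff₀ hw0]
    refine (pow_le_pow_iff_left₀ (by positivity) hG.le two_ne_zero).1 ?_
    have : (‖ξ‖ * ‖h₀ (r, ξ)‖ * w) ^ 2 = ν₁ * ν₂ / 2 * (‖ξ‖ * ‖h₀ (r, ξ)‖) ^ 2 := by
      rw [mul_pow, hw2]; ring
    rw [this]
    linarith [sq_nonneg ‖h₁ (r, ξ)‖]
  match a, b with
  | false, false =>
    simp only [propSym, propOrder, zpow_zero, mul_one]
    refine (norm_add_le _ _).trans ?_
    rw [norm_mul, Complex.norm_real, Real.norm_of_nonneg (by positivity)]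
    calc ‖h₁ (r, ξ)‖ + η * ‖ξ‖ ^ 2 * ‖h₀ (r, ξ)‖
        = ‖h₁ (r, ξ)‖ + η * ‖ξ‖ * (‖ξ‖ * ‖h₀ (r, ξ)‖) := by ring
      _ ≤ G + η * R * (G / w) := by gcongr
      _ = (1 + η * R / w) * G := by ring
      _ ≤ C * G := by gcongr
  | false, true =>
    simp only [propSym, propOrder, zpow_neg_one]
    rw [norm_mul, Complex.norm_real, Real.norm_of_nonneg hν₁.le]
    have b2 : ‖h₀ (r, ξ)‖ ≤ 16 / 3 * (2 ^ k)⁻¹ * (G / w) := by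
      have : 3 / 16 * (2 : ℝ) ^ k * ‖h₀ (r, ξ)‖ ≤ G / w :=
        (mul_le_mul_of_nonneg_right n1 (norm_nonneg _)).trans b0
      calc ‖h₀ (r, ξ)‖ = 16 / 3 * (2 ^ k)⁻¹ * (3 / 16 * (2 : ℝ) ^ k * ‖h₀ (r, ξ)‖) := by
            field_simp
        _ ≤ _ := by gcongr
    calc ν₁ * ‖h₀ (r, ξ)‖ ≤ ν₁ * (16 / 3 * (2 ^ k)⁻¹ * (G / w)) := by gcongr
      _ = ν₁ * (16 / 3) / w * (2 ^ k)⁻¹ * G := by ring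
      _ ≤ C * (2 ^ k)⁻¹ * G := by gcongr
  | true, false =>
    simp only [propSym, propOrder, zpow_one]
    rw [norm_mul, norm_neg, Complex.norm_real, Real.norm_of_nonneg (by positivity)]
    calc ν₂ / 2 * ‖ξ‖ ^ 2 * ‖h₀ (r, ξ)‖ = ν₂ / 2 * ‖ξ‖ * (‖ξ‖ * ‖h₀ (r, ξ)‖) := by ring
      _ ≤ ν₂ / 2 * (16 / 3 * 2 ^ k) * (G / w) := by gcongr
      _ = ν₂ / 2 * (16 / 3) / w * 2 ^ k * G := by ring
      _ ≤ C * 2 ^ k * G := by gcongr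
  | true, true =>
    simp only [propSym, propOrder, zpow_zero, mul_one]
    exact b1.trans (by nlinarith)

/-- Both energy bounds, taken at `ρ = |ξ|²`, are read on the annulus `|ξ| ≈ 2^k`. The condition `k ≤
k₀` bounds `ρ` by `R`, which the forward decay requires. -/
theorem exists_low_propagator (hχ : IsCutoff χ) {ν₁ ν₂ η : ℝ} (hν₁ : 0 < ν₁) (hν₂ : 0 < ν₂)
    (hη : 0 < η) (k₀ : ℤ) : ∃ C, 0 < C ∧ ∃ c, 0 < c ∧ ∃ c', 0 < c' ∧ ∀ k ≤ k₀,
      ∃ h₀ h₁ : ℝ × Sp d → ℂ, IsFund η (ν₁ * ν₂ / 2) (fatk χ k) h₀ h₁ ∧ ∀ t, 0 ≤ t →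
        (∀ a b, LpB 2 (fun ξ => propSym ν₁ ν₂ η h₀ h₁ a b (t, ξ))
          (C * ((2 : ℝ) ^ k) ^ propOrder a b * Real.exp (-(c * ((2 : ℝ) ^ k) ^ 2 * t)))) ∧
        (∀ a b, LpB 2 (fun ξ => propSym ν₁ ν₂ η h₀ h₁ a b (-t, ξ))
          (C * ((2 : ℝ) ^ k) ^ propOrder a b * Real.exp (c' * ((2 : ℝ) ^ k) ^ 2 * t))) ∧
        LpB 2 (fun ξ => heatSym χ k η (t, ξ)) (C * Real.exp (-(c * ((2 : ℝ) ^ k) ^ 2 * t))) ∧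
        LpB 2 (fun ξ => heatSym χ k η (-t, ξ)) (C * Real.exp (c' * ((2 : ℝ) ^ k) ^ 2 * t)) := by
  obtain ⟨C, hC, hb⟩ := exists_lpB_propSym_of_energy hχ hν₁ hν₂ hη k₀
  set R := (16 / 3 * (2 : ℝ) ^ k₀) ^ 2 with hR
  obtain ⟨μ, hμ, hdec⟩ := exists_energy_decay (c := ν₁ * ν₂ / 2) (η := η) (R := R) (by positivity) hη
    (by positivity)
  obtain ⟨x, y, hx, hy, hosc⟩ := exists_oscillator (ν₁ * ν₂ / 2) η
  -- `μ / 2` because the energy is quadratic in the symbols, `η` for the heat symbol; `3/16` is the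
  -- inner radius of the annulus.
  set c := min (μ / 2) η * (3 / 16) ^ 2 with hc
  refine ⟨2 * C + 1, by positivity, c, by positivity, η * (16 / 3) ^ 2, by positivity,
    fun k hk => ⟨_, _, IsOscillator.isFund hχ k hx hy hosc, fun t ht => ?_⟩⟩
  have h2k : (0 : ℝ) < 2 ^ k := by positivity
  have e4 : ∀ r ξ, ν₁ * ν₂ / 2 * (‖ξ‖ * ‖fatk χ k ξ * ((x (r, ‖ξ‖ ^ 2) : ℝ) : ℂ)‖) ^ 2 +
      ‖fatk χ k ξ * ((y (r, ‖ξ‖ ^ 2) : ℝ) : ℂ)‖ ^ 2 ≤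
      ν₁ * ν₂ / 2 * ‖ξ‖ ^ 2 * x (r, ‖ξ‖ ^ 2) ^ 2 + y (r, ‖ξ‖ ^ 2) ^ 2 := by
    intro r ξ
    have hn := norm_fatk_le hχ k ξ
    have hn2 : ‖fatk χ k ξ‖ ^ 2 ≤ 1 := pow_le_one₀ (norm_nonneg _) hn
    have h0 : 0 ≤ ν₁ * ν₂ / 2 * ‖ξ‖ ^ 2 * x (r, ‖ξ‖ ^ 2) ^ 2 + y (r, ‖ξ‖ ^ 2) ^ 2 := by positivity
    calc _ = ‖fatk χ k ξ‖ ^ 2 *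
          (ν₁ * ν₂ / 2 * ‖ξ‖ ^ 2 * x (r, ‖ξ‖ ^ 2) ^ 2 + y (r, ‖ξ‖ ^ 2) ^ 2) := by
          simp only [norm_mul, Complex.norm_real, mul_pow, Real.norm_eq_abs, sq_abs]; ring
      _ ≤ 1 * _ := by gcongr
      _ = _ := one_mul _
  refine ⟨fun a b => ?_, fun a b => ?_, ?_, ?_⟩
  · refine (hb k hk _ _ (IsOscillator.isFund hχ k hx hy hosc) t
      (2 * Real.exp (-(c * ((2 : ℝ) ^ k) ^ 2 * t))) (by positivity) (fun ξ => ?_) a b).mono ?_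
    · by_cases hn : fatk χ k ξ = 0
      · left; simp [hn]
      refine Or.inr ⟨hn, (e4 t ξ).trans ?_⟩
      obtain ⟨n1, n2⟩ := norm_of_fatk_ne_zero hχ hn
      have nR : ‖ξ‖ ^ 2 ≤ R := by
        rw [hR]; gcongr; exact n2.trans (by gcongr; norm_num)
      refine (hdec _ _ _ (sq_nonneg _) nR (hosc _) t ht).trans ?_
      rw [mul_pow, ← Real.exp_nat_mul]
      have : -(μ * ‖ξ‖ ^ 2 * t) ≤ (2 : ℕ) * -(c * ((2 : ℝ) ^ k) ^ 2 * t) := by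
        have h1 : c * ((2 : ℝ) ^ k) ^ 2 ≤ μ / 2 * ‖ξ‖ ^ 2 := by
          calc c * ((2 : ℝ) ^ k) ^ 2 = min (μ / 2) η * (3 / 16 * 2 ^ k) ^ 2 := by rw [hc]; ring
            _ ≤ μ / 2 * ‖ξ‖ ^ 2 := by gcongr; exact min_le_left _ _
        have := mul_le_mul_of_nonneg_right h1 ht
        push_cast; linarith
      have := Real.exp_le_exp.2 this
      nlinarith [Real.exp_pos (-(μ * ‖ξ‖ ^ 2 * t))]
    · have h0 : 0 ≤ ((2 : ℝ) ^ k) ^ propOrder a b * Real.exp (-(c * ((2 : ℝ) ^ k) ^ 2 * t)) := by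
        positivity
      nlinarith
  · refine (hb k hk _ _ (IsOscillator.isFund hχ k hx hy hosc) (-t)
      (Real.exp (η * (16 / 3) ^ 2 * ((2 : ℝ) ^ k) ^ 2 * t)) (by positivity) (fun ξ => ?_) a b).mono ?_
    · by_cases hn : fatk χ k ξ = 0
      · left; simp [hn]
      refine Or.inr ⟨hn, (e4 (-t) ξ).trans ?_⟩
      obtain ⟨n1, n2⟩ := norm_of_fatk_ne_zero hχ hn
      refine ((hosc _).energy_backward (by positivity) hη.le ht).trans ?_
      rw [← Real.exp_nat_mul]
      refine Real.exp_le_exp.2 ?_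
      have h1 : ‖ξ‖ ^ 2 ≤ (16 / 3 * (2 : ℝ) ^ k) ^ 2 := by gcongr
      calc 2 * η * ‖ξ‖ ^ 2 * t ≤ 2 * η * (16 / 3 * (2 : ℝ) ^ k) ^ 2 * t := by gcongr
        _ = _ := by push_cast; ring
    · have h0 : 0 ≤ ((2 : ℝ) ^ k) ^ propOrder a b *
          Real.exp (η * (16 / 3) ^ 2 * ((2 : ℝ) ^ k) ^ 2 * t) := by
        positivity
      nlinarith
  · refine (lpB_two (C := Real.exp (-(c * ((2 : ℝ) ^ k) ^ 2 * t))) (by positivity)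
      (isTest_heatSym hχ k η t).tg fun ξ => ?_).mono ?_
    · by_cases hn : fatk χ k ξ = 0
      · simp only [heatSym, hn, zero_mul, norm_zero]; positivity
      obtain ⟨n1, n2⟩ := norm_of_fatk_ne_zero hχ hn
      simp only [heatSym, norm_mul, Complex.norm_real, Real.norm_eq_abs, Real.abs_exp]
      refine (mul_le_of_le_one_left (Real.exp_pos _).le (norm_fatk_le hχ k ξ)).trans
        (Real.exp_le_exp.2 ?_)
      have h1 : c * ((2 : ℝ) ^ k) ^ 2 ≤ η * ‖ξ‖ ^ 2 := by
        calc c * ((2 : ℝ) ^ k) ^ 2 = min (μ / 2) η * (3 / 16 * 2 ^ k) ^ 2 := by rw [hc]; ring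
          _ ≤ η * ‖ξ‖ ^ 2 := by gcongr; exact min_le_right _ _
      have := mul_le_mul_of_nonneg_right h1 ht
      linarith
    · nlinarith [Real.exp_pos (-(c * ((2 : ℝ) ^ k) ^ 2 * t))]
  · refine (lpB_two (C := Real.exp (η * (16 / 3) ^ 2 * ((2 : ℝ) ^ k) ^ 2 * t)) (by positivity)
      (isTest_heatSym hχ k η (-t)).tg fun ξ => ?_).mono ?_
    · by_cases hn : fatk χ k ξ = 0
      · simp only [heatSym, hn, zero_mul, norm_zero]; positivity
      obtain ⟨n1, n2⟩ := norm_of_fatk_ne_zero hχ hn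
      simp only [heatSym, norm_mul, Complex.norm_real, Real.norm_eq_abs, Real.abs_exp]
      refine (mul_le_of_le_one_left (Real.exp_pos _).le (norm_fatk_le hχ k ξ)).trans
        (Real.exp_le_exp.2 ?_)
      have h1 : ‖ξ‖ ^ 2 ≤ (16 / 3 * (2 : ℝ) ^ k) ^ 2 := by gcongr
      calc - -t * (η * ‖ξ‖ ^ 2) = η * ‖ξ‖ ^ 2 * t := by ring
        _ ≤ η * (16 / 3 * (2 : ℝ) ^ k) ^ 2 * t := by gcongr
        _ = _ := by ring
    · nlinarith [Real.exp_pos (η * (16 / 3) ^ 2 * ((2 : ℝ) ^ k) ^ 2 * t)]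

end LowFrequency

/-! ### Propagators built from real characteristic roots -/

section HighFrequency

theorem isOscillator_of_roots {c η ρ α β : ℝ} (hne : β - α ≠ 0) (hsum : α + β = η * ρ)
    (hprod : α * β = c * ρ) :
    IsOscillator c η ρ (fun t => (Real.exp (-t * α) - Real.exp (-t * β)) / (β - α))
      (fun t => (β * Real.exp (-t * β) - α * Real.exp (-t * α)) / (β - α)) := by
  have he : ∀ γ t : ℝ, HasDerivAt (fun t => Real.exp (-t * γ)) (Real.exp (-t * γ) * (-1 * γ)) t :=
    fun γ t => ((hasDerivAt_neg t).mul_const γ).exp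
  refine ⟨fun t => ?_, fun t => ?_, by simp, by simp [hne]⟩
  · refine (((he α t).sub (he β t)).div_const (β - α)).congr_deriv ?_
    ring
  · refine ((((he β t).const_mul β).sub ((he α t).const_mul α)).div_const (β - α)).congr_deriv ?_
    rw [← hsum, ← hprod]
    field_simp
    ring

variable {d : ℕ} {χ : Sp d → ℝ}

theorem mem_tsupport_fat_of_fatk {k : ℤ} {ξ : Sp d} (h : ξ ∈ tsupport (fatk χ k)) :
    (2 : ℝ) ^ (-k) • ξ ∈ tsupport (fat χ) :=
  tsupport_comp_subset_preimage (fat χ) (f := fun ξ : Sp d => (2 : ℝ) ^ (-k) • ξ)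
    (by fun_prop) h

/-- The roots matter only on the support of the cut-off; elsewhere the products vanish and all
equations are trivial. -/
theorem isFund_of_roots (hχ : IsCutoff χ) (k : ℤ) {c η : ℝ} {α β : Sp d → ℝ}
    (hα : ∀ ξ ∈ tsupport (fatk χ k), ContDiffAt ℝ ∞ α ξ)
    (hβ : ∀ ξ ∈ tsupport (fatk χ k), ContDiffAt ℝ ∞ β ξ)
    (hne : ∀ ξ ∈ tsupport (fatk χ k), β ξ - α ξ ≠ 0)
    (hsum : ∀ ξ ∈ tsupport (fatk χ k), α ξ + β ξ = η * ‖ξ‖ ^ 2)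
    (hprod : ∀ ξ ∈ tsupport (fatk χ k), α ξ * β ξ = c * ‖ξ‖ ^ 2) :
    IsFund η c (fatk χ k)
      (fun q => fatk χ k q.2 *
        (((Real.exp (-q.1 * α q.2) - Real.exp (-q.1 * β q.2)) / (β q.2 - α q.2) : ℝ) : ℂ))
      (fun q => fatk χ k q.2 * (((β q.2 * Real.exp (-q.1 * β q.2) -
        α q.2 * Real.exp (-q.1 * α q.2)) / (β q.2 - α q.2) : ℝ) : ℂ)) := by
  have ht := isTest_fatk hχ k
  have hosc : ∀ ξ ∈ tsupport (fatk χ k), IsOscillator c η (‖ξ‖ ^ 2) _ _ := fun ξ hξ =>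
    isOscillator_of_roots (hne ξ hξ) (hsum ξ hξ) (hprod ξ hξ)
  have hα' : ∀ (s : ℝ), ∀ ξ ∈ tsupport (fatk χ k),
      ContDiffAt ℝ ∞ (fun q : ℝ × Sp d => α q.2) (s, ξ) :=
    fun s ξ hξ => (hα ξ hξ).comp (s, ξ) contDiffAt_snd
  have hβ' : ∀ (s : ℝ), ∀ ξ ∈ tsupport (fatk χ k),
      ContDiffAt ℝ ∞ (fun q : ℝ × Sp d => β q.2) (s, ξ) :=
    fun s ξ hξ => (hβ ξ hξ).comp (s, ξ) contDiffAt_snd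
  have hs : ∀ (s : ℝ) (ξ : Sp d), ContDiffAt ℝ ∞ (fun q : ℝ × Sp d => -q.1) (s, ξ) :=
    fun s ξ => contDiffAt_fst.neg
  have hofReal : ContDiff ℝ ∞ (fun x : ℝ => (x : ℂ)) := Complex.ofRealCLM.contDiff
  refine ⟨?_, ?_, ⟨16 / 3 * (2 : ℝ) ^ k, fun s ξ hξ => by simp [fatk_eq_zero_of_ge hχ hξ]⟩,
    ?_, ?_, ?_, ?_⟩
  · refine contDiff_iff_contDiffAt.2 fun ⟨s, ξ⟩ => contDiffAt_cutoff_mul ht.1 fun hξ => ?_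
    exact hofReal.contDiffAt.comp _ ((((hs s ξ).mul (hα' s ξ hξ)).exp.sub
      ((hs s ξ).mul (hβ' s ξ hξ)).exp).div ((hβ' s ξ hξ).sub (hα' s ξ hξ)) (hne ξ hξ))
  · refine contDiff_iff_contDiffAt.2 fun ⟨s, ξ⟩ => contDiffAt_cutoff_mul ht.1 fun hξ => ?_
    exact hofReal.contDiffAt.comp _ ((((hβ' s ξ hξ).mul ((hs s ξ).mul (hβ' s ξ hξ)).exp).sub
      ((hα' s ξ hξ).mul ((hs s ξ).mul (hα' s ξ hξ)).exp)).div
        ((hβ' s ξ hξ).sub (hα' s ξ hξ)) (hne ξ hξ))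
  · intro s ξ
    by_cases hξ : ξ ∈ tsupport (fatk χ k)
    · exact ((hosc ξ hξ).deriv₀ s).ofReal_comp.const_mul (fatk χ k ξ)
    · simpa [image_eq_zero_of_notMem_tsupport hξ] using hasDerivAt_const s (0 : ℂ)
  · intro s ξ
    by_cases hξ : ξ ∈ tsupport (fatk χ k)
    · refine (((hosc ξ hξ).deriv₁ s).ofReal_comp.const_mul (fatk χ k ξ)).congr_deriv ?_
      push_cast; ring
    · simpa [image_eq_zero_of_notMem_tsupport hξ] using hasDerivAt_const s (0 : ℂ)
  · intro ξ; simp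
  · intro ξ
    by_cases hξ : ξ ∈ tsupport (fatk χ k)
    · have := (hosc ξ hξ).init₁
      simp only [this, Complex.ofReal_one, mul_one]
    · simp [image_eq_zero_of_notMem_tsupport hξ]

/-- Uniform bounds for symbols `A e^{-sg}` with `g > c`, localized at frequencies of size `2^k`,
where `A` and `g` depend smoothly on the rescaled frequency and on `4^{-k}`. -/
theorem exists_lpB_rescaled_exp (hχ : IsCutoff χ) {z₀ : ℝ} {A g : ℝ × Sp d → ℝ} {c : ℝ}
    (hA : ∀ z ∈ Icc 0 z₀, ∀ ζ ∈ tsupport (fat χ), ContDiffAt ℝ ∞ A (z, ζ))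
    (hg : ∀ z ∈ Icc 0 z₀, ∀ ζ ∈ tsupport (fat χ), ContDiffAt ℝ ∞ g (z, ζ))
    (hc : ∀ z ∈ Icc 0 z₀, ∀ ζ ∈ tsupport (fat χ), c < g (z, ζ)) :
    ∃ C, 0 < C ∧ ∀ k : ℤ, ∀ z ∈ Icc 0 z₀, ∀ s, 0 ≤ s → ∀ p : ℝ, 1 < p →
      IsTest (fun ξ => fatk χ k ξ * ((A (z, (2 : ℝ) ^ (-k) • ξ) *
        Real.exp (-s * g (z, (2 : ℝ) ^ (-k) • ξ)) : ℝ) : ℂ)) ∧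
      LpB (ENNReal.ofReal p) (fun ξ => fatk χ k ξ * ((A (z, (2 : ℝ) ^ (-k) • ξ) *
        Real.exp (-s * g (z, (2 : ℝ) ^ (-k) • ξ)) : ℝ) : ℂ)) (C * Real.exp (-c * s)) := by
  obtain ⟨C, hC, h⟩ := exists_kernelNorm_exp_bound isCompact_Icc (isTest_fat hχ) hA hg hc
  refine ⟨C, hC, fun k z hz s hs p hp => ?_⟩
  obtain ⟨h1, h2⟩ := h z hz s hs
  exact ⟨h1.comp_smul (by positivity), lpB_comp_smul hp h1 (by positivity) h2 (by positivity)⟩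

end HighFrequency

/-! ### Rescaled characteristic roots -/

section Roots

variable {d : ℕ}

/-- The square root in the eigenvalues of the high-frequency system, in rescaled variables. -/
noncomputable def rootS (κ : ℝ) (q : ℝ × Sp d) : ℝ := √(1 - κ * q.1 / ‖q.2‖ ^ 2)

/-- The small eigenvalue. -/
noncomputable def rootα (ν₁ ν₂ η : ℝ) (q : ℝ × Sp d) : ℝ :=
  ν₁ * ν₂ / (η * (1 + rootS (2 * ν₁ * ν₂ / η ^ 2) q))

/-- The rescaled large eigenvalue. -/
noncomputable def rootβ (ν₁ ν₂ η : ℝ) (q : ℝ × Sp d) : ℝ :=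
  η * ‖q.2‖ ^ 2 / 2 * (1 + rootS (2 * ν₁ * ν₂ / η ^ 2) q)

/-- The rescaled difference of the eigenvalues. -/
noncomputable def rootD (ν₁ ν₂ η : ℝ) (q : ℝ × Sp d) : ℝ :=
  η * ‖q.2‖ ^ 2 * rootS (2 * ν₁ * ν₂ / η ^ 2) q

/-- The condition on the rescaled variables under which the eigenvalues are real and distinct. -/
def IsHigh (ν₁ ν₂ η : ℝ) (q : ℝ × Sp d) : Prop :=
  0 ≤ q.1 ∧ 3 / 16 ≤ ‖q.2‖ ∧ 2 * ν₁ * ν₂ / η ^ 2 * q.1 ≤ 1 / 64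

variable {ν₁ ν₂ η : ℝ} {q : ℝ × Sp d}

theorem IsHigh.norm_pos (h : IsHigh ν₁ ν₂ η q) : 0 < ‖q.2‖ := by linarith [h.2.1]

/-- `1/64` is less than `(3/16)²/2 = 9/512`; so the argument of the square root stays away from zero
and the root is smooth. -/
theorem IsHigh.half_le (h : IsHigh ν₁ ν₂ η q) :
    1 / 2 ≤ 1 - 2 * ν₁ * ν₂ / η ^ 2 * q.1 / ‖q.2‖ ^ 2 := by
  obtain ⟨h1, h2, h3⟩ := h
  have h4 : (3 / 16 : ℝ) ^ 2 ≤ ‖q.2‖ ^ 2 := by gcongr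
  have h5 : 2 * ν₁ * ν₂ / η ^ 2 * q.1 / ‖q.2‖ ^ 2 ≤ 1 / 2 := by
    rw [div_le_iff₀ (by linarith [h4])]
    linarith
  linarith

theorem IsHigh.rootS_pos (h : IsHigh ν₁ ν₂ η q) : 0 < rootS (2 * ν₁ * ν₂ / η ^ 2) q :=
  Real.sqrt_pos.2 (by linarith [h.half_le])

theorem IsHigh.rootS_le (h : IsHigh ν₁ ν₂ η q) (hν₁ : 0 < ν₁) (hν₂ : 0 < ν₂) (hη : 0 < η) :
    rootS (2 * ν₁ * ν₂ / η ^ 2) q ≤ 1 := by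
  refine Real.sqrt_le_one.2 ?_
  have := h.1
  have : 0 ≤ 2 * ν₁ * ν₂ / η ^ 2 * q.1 / ‖q.2‖ ^ 2 := by positivity
  linarith

theorem contDiffAt_normSq_snd (q : ℝ × Sp d) :
    ContDiffAt ℝ ∞ (fun q : ℝ × Sp d => ‖q.2‖ ^ 2) q :=
  ((contDiff_norm_sq ℝ).comp contDiff_snd).contDiffAt

theorem IsHigh.contDiffAt_rootS (h : IsHigh ν₁ ν₂ η q) :
    ContDiffAt ℝ ∞ (rootS (2 * ν₁ * ν₂ / η ^ 2)) q := by
  have h0 := h.norm_pos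
  exact (contDiffAt_const.sub ((contDiffAt_const.mul contDiffAt_fst).div (contDiffAt_normSq_snd q)
    (by positivity))).sqrt
      (by have := h.half_le; simp only [Pi.div_apply]; linarith)

theorem IsHigh.contDiffAt_rootα (h : IsHigh ν₁ ν₂ η q) (hη : 0 < η) :
    ContDiffAt ℝ ∞ (rootα ν₁ ν₂ η) q := by
  have h0 := h.rootS_pos
  exact contDiffAt_const.div (contDiffAt_const.mul (contDiffAt_const.add h.contDiffAt_rootS))
    (by positivity)

theorem IsHigh.contDiffAt_rootβ (h : IsHigh ν₁ ν₂ η q) :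
    ContDiffAt ℝ ∞ (rootβ ν₁ ν₂ η) q :=
  ((contDiffAt_const.mul (contDiffAt_normSq_snd q)).div_const 2).mul
    (contDiffAt_const.add h.contDiffAt_rootS)

theorem IsHigh.contDiffAt_rootD (h : IsHigh ν₁ ν₂ η q) :
    ContDiffAt ℝ ∞ (rootD ν₁ ν₂ η) q :=
  (contDiffAt_const.mul (contDiffAt_normSq_snd q)).mul h.contDiffAt_rootS

theorem IsHigh.rootD_pos (h : IsHigh ν₁ ν₂ η q) (hη : 0 < η) : 0 < rootD ν₁ ν₂ η q := by
  have := h.rootS_pos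
  have := h.norm_pos
  unfold rootD; positivity

/-- Since `rootS ≤ 1`, the small root is at least `ν₁ν₂/(2η)`; the `3` leaves the strict gap
demanded by the exponential kernel bound. -/
theorem IsHigh.lt_rootα (h : IsHigh ν₁ ν₂ η q) (hν₁ : 0 < ν₁) (hν₂ : 0 < ν₂) (hη : 0 < η) :
    ν₁ * ν₂ / (3 * η) < rootα ν₁ ν₂ η q := by
  have h1 := h.rootS_pos
  have h2 := h.rootS_le hν₁ hν₂ hη
  unfold rootα
  refine div_lt_div_of_pos_left (by positivity) (by positivity) ?_
  nlinarith

theorem IsHigh.lt_normSq (h : IsHigh ν₁ ν₂ η q) (hη : 0 < η) : η / 64 < η * ‖q.2‖ ^ 2 := by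
  have h4 : (3 / 16 : ℝ) ^ 2 ≤ ‖q.2‖ ^ 2 := by gcongr; exact h.2.1
  nlinarith

theorem IsHigh.lt_rootβ (h : IsHigh ν₁ ν₂ η q) (hη : 0 < η) :
    η / 128 < rootβ ν₁ ν₂ η q := by
  have h1 := h.rootS_pos
  have h2 := h.lt_normSq hη
  unfold rootβ
  nlinarith

/-- Vieta's relations in rescaled form. At `q = (4^{-k}, 2^{-k}ξ)` the true roots are `rootα` and
`4^k rootβ`. The small root is rationalized, with `1 + rootS` in the denominator, so nothing
degenerates at `q.1 = 0`. -/
theorem IsHigh.root_identity (h : IsHigh ν₁ ν₂ η q) (hη : 0 < η) :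
    q.1 * rootα ν₁ ν₂ η q + rootβ ν₁ ν₂ η q = η * ‖q.2‖ ^ 2 ∧
      rootβ ν₁ ν₂ η q - q.1 * rootα ν₁ ν₂ η q = rootD ν₁ ν₂ η q ∧
      rootα ν₁ ν₂ η q * rootβ ν₁ ν₂ η q = ν₁ * ν₂ / 2 * ‖q.2‖ ^ 2 := by
  have h1 := h.rootS_pos
  have h0 := h.norm_pos
  have hS : rootS (2 * ν₁ * ν₂ / η ^ 2) q ^ 2 = 1 - 2 * ν₁ * ν₂ / η ^ 2 * q.1 / ‖q.2‖ ^ 2 :=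
    Real.sq_sqrt (by linarith [h.half_le])
  set S := rootS (2 * ν₁ * ν₂ / η ^ 2) q with hSdef
  have e : q.1 * rootα ν₁ ν₂ η q = η * ‖q.2‖ ^ 2 / 2 * (1 - S) := by
    have : ν₁ * ν₂ * q.1 = η ^ 2 * ‖q.2‖ ^ 2 / 2 * (1 - S ^ 2) := by
      rw [hS]; field_simp; ring
    rw [rootα, ← hSdef, mul_div_assoc', div_eq_iff (by positivity)]
    linear_combination this
  refine ⟨?_, ?_, ?_⟩
  · rw [e, rootβ, ← hSdef]; ring
  · rw [e, rootβ, rootD, ← hSdef]; ring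
  · rw [rootα, rootβ, ← hSdef]; field_simp

end Roots

/-! ### The propagator at high frequencies, in `L^p` -/

section HighPropagator

variable {d : ℕ} {χ : Sp d → ℝ}

/-- The amplitudes of the slow exponential in the entries of the propagator. -/
noncomputable def slowAmp (ν₁ ν₂ η : ℝ) : Bool → Bool → ℝ × Sp d → ℝ
  | false, false => fun q => (η * ‖q.2‖ ^ 2 - q.1 * rootα ν₁ ν₂ η q) / rootD ν₁ ν₂ η q
  | false, true => fun q => ν₁ / rootD ν₁ ν₂ η q
  | true, false => fun q => -(ν₂ / 2 * ‖q.2‖ ^ 2) / rootD ν₁ ν₂ η q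
  | true, true => fun q => -rootα ν₁ ν₂ η q / rootD ν₁ ν₂ η q

/-- The amplitudes of the fast exponential in the entries of the propagator. -/
noncomputable def fastAmp (ν₁ ν₂ η : ℝ) : Bool → Bool → ℝ × Sp d → ℝ
  | false, false => fun q => (rootβ ν₁ ν₂ η q - η * ‖q.2‖ ^ 2) / rootD ν₁ ν₂ η q
  | false, true => fun q => -ν₁ / rootD ν₁ ν₂ η q
  | true, false => fun q => ν₂ / 2 * ‖q.2‖ ^ 2 / rootD ν₁ ν₂ η q
  | true, true => fun q => rootβ ν₁ ν₂ η q / rootD ν₁ ν₂ η q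

/-- The powers of `4^{-k}` that accompany the slow exponential. -/
def slowOrder : Bool → Bool → ℕ
  | _, false => 0
  | _, true => 1

/-- The powers of `4^{-k}` that accompany the fast exponential. -/
def fastOrder : Bool → Bool → ℕ
  | false, true => 1
  | _, _ => 0

theorem IsHigh.contDiffAt_slowAmp {ν₁ ν₂ η : ℝ} {q : ℝ × Sp d} (h : IsHigh ν₁ ν₂ η q) (hη : 0 < η)
    (a b : Bool) : ContDiffAt ℝ ∞ (slowAmp ν₁ ν₂ η a b) q := by
  have hD := h.contDiffAt_rootD
  have h0 := (h.rootD_pos hη).ne'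
  match a, b with
  | false, false =>
    exact ((contDiffAt_const.mul (contDiffAt_normSq_snd q)).sub
      (contDiffAt_fst.mul (h.contDiffAt_rootα hη))).div hD h0
  | false, true => exact contDiffAt_const.div hD h0
  | true, false => exact (contDiffAt_const.mul (contDiffAt_normSq_snd q)).neg.div hD h0
  | true, true => exact (h.contDiffAt_rootα hη).neg.div hD h0

theorem IsHigh.contDiffAt_fastAmp {ν₁ ν₂ η : ℝ} {q : ℝ × Sp d} (h : IsHigh ν₁ ν₂ η q) (hη : 0 < η)
    (a b : Bool) : ContDiffAt ℝ ∞ (fastAmp ν₁ ν₂ η a b) q := by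
  have hD := h.contDiffAt_rootD
  have h0 := (h.rootD_pos hη).ne'
  match a, b with
  | false, false =>
    exact (h.contDiffAt_rootβ.sub (contDiffAt_const.mul (contDiffAt_normSq_snd q))).div hD h0
  | false, true => exact contDiffAt_const.div hD h0
  | true, false => exact (contDiffAt_const.mul (contDiffAt_normSq_snd q)).div hD h0
  | true, true => exact h.contDiffAt_rootβ.div hD h0

/-- Each entry splits into a slow and a fast exponential with the powers of `w⁻¹` taken out, so that
the amplitudes stay smooth in the rescaled variables down to `w⁻¹ = 0`. In the application `w =
4^k`, and the fast mode runs in the rescaled time `wt`. -/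
theorem propSym_eq_slow_add_fast {ν₁ ν₂ η w t : ℝ} {ζ ξ : Sp d} (hw : 0 < w)
    (h : IsHigh ν₁ ν₂ η (w⁻¹, ζ)) (hη : 0 < η) (hn : ‖ξ‖ ^ 2 = w * ‖ζ‖ ^ 2)
    {h₀ h₁ : ℝ × Sp d → ℂ} {F : ℂ}
    (e₀ : h₀ (t, ξ) = F * (((Real.exp (-t * rootα ν₁ ν₂ η (w⁻¹, ζ)) -
      Real.exp (-t * (w * rootβ ν₁ ν₂ η (w⁻¹, ζ)))) /
      (w * rootβ ν₁ ν₂ η (w⁻¹, ζ) - rootα ν₁ ν₂ η (w⁻¹, ζ)) : ℝ) : ℂ))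
    (e₁ : h₁ (t, ξ) = F * (((w * rootβ ν₁ ν₂ η (w⁻¹, ζ) *
      Real.exp (-t * (w * rootβ ν₁ ν₂ η (w⁻¹, ζ))) -
      rootα ν₁ ν₂ η (w⁻¹, ζ) * Real.exp (-t * rootα ν₁ ν₂ η (w⁻¹, ζ))) /
      (w * rootβ ν₁ ν₂ η (w⁻¹, ζ) - rootα ν₁ ν₂ η (w⁻¹, ζ)) : ℝ) : ℂ)) (a b : Bool) :
    propSym ν₁ ν₂ η h₀ h₁ a b (t, ξ) =
      ((w⁻¹ ^ slowOrder a b : ℝ) : ℂ) * (F * ((slowAmp ν₁ ν₂ η a b (w⁻¹, ζ) *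
        Real.exp (-t * rootα ν₁ ν₂ η (w⁻¹, ζ)) : ℝ) : ℂ)) +
      ((w⁻¹ ^ fastOrder a b : ℝ) : ℂ) * (F * ((fastAmp ν₁ ν₂ η a b (w⁻¹, ζ) *
        Real.exp (-(w * t) * rootβ ν₁ ν₂ η (w⁻¹, ζ)) : ℝ) : ℂ)) := by
  obtain ⟨-, e2, -⟩ := h.root_identity hη
  have hD := (h.rootD_pos hη).ne'
  have e5 : -t * (w * rootβ ν₁ ν₂ η (w⁻¹, ζ)) = -(w * t) * rootβ ν₁ ν₂ η (w⁻¹, ζ) := by ring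
  have e4 : w * rootβ ν₁ ν₂ η (w⁻¹, ζ) - rootα ν₁ ν₂ η (w⁻¹, ζ) = w * rootD ν₁ ν₂ η (w⁻¹, ζ) := by
    rw [← e2]; field_simp
  rw [e5, e4] at e₀ e₁
  have hw' : (w : ℂ) ≠ 0 := Complex.ofReal_ne_zero.2 hw.ne'
  have hD' : (rootD ν₁ ν₂ η (w⁻¹, ζ) : ℂ) ≠ 0 := Complex.ofReal_ne_zero.2 hD
  match a, b with
  | false, false =>
    simp only [propSym, slowAmp, fastAmp, slowOrder, fastOrder, e₀, e₁, hn]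
    push_cast; field_simp; ring
  | false, true =>
    simp only [propSym, slowAmp, fastAmp, slowOrder, fastOrder, e₀]
    push_cast; field_simp; ring
  | true, false =>
    simp only [propSym, slowAmp, fastAmp, slowOrder, fastOrder, e₀, hn]
    push_cast; field_simp; ring
  | true, true =>
    simp only [propSym, slowAmp, fastAmp, slowOrder, fastOrder, e₁]
    push_cast; field_simp; ring

theorem LpB.congr_symbol {p : ℝ≥0∞} {m n : Sp d → ℂ} {C D : ℝ} (h : LpB p m C)
    (he : ∀ ξ, n ξ = m ξ) (hCD : C ≤ D) : LpB p n D := by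
  rw [funext he]
  exact h.mono hCD

theorem IsTest.const_mul {m : Sp d → ℂ} (hm : IsTest m) (z : ℂ) : IsTest (fun ξ => z * m ξ) :=
  ⟨contDiff_const.mul hm.1, hm.2.mul_left⟩

theorem exists_high_propagator (hχ : IsCutoff χ) {ν₁ ν₂ η : ℝ} (hν₁ : 0 < ν₁) (hν₂ : 0 < ν₂)
    (hη : 0 < η) : ∃ K : ℤ, 0 ≤ K ∧ ∃ C, 0 < C ∧ ∃ c, 0 < c ∧ ∀ k ≥ K,
      ∃ h₀ h₁ : ℝ × Sp d → ℂ, IsFund η (ν₁ * ν₂ / 2) (fatk χ k) h₀ h₁ ∧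
        ∀ t, 0 ≤ t → ∀ p : ℝ, 1 < p →
        (∀ a b, LpB (ENNReal.ofReal p) (fun ξ => propSym ν₁ ν₂ η h₀ h₁ a b (t, ξ))
          (C * ((((2 : ℝ) ^ k) ^ 2)⁻¹ ^ slowOrder a b * Real.exp (-c * t) +
            (((2 : ℝ) ^ k) ^ 2)⁻¹ ^ fastOrder a b * Real.exp (-c * (((2 : ℝ) ^ k) ^ 2 * t))))) ∧
        LpB (ENNReal.ofReal p) (fun ξ => heatSym χ k η (t, ξ))
          (C * Real.exp (-c * (((2 : ℝ) ^ k) ^ 2 * t))) := by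
  set κ := 2 * ν₁ * ν₂ / η ^ 2 with hκ
  have hκ0 : 0 < κ := by positivity
  -- The largest value of `4^{-k}` allowed by `IsHigh`; it determines the threshold `K`.
  set z₀ := (64 * κ)⁻¹ with hz₀
  have hhigh : ∀ z ∈ Icc 0 z₀, ∀ ζ ∈ tsupport (fat χ), IsHigh ν₁ ν₂ η (z, ζ) := by
    intro z hz ζ hζ
    refine ⟨hz.1, (norm_of_mem_tsupport_fat hχ hζ).1, ?_⟩
    calc κ * z ≤ κ * z₀ := by gcongr; exact hz.2
      _ = 1 / 64 := by rw [hz₀]; field_simp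
  -- `c` lies strictly below the slow root, the rescaled fast root and, since the heat exponent
  -- exceeds `η/64`, also below the latter.
  set c := min (ν₁ * ν₂ / (3 * η)) (η / 128) with hc
  have hc0 : 0 < c := by positivity
  have hc1 : c ≤ ν₁ * ν₂ / (3 * η) := min_le_left _ _
  have hc2 : c ≤ η / 128 := min_le_right _ _
  choose C₁ hC₁ H₁ using fun a b => exists_lpB_rescaled_exp hχ (z₀ := z₀) (c := c)
    (A := slowAmp ν₁ ν₂ η a b) (g := rootα ν₁ ν₂ η)
    (fun z hz ζ hζ => (hhigh z hz ζ hζ).contDiffAt_slowAmp hη a b)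
    (fun z hz ζ hζ => (hhigh z hz ζ hζ).contDiffAt_rootα hη)
    (fun z hz ζ hζ => hc1.trans_lt ((hhigh z hz ζ hζ).lt_rootα hν₁ hν₂ hη))
  choose C₂ hC₂ H₂ using fun a b => exists_lpB_rescaled_exp hχ (z₀ := z₀) (c := c)
    (A := fastAmp ν₁ ν₂ η a b) (g := rootβ ν₁ ν₂ η)
    (fun z hz ζ hζ => (hhigh z hz ζ hζ).contDiffAt_fastAmp hη a b)
    (fun z hz ζ hζ => (hhigh z hz ζ hζ).contDiffAt_rootβ)
    (fun z hz ζ hζ => hc2.trans_lt ((hhigh z hz ζ hζ).lt_rootβ hη))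
  obtain ⟨C₃, hC₃, H₃⟩ := exists_lpB_rescaled_exp hχ (z₀ := z₀) (c := c)
    (A := fun _ => 1) (g := fun q => η * ‖q.2‖ ^ 2)
    (fun z hz ζ hζ => contDiffAt_const)
    (fun z hz ζ hζ => contDiffAt_const.mul (contDiffAt_normSq_snd _))
    (fun z hz ζ hζ => by
      have := (hhigh z hz ζ hζ).lt_normSq hη
      simp only at this ⊢
      linarith)
  -- For `k ≥ n` one has `4^k ≥ 2^k ≥ n > 1/z₀`, hence `4^{-k} ≤ z₀`.
  obtain ⟨n, hn⟩ := exists_nat_gt z₀⁻¹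
  set C := (∑ a, ∑ b, (C₁ a b + C₂ a b)) + C₃ with hC
  have hCab : ∀ a b, C₁ a b + C₂ a b ≤ C := by
    intro a b
    have h1 : C₁ a b + C₂ a b ≤ ∑ b, (C₁ a b + C₂ a b) :=
      Finset.single_le_sum (f := fun b => C₁ a b + C₂ a b)
        (fun b _ => (add_pos (hC₁ a b) (hC₂ a b)).le) (Finset.mem_univ b)
    have h2 : ∑ b, (C₁ a b + C₂ a b) ≤ ∑ a, ∑ b, (C₁ a b + C₂ a b) :=
      Finset.single_le_sum (f := fun a => ∑ b, (C₁ a b + C₂ a b))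
        (fun a _ => Finset.sum_nonneg fun b _ => (add_pos (hC₁ a b) (hC₂ a b)).le)
        (Finset.mem_univ a)
    linarith
  have hC0 : 0 < C := by linarith [hCab true true, hC₁ true true, hC₂ true true]
  have hC3 : C₃ ≤ C := by
    have : 0 ≤ ∑ a, ∑ b, (C₁ a b + C₂ a b) := Finset.sum_nonneg fun a _ =>
      Finset.sum_nonneg fun b _ => (add_pos (hC₁ a b) (hC₂ a b)).le
    linarith
  refine ⟨n, by positivity, C, hC0, c, hc0, fun k hk => ?_⟩
  set w := ((2 : ℝ) ^ k) ^ 2 with hw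
  have hw0 : 0 < w := by positivity
  have hz : w⁻¹ ∈ Icc 0 z₀ := by
    refine ⟨by positivity, inv_le_of_inv_le₀ (by positivity) ?_⟩
    have h1 : (n : ℝ) ≤ 2 ^ (n : ℕ) := by exact_mod_cast Nat.lt_two_pow_self.le
    have h2 : (2 : ℝ) ^ (n : ℕ) ≤ 2 ^ k := by
      rw [← zpow_natCast]; exact zpow_le_zpow_right₀ (by norm_num) hk
    have h3 : (1 : ℝ) ≤ 2 ^ k := le_trans (one_le_pow₀ (by norm_num)) h2
    have h4 : (2 : ℝ) ^ k ≤ w := by rw [hw]; nlinarith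
    linarith
  have hnorm : ∀ ξ : Sp d, ‖(2 : ℝ) ^ (-k) • ξ‖ ^ 2 = w⁻¹ * ‖ξ‖ ^ 2 := by
    intro ξ
    rw [norm_smul, Real.norm_of_nonneg (by positivity), mul_pow, hw, zpow_neg, inv_pow]
  have hh : ∀ ξ ∈ tsupport (fatk χ k), IsHigh ν₁ ν₂ η (w⁻¹, (2 : ℝ) ^ (-k) • ξ) :=
    fun ξ hξ => hhigh _ hz _ (mem_tsupport_fat_of_fatk hξ)
  have hmap : ∀ ξ : Sp d, ContDiffAt ℝ ∞ (fun ξ : Sp d => (w⁻¹, (2 : ℝ) ^ (-k) • ξ)) ξ :=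
    fun ξ => contDiffAt_const.prodMk (contDiffAt_id.const_smul _)
  have hfund := isFund_of_roots hχ k (c := ν₁ * ν₂ / 2) (η := η)
    (α := fun ξ => rootα ν₁ ν₂ η (w⁻¹, (2 : ℝ) ^ (-k) • ξ))
    (β := fun ξ => w * rootβ ν₁ ν₂ η (w⁻¹, (2 : ℝ) ^ (-k) • ξ))
    (fun ξ hξ => ContDiffAt.comp ξ (g := rootα ν₁ ν₂ η) ((hh ξ hξ).contDiffAt_rootα hη) (hmap ξ))
    (fun ξ hξ => contDiffAt_const.mul
      (ContDiffAt.comp ξ (g := rootβ ν₁ ν₂ η) (hh ξ hξ).contDiffAt_rootβ (hmap ξ)))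
    (fun ξ hξ => by
      obtain ⟨-, e2, -⟩ := (hh ξ hξ).root_identity hη
      have e3 := (hh ξ hξ).rootD_pos hη
      have : w * rootβ ν₁ ν₂ η (w⁻¹, (2 : ℝ) ^ (-k) • ξ) -
          rootα ν₁ ν₂ η (w⁻¹, (2 : ℝ) ^ (-k) • ξ) =
          w * rootD ν₁ ν₂ η (w⁻¹, (2 : ℝ) ^ (-k) • ξ) := by
        rw [← e2]; field_simp
      rw [this]; positivity)
    (fun ξ hξ => by
      obtain ⟨e1, -, -⟩ := (hh ξ hξ).root_identity hη
      simp only [hnorm] at e1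
      have : η * ‖ξ‖ ^ 2 = w * (η * (w⁻¹ * ‖ξ‖ ^ 2)) := by field_simp
      rw [this, ← e1]; field_simp)
    (fun ξ hξ => by
      obtain ⟨-, -, e1⟩ := (hh ξ hξ).root_identity hη
      simp only [hnorm] at e1
      rw [mul_left_comm, e1]; field_simp)
  refine ⟨_, _, hfund, fun t ht p hp => ⟨fun a b => ?_, ?_⟩⟩
  · obtain ⟨t1, b1⟩ := H₁ a b k _ hz t ht p hp
    obtain ⟨t2, b2⟩ := H₂ a b k _ hz (w * t) (by positivity) p hp
    have hzp : ∀ m : ℕ, ((w⁻¹ ^ m : ℝ) : ℂ) ≠ 0 := fun m =>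
      Complex.ofReal_ne_zero.2 (by positivity)
    have p1 := hC₁ a b
    have p2 := hC₂ a b
    have key := LpB.add (C := ‖((w⁻¹ ^ slowOrder a b : ℝ) : ℂ)‖ * (C₁ a b * Real.exp (-c * t)))
      (D := ‖((w⁻¹ ^ fastOrder a b : ℝ) : ℂ)‖ * (C₂ a b * Real.exp (-c * (w * t))))
      (by rw [ENNReal.one_le_ofReal]; exact hp.le) (by positivity) (by positivity)
      (t1.const_mul _).tg (t2.const_mul _).tg
      (b1.const_mul (hzp (slowOrder a b)) t1.tg) (b2.const_mul (hzp (fastOrder a b)) t2.tg)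
    refine LpB.congr_symbol key (fun ξ => ?_) ?_
    · by_cases hξ : ξ ∈ tsupport (fatk χ k)
      · exact propSym_eq_slow_add_fast hw0 (hh ξ hξ) hη (by rw [hnorm]; field_simp) rfl rfl a b
      · have h0 := image_eq_zero_of_notMem_tsupport hξ
        match a, b with
        | false, false => simp [propSym, h0]
        | false, true => simp [propSym, h0]
        | true, false => simp [propSym, h0]
        | true, true => simp [propSym, h0]
    rw [Complex.norm_real, Complex.norm_real, Real.norm_of_nonneg (by positivity),
      Real.norm_of_nonneg (by positivity)]
    have h1 : C₁ a b ≤ C := by linarith [hCab a b, hC₂ a b]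
    have h2 : C₂ a b ≤ C := by linarith [hCab a b, hC₁ a b]
    calc _ ≤ w⁻¹ ^ slowOrder a b * (C * Real.exp (-c * t)) +
          w⁻¹ ^ fastOrder a b * (C * Real.exp (-c * (w * t))) := by gcongr
      _ = _ := by ring
  · obtain ⟨-, b3⟩ := H₃ k _ hz (w * t) (by positivity) p hp
    have e : (fun ξ => heatSym χ k η (t, ξ)) = fun ξ => fatk χ k ξ *
        ((1 * Real.exp (-(w * t) * (η * ‖(2 : ℝ) ^ (-k) • ξ‖ ^ 2)) : ℝ) : ℂ) := by
      ext ξ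
      simp only [heatSym, hnorm, one_mul]
      congr 3
      field_simp
    rw [e]
    exact b3.mono (by gcongr)

end HighPropagator

/-! ### Elementary bounds for `⟨t⟩` -/

section Bracket

theorem one_le_bracket (t : ℝ) : 1 ≤ bracket t := by
  rw [bracket, Real.one_le_sqrt]; nlinarith [sq_nonneg t]

theorem bracket_pos (t : ℝ) : 0 < bracket t := by linarith [one_le_bracket t]

theorem le_bracket (t : ℝ) : t ≤ bracket t := Real.le_sqrt_of_sq_le (by linarith)

theorem bracket_le {t : ℝ} (ht : 0 ≤ t) : bracket t ≤ 1 + t := by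
  rw [bracket, Real.sqrt_le_iff]; constructor <;> nlinarith

theorem exists_rpow_mul_exp_le (s : ℝ) {b : ℝ} (hb : 0 < b) :
    ∃ C, 0 < C ∧ ∀ x, 1 ≤ x → x ^ s * Real.exp (-(b * x)) ≤ C := by
  obtain ⟨n, hn⟩ := exists_nat_ge s
  refine ⟨n.factorial / b ^ n, by positivity, fun x hx => ?_⟩
  have h1 : x ^ s ≤ x ^ n := by
    rw [← Real.rpow_natCast]; exact Real.rpow_le_rpow_of_exponent_le hx hn
  have h2 := Real.pow_div_factorial_le_exp (b * x) (by positivity) n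
  have h3 : Real.exp (b * x) * Real.exp (-(b * x)) = 1 := by rw [← Real.exp_add]; simp
  have h4 := mul_le_mul_of_nonneg_right h2 (Real.exp_pos (-(b * x))).le
  rw [h3, mul_pow] at h4
  refine (mul_le_mul_of_nonneg_right h1 (Real.exp_pos _).le).trans ?_
  rw [le_div_iff₀ (by positivity)]
  have h5 : (b ^ n * x ^ n / n.factorial) * Real.exp (-(b * x)) * n.factorial ≤ 1 * n.factorial := by
    gcongr
  have h6 : (b ^ n * x ^ n / n.factorial) * Real.exp (-(b * x)) * n.factorial =
      x ^ n * Real.exp (-(b * x)) * b ^ n := by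
    field_simp
  linarith

end Bracket

/-! ### Dyadic sums with heat-like decay -/

section Sequences

theorem two_zpow_eq (k : ℤ) : (2 : ℝ) ^ k = (2 : ℝ) ^ (k : ℝ) := (Real.rpow_intCast 2 k).symm

theorem two_zpow_sq (k : ℤ) : ((2 : ℝ) ^ k) ^ 2 = (4 : ℝ) ^ k := by
  rw [← zpow_natCast, zpow_comm]; norm_num

theorem two_rpow_add (x y : ℝ) : (2 : ℝ) ^ (x + y) = 2 ^ x * 2 ^ y := Real.rpow_add two_pos x y

theorem four_zpow_rpow (k : ℤ) (δ : ℝ) : ((4 : ℝ) ^ k) ^ (δ / 2) = 2 ^ (δ * k) := by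
  rw [← two_zpow_sq, two_zpow_eq, ← Real.rpow_natCast, ← Real.rpow_mul two_pos.le,
    ← Real.rpow_mul two_pos.le]
  congr 1; push_cast; ring

/-- The model kernel of dyadic decay. -/
noncomputable def dyadicKernel (c δ : ℝ) (i : ℤ) : ℝ := (2 : ℝ) ^ (δ * i) * Real.exp (-(c * 4 ^ i))

theorem dyadicKernel_nonneg (c δ : ℝ) (i : ℤ) : 0 ≤ dyadicKernel c δ i := by
  unfold dyadicKernel; positivity

/-- The exponential dominates as `i → ∞`, and `2^{δi}` is geometric as `i → -∞`; the latter is where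
`σ > σ₁` enters. -/
theorem summable_dyadicKernel {c δ : ℝ} (hc : 0 < c) (hδ : 0 < δ) :
    Summable (dyadicKernel c δ) := by
  have hr : (2 : ℝ) ^ (-δ) < 1 := Real.rpow_lt_one_of_one_lt_of_neg one_lt_two (by linarith)
  have hgeo : Summable fun n : ℕ => ((2 : ℝ) ^ (-δ)) ^ n :=
    summable_geometric_of_lt_one (by positivity) hr
  have hpow : ∀ n : ℕ, ((2 : ℝ) ^ (-δ)) ^ n = 2 ^ (-δ * n) := fun n => by
    rw [Real.rpow_mul two_pos.le, Real.rpow_natCast]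
  refine Summable.of_nat_of_neg ?_ ?_
  · obtain ⟨C, hC, h⟩ := exists_rpow_mul_exp_le δ hc
    refine (hgeo.mul_left C).of_nonneg_of_le (fun n => dyadicKernel_nonneg c δ _) fun n => ?_
    have h1 := h (4 ^ (n : ℤ)) (one_le_zpow₀ (by norm_num) (by positivity))
    have h2 : ((4 : ℝ) ^ (n : ℤ)) ^ δ = 2 ^ (δ * n) * 2 ^ (δ * n) := by
      have := four_zpow_rpow n (2 * δ)
      rw [show 2 * δ / 2 = δ by ring] at this
      rw [this, ← two_rpow_add]; congr 1; push_cast; ring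
    rw [h2] at h1
    have h3 : (2 : ℝ) ^ (δ * (n : ℝ)) * 2 ^ (-δ * n) = 1 := by
      rw [← two_rpow_add]; simp
    rw [hpow, dyadicKernel]
    calc (2 : ℝ) ^ (δ * ((n : ℤ) : ℝ)) * Real.exp (-(c * 4 ^ (n : ℤ)))
        = 2 ^ (δ * (n : ℝ)) * 2 ^ (-δ * n) *
          (2 ^ (δ * (n : ℝ)) * Real.exp (-(c * 4 ^ (n : ℤ)))) := by rw [h3, one_mul]; simp
      _ = 2 ^ (δ * (n : ℝ)) * 2 ^ (δ * (n : ℝ)) * Real.exp (-(c * 4 ^ (n : ℤ))) * 2 ^ (-δ * n) := by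
          ring
      _ ≤ C * 2 ^ (-δ * n) := by gcongr
  · refine hgeo.of_nonneg_of_le (fun n => dyadicKernel_nonneg c δ _) fun n => ?_
    rw [hpow, dyadicKernel]
    have : Real.exp (-(c * 4 ^ (-(n : ℤ)))) ≤ 1 := Real.exp_le_one_iff.2 (by
      have : 0 < c * (4 : ℝ) ^ (-(n : ℤ)) := by positivity
      linarith)
    calc (2 : ℝ) ^ (δ * ((-(n : ℤ) : ℤ) : ℝ)) * Real.exp (-(c * 4 ^ (-(n : ℤ))))
        ≤ (2 : ℝ) ^ (δ * ((-(n : ℤ) : ℤ) : ℝ)) * 1 := by gcongr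
      _ = 2 ^ (-δ * n) := by rw [mul_one]; congr 1; push_cast; ring

/-- Two-sided heat-like bounds for a family of dyadic blocks with frequencies at most `2^{k₀}`. -/
structure DyadicDecay (k₀ : ℤ) (C c c' : ℝ) (n : ℤ → ℝ → ℝ) : Prop where
  nonneg : ∀ k t, 0 ≤ n k t
  zero : ∀ k t, k₀ < k → n k t = 0
  upper : ∀ k t, k ≤ k₀ → 0 ≤ t → n k t ≤ C * Real.exp (-(c * 4 ^ k * t)) * n k 0
  lower : ∀ k t, k ≤ k₀ → 0 ≤ t → n k 0 ≤ C * Real.exp (c' * 4 ^ k * t) * n k t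

/-- The weighted `ℓ¹` norm of a family of dyadic blocks. -/
noncomputable def dyadicSum (σ : ℝ) (n : ℤ → ℝ → ℝ) (t : ℝ) : ℝ≥0∞ :=
  ∑' k : ℤ, ENNReal.ofReal (2 ^ (σ * k) * n k t)

variable {k₀ : ℤ} {C c c' : ℝ} {n : ℤ → ℝ → ℝ}

theorem DyadicDecay.term_le (h : DyadicDecay k₀ C c c' n) (hC : 0 < C) {σ σ₁ Q : ℝ}
    (hQ : ∀ k : ℤ, 2 ^ (σ₁ * k) * n k 0 ≤ Q) {t : ℝ} (ht : 0 ≤ t) (k : ℤ) (hk : k ≤ k₀) :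
    2 ^ (σ * k) * n k t ≤ C * Q * (2 ^ ((σ - σ₁) * k) * Real.exp (-(c * 4 ^ k * t))) := by
  have e : (2 : ℝ) ^ (σ * k) = 2 ^ ((σ - σ₁) * k) * 2 ^ (σ₁ * k) := by
    rw [← two_rpow_add]; congr 1; ring
  calc (2 : ℝ) ^ (σ * k) * n k t ≤ 2 ^ (σ * k) * (C * Real.exp (-(c * 4 ^ k * t)) * n k 0) := by
        gcongr; exact h.upper k t hk ht
    _ = C * (2 ^ ((σ - σ₁) * k) * Real.exp (-(c * 4 ^ k * t))) * (2 ^ (σ₁ * k) * n k 0) := by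
        rw [e]; ring
    _ ≤ C * (2 ^ ((σ - σ₁) * k) * Real.exp (-(c * 4 ^ k * t))) * Q := by gcongr; exact hQ k
    _ = _ := by ring

theorem DyadicDecay.upperDecay (h : DyadicDecay k₀ C c c' n) (hC : 0 < C) (hc : 0 < c)
    {σ σ₁ Q : ℝ} (hσ : σ₁ < σ) (hQ : ∀ k : ℤ, 2 ^ (σ₁ * k) * n k 0 ≤ Q) :
    ∃ A, 0 < A ∧ ∀ t, 0 ≤ t →
      dyadicSum σ n t ≤ ENNReal.ofReal (A * bracket t ^ (-((σ - σ₁) / 2))) := by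
  set δ := σ - σ₁ with hδ
  have hδ0 : 0 < δ := by linarith
  have hQ0 : 0 ≤ Q := le_trans (mul_nonneg (by positivity) (h.nonneg 0 0)) (hQ 0)
  have hsum := summable_dyadicKernel hc hδ0
  set G := ∑' i, dyadicKernel c δ i with hG
  have hG0 : 0 ≤ G := tsum_nonneg fun i => dyadicKernel_nonneg c δ i
  set A := C * Q * Real.exp (c * 4 ^ k₀) * G * 2 ^ δ with hA
  refine ⟨A + 1, by positivity, fun t ht => ?_⟩
  -- Shifting by the `m` with `4^m ≤ ⟨t⟩ < 4^{m+1}` turns the sum into `2^{-δm}` times the sum of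
  -- the fixed kernel. Using `⟨t⟩ ≤ 1 + t` in the exponent costs at most `e^{c4^{k₀}}`, as `k ≤ k₀`.
  obtain ⟨m, hm1, hm2⟩ := exists_nat_pow_near (one_le_bracket t) (by norm_num : (1 : ℝ) < 4)
  have hterm : ∀ k : ℤ, 2 ^ (σ * k) * n k t ≤
      C * Q * Real.exp (c * 4 ^ k₀) * 2 ^ (-(δ * m)) * dyadicKernel c δ (k + m) := by
    intro k
    have hK := dyadicKernel_nonneg c δ (k + m)
    by_cases hk : k ≤ k₀
    swap
    · rw [h.zero k t (not_le.1 hk), mul_zero]; positivity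
    refine (h.term_le hC hQ ht k hk).trans ?_
    have e1 : Real.exp (-(c * 4 ^ k * t)) ≤
        Real.exp (c * 4 ^ k₀) * Real.exp (-(c * 4 ^ (k + m))) := by
      rw [← Real.exp_add, Real.exp_le_exp, zpow_add₀ (by norm_num), zpow_natCast]
      have h1 : (4 : ℝ) ^ k ≤ 4 ^ k₀ := zpow_le_zpow_right₀ (by norm_num) hk
      have h2 : (4 : ℝ) ^ m ≤ 1 + t := hm1.trans (bracket_le ht)
      have h3 : c * 4 ^ k * 4 ^ m ≤ c * 4 ^ k * (1 + t) := by gcongr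
      have h4 : c * 4 ^ k ≤ c * 4 ^ k₀ := by gcongr
      nlinarith
    have e2 : (2 : ℝ) ^ (δ * k) = 2 ^ (-(δ * m)) * 2 ^ (δ * ((k + m : ℤ) : ℝ)) := by
      rw [← two_rpow_add]; congr 1; push_cast; ring
    calc C * Q * (2 ^ (δ * k) * Real.exp (-(c * 4 ^ k * t)))
        ≤ C * Q * (2 ^ (δ * k) * (Real.exp (c * 4 ^ k₀) * Real.exp (-(c * 4 ^ (k + m))))) := by
          gcongr
      _ = _ := by rw [e2, dyadicKernel]; ring
  have hsum' : Summable fun k : ℤ => dyadicKernel c δ (k + m) :=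
    hsum.comp_injective (add_left_injective (m : ℤ))
  have htsum : ∑' k : ℤ, dyadicKernel c δ (k + m) = G :=
    (Equiv.addRight (m : ℤ)).tsum_eq (dyadicKernel c δ)
  calc dyadicSum σ n t ≤ ∑' k : ℤ, ENNReal.ofReal
        (C * Q * Real.exp (c * 4 ^ k₀) * 2 ^ (-(δ * m)) * dyadicKernel c δ (k + m)) :=
        ENNReal.tsum_le_tsum fun k => ENNReal.ofReal_le_ofReal (hterm k)
    _ = ENNReal.ofReal (C * Q * Real.exp (c * 4 ^ k₀) * 2 ^ (-(δ * m)) * G) := by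
        rw [← ENNReal.ofReal_tsum_of_nonneg
          (fun k => mul_nonneg (by positivity) (dyadicKernel_nonneg c δ _)) (hsum'.mul_left _),
          tsum_mul_left, htsum]
    _ ≤ _ := by
        refine ENNReal.ofReal_le_ofReal ?_
        have e3 : (2 : ℝ) ^ (-(δ * m)) ≤ 2 ^ δ * bracket t ^ (-(δ / 2)) := by
          have h1 : bracket t ^ (δ / 2) ≤ 2 ^ (δ * m) * 2 ^ δ := by
            calc bracket t ^ (δ / 2) ≤ ((4 : ℝ) ^ ((m + 1 : ℕ) : ℤ)) ^ (δ / 2) := by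
                  rw [zpow_natCast]
                  exact Real.rpow_le_rpow (bracket_pos t).le hm2.le (by positivity)
              _ = _ := by
                  rw [four_zpow_rpow, ← two_rpow_add]; congr 1; push_cast; ring
          have h0 := bracket_pos t
          rw [Real.rpow_neg two_pos.le, Real.rpow_neg h0.le, inv_le_iff_one_le_mul₀ (by positivity)]
          rw [← div_eq_mul_inv, div_mul_eq_mul_div, le_div_iff₀ (by positivity)]
          linarith
        have hb : 0 ≤ bracket t ^ (-(δ / 2)) := Real.rpow_nonneg (bracket_pos t).le _
        calc _ ≤ C * Q * Real.exp (c * 4 ^ k₀) * (2 ^ δ * bracket t ^ (-(δ / 2))) * G := by gcongr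
          _ = A * bracket t ^ (-(δ / 2)) := by rw [hA]; ring
          _ ≤ _ := by nlinarith

/-- At `t = 4^{-k}` the backward bound loses only `e^{c'}`, so decay of the sum controls its `k`-th
term at time zero. The condition `t > tL` leaves finitely many `k ≤ k₀`, which are added to the
bound. -/
theorem DyadicDecay.exists_bound_of_upperDecay (h : DyadicDecay k₀ C c c' n) (hC : 0 < C)
    {σ σ₁ tL : ℝ} (hσ : σ₁ < σ) (hu : UpperDecay (dyadicSum σ n) ((σ - σ₁) / 2) tL) :
    ∃ Q, ∀ k : ℤ, 2 ^ (σ₁ * k) * n k 0 ≤ Q := by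
  obtain ⟨A, hA, hu⟩ := hu
  set δ := σ - σ₁ with hδ
  obtain ⟨m, hm⟩ := pow_unbounded_of_one_lt tL (by norm_num : (1 : ℝ) < 4)
  have key : ∀ k : ℤ, k ≤ k₀ → k ≤ -(m : ℤ) → 2 ^ (σ₁ * k) * n k 0 ≤ C * Real.exp c' * A := by
    intro k hk hkm
    set t := (4 : ℝ) ^ (-k) with ht
    have ht0 : 0 < t := by positivity
    have htL : tL < t := by
      refine hm.trans_le ?_
      rw [ht, ← zpow_natCast]
      exact zpow_le_zpow_right₀ (by norm_num) (by omega)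
    have h1 : ENNReal.ofReal (2 ^ (σ * k) * n k t) ≤ ENNReal.ofReal (A * bracket t ^ (-(δ / 2))) :=
      (ENNReal.le_tsum k).trans (hu t htL)
    have hb : bracket t ^ (-(δ / 2)) ≤ 2 ^ (δ * k) := by
      have : t ^ (-(δ / 2)) = 2 ^ (δ * k) := by
        rw [ht, show -(δ / 2) = -δ / 2 by ring, four_zpow_rpow]; congr 1; push_cast; ring
      rw [← this]
      exact Real.rpow_le_rpow_of_nonpos ht0 (le_bracket t) (by linarith)
    rw [ENNReal.ofReal_le_ofReal_iff (by have := bracket_pos t; positivity)] at h1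
    have h2 := h.lower k t hk ht0.le
    have e1 : c' * 4 ^ k * t = c' := by
      rw [ht, mul_assoc, ← zpow_add₀ (by norm_num)]; simp
    rw [e1] at h2
    have e2 : (2 : ℝ) ^ (σ₁ * k) = 2 ^ (-(δ * k)) * 2 ^ (σ * k) := by
      rw [← two_rpow_add]; congr 1; rw [hδ]; ring
    have e3 : (2 : ℝ) ^ (-(δ * k)) * 2 ^ (δ * k) = 1 := by rw [← two_rpow_add]; simp
    calc (2 : ℝ) ^ (σ₁ * k) * n k 0 ≤ 2 ^ (σ₁ * k) * (C * Real.exp c' * n k t) := by gcongr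
      _ = C * Real.exp c' * 2 ^ (-(δ * k)) * (2 ^ (σ * k) * n k t) := by rw [e2]; ring
      _ ≤ C * Real.exp c' * 2 ^ (-(δ * k)) * (A * 2 ^ (δ * k)) := by
          refine mul_le_mul_of_nonneg_left (h1.trans ?_) (by positivity)
          gcongr
      _ = C * Real.exp c' * A * (2 ^ (-(δ * k)) * 2 ^ (δ * k)) := by ring
      _ = _ := by rw [e3, mul_one]
  refine ⟨C * Real.exp c' * A + ∑ k ∈ Finset.Icc (-(m : ℤ)) k₀, 2 ^ (σ₁ * k) * n k 0, fun k => ?_⟩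
  have hnn : ∀ k : ℤ, 0 ≤ (2 : ℝ) ^ (σ₁ * k) * n k 0 := fun k =>
    mul_nonneg (by positivity) (h.nonneg k 0)
  have hs : 0 ≤ ∑ k ∈ Finset.Icc (-(m : ℤ)) k₀, (2 : ℝ) ^ (σ₁ * k) * n k 0 :=
    Finset.sum_nonneg fun k _ => hnn k
  have hA' : 0 ≤ C * Real.exp c' * A := by positivity
  by_cases hk : k ≤ k₀
  · by_cases hkm : k ≤ -(m : ℤ)
    · linarith [key k hk hkm]
    · have := Finset.single_le_sum (f := fun k : ℤ => (2 : ℝ) ^ (σ₁ * k) * n k 0)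
        (fun k _ => hnn k) (Finset.mem_Icc.2 ⟨(not_le.1 hkm).le, hk⟩)
      linarith
  · rw [h.zero k 0 (not_le.1 hk), mul_zero]; linarith

/-- At `t = 4^m` the term with `k = i - m` is at most a multiple of `2^{-δm}` times a summable
kernel in `i`. A lower bound of order `2^{-δm}` must therefore come from a fixed window `|i| ≤ L`,
and the pigeonhole principle finds a large block within `L` of `-m`. -/
theorem DyadicDecay.exists_lower_sequence (h : DyadicDecay k₀ C c c' n) (hC : 0 < C) (hc : 0 < c)
    {σ σ₁ Q tL : ℝ} (hσ : σ₁ < σ) (hQ : ∀ k : ℤ, 2 ^ (σ₁ * k) * n k 0 ≤ Q)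
    (hl : LowerDecay (dyadicSum σ n) ((σ - σ₁) / 2) tL) :
    ∃ M₀ : ℝ, 0 < M₀ ∧ ∃ M : ℝ, 0 < M ∧ ∃ j : ℕ → ℤ, Tendsto j atTop atBot ∧
      (∀ k, |(j k : ℝ) - (j (k + 1) : ℝ)| ≤ M) ∧ ∀ k, M₀ ≤ 2 ^ (σ₁ * (j k : ℝ)) * n (j k) 0 := by
  obtain ⟨a, ha, hl⟩ := hl
  set δ := σ - σ₁ with hδ
  have hδ0 : 0 < δ := by linarith
  have hQ0 : 0 ≤ Q := le_trans (mul_nonneg (by positivity) (h.nonneg 0 0)) (hQ 0)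
  have hsum := summable_dyadicKernel hc hδ0
  -- The factor `2^{-δ/2}` accounts for `⟨t⟩ ≤ 2t`.
  set a' := a * 2 ^ (-(δ / 2)) with ha'
  have ha'0 : 0 < a' := by positivity
  -- The part outside the window is at most half of the lower bound; the `+ 1` covers `Q = 0`.
  obtain ⟨L, hL⟩ : ∃ L : ℕ, ∑' i : {x // x ∉ Finset.Icc (-(L : ℤ)) L}, dyadicKernel c δ i ≤
      a' / (2 * (C * Q + 1)) := by
    have h1 := (tendsto_tsum_compl_atTop_zero (dyadicKernel c δ)).eventually
      (gt_mem_nhds (show 0 < a' / (2 * (C * Q + 1)) by positivity))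
    obtain ⟨s, hs⟩ := eventually_atTop.1 h1
    refine ⟨s.sup Int.natAbs, (hs _ fun i hi => ?_).le⟩
    have : i.natAbs ≤ s.sup Int.natAbs := Finset.le_sup (f := Int.natAbs) hi
    rw [Finset.mem_Icc]
    omega
  set S := Finset.Icc (-(L : ℤ)) L with hS
  have hSne : S.Nonempty := ⟨0, by simp [hS]⟩
  have hScard : (0 : ℝ) < S.card := by exact_mod_cast hSne.card_pos
  obtain ⟨m₀, hm₀⟩ := pow_unbounded_of_one_lt tL (by norm_num : (1 : ℝ) < 4)
  have key : ∀ m : ℕ, m₀ ≤ m → ∃ i ∈ S,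
      a' / (2 * S.card * C) * 2 ^ (-(δ * L)) ≤
        2 ^ (σ₁ * ((i - m : ℤ) : ℝ)) * n (i - m) 0 := by
    intro m hm
    set t := (4 : ℝ) ^ m with ht
    have ht1 : 1 ≤ t := one_le_pow₀ (by norm_num)
    have htL : tL < t := hm₀.trans_le (pow_le_pow_right₀ (by norm_num) hm)
    let f : ℤ → ℝ := fun i => 2 ^ (σ * ((i - m : ℤ) : ℝ)) * n (i - m) t
    have hf0 : ∀ i, 0 ≤ f i := fun i => mul_nonneg (by positivity) (h.nonneg _ _)
    have hfle : ∀ i, f i ≤ C * Q * 2 ^ (-(δ * m)) * dyadicKernel c δ i := by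
      intro i
      have hK := dyadicKernel_nonneg c δ i
      by_cases hk : i - m ≤ k₀
      swap
      · simp only [f]
        rw [h.zero _ t (not_le.1 hk), mul_zero]; positivity
      refine (h.term_le hC hQ (by linarith) _ hk).trans (le_of_eq ?_)
      have e1 : c * (4 : ℝ) ^ (i - m) * t = c * 4 ^ i := by
        rw [ht, mul_assoc, ← zpow_natCast, ← zpow_add₀ (by norm_num)]; simp
      have e2 : (2 : ℝ) ^ ((σ - σ₁) * ((i - m : ℤ) : ℝ)) = 2 ^ (-(δ * m)) * 2 ^ (δ * i) := by
        rw [← two_rpow_add]; congr 1; push_cast; rw [hδ]; ring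
      rw [e1, e2, dyadicKernel]; ring
    have hfs : Summable f := (hsum.mul_left _).of_nonneg_of_le hf0 hfle
    have hd : dyadicSum σ n t = ENNReal.ofReal (∑' i, f i) := by
      rw [ENNReal.ofReal_tsum_of_nonneg hf0 hfs, dyadicSum]
      exact ((Equiv.subRight (m : ℤ)).tsum_eq
        (fun k : ℤ => ENNReal.ofReal (2 ^ (σ * k) * n k t))).symm
    have hlow : a' * 2 ^ (-(δ * m)) ≤ ∑' i, f i := by
      have h1 := hl t htL
      rw [hd, ENNReal.ofReal_le_ofReal_iff (tsum_nonneg hf0)] at h1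
      refine le_trans ?_ h1
      have h2 : bracket t ≤ 2 * t := (bracket_le (by linarith)).trans (by linarith)
      have h3 : (2 * t) ^ (-(δ / 2)) ≤ bracket t ^ (-(δ / 2)) :=
        Real.rpow_le_rpow_of_nonpos (bracket_pos t) h2 (by linarith)
      have h4 : t ^ (-(δ / 2)) = 2 ^ (-(δ * m)) := by
        have := four_zpow_rpow m (-δ)
        rw [zpow_natCast] at this
        rw [ht, show -(δ / 2) = -δ / 2 by ring, this]; congr 1; push_cast; ring
      rw [Real.mul_rpow two_pos.le (by positivity), h4] at h3
      calc a' * 2 ^ (-(δ * m)) = a * (2 ^ (-(δ / 2)) * 2 ^ (-(δ * m))) := by rw [ha']; ring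
        _ ≤ _ := by gcongr
    have hsplit := hfs.sum_add_tsum_subtype_compl S
    have htail : ∑' i : {x // x ∉ S}, f i ≤ a' / 2 * 2 ^ (-(δ * m)) := by
      calc ∑' i : {x // x ∉ S}, f i
          ≤ ∑' i : {x // x ∉ S}, C * Q * 2 ^ (-(δ * m)) * dyadicKernel c δ i :=
            Summable.tsum_le_tsum (fun i => hfle i) (hfs.subtype _) ((hsum.mul_left _).subtype _)
        _ = C * Q * 2 ^ (-(δ * m)) * ∑' i : {x // x ∉ S}, dyadicKernel c δ i := tsum_mul_left
        _ ≤ C * Q * 2 ^ (-(δ * m)) * (a' / (2 * (C * Q + 1))) := by gcongr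
        _ = a' / 2 * 2 ^ (-(δ * m)) * (C * Q / (C * Q + 1)) := by field_simp
        _ ≤ a' / 2 * 2 ^ (-(δ * m)) * 1 := by
            gcongr
            rw [div_le_one (by positivity)]; linarith
        _ = _ := mul_one _
    have hmain : ∑ i ∈ S, a' / (2 * S.card) * 2 ^ (-(δ * m)) ≤ ∑ i ∈ S, f i := by
      rw [Finset.sum_const, nsmul_eq_mul]
      have : (S.card : ℝ) * (a' / (2 * S.card) * 2 ^ (-(δ * m))) = a' / 2 * 2 ^ (-(δ * m)) := by
        field_simp
      rw [this]
      linarith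
    obtain ⟨i, hi, hfi⟩ := Finset.exists_le_of_sum_le hSne hmain
    refine ⟨i, hi, ?_⟩
    have hnn : 0 ≤ n (i - m) 0 := h.nonneg _ _
    have hik : i - m ≤ k₀ := by
      by_contra hk
      simp only [f] at hfi
      rw [h.zero _ t (not_le.1 hk), mul_zero] at hfi
      have : 0 < a' / (2 * S.card) * 2 ^ (-(δ * m)) := by positivity
      linarith
    have hup : n (i - m) t ≤ C * n (i - m) 0 := by
      refine (h.upper _ t hik (by linarith)).trans ?_
      have : Real.exp (-(c * 4 ^ (i - m) * t)) ≤ 1 := Real.exp_le_one_iff.2 (by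
        have : 0 < c * (4 : ℝ) ^ (i - m) * t := by positivity
        linarith)
      calc C * Real.exp (-(c * 4 ^ (i - m) * t)) * n (i - m) 0 ≤ C * 1 * n (i - m) 0 := by gcongr
        _ = _ := by rw [mul_one]
    have e1 : (2 : ℝ) ^ (σ₁ * ((i - m : ℤ) : ℝ)) =
        2 ^ (-(δ * i)) * 2 ^ (δ * m) * 2 ^ (σ * ((i - m : ℤ) : ℝ)) := by
      rw [← two_rpow_add, ← two_rpow_add]; congr 1; push_cast; rw [hδ]; ring
    have e2 : (2 : ℝ) ^ (δ * m) * 2 ^ (-(δ * m)) = 1 := by rw [← two_rpow_add]; simp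
    have e3 : (2 : ℝ) ^ (-(δ * L)) ≤ 2 ^ (-(δ * i)) := by
      refine Real.rpow_le_rpow_of_exponent_le one_le_two ?_
      have : (i : ℝ) ≤ L := by exact_mod_cast (Finset.mem_Icc.1 hi).2
      nlinarith
    calc a' / (2 * S.card * C) * 2 ^ (-(δ * L))
        ≤ a' / (2 * S.card * C) * 2 ^ (-(δ * i)) := by gcongr
      _ = 2 ^ (-(δ * i)) * C⁻¹ * (a' / (2 * S.card)) * (2 ^ (δ * m) * 2 ^ (-(δ * m))) := by
          rw [e2]; field_simp
      _ = 2 ^ (-(δ * i)) * C⁻¹ * 2 ^ (δ * m) * (a' / (2 * S.card) * 2 ^ (-(δ * m))) := by ring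
      _ ≤ 2 ^ (-(δ * i)) * C⁻¹ * 2 ^ (δ * m) *
          (2 ^ (σ * ((i - m : ℤ) : ℝ)) * (C * n (i - m) 0)) := by
          refine mul_le_mul_of_nonneg_left (hfi.trans ?_) (by positivity)
          simp only [f]; gcongr
      _ = _ := by rw [e1]; field_simp
  choose! i hiS hi using key
  -- Consecutive windows have radius `L` and centres one apart, whence the gap `2L + 1`. Starting at
  -- `m₀` ensures `4^m > tL`.
  refine ⟨a' / (2 * S.card * C) * 2 ^ (-(δ * L)), by positivity, 2 * L + 1, by positivity,
    fun r => i (m₀ + r) - (m₀ + r : ℕ), ?_, ?_, fun r => hi _ (by omega)⟩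
  · refine tendsto_atBot.2 fun b => ?_
    filter_upwards [eventually_ge_atTop ((L : ℤ) - b).toNat] with r hr
    have h1 := (Finset.mem_Icc.1 (hiS (m₀ + r) (by omega))).2
    have := Int.self_le_toNat ((L : ℤ) - b)
    push_cast
    omega
  · intro r
    have h1 := Finset.mem_Icc.1 (hiS (m₀ + r) (by omega))
    have h2 := Finset.mem_Icc.1 (hiS (m₀ + (r + 1)) (by omega))
    have : |(i (m₀ + r) - (m₀ + r : ℕ)) - (i (m₀ + (r + 1)) - (m₀ + (r + 1) : ℕ))| ≤
        (2 * L + 1 : ℤ) := by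
      rw [abs_le]
      push_cast
      constructor <;> omega
    exact_mod_cast this

/-- One block suffices: the first `r` with `4^{j r}⟨t⟩ ≤ 1`. There the backward bound loses only
`e^{c'}`, while minimality and the bounded gaps keep `4^{j r}` from being much smaller than `⟨t⟩⁻¹`.
No monotonicity of `j` is involved. -/
theorem DyadicDecay.lowerDecay (h : DyadicDecay k₀ C c c' n) (hC : 0 < C) (hc' : 0 < c')
    {σ σ₁ M₀ M tL : ℝ} (hσ : σ₁ < σ) (htL : 0 ≤ tL) (hM₀ : 0 < M₀) {j : ℕ → ℤ}
    (hj : Tendsto j atTop atBot) (hM : ∀ k, |(j k : ℝ) - (j (k + 1) : ℝ)| ≤ M)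
    (hlow : ∀ k, M₀ ≤ 2 ^ (σ₁ * (j k : ℝ)) * n (j k) 0) :
    LowerDecay (dyadicSum σ n) ((σ - σ₁) / 2) tL := by
  set δ := σ - σ₁ with hδ
  have hδ0 : 0 < δ := by linarith
  refine ⟨C⁻¹ * Real.exp (-c') * M₀ * min (2 ^ (δ * j 0)) (2 ^ (-(δ * M))), by positivity,
    fun t ht => ?_⟩
  have ht0 : 0 ≤ t := htL.trans ht.le
  have hb1 := one_le_bracket t
  have hb0 := bracket_pos t
  have hex : ∃ r, (4 : ℝ) ^ j r * bracket t ≤ 1 := by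
    obtain ⟨m, hm⟩ := pow_unbounded_of_one_lt (bracket t) (by norm_num : (1 : ℝ) < 4)
    obtain ⟨r, hr⟩ := (tendsto_atBot.1 hj (-(m : ℤ))).exists
    refine ⟨r, ?_⟩
    calc (4 : ℝ) ^ j r * bracket t ≤ 4 ^ (-(m : ℤ)) * 4 ^ m := by
          gcongr
          norm_num
      _ = 1 := by rw [zpow_neg, zpow_natCast, inv_mul_cancel₀ (by positivity)]
  classical
  set r := Nat.find hex with hr
  have hr1 : (4 : ℝ) ^ j r * bracket t ≤ 1 := Nat.find_spec hex
  have hδr : min (2 ^ (δ * j 0)) (2 ^ (-(δ * M))) * bracket t ^ (-(δ / 2)) ≤ (2 : ℝ) ^ (δ * j r) := by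
    -- For `r = 0` there is no predecessor; then `2^{δ j 0}` is a constant and `⟨t⟩^{-δ/2} ≤ 1`.
    -- This is the reason for the minimum.
    rcases Nat.eq_zero_or_pos r with h0 | h0
    · rw [h0]
      have : bracket t ^ (-(δ / 2)) ≤ 1 := Real.rpow_le_one_of_one_le_of_nonpos hb1 (by linarith)
      calc _ ≤ (2 : ℝ) ^ (δ * j 0) * 1 := by gcongr; exact min_le_left _ _
        _ = _ := mul_one _
    · have h1 : 1 < (4 : ℝ) ^ j (r - 1) * bracket t := not_le.1 (Nat.find_min hex (by omega))
      have h2 := (abs_le.1 (hM (r - 1))).2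
      rw [Nat.sub_add_cancel h0] at h2
      have h3 : bracket t ^ (-(δ / 2)) ≤ 2 ^ (δ * j (r - 1)) := by
        rw [← four_zpow_rpow, Real.rpow_neg hb0.le, inv_le_iff_one_le_mul₀ (by positivity),
          ← Real.mul_rpow (by positivity) hb0.le]
        exact Real.one_le_rpow h1.le (by positivity)
      calc _ ≤ (2 : ℝ) ^ (-(δ * M)) * 2 ^ (δ * j (r - 1)) := by gcongr; exact min_le_right _ _
        _ = 2 ^ (-(δ * M) + δ * j (r - 1)) := (two_rpow_add _ _).symm
        _ ≤ _ := Real.rpow_le_rpow_of_exponent_le one_le_two (by nlinarith)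
  have hn0 : 0 < n (j r) 0 := by
    have h1 : 0 < (2 : ℝ) ^ (σ₁ * (j r : ℝ)) * n (j r) 0 := hM₀.trans_le (hlow r)
    exact pos_of_mul_pos_right h1 (by positivity)
  have hjr : j r ≤ k₀ := by
    by_contra hk
    rw [h.zero _ 0 (not_le.1 hk)] at hn0
    exact lt_irrefl _ hn0
  have hnl := h.lower (j r) t hjr ht0
  have hexp : Real.exp (c' * 4 ^ j r * t) ≤ Real.exp c' := by
    refine Real.exp_le_exp.2 ?_
    have : (4 : ℝ) ^ j r * t ≤ 1 := (by gcongr; exact le_bracket t :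
      (4 : ℝ) ^ j r * t ≤ 4 ^ j r * bracket t).trans hr1
    nlinarith
  have hnt := h.nonneg (j r) t
  have h4 : M₀ ≤ 2 ^ (σ₁ * (j r : ℝ)) * (C * Real.exp c' * n (j r) t) := by
    refine (hlow r).trans ?_
    gcongr
    exact hnl.trans (by gcongr)
  refine le_trans (ENNReal.ofReal_le_ofReal ?_) (ENNReal.le_tsum (j r))
  have e1 : (2 : ℝ) ^ (σ * (j r : ℝ)) = 2 ^ (δ * j r) * 2 ^ (σ₁ * (j r : ℝ)) := by
    rw [← two_rpow_add]; congr 1; rw [hδ]; ring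
  have e2 : Real.exp (-c') * Real.exp c' = 1 := by rw [← Real.exp_add]; simp
  calc _ = C⁻¹ * Real.exp (-c') * M₀ *
        (min (2 ^ (δ * j 0)) (2 ^ (-(δ * M))) * bracket t ^ (-(δ / 2))) := by ring
    _ ≤ C⁻¹ * Real.exp (-c') * (2 ^ (σ₁ * (j r : ℝ)) * (C * Real.exp c' * n (j r) t)) *
        2 ^ (δ * j r) := by gcongr
    _ = (C⁻¹ * C) * (Real.exp (-c') * Real.exp c') *
        (2 ^ (δ * j r) * 2 ^ (σ₁ * (j r : ℝ)) * n (j r) t) := by ring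
    _ = _ := by rw [e1, e2, inv_mul_cancel₀ hC.ne']; ring

end Sequences

/-! ### Symbols of `Δ̇_k` and `Ṡ_k` -/

section BlockSymbols

variable {d : ℕ} {χ : Sp d → ℝ}

/-- The symbol of `Δ̇_k`. -/
noncomputable def blockSym (χ : Sp d → ℝ) (k : ℤ) (ξ : Sp d) : ℂ :=
  ((χ ((2 : ℝ)⁻¹ • (2 : ℝ) ^ (-k) • ξ) - χ ((2 : ℝ) ^ (-k) • ξ) : ℝ) : ℂ)

/-- The symbol of `Ṡ_k`. -/
noncomputable def lowSym (χ : Sp d → ℝ) (k : ℤ) (ξ : Sp d) : ℂ :=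
  ((χ ((2 : ℝ) ^ (-k) • ξ) : ℝ) : ℂ)

theorem norm_two_zpow_smul (k : ℤ) (ξ : Sp d) : ‖(2 : ℝ) ^ (-k) • ξ‖ = ‖ξ‖ / 2 ^ k := by
  rw [norm_smul, Real.norm_of_nonneg (by positivity), zpow_neg, inv_mul_eq_div]

theorem lowSym_eq_one (hχ : IsCutoff χ) {k : ℤ} {ξ : Sp d} (h : ‖ξ‖ ≤ 3 / 4 * 2 ^ k) :
    lowSym χ k ξ = 1 := by
  rw [lowSym, hχ.eq_one, Complex.ofReal_one]
  rw [norm_two_zpow_smul, div_le_iff₀ (by positivity)]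
  exact h

theorem lowSym_eq_zero (hχ : IsCutoff χ) {k : ℤ} {ξ : Sp d} (h : 4 / 3 * 2 ^ k ≤ ‖ξ‖) :
    lowSym χ k ξ = 0 := by
  rw [lowSym, hχ.eq_zero, Complex.ofReal_zero]
  rw [norm_two_zpow_smul, le_div_iff₀ (by positivity)]
  exact h

theorem norm_lowSym_le (hχ : IsCutoff χ) (k : ℤ) (ξ : Sp d) : ‖lowSym χ k ξ‖ ≤ 1 := by
  have := hχ.mem_unit ((2 : ℝ) ^ (-k) • ξ)
  rw [lowSym, Complex.norm_real, Real.norm_of_nonneg this.1]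
  exact this.2

theorem isTest_lowSym (hχ : IsCutoff χ) (k : ℤ) : IsTest (lowSym χ k) := by
  refine isTest_of_contDiffAt (R := 4 / 3 * 2 ^ k) (fun v => ?_) fun ξ h => lowSym_eq_zero hχ h
  exact (Complex.ofRealCLM.contDiff.comp (hχ.smooth.comp (by fun_prop))).contDiffAt

theorem blockSym_eq (χ : Sp d → ℝ) (k : ℤ) (ξ : Sp d) :
    blockSym χ k ξ = lowSym χ (k + 1) ξ - lowSym χ k ξ := by
  rw [blockSym, lowSym, lowSym, smul_smul, ← Complex.ofReal_sub]
  congr 5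
  rw [neg_add, zpow_add₀ (by norm_num), mul_comm]
  norm_num

theorem isTest_blockSym (hχ : IsCutoff χ) (k : ℤ) : IsTest (blockSym χ k) := by
  have h1 := isTest_lowSym hχ (k + 1)
  have h2 := isTest_lowSym hχ k
  rw [funext (blockSym_eq χ k)]
  exact ⟨h1.1.sub h2.1, h1.2.sub h2.2⟩

theorem norm_of_blockSym_ne_zero (hχ : IsCutoff χ) {k : ℤ} {ξ : Sp d} (h : blockSym χ k ξ ≠ 0) :
    3 / 4 * (2 : ℝ) ^ k ≤ ‖ξ‖ ∧ ‖ξ‖ ≤ 8 / 3 * (2 : ℝ) ^ k := by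
  have e : (2 : ℝ) ^ (k + 1) = 2 * 2 ^ k := by rw [zpow_add_one₀ (by norm_num), mul_comm]
  have h2k : (0 : ℝ) < 2 ^ k := by positivity
  rw [blockSym_eq] at h
  constructor
  · by_contra hn
    rw [lowSym_eq_one hχ (by rw [e]; linarith), lowSym_eq_one hχ (by linarith)] at h
    simp at h
  · by_contra hn
    rw [lowSym_eq_zero hχ (by rw [e]; linarith), lowSym_eq_zero hχ (by linarith)] at h
    simp at h

theorem fatk_mul_blockSym (hχ : IsCutoff χ) (k : ℤ) (ξ : Sp d) :
    fatk χ k ξ * blockSym χ k ξ = blockSym χ k ξ := by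
  by_cases h : blockSym χ k ξ = 0
  · rw [h, MulZeroClass.mul_zero]
  obtain ⟨h1, h2⟩ := norm_of_blockSym_ne_zero hχ h
  rw [fatk, fat_eq_one hχ, one_mul]
  · rw [norm_two_zpow_smul, le_div_iff₀ (by positivity)]
    have : (0 : ℝ) < 2 ^ k := by positivity
    linarith
  · rw [norm_two_zpow_smul, div_le_iff₀ (by positivity)]
    have : (0 : ℝ) < 2 ^ k := by positivity
    linarith

theorem blockSym_mul_lowSym_eq_zero (hχ : IsCutoff χ) {k k₀ : ℤ} (h : k₀ < k) (ξ : Sp d) :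
    blockSym χ k ξ * lowSym χ k₀ ξ = 0 := by
  by_cases hb : blockSym χ k ξ = 0
  · rw [hb, MulZeroClass.zero_mul]
  rw [lowSym_eq_zero hχ, MulZeroClass.mul_zero]
  have h1 := (norm_of_blockSym_ne_zero hχ hb).1
  have h2 : (2 : ℝ) ^ (k₀ + 1) ≤ 2 ^ k := zpow_le_zpow_right₀ (by norm_num) (by omega)
  rw [zpow_add_one₀ (by norm_num)] at h2
  have : (0 : ℝ) < 2 ^ k₀ := by positivity
  linarith

/-- Low-frequency cut-off preserves `𝓢'_h`. -/
theorem IsSh.lowCut (hχ : IsCutoff χ) (k₀ : ℤ) {f : Dist d} (hf : IsSh f) :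
    IsSh (mult (lowSym χ k₀) f) := by
  intro θ hθ hθc
  refine (hf θ hθ hθc).congr' ?_
  have ht : IsTest θ := ⟨hθ, hθc⟩
  obtain ⟨R, hR⟩ := ht.exists_radius
  -- For large `l` the support of `θ(l·)` lies where the low-frequency cut-off equals one.
  filter_upwards [eventually_gt_atTop (max 0 (R / (3 / 4 * 2 ^ k₀)))] with l hl
  have hl0 : 0 < l := (le_max_left _ _).trans_lt hl
  have hl1 : R < l * (3 / 4 * 2 ^ k₀) := by
    rw [← div_lt_iff₀ (by positivity)]; exact (le_max_right _ _).trans_lt hl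
  rw [mult_mult (ht.comp_smul hl0.ne').tg (isTest_lowSym hχ k₀).tg]
  congr 2
  ext ξ
  by_cases h : ‖ξ‖ ≤ 3 / 4 * 2 ^ k₀
  · rw [lowSym_eq_one hχ h, mul_one]
  · rw [hR (l • ξ), MulZeroClass.zero_mul]
    rw [norm_smul, Real.norm_of_nonneg hl0.le]
    nlinarith [not_le.1 h]

end BlockSymbols

/-! ### Estimates of localized velocity and stress -/

section BlockEstimates

variable {d : ℕ} {χ : Sp d → ℝ}

/-- The sum of the `L^p` norms of the components of a vector. -/
noncomputable def vecNorm (p : ℝ≥0∞) (U : Fin d → Dist d) : ℝ≥0∞ := ∑ i, distLp p (U i)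

/-- The sum of the `L^p` norms of the entries of a tensor. -/
noncomputable def tensorNorm (p : ℝ≥0∞) (T : Fin d → Fin d → Dist d) : ℝ≥0∞ :=
  ∑ i, ∑ j, distLp p (T i j)

theorem exists_common_bound {ι : Type*} [Fintype ι] {P : ι → ℝ → Prop}
    (hmono : ∀ i C C', C ≤ C' → P i C → P i C') (h : ∀ i, ∃ C, 0 < C ∧ P i C) :
    ∃ C, 0 < C ∧ ∀ i, P i C := by
  choose C hC hP using h
  have hs : 0 ≤ ∑ i, C i := Finset.sum_nonneg fun i _ => (hC i).le
  refine ⟨1 + ∑ i, C i, by positivity, fun i => hmono i _ _ ?_ (hP i)⟩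
  have := Finset.single_le_sum (f := C) (fun i _ => (hC i).le) (Finset.mem_univ i)
  linarith

theorem exists_lpB_family (hχ : IsCutoff χ) {ι : Type*} [Fintype ι] {a : ι → Sp d → ℂ} (n : ℤ)
    (ha : ∀ i ξ, ξ ≠ 0 → ContDiffAt ℝ ∞ (a i) ξ)
    (hh : ∀ i (l : ℝ), 0 < l → ∀ ξ, a i (l • ξ) = ((l ^ n : ℝ) : ℂ) * a i ξ) :
    ∃ C, 0 < C ∧ ∀ i, ∀ k : ℤ, ∀ p : ℝ, 1 < p →
      LpB (ENNReal.ofReal p) (fun ξ => fatk χ k ξ * a i ξ) (C * ((2 : ℝ) ^ k) ^ n) := by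
  refine exists_common_bound (fun i C C' hCC h k p hp => (h k p hp).mono (by gcongr)) fun i => ?_
  obtain ⟨C, hC, h⟩ := exists_lpB_homogeneous hχ n (ha i) (hh i)
  exact ⟨C, hC, fun k => (h k).2⟩

theorem exists_lpB_divSym (hχ : IsCutoff χ) : ∃ C, 0 < C ∧ ∀ (i l j : Fin d) (k : ℤ) (p : ℝ), 1 < p →
    LpB (ENNReal.ofReal p) (divSym χ k i l j) (C * 2 ^ k) := by
  obtain ⟨C, hC, h⟩ := exists_lpB_family hχ
    (a := fun (q : Fin d × Fin d × Fin d) ξ => projSymbol q.1 q.2.1 ξ * pdSymbol q.2.2 ξ) 1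
    (fun q ξ hξ => (contDiffAt_projSymbol _ _ hξ).mul (contDiffAt_pdSymbol _ ξ))
    (fun q l hl ξ => by rw [projSymbol_smul _ _ hl, pdSymbol_smul, zpow_one]; ring)
  exact ⟨C, hC, fun i l j k p hp => by
    have := h (i, l, j) k p hp
    rwa [zpow_one] at this⟩

theorem exists_lpB_invSym (hχ : IsCutoff χ) : ∃ C, 0 < C ∧ ∀ (j : Fin d) (k : ℤ) (p : ℝ), 1 < p →
    LpB (ENNReal.ofReal p) (invSym χ k j) (C * (2 ^ k)⁻¹) := by
  obtain ⟨C, hC, h⟩ := exists_lpB_family hχ (a := invSymbol) (-1)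
    (fun j ξ hξ => contDiffAt_invSymbol j hξ) (fun j l hl ξ => invSymbol_smul j hl ξ)
  exact ⟨C, hC, fun j k p hp => by
    have := h j k p hp
    rwa [zpow_neg_one] at this⟩

/-- Bernstein's inequality, from the homogeneity of `iξ_j`. -/
theorem exists_distLp_pd_le (hχ : IsCutoff χ) : ∃ C, 0 < C ∧ ∀ (k : ℤ) (p : ℝ), 1 < p →
    ∀ (ψ : Sp d → ℂ), IsTest ψ → (∀ ξ, fatk χ k ξ * ψ ξ = ψ ξ) → ∀ (j : Fin d) (f : Dist d),
      distLp (ENNReal.ofReal p) (mult ψ (pd j f)) ≤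
        ENNReal.ofReal (C * 2 ^ k) * distLp (ENNReal.ofReal p) (mult ψ f) := by
  obtain ⟨C, hC, h⟩ := exists_lpB_family hχ (a := pdSymbol) 1
    (fun j ξ _ => contDiffAt_pdSymbol j ξ) (fun j l hl ξ => by rw [pdSymbol_smul, zpow_one])
  refine ⟨C, hC, fun k p hp ψ hψ hf j f => ?_⟩
  rw [pd_eq_mult, mult_comm hψ.tg (hasTemperateGrowth_pdSymbol j),
    ← mult_fatk_mul_block' hχ hψ hf (fun ξ _ => contDiffAt_pdSymbol j ξ)
      (hasTemperateGrowth_pdSymbol j)]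
  simpa using h j k p hp (mult ψ f)

theorem contDiffAt_lerayRieszSymbol (i l j : Fin d) {ξ : Sp d} (h : ξ ≠ 0) :
    ContDiffAt ℝ ∞ (lerayRieszSymbol i l j) ξ :=
  (contDiffAt_projSymbol i l h).mul (contDiffAt_const.mul (contDiff_ofReal_comp
    ((contDiff_coord j).contDiffAt.div (contDiffAt_norm ℝ h) (norm_ne_zero_iff.2 h))))

theorem lerayRieszSymbol_smul (i l j : Fin d) {c : ℝ} (hc : 0 < c) (ξ : Sp d) :
    lerayRieszSymbol i l j (c • ξ) = lerayRieszSymbol i l j ξ := by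
  change projSymbol i l (c • ξ) * _ = projSymbol i l ξ * _
  rw [projSymbol_smul i l hc]
  simp only [PiLp.smul_apply, smul_eq_mul, norm_smul, Real.norm_of_nonneg hc.le]
  rw [mul_div_mul_left _ _ hc.ne']

/-- The symbol is homogeneous of degree `0`, hence bounded uniformly in `k` on annuli. The support
of `ψ` avoids the origin, so the identity defining `Z` may be used with `ψ` itself. -/
theorem exists_lerayRieszDiv_le (hχ : IsCutoff χ) : ∃ C, 0 < C ∧ ∀ (k : ℤ) (p : ℝ), 1 < p →
    ∀ (ψ : Sp d → ℂ), IsTest ψ → (∀ ξ, fatk χ k ξ * ψ ξ = ψ ξ) →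
    ∀ (τ : Fin d → Fin d → Dist d) (Z : Fin d → Dist d), IsLerayRieszDiv τ Z →
      vecNorm (ENNReal.ofReal p) (fun i => mult ψ (Z i)) ≤
        ENNReal.ofReal C * tensorNorm (ENNReal.ofReal p) (fun i j => mult ψ (τ i j)) := by
  obtain ⟨C, hC, h⟩ := exists_lpB_family hχ
    (a := fun (q : Fin d × Fin d × Fin d) => lerayRieszSymbol q.1 q.2.1 q.2.2) 0
    (fun q ξ hξ => contDiffAt_lerayRieszSymbol _ _ _ hξ)
    (fun q l hl ξ => by rw [lerayRieszSymbol_smul _ _ _ hl]; simp)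
  -- `d + 1` instead of `d` keeps the constant positive when `d = 0`.
  refine ⟨(d + 1 : ℝ) * C, by positivity, fun k p hp ψ hψ hf τ Z hZ => ?_⟩
  have hp' : 1 ≤ ENNReal.ofReal p := by rw [ENNReal.one_le_ofReal]; exact hp.le
  have h0 : (0 : Sp d) ∉ tsupport ψ := by
    intro hmem
    have hc : IsClosed {ξ : Sp d | 3 / 16 * (2 : ℝ) ^ k ≤ ‖ξ‖} :=
      isClosed_le continuous_const continuous_norm
    have : (0 : Sp d) ∈ {ξ : Sp d | 3 / 16 * (2 : ℝ) ^ k ≤ ‖ξ‖} := by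
      refine closure_minimal (fun ζ hζ => ?_) hc hmem
      refine (norm_of_fatk_ne_zero hχ fun hn => hζ ?_).1
      rw [← hf ζ, hn, MulZeroClass.zero_mul]
    have h2 : 3 / 16 * (2 : ℝ) ^ k ≤ ‖(0 : Sp d)‖ := this
    rw [norm_zero] at h2
    have : (0 : ℝ) < 2 ^ k := by positivity
    linarith
  have key : ∀ i, distLp (ENNReal.ofReal p) (mult ψ (Z i)) ≤
      ENNReal.ofReal C * tensorNorm (ENNReal.ofReal p) (fun i j => mult ψ (τ i j)) := by
    intro i
    rw [hZ.2 ψ hψ.1 hψ.2 h0 i, tensorNorm, Finset.mul_sum]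
    refine (distLp_sum_le hp' _ _).trans (Finset.sum_le_sum fun l _ => ?_)
    rw [Finset.mul_sum]
    refine (distLp_sum_le hp' _ _).trans (Finset.sum_le_sum fun j _ => ?_)
    rw [← mult_fatk_mul_block hχ hψ hf fun ξ hξ => contDiffAt_lerayRieszSymbol i l j hξ]
    simpa using h (i, l, j) k p hp (mult ψ (τ l j))
  refine (Finset.sum_le_sum fun i _ => key i).trans ?_
  rw [Finset.sum_const, Finset.card_univ, Fintype.card_fin, nsmul_eq_mul, ← mul_assoc]
  gcongr
  rw [ENNReal.ofReal_mul (by positivity)]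
  gcongr
  rw [← ENNReal.ofReal_natCast]
  exact ENNReal.ofReal_le_ofReal (by linarith)

theorem exists_vecNorm_projDiv_le (hχ : IsCutoff χ) : ∃ C, 0 < C ∧ ∀ (k : ℤ) (p : ℝ), 1 < p →
    ∀ T : Fin d → Fin d → Dist d, vecNorm (ENNReal.ofReal p) (projDiv χ k T) ≤
      ENNReal.ofReal (C * 2 ^ k) * tensorNorm (ENNReal.ofReal p) T := by
  obtain ⟨C, hC, h⟩ := exists_lpB_divSym hχ
  refine ⟨(d + 1 : ℝ) * C, by positivity, fun k p hp T => ?_⟩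
  have hp' : 1 ≤ ENNReal.ofReal p := by rw [ENNReal.one_le_ofReal]; exact hp.le
  have key : ∀ i, distLp (ENNReal.ofReal p) (projDiv χ k T i) ≤
      ENNReal.ofReal (C * 2 ^ k) * tensorNorm (ENNReal.ofReal p) T := by
    intro i
    rw [projDiv, tensorNorm, Finset.mul_sum]
    refine (distLp_sum_le hp' _ _).trans (Finset.sum_le_sum fun l _ => ?_)
    rw [Finset.mul_sum]
    exact (distLp_sum_le hp' _ _).trans (Finset.sum_le_sum fun j _ => h i l j k p hp _)
  refine (Finset.sum_le_sum fun i _ => key i).trans ?_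
  rw [Finset.sum_const, Finset.card_univ, Fintype.card_fin, nsmul_eq_mul, ← mul_assoc]
  gcongr
  rw [mul_assoc, ENNReal.ofReal_mul (p := (d + 1 : ℝ)) (by positivity)]
  gcongr
  rw [← ENNReal.ofReal_natCast]
  exact ENNReal.ofReal_le_ofReal (by linarith)

/-- The symmetrized correction that relates a tensor and its heat part. -/
theorem exists_tensorNorm_correction_le (hχ : IsCutoff χ) : ∃ C, 0 < C ∧ ∀ (k : ℤ) (p : ℝ), 1 < p →
    ∀ W : Fin d → Dist d, ∑ i, ∑ j, (distLp (ENNReal.ofReal p) (mult (invSym χ k j) (W i)) +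
      distLp (ENNReal.ofReal p) (mult (invSym χ k i) (W j))) ≤
      ENNReal.ofReal (C * (2 ^ k)⁻¹) * vecNorm (ENNReal.ofReal p) W := by
  obtain ⟨C, hC, h⟩ := exists_lpB_invSym hχ
  refine ⟨2 * (d + 1 : ℝ) * C, by positivity, fun k p hp W => ?_⟩
  have hd : (d : ℝ≥0∞) ≤ ENNReal.ofReal (d + 1 : ℝ) := by
    rw [← ENNReal.ofReal_natCast]
    exact ENNReal.ofReal_le_ofReal (by linarith)
  have h1 : ∑ i, ∑ j, distLp (ENNReal.ofReal p) (mult (invSym χ k j) (W i)) ≤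
      d * (ENNReal.ofReal (C * (2 ^ k)⁻¹) * vecNorm (ENNReal.ofReal p) W) := by
    rw [vecNorm, Finset.mul_sum, Finset.mul_sum]
    refine Finset.sum_le_sum fun i _ => ?_
    refine (Finset.sum_le_sum fun j _ => h j k p hp (W i)).trans ?_
    rw [Finset.sum_const, Finset.card_univ, Fintype.card_fin, nsmul_eq_mul]
  have h2 : ∑ i, ∑ j, distLp (ENNReal.ofReal p) (mult (invSym χ k i) (W j)) ≤
      d * (ENNReal.ofReal (C * (2 ^ k)⁻¹) * vecNorm (ENNReal.ofReal p) W) := by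
    rw [Finset.sum_comm]; exact h1
  simp only [Finset.sum_add_distrib]
  refine (add_le_add h1 h2).trans ?_
  rw [← two_mul, ← mul_assoc, ← mul_assoc]
  gcongr
  rw [mul_assoc (2 * (d + 1 : ℝ)), ENNReal.ofReal_mul (p := 2 * (d + 1 : ℝ)) (by positivity),
    ENNReal.ofReal_mul (p := (2 : ℝ)) (by positivity), ENNReal.ofReal_ofNat]
  gcongr

/-- The effect of the propagator on the norms of the localized velocity and stress. -/
theorem exists_block_estimate (hχ : IsCutoff χ) (ν₁ ν₂ η : ℝ) :
    ∃ C, 1 ≤ C ∧ ∀ (k : ℤ) (p : ℝ), 1 < p → ∀ (h₀ h₁ : ℝ × Sp d → ℂ) (r : ℝ)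
      (U U' : Fin d → Dist d) (T T' : Fin d → Fin d → Dist d),
      (∀ i, Propagates ν₁ ν₂ η h₀ h₁ r (U i) (projDiv χ k T i) (U' i) (projDiv χ k T' i)) →
      (∀ i j, heatPart χ k T' i j = mult (fun ξ => heatSym χ k η (r, ξ)) (heatPart χ k T i j)) →
      ∀ (B : Bool → Bool → ℝ) (Bh : ℝ), (∀ a b, 0 ≤ B a b) → 0 ≤ Bh →
      (∀ a b, LpB (ENNReal.ofReal p) (fun ξ => propSym ν₁ ν₂ η h₀ h₁ a b (r, ξ)) (B a b)) →
      LpB (ENNReal.ofReal p) (fun ξ => heatSym χ k η (r, ξ)) Bh →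
      vecNorm (ENNReal.ofReal p) U' ≤
          ENNReal.ofReal (B false false) * vecNorm (ENNReal.ofReal p) U +
          ENNReal.ofReal (C * 2 ^ k * B false true) * tensorNorm (ENNReal.ofReal p) T ∧
        tensorNorm (ENNReal.ofReal p) T' ≤
          ENNReal.ofReal (C * (Bh + B true true)) * tensorNorm (ENNReal.ofReal p) T +
          ENNReal.ofReal (C * (2 ^ k)⁻¹ * B true false) * vecNorm (ENNReal.ofReal p) U := by
  obtain ⟨C₁, hC₁, H₁⟩ := exists_vecNorm_projDiv_le hχ
  obtain ⟨C₂, hC₂, H₂⟩ := exists_tensorNorm_correction_le hχ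
  set C := 1 + C₁ + C₂ + C₁ * C₂ with hC
  refine ⟨C, by rw [hC]; nlinarith [mul_pos hC₁ hC₂], ?_⟩
  intro k p hp h₀ h₁ r U U' T T' hP hH B Bh hB hBh hLB hLh
  have hp' : 1 ≤ ENNReal.ofReal p := by rw [ENNReal.one_le_ofReal]; exact hp.le
  set P := ENNReal.ofReal p
  have h2k : (0 : ℝ) < 2 ^ k := by positivity
  set W := projDiv χ k T with hW
  set W' := projDiv χ k T' with hW'
  have hCC : 0 < C₁ * C₂ := mul_pos hC₁ hC₂
  have bW : vecNorm P W ≤ ENNReal.ofReal (C₁ * 2 ^ k) * tensorNorm P T := H₁ k p hp T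
  have bU' : vecNorm P U' ≤ ENNReal.ofReal (B false false) * vecNorm P U +
      ENNReal.ofReal (B false true) * vecNorm P W := by
    simp only [vecNorm, Finset.mul_sum, ← Finset.sum_add_distrib]
    refine Finset.sum_le_sum fun i _ => ?_
    rw [(hP i).1]
    exact (distLp_add_le hp' _ _).trans (add_le_add (hLB _ _ _) (hLB _ _ _))
  have bW' : vecNorm P W' ≤ ENNReal.ofReal (B true false) * vecNorm P U +
      ENNReal.ofReal (B true true) * vecNorm P W := by
    simp only [vecNorm, Finset.mul_sum, ← Finset.sum_add_distrib]
    refine Finset.sum_le_sum fun i _ => ?_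
    rw [(hP i).2]
    exact (distLp_add_le hp' _ _).trans (add_le_add (hLB _ _ _) (hLB _ _ _))
  have bΘ : tensorNorm P (heatPart χ k T) ≤
      tensorNorm P T + ENNReal.ofReal (C₂ * (2 ^ k)⁻¹) * vecNorm P W := by
    refine le_trans ?_ (add_le_add le_rfl (H₂ k p hp W))
    simp only [tensorNorm, ← Finset.sum_add_distrib]
    refine Finset.sum_le_sum fun i _ => Finset.sum_le_sum fun j _ => ?_
    rw [heatPart, add_assoc]
    exact (distLp_add_le hp' _ _).trans (add_le_add le_rfl (distLp_add_le hp' _ _))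
  have bΘ' : tensorNorm P (heatPart χ k T') ≤
      ENNReal.ofReal Bh * tensorNorm P (heatPart χ k T) := by
    simp only [tensorNorm, Finset.mul_sum]
    refine Finset.sum_le_sum fun i _ => Finset.sum_le_sum fun j _ => ?_
    rw [hH i j]
    exact hLh _
  have bT' : tensorNorm P T' ≤
      tensorNorm P (heatPart χ k T') + ENNReal.ofReal (C₂ * (2 ^ k)⁻¹) * vecNorm P W' := by
    refine le_trans ?_ (add_le_add le_rfl (H₂ k p hp W'))
    simp only [tensorNorm, ← Finset.sum_add_distrib]
    refine Finset.sum_le_sum fun i _ => Finset.sum_le_sum fun j _ => ?_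
    have : T' i j = heatPart χ k T' i j -
        (mult (invSym χ k j) (W' i) + mult (invSym χ k i) (W' j)) := by
      rw [heatPart]; abel
    conv_lhs => rw [this]
    exact (distLp_sub_le hp' _ _).trans (add_le_add le_rfl (distLp_add_le hp' _ _))
  constructor
  · refine bU'.trans (add_le_add le_rfl ?_)
    calc ENNReal.ofReal (B false true) * vecNorm P W
        ≤ ENNReal.ofReal (B false true) * (ENNReal.ofReal (C₁ * 2 ^ k) * tensorNorm P T) := by
          gcongr
      _ = ENNReal.ofReal (B false true * (C₁ * 2 ^ k)) * tensorNorm P T := by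
          rw [← mul_assoc, ← ENNReal.ofReal_mul (hB _ _)]
      _ ≤ _ := by
          refine mul_le_mul_left (ENNReal.ofReal_le_ofReal ?_) _
          have : C₁ ≤ C := by rw [hC]; linarith
          calc B false true * (C₁ * 2 ^ k) = C₁ * 2 ^ k * B false true := by ring
            _ ≤ C * 2 ^ k * B false true := by
              have := hB false true
              gcongr
  -- The order `1` of `ℙ div` and the order `-1` of `∂_j(-Δ)⁻¹` compensate, so the correction costs
  -- no power of `2^k`.
  · have bW2 : ENNReal.ofReal (C₂ * (2 ^ k)⁻¹) * vecNorm P W ≤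
        ENNReal.ofReal (C₁ * C₂) * tensorNorm P T := by
      calc _ ≤ ENNReal.ofReal (C₂ * (2 ^ k)⁻¹) * (ENNReal.ofReal (C₁ * 2 ^ k) * tensorNorm P T) := by
            gcongr
        _ = _ := by
            rw [← mul_assoc, ← ENNReal.ofReal_mul (by positivity)]
            congr 2; field_simp
    have b1 : tensorNorm P (heatPart χ k T') ≤
        ENNReal.ofReal (Bh * (1 + C₁ * C₂)) * tensorNorm P T := by
      refine bΘ'.trans ?_
      rw [ENNReal.ofReal_mul hBh, mul_assoc, ENNReal.ofReal_add zero_le_one hCC.le, add_mul,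
        ENNReal.ofReal_one, one_mul]
      gcongr
      exact bΘ.trans (by gcongr)
    have b2 : ENNReal.ofReal (C₂ * (2 ^ k)⁻¹) * vecNorm P W' ≤
        ENNReal.ofReal (C₂ * (2 ^ k)⁻¹ * B true false) * vecNorm P U +
          ENNReal.ofReal (B true true * (C₁ * C₂)) * tensorNorm P T := by
      calc _ ≤ ENNReal.ofReal (C₂ * (2 ^ k)⁻¹) * (ENNReal.ofReal (B true false) * vecNorm P U +
            ENNReal.ofReal (B true true) * vecNorm P W) := by gcongr
        _ = ENNReal.ofReal (C₂ * (2 ^ k)⁻¹ * B true false) * vecNorm P U +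
            ENNReal.ofReal (B true true) * (ENNReal.ofReal (C₂ * (2 ^ k)⁻¹) * vecNorm P W) := by
            rw [ENNReal.ofReal_mul (q := B true false) (by positivity)]; ring
        _ ≤ _ := by
            rw [ENNReal.ofReal_mul (hB true true), mul_assoc (ENNReal.ofReal (B true true))]
            exact add_le_add le_rfl (mul_le_mul_right bW2 _)
    have hBt := hB true true
    have hBf := hB true false
    calc tensorNorm P T' ≤ ENNReal.ofReal (Bh * (1 + C₁ * C₂)) * tensorNorm P T +
          (ENNReal.ofReal (C₂ * (2 ^ k)⁻¹ * B true false) * vecNorm P U +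
          ENNReal.ofReal (B true true * (C₁ * C₂)) * tensorNorm P T) :=
          bT'.trans (add_le_add b1 b2)
      _ = ENNReal.ofReal (Bh * (1 + C₁ * C₂) + B true true * (C₁ * C₂)) * tensorNorm P T +
          ENNReal.ofReal (C₂ * (2 ^ k)⁻¹ * B true false) * vecNorm P U := by
          rw [ENNReal.ofReal_add (by positivity) (by positivity)]; ring
      _ ≤ _ := by
          gcongr
          · rw [hC]; nlinarith
          · rw [hC]; linarith

end BlockEstimates

/-! ### Two-sided and high-frequency estimates for the blocks of a solution -/

section SolutionBlocks

variable {d : ℕ} {χ : Sp d → ℝ}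

/-- Localized norm of the velocity. -/
noncomputable def velNorm (p : ℝ≥0∞) (ψ : Sp d → ℂ) (u : Fin d → Dist d) : ℝ≥0∞ :=
  vecNorm p fun i => mult ψ (u i)

/-- Localized norm of the stress. -/
noncomputable def stressNorm (p : ℝ≥0∞) (ψ : Sp d → ℂ) (τ : Fin d → Fin d → Dist d) : ℝ≥0∞ :=
  tensorNorm p fun i j => mult ψ (τ i j)

/-- `ψ` is a test function that the cut-off at scale `2^k` does not change. -/
def IsLocalized (χ : Sp d → ℝ) (k : ℤ) (ψ : Sp d → ℂ) : Prop :=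
  IsTest ψ ∧ ∀ ξ, fatk χ k ξ * ψ ξ = ψ ξ

theorem isLocalized_blockSym (hχ : IsCutoff χ) (k : ℤ) : IsLocalized χ k (blockSym χ k) :=
  ⟨isTest_blockSym hχ k, fatk_mul_blockSym hχ k⟩

theorem isLocalized_blockSym_mul_lowSym (hχ : IsCutoff χ) (k k₀ : ℤ) :
    IsLocalized χ k (fun ξ => blockSym χ k ξ * lowSym χ k₀ ξ) := by
  have h1 := isTest_blockSym hχ k
  have h2 := isTest_lowSym hχ k₀
  exact ⟨⟨h1.1.mul h2.1, h1.2.mul_right⟩, fun ξ => by rw [← mul_assoc, fatk_mul_blockSym hχ k]⟩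

/-- The off-diagonal entries of the propagator have orders `∓1`, which compensate the `2^{±k}`
between `T` and `ℙ div T`; thus `u` and `τ` carry the same weight. The argument `key` serves both
time directions. -/
theorem exists_low_block (hχ : IsCutoff χ) {ν₁ ν₂ η : ℝ} (hν₁ : 0 < ν₁) (hν₂ : 0 < ν₂)
    (hη : 0 < η) (k₀ : ℤ) : ∃ C, 0 < C ∧ ∃ c, 0 < c ∧ ∃ c', 0 < c' ∧
      ∀ {u₀ : Fin d → Dist d} {τ₀ : Fin d → Fin d → Dist d}
        {u : ℝ → Fin d → Dist d} {τ : ℝ → Fin d → Fin d → Dist d},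
        IsSolution ν₁ ν₂ η u₀ τ₀ u τ → ∀ k ≤ k₀, ∀ ψ, IsLocalized χ k ψ → ∀ t, 0 ≤ t →
          velNorm 2 ψ (u t) + stressNorm 2 ψ (τ t) ≤
            ENNReal.ofReal (C * Real.exp (-(c * 4 ^ k * t))) *
              (velNorm 2 ψ u₀ + stressNorm 2 ψ τ₀) ∧
          velNorm 2 ψ u₀ + stressNorm 2 ψ τ₀ ≤
            ENNReal.ofReal (C * Real.exp (c' * 4 ^ k * t)) *
              (velNorm 2 ψ (u t) + stressNorm 2 ψ (τ t)) := by
  obtain ⟨C₁, hC₁, H⟩ := exists_block_estimate hχ ν₁ ν₂ η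
  obtain ⟨C₂, hC₂, c, hc, c', hc', L⟩ := exists_low_propagator hχ hν₁ hν₂ hη k₀
  have e2 : ENNReal.ofReal 2 = 2 := by simp
  refine ⟨C₂ * (1 + 4 * C₁), by positivity, c, hc, c', hc', ?_⟩
  intro u₀ τ₀ u τ hs k hk ψ hψ t ht
  obtain ⟨h₀, h₁, hf, hb⟩ := L k hk
  obtain ⟨b1, b2, b3, b4⟩ := hb t ht
  have h2k : (0 : ℝ) < 2 ^ k := by positivity
  have key : ∀ (e r : ℝ), 0 ≤ e → ∀ (U U' : Fin d → Dist d) (T T' : Fin d → Fin d → Dist d),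
      (∀ i, Propagates ν₁ ν₂ η h₀ h₁ r (U i) (projDiv χ k T i) (U' i) (projDiv χ k T' i)) →
      (∀ i j, heatPart χ k T' i j = mult (fun ξ => heatSym χ k η (r, ξ)) (heatPart χ k T i j)) →
      (∀ a b, LpB 2 (fun ξ => propSym ν₁ ν₂ η h₀ h₁ a b (r, ξ))
        (C₂ * ((2 : ℝ) ^ k) ^ propOrder a b * e)) →
      LpB 2 (fun ξ => heatSym χ k η (r, ξ)) (C₂ * e) →
      vecNorm 2 U' + tensorNorm 2 T' ≤
        ENNReal.ofReal (C₂ * (1 + 4 * C₁) * e) * (vecNorm 2 U + tensorNorm 2 T) := by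
    intro e r he U U' T T' hP hH hB hh
    obtain ⟨q1, q2⟩ := H k 2 (by norm_num) h₀ h₁ r U U' T T' hP hH
      (fun a b => C₂ * ((2 : ℝ) ^ k) ^ propOrder a b * e) (C₂ * e) (fun a b => by positivity)
      (by positivity) (by rw [e2]; exact hB) (by rw [e2]; exact hh)
    rw [e2] at q1 q2
    simp only [propOrder, zpow_zero, zpow_neg_one, zpow_one, mul_one] at q1 q2
    have r1 : C₁ * 2 ^ k * (C₂ * (2 ^ k)⁻¹ * e) = C₁ * C₂ * e := by field_simp
    have r2 : C₁ * (2 ^ k)⁻¹ * (C₂ * 2 ^ k * e) = C₁ * C₂ * e := by field_simp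
    rw [r1] at q1
    rw [r2] at q2
    have hC₁' : 0 ≤ C₁ := by linarith
    refine (add_le_add q1 q2).trans ?_
    calc _ = ENNReal.ofReal (C₂ * e + C₁ * C₂ * e) * vecNorm 2 U +
          ENNReal.ofReal (C₁ * C₂ * e + C₁ * (C₂ * e + C₂ * e)) * tensorNorm 2 T := by
          rw [ENNReal.ofReal_add (p := C₂ * e) (by positivity) (by positivity),
            ENNReal.ofReal_add (p := C₁ * C₂ * e) (by positivity) (by positivity)]
          ring
      _ ≤ ENNReal.ofReal (C₂ * (1 + 4 * C₁) * e) * vecNorm 2 U +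
          ENNReal.ofReal (C₂ * (1 + 4 * C₁) * e) * tensorNorm 2 T := by
          have h0 : 0 ≤ C₁ * C₂ * e := by positivity
          have h1 : 0 ≤ C₂ * e := by positivity
          gcongr <;> nlinarith
      _ = _ := by ring
  have p1 := fun i => (propagates_aux hχ hs hψ.1 hψ.2 hf i ht)
  have p2 := fun i j => (heat_aux hχ hs hψ.1 hψ.2 i j ht)
  rw [← hs.init_u, ← hs.init_τ]
  rw [← two_zpow_sq]
  exact ⟨key _ t (Real.exp_pos _).le _ _ _ _ (fun i => (p1 i).1) (fun i j => (p2 i j).1) b1 b3,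
    key _ (-t) (Real.exp_pos _).le _ _ _ _ (fun i => (p1 i).2) (fun i j => (p2 i j).2) b2 b4⟩

/-- The natural pair is `(2^k u, τ)`. The slow mode reaches the stress only with the factor
`4^{-k}`, the source of the later gain of two derivatives; the remaining effect of `τ₀` on `τ`
decays at the parabolic rate. -/
theorem exists_high_block (hχ : IsCutoff χ) {ν₁ ν₂ η : ℝ} (hν₁ : 0 < ν₁) (hν₂ : 0 < ν₂)
    (hη : 0 < η) : ∃ K : ℤ, 0 ≤ K ∧ ∃ C, 0 < C ∧ ∃ c, 0 < c ∧
      ∀ {u₀ : Fin d → Dist d} {τ₀ : Fin d → Fin d → Dist d}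
        {u : ℝ → Fin d → Dist d} {τ : ℝ → Fin d → Fin d → Dist d},
        IsSolution ν₁ ν₂ η u₀ τ₀ u τ → ∀ k ≥ K, ∀ ψ, IsLocalized χ k ψ →
        ∀ p : ℝ, 1 < p → ∀ t, 0 ≤ t →
          ENNReal.ofReal (2 ^ k) * velNorm (ENNReal.ofReal p) ψ (u t) ≤
            ENNReal.ofReal (C * Real.exp (-(c * t))) *
              (ENNReal.ofReal (2 ^ k) * velNorm (ENNReal.ofReal p) ψ u₀ +
                stressNorm (ENNReal.ofReal p) ψ τ₀) ∧
          stressNorm (ENNReal.ofReal p) ψ (τ t) ≤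
            ENNReal.ofReal (C * Real.exp (-(c * 4 ^ k * t))) * stressNorm (ENNReal.ofReal p) ψ τ₀ +
            ENNReal.ofReal (C * (4 ^ k)⁻¹ * Real.exp (-(c * t))) *
              (ENNReal.ofReal (2 ^ k) * velNorm (ENNReal.ofReal p) ψ u₀ +
                stressNorm (ENNReal.ofReal p) ψ τ₀) := by
  obtain ⟨C₁, hC₁, H⟩ := exists_block_estimate hχ ν₁ ν₂ η
  obtain ⟨K, hK, C₂, hC₂, c, hc, L⟩ := exists_high_propagator hχ hν₁ hν₂ hη
  have hC₁' : 0 < C₁ := by linarith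
  refine ⟨K, hK, 2 * C₁ * C₂, by positivity, c, hc, ?_⟩
  intro u₀ τ₀ u τ hs k hk ψ hψ p hp t ht
  obtain ⟨h₀, h₁, hf, hb⟩ := L k hk
  obtain ⟨b1, b2⟩ := hb t ht p hp
  have p1 := fun i => (propagates_aux hχ hs hψ.1 hψ.2 hf i ht).1
  have p2 := fun i j => (heat_aux hχ hs hψ.1 hψ.2 i j ht).1
  rw [hs.init_u, hs.init_τ] at p1
  rw [hs.init_τ] at p2
  obtain ⟨q1, q2⟩ := H k p hp h₀ h₁ t _ _ _ _ p1 p2 _ _ (fun a b => by positivity) (by positivity)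
    b1 b2
  rw [two_zpow_sq] at q1 q2
  have h2k : (0 : ℝ) < 2 ^ k := by positivity
  have h4k : (0 : ℝ) < 4 ^ k := by positivity
  have h41 : (1 : ℝ) ≤ 4 ^ k := one_le_zpow₀ (by norm_num) (hK.trans hk)
  have h42 : (4 : ℝ) ^ k = 2 ^ k * 2 ^ k := by rw [← two_zpow_sq, sq]
  simp only [slowOrder, fastOrder, pow_zero, pow_one, one_mul] at q1 q2
  rw [show -c * t = -(c * t) by ring, show -c * (4 ^ k * t) = -(c * 4 ^ k * t) by ring] at q1 q2
  have hEe : Real.exp (-(c * 4 ^ k * t)) ≤ Real.exp (-(c * t)) := by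
    refine Real.exp_le_exp.2 ?_
    have : c * t * 1 ≤ c * t * 4 ^ k := by gcongr
    linarith
  set e := Real.exp (-(c * t)) with he
  set E := Real.exp (-(c * 4 ^ k * t)) with hE
  have he0 : 0 < e := Real.exp_pos _
  have hE0 : 0 < E := Real.exp_pos _
  set NU := velNorm (ENNReal.ofReal p) ψ u₀ with hNU
  set NT := stressNorm (ENNReal.ofReal p) ψ τ₀ with hNT
  change velNorm (ENNReal.ofReal p) ψ (u t) ≤ _ * NU + _ * NT at q1
  change stressNorm (ENNReal.ofReal p) ψ (τ t) ≤ _ * NT + _ * NU at q2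
  constructor
  · calc ENNReal.ofReal (2 ^ k) * velNorm (ENNReal.ofReal p) ψ (u t)
        ≤ ENNReal.ofReal (2 ^ k) * (ENNReal.ofReal (C₂ * (e + E)) * NU +
          ENNReal.ofReal (C₁ * 2 ^ k * (C₂ * ((4 ^ k)⁻¹ * e + (4 ^ k)⁻¹ * E))) * NT) := by
          gcongr
      _ = ENNReal.ofReal (C₂ * (e + E)) * (ENNReal.ofReal (2 ^ k) * NU) +
          ENNReal.ofReal (C₁ * C₂ * (e + E)) * NT := by
          have r : C₁ * C₂ * (e + E) =
              2 ^ k * (C₁ * 2 ^ k * (C₂ * ((4 ^ k)⁻¹ * e + (4 ^ k)⁻¹ * E))) := by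
            rw [h42]; field_simp
          rw [r, ENNReal.ofReal_mul (p := (2 : ℝ) ^ k) h2k.le]; ring
      _ ≤ ENNReal.ofReal (2 * C₁ * C₂ * e) * (ENNReal.ofReal (2 ^ k) * NU) +
          ENNReal.ofReal (2 * C₁ * C₂ * e) * NT := by
          have h1 : C₂ * (e + E) ≤ C₁ * (C₂ * (e + E)) :=
            le_mul_of_one_le_left (by positivity) hC₁
          have h2 : C₁ * C₂ * (e + E) ≤ C₁ * C₂ * (e + e) := by gcongr
          exact add_le_add (mul_le_mul_left (ENNReal.ofReal_le_ofReal (by linarith)) _)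
            (mul_le_mul_left (ENNReal.ofReal_le_ofReal (by linarith)) _)
      _ = _ := by ring
  · calc stressNorm (ENNReal.ofReal p) ψ (τ t)
        ≤ ENNReal.ofReal (C₁ * (C₂ * E + C₂ * ((4 ^ k)⁻¹ * e + E))) * NT +
          ENNReal.ofReal (C₁ * (2 ^ k)⁻¹ * (C₂ * (e + E))) * NU := q2
      _ = ENNReal.ofReal (2 * C₁ * C₂ * E) * NT +
          (ENNReal.ofReal (C₁ * C₂ * (4 ^ k)⁻¹ * (e + E)) * (ENNReal.ofReal (2 ^ k) * NU) +
            ENNReal.ofReal (C₁ * C₂ * (4 ^ k)⁻¹ * e) * NT) := by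
          have r1 : C₁ * (C₂ * E + C₂ * ((4 ^ k)⁻¹ * e + E)) =
            2 * C₁ * C₂ * E + C₁ * C₂ * (4 ^ k)⁻¹ * e := by ring
          have r2 : C₁ * (2 ^ k)⁻¹ * (C₂ * (e + E)) =
            C₁ * C₂ * (4 ^ k)⁻¹ * (e + E) * 2 ^ k := by
            rw [h42]; field_simp
          rw [r1, r2, ENNReal.ofReal_add (by positivity) (by positivity),
            ENNReal.ofReal_mul (q := (2 : ℝ) ^ k) (by positivity)]
          ring
      _ ≤ ENNReal.ofReal (2 * C₁ * C₂ * E) * NT +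
          (ENNReal.ofReal (2 * C₁ * C₂ * (4 ^ k)⁻¹ * e) * (ENNReal.ofReal (2 ^ k) * NU) +
            ENNReal.ofReal (2 * C₁ * C₂ * (4 ^ k)⁻¹ * e) * NT) := by
          have h1 : C₁ * C₂ * (4 ^ k)⁻¹ * (e + E) ≤ C₁ * C₂ * (4 ^ k)⁻¹ * (e + e) := by gcongr
          have h2 : 0 < C₁ * C₂ * (4 ^ k)⁻¹ * e := by positivity
          exact add_le_add le_rfl (add_le_add
            (mul_le_mul_left (ENNReal.ofReal_le_ofReal (by linarith)) _)
            (mul_le_mul_left (ENNReal.ofReal_le_ofReal (by linarith)) _))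
      _ = _ := by ring

end SolutionBlocks

/-! ### Block norms and time integrals -/

section Norms

variable {d : ℕ} {χ : Sp d → ℝ}

theorem blockNorm_velocity (χ : Sp d → ℝ) (p : ℝ≥0∞) (k : ℤ) (u : Fin d → Dist d) :
    blockNorm χ p k u = velNorm p (blockSym χ k) u := rfl

theorem blockNorm_entries (χ : Sp d → ℝ) (p : ℝ≥0∞) (k : ℤ) (τ : Fin d → Fin d → Dist d) :
    blockNorm χ p k (entries τ) = stressNorm p (blockSym χ k) τ := by
  rw [blockNorm, Fintype.sum_prod_type]
  rfl

theorem blockNorm_sumElim {ι κ : Type} [Fintype ι] [Fintype κ] (χ : Sp d → ℝ) (p : ℝ≥0∞) (k : ℤ)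
    (f : ι → Dist d) (g : κ → Dist d) :
    blockNorm χ p k (Sum.elim f g) = blockNorm χ p k f + blockNorm χ p k g := by
  rw [blockNorm, Fintype.sum_sum_type]
  rfl

theorem blockNorm_pair (χ : Sp d → ℝ) (p : ℝ≥0∞) (k : ℤ) (u : Fin d → Dist d)
    (τ : Fin d → Fin d → Dist d) : blockNorm χ p k (pair u τ) =
      velNorm p (blockSym χ k) u + stressNorm p (blockSym χ k) τ := by
  rw [pair, blockNorm_sumElim, blockNorm_velocity, blockNorm_entries]

theorem blockNorm_expWeight_le {ι : Type} [Fintype ι] (χ : Sp d → ℝ) (p : ℝ≥0∞) (k : ℤ) (C : ℝ)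
    (f : ℝ → ι → Dist d) (t : ℝ) :
    blockNorm χ p k (expWeight C f t) ≤ ENNReal.ofReal (Real.exp (C * t)) * blockNorm χ p k (f t) := by
  rw [blockNorm, blockNorm, Finset.mul_sum]
  refine Finset.sum_le_sum fun i _ => ?_
  have e : block χ k (expWeight C f t i) = ((Real.exp (C * t) : ℝ) : ℂ) • block χ k (f t i) :=
    mult_smul _ _ _
  rw [e]
  refine (distLp_smul_le p _ (Complex.ofReal_ne_zero.2 (Real.exp_pos _).ne') _).trans ?_
  rw [Complex.norm_real, Real.norm_of_nonneg (Real.exp_pos _).le]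

theorem exists_blockNorm_grad_le (hχ : IsCutoff χ) : ∃ C, 0 < C ∧ ∀ (k : ℤ) (p : ℝ), 1 < p →
    (∀ u : Fin d → Dist d, blockNorm χ (ENNReal.ofReal p) k (entries (grad u)) ≤
      ENNReal.ofReal (C * 2 ^ k) * velNorm (ENNReal.ofReal p) (blockSym χ k) u) ∧
    ∀ τ : Fin d → Fin d → Dist d, blockNorm χ (ENNReal.ofReal p) k (gradTensor τ) ≤
      ENNReal.ofReal (C * 2 ^ k) * stressNorm (ENNReal.ofReal p) (blockSym χ k) τ := by
  obtain ⟨C, hC, h⟩ := exists_distLp_pd_le hχ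
  refine ⟨(d + 1) * C, by positivity, fun k p hp => ?_⟩
  have hpd := h k p hp _ (isTest_blockSym hχ k) (fatk_mul_blockSym hχ k)
  have hd : ∀ x : ℝ≥0∞, ∑ _j : Fin d, ENNReal.ofReal (C * 2 ^ k) * x ≤
      ENNReal.ofReal ((d + 1) * C * 2 ^ k) * x := by
    intro x
    rw [Finset.sum_const, Finset.card_univ, Fintype.card_fin, nsmul_eq_mul, ← mul_assoc]
    gcongr
    rw [mul_assoc, ENNReal.ofReal_mul (p := (d + 1 : ℝ)) (by positivity)]
    gcongr
    rw [← ENNReal.ofReal_natCast]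
    exact ENNReal.ofReal_le_ofReal (by linarith)
  constructor
  · intro u
    rw [blockNorm, Fintype.sum_prod_type, velNorm, vecNorm, Finset.mul_sum]
    exact Finset.sum_le_sum fun i _ => (Finset.sum_le_sum fun j _ => hpd j (u i)).trans (hd _)
  · intro τ
    rw [blockNorm, Fintype.sum_prod_type, Fintype.sum_prod_type, stressNorm, tensorNorm,
      Finset.mul_sum]
    refine Finset.sum_le_sum fun i _ => ?_
    rw [Finset.mul_sum]
    exact Finset.sum_le_sum fun j _ => (Finset.sum_le_sum fun m _ => hpd m (τ i j)).trans (hd _)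

theorem two_rpow_mul_add_one (s : ℝ) (k : ℤ) :
    (2 : ℝ≥0∞) ^ ((s + 1) * (k : ℝ)) = 2 ^ (s * (k : ℝ)) * ENNReal.ofReal (2 ^ k) := by
  rw [add_mul, ENNReal.rpow_add _ _ (by norm_num) (by norm_num), one_mul, two_zpow_eq,
    ← ENNReal.ofReal_rpow_of_pos two_pos]
  simp

theorem two_rpow_mul_add_two (s : ℝ) (k : ℤ) :
    (2 : ℝ≥0∞) ^ ((s + 2) * (k : ℝ)) = 2 ^ (s * (k : ℝ)) * ENNReal.ofReal (4 ^ k) := by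
  rw [show s + 2 = s + 1 + 1 by ring, two_rpow_mul_add_one, two_rpow_mul_add_one, mul_assoc,
    ← ENNReal.ofReal_mul (by positivity), ← sq, two_zpow_sq]

theorem eLpNorm_top_Ioo_le {f : ℝ → ℝ≥0∞} {a b : ℝ} {M : ℝ≥0∞} (h : ∀ s ∈ Ioo a b, f s ≤ M) :
    eLpNorm f ⊤ (volume.restrict (Ioo a b)) ≤ M := by
  rw [eLpNorm_exponent_top]
  exact essSup_le_of_ae_le M ((ae_restrict_iff' measurableSet_Ioo).2 (Eventually.of_forall h))

theorem lintegral_exp_decay_le {c A b : ℝ} (hc : 0 < c) (hA : 0 ≤ A) (M : ℝ≥0∞) :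
    ∫⁻ s in Ioo 0 b, ENNReal.ofReal (A * Real.exp (-(c * s))) * M ≤ ENNReal.ofReal (A / c) * M := by
  rw [lintegral_mul_const _ (by fun_prop)]
  refine mul_le_mul_left ?_ _
  have hint : IntegrableOn (fun s => A * Real.exp (-(c * s))) (Ioi 0) := by
    have := (integrableOn_exp_mul_Ioi (a := -c) (by linarith) 0).const_mul A
    simp only [neg_mul] at this
    exact this
  calc ∫⁻ s in Ioo 0 b, ENNReal.ofReal (A * Real.exp (-(c * s)))
      ≤ ∫⁻ s in Ioi 0, ENNReal.ofReal (A * Real.exp (-(c * s))) :=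
        lintegral_mono_set Ioo_subset_Ioi_self
    _ = ENNReal.ofReal (∫ s in Ioi 0, A * Real.exp (-(c * s))) :=
        (ofReal_integral_eq_lintegral_ofReal hint
          (Eventually.of_forall fun s => by simp only [Pi.zero_apply]; positivity)).symm
    _ = ENNReal.ofReal (A / c) := by
        have := integral_exp_mul_Ioi (a := -c) (by linarith) 0
        simp only [neg_mul, mul_zero, Real.exp_zero] at this
        rw [integral_const_mul, this]
        congr 1; field_simp

theorem eLpNorm_one_Ioo_le {f : ℝ → ℝ≥0∞} {b c c' A A' : ℝ} {M M' : ℝ≥0∞} (hc : 0 < c) (hc' : 0 < c')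
    (hA : 0 ≤ A) (hA' : 0 ≤ A')
    (h : ∀ s ∈ Ioo 0 b, f s ≤ ENNReal.ofReal (A * Real.exp (-(c * s))) * M +
      ENNReal.ofReal (A' * Real.exp (-(c' * s))) * M') :
    eLpNorm f 1 (volume.restrict (Ioo 0 b)) ≤
      ENNReal.ofReal (A / c) * M + ENNReal.ofReal (A' / c') * M' := by
  rw [eLpNorm_one_eq_lintegral_enorm]
  refine (setLIntegral_mono_ae' measurableSet_Ioo (Eventually.of_forall h)).trans ?_
  rw [lintegral_add_left (by fun_prop)]
  exact add_le_add (lintegral_exp_decay_le hc hA M) (lintegral_exp_decay_le hc' hA' M')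

end Norms

/-! ### The critical energy bound -/

section Energy

variable {d : ℕ} {χ : Sp d → ℝ}

theorem tsum_mul_le_of_forall {ι : Type*} {a f g : ι → ℝ≥0∞} {M : ℝ≥0∞}
    (h : ∀ k, f k ≤ M * g k) : ∑' k, a k * f k ≤ M * ∑' k, a k * g k := by
  rw [← ENNReal.tsum_mul_left]
  refine ENNReal.tsum_le_tsum fun k => ?_
  rw [mul_left_comm]
  exact mul_le_mul_right (h k) _

/-- The time integral of `e^{-c4^k t}` is at most `4^{-k}/c`, a gain of two derivatives in `L¹` in
time. -/
theorem exists_low_energy (hχ : IsCutoff χ) {ν₁ ν₂ η : ℝ} (hν₁ : 0 < ν₁) (hν₂ : 0 < ν₂)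
    (hη : 0 < η) (k₀ : ℤ) : ∃ A, 0 < A ∧
      ∀ {u₀ : Fin d → Dist d} {τ₀ : Fin d → Fin d → Dist d}
        {u : ℝ → Fin d → Dist d} {τ : ℝ → Fin d → Fin d → Dist d},
        IsSolution ν₁ ν₂ η u₀ τ₀ u τ → ∀ s t : ℝ,
          cheminLerner χ (Iic k₀) ⊤ 0 t s 2 (fun r => pair (u r) (τ r)) +
            cheminLerner χ (Iic k₀) 1 0 t (s + 2) 2 (fun r => pair (u r) (τ r)) ≤
          ENNReal.ofReal A * besovOne χ (Iic k₀) s 2 (pair u₀ τ₀) := by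
  obtain ⟨C, hC, c, hc, c', hc', H⟩ := exists_low_block hχ hν₁ hν₂ hη k₀
  refine ⟨C + C / c, by positivity, fun {u₀ τ₀ u τ} hs s t => ?_⟩
  have hb : ∀ k ≤ k₀, ∀ r, 0 ≤ r → blockNorm χ 2 k (pair (u r) (τ r)) ≤
      ENNReal.ofReal (C * Real.exp (-(c * 4 ^ k * r))) * blockNorm χ 2 k (pair u₀ τ₀) := by
    intro k hk r hr
    rw [blockNorm_pair, blockNorm_pair]
    exact (H hs k hk _ (isLocalized_blockSym hχ k) r hr).1
  rw [ENNReal.ofReal_add hC.le (by positivity), add_mul]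
  refine add_le_add ?_ ?_
  · unfold cheminLerner besovOne
    refine tsum_mul_le_of_forall fun ⟨k, hk⟩ => eLpNorm_top_Ioo_le fun r hr => ?_
    refine (hb k hk r hr.1.le).trans ?_
    gcongr
    refine mul_le_of_le_one_right hC.le (Real.exp_le_one_iff.2 ?_)
    have := hr.1
    have : 0 < c * (4 : ℝ) ^ k * r := by positivity
    linarith
  · unfold cheminLerner besovOne
    simp only [two_rpow_mul_add_two, mul_assoc]
    refine tsum_mul_le_of_forall fun ⟨k, hk⟩ => ?_
    have h4 : (0 : ℝ) < 4 ^ k := by positivity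
    have h1 := eLpNorm_one_Ioo_le (f := fun r => blockNorm χ 2 k (pair (u r) (τ r))) (b := t)
      (c := c * 4 ^ k) (c' := 1) (A := C) (A' := 0) (M := blockNorm χ 2 k (pair u₀ τ₀)) (M' := 0)
      (by positivity) one_pos hC.le le_rfl
      (fun r hr => (hb k hk r hr.1.le).trans (by simp))
    refine (mul_le_mul_right h1 _).trans (le_of_eq ?_)
    rw [MulZeroClass.mul_zero, add_zero, ← mul_assoc, ← ENNReal.ofReal_mul h4.le]
    congr 2
    field_simp

/-- The size of the `k`-th block of the data at high frequencies. -/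
noncomputable def highData (χ : Sp d → ℝ) (p : ℝ) (u₀ : Fin d → Dist d)
    (τ₀ : Fin d → Fin d → Dist d) (k : ℤ) : ℝ≥0∞ :=
  ENNReal.ofReal (2 ^ k) * velNorm (ENNReal.ofReal p) (blockSym χ k) u₀ +
    stressNorm (ENNReal.ofReal p) (blockSym χ k) τ₀

theorem tsum_highData (χ : Sp d → ℝ) (p s : ℝ) (S : Set ℤ) (u₀ : Fin d → Dist d)
    (τ₀ : Fin d → Fin d → Dist d) :
    ∑' k : S, (2 : ℝ≥0∞) ^ (s * ((k : ℤ) : ℝ)) * highData χ p u₀ τ₀ k =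
      besovOne χ S (s + 1) (ENNReal.ofReal p) u₀ +
        besovOne χ S s (ENNReal.ofReal p) (entries τ₀) := by
  unfold besovOne
  rw [← ENNReal.tsum_add]
  refine tsum_congr fun k => ?_
  rw [highData, two_rpow_mul_add_one, blockNorm_entries, blockNorm_velocity, mul_add, mul_assoc]

theorem stressNorm_le_highData (χ : Sp d → ℝ) (p : ℝ) (u₀ : Fin d → Dist d)
    (τ₀ : Fin d → Fin d → Dist d) (k : ℤ) :
    stressNorm (ENNReal.ofReal p) (blockSym χ k) τ₀ ≤ highData χ p u₀ τ₀ k := le_add_self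

theorem mul_exp_neg_le {c x : ℝ} (hc : 0 < c) : x * Real.exp (-(c * x)) ≤ c⁻¹ := by
  have h1 := Real.add_one_le_exp (c * x)
  have h2 : Real.exp (c * x) * Real.exp (-(c * x)) = 1 := by rw [← Real.exp_add]; simp
  have h3 : c * x * Real.exp (-(c * x)) ≤ 1 := by
    rw [← h2]; gcongr; linarith
  rw [← one_div, le_div_iff₀ hc]
  linarith

/-- Half of the damping pays for the weight `e^{ct/2}`. In the `L¹` norm `u` needs no gain beyond
its weight `2^k`, and `∇τ` gains from parabolic integration and from the factor `4^{-k}`. The last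
norm starts at time one, since `τ₀` itself lacks the two derivatives. -/
theorem exists_high_energy (hχ : IsCutoff χ) {ν₁ ν₂ η : ℝ} (hν₁ : 0 < ν₁) (hν₂ : 0 < ν₂)
    (hη : 0 < η) : ∃ K : ℤ, ∃ C, 0 < C ∧ ∃ A, 0 < A ∧
      ∀ {u₀ : Fin d → Dist d} {τ₀ : Fin d → Fin d → Dist d}
        {u : ℝ → Fin d → Dist d} {τ : ℝ → Fin d → Fin d → Dist d},
        IsSolution ν₁ ν₂ η u₀ τ₀ u τ → ∀ k₁ ≥ K, ∀ p : ℝ, 1 < p → ∀ s t : ℝ,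
          cheminLerner χ (Ici k₁) ⊤ 0 t s (ENNReal.ofReal p)
              (expWeight C (fun r => Sum.elim (entries (grad (u r))) (entries (τ r)))) +
            cheminLerner χ (Ici k₁) 1 0 t (s + 1) (ENNReal.ofReal p)
              (fun r => Sum.elim (u r) (gradTensor (τ r))) +
            cheminLerner χ (Ici k₁) ⊤ 1 t (s + 2) (ENNReal.ofReal p)
              (expWeight C (fun r => entries (τ r))) ≤
          ENNReal.ofReal A * (besovOne χ (Ici k₁) (s + 1) (ENNReal.ofReal p) u₀ +
            besovOne χ (Ici k₁) s (ENNReal.ofReal p) (entries τ₀)) := by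
  obtain ⟨K, hK, C, hC, c, hc, H⟩ := exists_high_block hχ hν₁ hν₂ hη
  obtain ⟨G, hG, hgrad⟩ := exists_blockNorm_grad_le hχ
  refine ⟨K, c / 2, by positivity, (G * C + 2 * C) + (C / c + 2 * (G * C / c)) + (C * (2 / c) + C),
    by positivity, fun {u₀ τ₀ u τ} hs k₁ hk₁ p hp s t => ?_⟩
  rw [← tsum_highData, ENNReal.ofReal_add (by positivity) (by positivity),
    ENNReal.ofReal_add (p := G * C + 2 * C) (by positivity) (by positivity), add_mul, add_mul]
  have hexp : ∀ x, 0 < Real.exp x := Real.exp_pos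
  have h41 : ∀ k ∈ Ici k₁, (1 : ℝ) ≤ 4 ^ k := fun k hk =>
    one_le_zpow₀ (by norm_num) (hK.trans (hk₁.le.trans hk))
  have hU : ∀ k ∈ Ici k₁, ∀ r, 0 ≤ r →
      ENNReal.ofReal (2 ^ k) * velNorm (ENNReal.ofReal p) (blockSym χ k) (u r) ≤
        ENNReal.ofReal (C * Real.exp (-(c * r))) * highData χ p u₀ τ₀ k :=
    fun k hk r hr => (H hs k (hk₁.le.trans hk) _ (isLocalized_blockSym hχ k) p hp r hr).1
  have hT : ∀ k ∈ Ici k₁, ∀ r, 0 ≤ r →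
      stressNorm (ENNReal.ofReal p) (blockSym χ k) (τ r) ≤
        ENNReal.ofReal (C * Real.exp (-(c * 4 ^ k * r)) + C * (4 ^ k)⁻¹ * Real.exp (-(c * r))) *
          highData χ p u₀ τ₀ k := by
    intro k hk r hr
    refine (H hs k (hk₁.le.trans hk) _ (isLocalized_blockSym hχ k) p hp r hr).2.trans ?_
    rw [ENNReal.ofReal_add (by positivity) (by positivity), add_mul]
    gcongr
    · exact stressNorm_le_highData χ p u₀ τ₀ k
    · exact le_rfl
  refine add_le_add (add_le_add ?_ ?_) ?_
  · unfold cheminLerner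
    refine tsum_mul_le_of_forall fun ⟨k, hk⟩ => eLpNorm_top_Ioo_le fun r hr => ?_
    have hr0 := hr.1.le
    refine (blockNorm_expWeight_le _ _ _ _ _ _).trans ?_
    rw [blockNorm_sumElim, blockNorm_entries (τ := τ r)]
    have b1 : blockNorm χ (ENNReal.ofReal p) k (entries (grad (u r))) ≤
        ENNReal.ofReal (G * (C * Real.exp (-(c * r)))) * highData χ p u₀ τ₀ k := by
      refine ((hgrad k p hp).1 (u r)).trans ?_
      rw [ENNReal.ofReal_mul hG.le, mul_assoc, ENNReal.ofReal_mul hG.le, mul_assoc]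
      exact mul_le_mul_right (hU k hk r hr0) _
    refine (mul_le_mul_right (add_le_add b1 (hT k hk r hr0)) _).trans ?_
    rw [← add_mul, ← ENNReal.ofReal_add (by positivity) (by positivity), ← mul_assoc,
      ← ENNReal.ofReal_mul (by positivity)]
    refine mul_le_mul_left (ENNReal.ofReal_le_ofReal ?_) _
    have i1 : Real.exp (-(c * 4 ^ k * r)) ≤ Real.exp (-(c * r)) := by
      refine Real.exp_le_exp.2 ?_
      have : c * r * 1 ≤ c * r * 4 ^ k := by gcongr; exact h41 k hk
      linarith
    have i2 : (4 ^ k : ℝ)⁻¹ ≤ 1 := inv_le_one_of_one_le₀ (h41 k hk)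
    have i3 : Real.exp (c / 2 * r) * Real.exp (-(c * r)) ≤ 1 := by
      rw [← Real.exp_add, Real.exp_le_one_iff]; nlinarith
    calc _ ≤ Real.exp (c / 2 * r) * (G * (C * Real.exp (-(c * r))) +
          (C * Real.exp (-(c * r)) + C * 1 * Real.exp (-(c * r)))) := by gcongr
      _ = (G * C + 2 * C) * (Real.exp (c / 2 * r) * Real.exp (-(c * r))) := by ring
      _ ≤ (G * C + 2 * C) * 1 := by gcongr
      _ = _ := mul_one _
  · unfold cheminLerner
    simp only [two_rpow_mul_add_one, mul_assoc]
    refine tsum_mul_le_of_forall fun ⟨k, hk⟩ => ?_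
    have h2 : (0 : ℝ) < 2 ^ k := by positivity
    have h4 : (0 : ℝ) < 4 ^ k := by positivity
    have h42 : (4 : ℝ) ^ k = 2 ^ k * 2 ^ k := by rw [← two_zpow_sq, sq]
    set X := highData χ p u₀ τ₀ k with hX
    have h1 := eLpNorm_one_Ioo_le
      (f := fun r => blockNorm χ (ENNReal.ofReal p) k (Sum.elim (u r) (gradTensor (τ r)))) (b := t)
      (c := c) (c' := c * 4 ^ k) (A := (C + G * C) * (2 ^ k)⁻¹) (A' := G * C * 2 ^ k)
      (M := X) (M' := X) hc (by positivity) (by positivity) (by positivity) (fun r hr => by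
        have hr0 := hr.1.le
        rw [blockNorm_sumElim, blockNorm_velocity]
        have b1 : velNorm (ENNReal.ofReal p) (blockSym χ k) (u r) ≤
            ENNReal.ofReal ((2 ^ k)⁻¹ * (C * Real.exp (-(c * r)))) * X := by
          calc _ = ENNReal.ofReal ((2 ^ k)⁻¹) * (ENNReal.ofReal (2 ^ k) *
                velNorm (ENNReal.ofReal p) (blockSym χ k) (u r)) := by
                rw [← mul_assoc, ← ENNReal.ofReal_mul (by positivity), inv_mul_cancel₀ h2.ne',
                  ENNReal.ofReal_one, one_mul]
            _ ≤ ENNReal.ofReal ((2 ^ k)⁻¹) * (ENNReal.ofReal (C * Real.exp (-(c * r))) * X) :=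
                mul_le_mul_right (hU k hk r hr0) _
            _ = _ := by rw [← mul_assoc, ← ENNReal.ofReal_mul (by positivity)]
        have b2 := ((hgrad k p hp).2 (τ r)).trans (mul_le_mul_right (hT k hk r hr0) _)
        refine (add_le_add b1 b2).trans (le_of_eq ?_)
        rw [← hX, ← mul_assoc (ENNReal.ofReal (G * 2 ^ k)), ← ENNReal.ofReal_mul (by positivity),
          ← add_mul, ← add_mul,
          ← ENNReal.ofReal_add (by positivity) (by positivity),
          ← ENNReal.ofReal_add (by positivity) (by positivity)]
        congr 2
        rw [h42]
        field_simp
        ring)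
    refine (mul_le_mul_right h1 _).trans (le_of_eq ?_)
    rw [← add_mul, ← ENNReal.ofReal_add (by positivity) (by positivity), ← mul_assoc,
      ← ENNReal.ofReal_mul (by positivity)]
    congr 2
    rw [h42]
    field_simp
    ring
  · unfold cheminLerner
    simp only [two_rpow_mul_add_two, mul_assoc]
    refine tsum_mul_le_of_forall fun ⟨k, hk⟩ => ?_
    have h4 : (0 : ℝ) < 4 ^ k := by positivity
    set X := highData χ p u₀ τ₀ k with hX
    have h1 := eLpNorm_top_Ioo_le (a := 1) (b := t)
      (f := fun r => blockNorm χ (ENNReal.ofReal p) k (expWeight (c / 2) (fun r => entries (τ r)) r))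
      (M := ENNReal.ofReal ((C * (2 / c) + C) * (4 ^ k)⁻¹) * X) (fun r hr => by
        have hr1 : 1 ≤ r := hr.1.le
        refine (blockNorm_expWeight_le _ _ _ _ _ _).trans ?_
        rw [blockNorm_entries]
        refine (mul_le_mul_right (hT k hk r (by linarith)) _).trans ?_
        rw [← mul_assoc, ← ENNReal.ofReal_mul (by positivity)]
        refine mul_le_mul_left (ENNReal.ofReal_le_ofReal ?_) _
        have i3 : Real.exp (c / 2 * r) * Real.exp (-(c * r)) ≤ 1 := by
          rw [← Real.exp_add, Real.exp_le_one_iff]; nlinarith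
        -- For `r ≥ 1` half of the exponent absorbs the weight; the other half yields `e^{-(c/2)4^k}
        -- ≤ (2/c)4^{-k}`.
        have i4 : Real.exp (c / 2 * r) * Real.exp (-(c * 4 ^ k * r)) ≤ 2 / c * (4 ^ k)⁻¹ := by
          have j1 : Real.exp (c / 2 * r) * Real.exp (-(c * 4 ^ k * r)) ≤
              Real.exp (-(c / 2 * 4 ^ k)) := by
            rw [← Real.exp_add, Real.exp_le_exp]
            have l1 : c / 2 * r * 1 ≤ c / 2 * r * 4 ^ k := by gcongr; exact h41 k hk
            have l2 : c / 2 * 4 ^ k * 1 ≤ c / 2 * 4 ^ k * r := by gcongr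
            linarith
          have j2 := mul_exp_neg_le (c := c / 2) (x := 4 ^ k) (by positivity)
          refine j1.trans ?_
          rw [← div_eq_mul_inv, le_div_iff₀ h4, mul_comm]
          refine j2.trans (le_of_eq (inv_div _ _))
        calc _ = C * (Real.exp (c / 2 * r) * Real.exp (-(c * 4 ^ k * r))) +
              C * (4 ^ k)⁻¹ * (Real.exp (c / 2 * r) * Real.exp (-(c * r))) := by ring
          _ ≤ C * (2 / c * (4 ^ k)⁻¹) + C * (4 ^ k)⁻¹ * 1 := by gcongr
          _ = _ := by ring)
    refine (mul_le_mul_right h1 _).trans (le_of_eq ?_)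
    rw [← mul_assoc, ← ENNReal.ofReal_mul (by positivity)]
    congr 2
    field_simp

end Energy

/-! ### Exponential decay of high frequencies -/

section HighDecay

variable {d : ℕ} {χ : Sp d → ℝ}

theorem exists_high_decay (hχ : IsCutoff χ) {ν₁ ν₂ η : ℝ} (hν₁ : 0 < ν₁) (hν₂ : 0 < ν₂)
    (hη : 0 < η) : ∃ K : ℤ, ∃ b, 0 < b ∧
      ∀ {u₀ : Fin d → Dist d} {τ₀ : Fin d → Fin d → Dist d}
        {u : ℝ → Fin d → Dist d} {τ : ℝ → Fin d → Fin d → Dist d},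
        IsSolution ν₁ ν₂ η u₀ τ₀ u τ → ∀ k₁ ≥ K, ∀ p : ℝ, 1 < p → ∀ s tL : ℝ, 0 ≤ tL →
          besovOne χ (Ici k₁) (s + 1) (ENNReal.ofReal p) u₀ < ⊤ →
          besovOne χ (Ici k₁) s (ENNReal.ofReal p) (entries τ₀) < ⊤ →
          (tL = 0 → besovOne χ (Ici k₁) (s + 1) (ENNReal.ofReal p) (entries τ₀) < ⊤) →
          ∃ B, 0 ≤ B ∧ ∀ t, tL < t →
            besovOne χ (Ici k₁) (s + 1) (ENNReal.ofReal p) (pair (u t) (τ t)) ≤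
              ENNReal.ofReal (B * Real.exp (-(b * t))) := by
  obtain ⟨K, hK, C, hC, c, hc, H⟩ := exists_high_block hχ hν₁ hν₂ hη
  refine ⟨K, c / 2, by positivity, fun {u₀ τ₀ u τ} hs k₁ hk₁ p hp s tL htL fu fτ f0 => ?_⟩
  have h41 : ∀ k ∈ Ici k₁, (1 : ℝ) ≤ 4 ^ k := fun k hk =>
    one_le_zpow₀ (by norm_num) (hK.trans (hk₁.le.trans hk))
  have h21 : ∀ k ∈ Ici k₁, (1 : ℝ) ≤ 2 ^ k := fun k hk =>
    one_le_zpow₀ (by norm_num) (hK.trans (hk₁.le.trans hk))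
  have h42 : ∀ k : ℤ, (4 : ℝ) ^ k = 2 ^ k * 2 ^ k := fun k => by rw [← two_zpow_sq, sq]
  -- The norm asks for one more derivative of the stress than the basic data give. `Z` bounds the
  -- parabolic part: for `tL = 0` through the extra regularity of `τ₀`, for `tL > 0` through `4^k
  -- e^{-(c tL/2)4^k} ≲ 1` at times beyond `tL`.
  obtain ⟨Z, hZ, hZfin⟩ : ∃ Z : ℤ → ℝ≥0∞, (∀ k ∈ Ici k₁, ∀ t, tL < t →
      ENNReal.ofReal (C * 2 ^ k * Real.exp (-(c * 4 ^ k * t))) *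
        stressNorm (ENNReal.ofReal p) (blockSym χ k) τ₀ ≤
      ENNReal.ofReal (Real.exp (-(c / 2 * t))) * Z k) ∧
      ∑' k : Ici k₁, (2 : ℝ≥0∞) ^ (s * ((k : ℤ) : ℝ)) * Z k < ⊤ := by
    rcases htL.eq_or_lt with h0 | h0
    · refine ⟨fun k => ENNReal.ofReal C * (ENNReal.ofReal (2 ^ k) *
        blockNorm χ (ENNReal.ofReal p) k (entries τ₀)), fun k hk t ht => ?_, ?_⟩
      · beta_reduce
        rw [blockNorm_entries, ← mul_assoc, ← mul_assoc, ← ENNReal.ofReal_mul (by positivity),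
          ← ENNReal.ofReal_mul (by positivity)]
        refine mul_le_mul_left (ENNReal.ofReal_le_ofReal ?_) _
        have : Real.exp (-(c * 4 ^ k * t)) ≤ Real.exp (-(c / 2 * t)) := by
          refine Real.exp_le_exp.2 ?_
          have ht0 : 0 ≤ t := by linarith
          have : c * t * 1 ≤ c * t * 4 ^ k := by gcongr; exact h41 k hk
          nlinarith
        calc C * 2 ^ k * Real.exp (-(c * 4 ^ k * t)) ≤ C * 2 ^ k * Real.exp (-(c / 2 * t)) := by
              gcongr
          _ = _ := by ring
      · have e : ∀ k : Ici k₁, (2 : ℝ≥0∞) ^ (s * ((k : ℤ) : ℝ)) * (ENNReal.ofReal C *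
            (ENNReal.ofReal (2 ^ (k : ℤ)) * blockNorm χ (ENNReal.ofReal p) k (entries τ₀))) =
            ENNReal.ofReal C * (2 ^ ((s + 1) * ((k : ℤ) : ℝ)) *
              blockNorm χ (ENNReal.ofReal p) k (entries τ₀)) := by
          intro k; rw [two_rpow_mul_add_one]; ring
        simp only [e]
        rw [ENNReal.tsum_mul_left]
        exact ENNReal.mul_lt_top ENNReal.ofReal_lt_top (f0 h0.symm)
    · refine ⟨fun k => ENNReal.ofReal (C * (2 / (c * tL))) *
        blockNorm χ (ENNReal.ofReal p) k (entries τ₀), fun k hk t ht => ?_, ?_⟩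
      · beta_reduce
        rw [blockNorm_entries, ← mul_assoc, ← ENNReal.ofReal_mul (by positivity)]
        refine mul_le_mul_left (ENNReal.ofReal_le_ofReal ?_) _
        have ht0 : 0 < t := by linarith
        have j1 : Real.exp (-(c * 4 ^ k * t)) ≤
            Real.exp (-(c / 2 * t)) * Real.exp (-(c * tL / 2 * 4 ^ k)) := by
          rw [← Real.exp_add, Real.exp_le_exp]
          have l1 : c / 2 * t * 1 ≤ c / 2 * t * 4 ^ k := by gcongr; exact h41 k hk
          have l2 : c / 2 * 4 ^ k * tL ≤ c / 2 * 4 ^ k * t := by gcongr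
          linarith
        have j2 := mul_exp_neg_le (c := c * tL / 2) (x := 4 ^ k) (by positivity)
        rw [inv_div] at j2
        have j3 : (2 : ℝ) ^ k ≤ 4 ^ k := by
          rw [h42]; exact le_mul_of_one_le_left (by positivity) (h21 k hk)
        calc C * 2 ^ k * Real.exp (-(c * 4 ^ k * t))
            ≤ C * 4 ^ k * (Real.exp (-(c / 2 * t)) * Real.exp (-(c * tL / 2 * 4 ^ k))) := by gcongr
          _ = Real.exp (-(c / 2 * t)) * (C * (4 ^ k * Real.exp (-(c * tL / 2 * 4 ^ k)))) := by ring
          _ ≤ _ := by gcongr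
      · simp only [mul_left_comm _ (ENNReal.ofReal (C * (2 / (c * tL))))]
        rw [ENNReal.tsum_mul_left]
        exact ENNReal.mul_lt_top ENNReal.ofReal_lt_top fτ
  set Q := ENNReal.ofReal (2 * C) *
    (besovOne χ (Ici k₁) (s + 1) (ENNReal.ofReal p) u₀ +
      besovOne χ (Ici k₁) s (ENNReal.ofReal p) (entries τ₀)) +
    ∑' k : Ici k₁, (2 : ℝ≥0∞) ^ (s * ((k : ℤ) : ℝ)) * Z k with hQ
  have hQfin : Q < ⊤ := ENNReal.add_lt_top.2 ⟨ENNReal.mul_lt_top ENNReal.ofReal_lt_top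
    (ENNReal.add_lt_top.2 ⟨fu, fτ⟩), hZfin⟩
  refine ⟨Q.toReal, ENNReal.toReal_nonneg, fun t ht => ?_⟩
  have ht0 : 0 ≤ t := htL.trans ht.le
  rw [ENNReal.ofReal_mul ENNReal.toReal_nonneg, ENNReal.ofReal_toReal hQfin.ne, mul_comm, hQ,
    ← tsum_highData, ← ENNReal.tsum_mul_left, ← ENNReal.tsum_add, ← ENNReal.tsum_mul_left]
  unfold besovOne
  refine ENNReal.tsum_le_tsum fun ⟨k, hk⟩ => ?_
  rw [blockNorm_pair, two_rpow_mul_add_one]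
  simp only
  have hH := H hs k (hk₁.le.trans hk) _ (isLocalized_blockSym hχ k) p hp t ht0
  have h2 : (0 : ℝ) < 2 ^ k := by positivity
  have key : ENNReal.ofReal (2 ^ k) * (velNorm (ENNReal.ofReal p) (blockSym χ k) (u t) +
      stressNorm (ENNReal.ofReal p) (blockSym χ k) (τ t)) ≤
      ENNReal.ofReal (Real.exp (-(c / 2 * t))) *
        (ENNReal.ofReal (2 * C) * highData χ p u₀ τ₀ k + Z k) := by
    have ec : Real.exp (-(c * t)) ≤ Real.exp (-(c / 2 * t)) := Real.exp_le_exp.2 (by nlinarith)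
    have b2 : ENNReal.ofReal (2 ^ k) * stressNorm (ENNReal.ofReal p) (blockSym χ k) (τ t) ≤
        ENNReal.ofReal (Real.exp (-(c / 2 * t))) * Z k +
          ENNReal.ofReal (C * Real.exp (-(c / 2 * t))) * highData χ p u₀ τ₀ k := by
      refine (mul_le_mul_right hH.2 _).trans ?_
      rw [mul_add, ← mul_assoc, ← mul_assoc, ← ENNReal.ofReal_mul h2.le, ← ENNReal.ofReal_mul h2.le]
      refine add_le_add (le_trans (le_of_eq ?_) (hZ k hk t ht)) ?_
      · congr 2; ring
      · refine mul_le_mul_left (ENNReal.ofReal_le_ofReal ?_) _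
        calc 2 ^ k * (C * (4 ^ k)⁻¹ * Real.exp (-(c * t)))
            = (2 ^ k)⁻¹ * (C * Real.exp (-(c * t))) := by rw [h42]; field_simp
          _ ≤ 1 * (C * Real.exp (-(c / 2 * t))) := by
              gcongr
              exact inv_le_one_of_one_le₀ (h21 k hk)
          _ = _ := one_mul _
    rw [mul_add]
    calc _ ≤ ENNReal.ofReal (C * Real.exp (-(c / 2 * t))) * highData χ p u₀ τ₀ k +
          (ENNReal.ofReal (Real.exp (-(c / 2 * t))) * Z k +
          ENNReal.ofReal (C * Real.exp (-(c / 2 * t))) * highData χ p u₀ τ₀ k) := by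
          refine add_le_add (hH.1.trans ?_) b2
          exact mul_le_mul_left (ENNReal.ofReal_le_ofReal (by gcongr)) _
      _ = _ := by
          rw [ENNReal.ofReal_mul hC.le, ENNReal.ofReal_mul two_pos.le, ENNReal.ofReal_ofNat]
          ring
  calc _ = (2 : ℝ≥0∞) ^ (s * (k : ℝ)) * (ENNReal.ofReal (2 ^ k) *
        (velNorm (ENNReal.ofReal p) (blockSym χ k) (u t) +
          stressNorm (ENNReal.ofReal p) (blockSym χ k) (τ t))) := by rw [mul_assoc]
    _ ≤ _ := mul_le_mul_right key _
    _ = _ := by ring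

end HighDecay

/-! ### Decay up to exponentially small errors -/

section Decay

theorem exists_exp_le_bracket (a : ℝ) {b : ℝ} (hb : 0 < b) :
    ∃ C, 0 < C ∧ ∀ t, 0 ≤ t → Real.exp (-(b * t)) ≤ C * bracket t ^ (-a) := by
  obtain ⟨C, hC, h⟩ := exists_rpow_mul_exp_le a hb
  refine ⟨Real.exp b * C, by positivity, fun t ht => ?_⟩
  have h0 := bracket_pos t
  have h1 := h (bracket t) (one_le_bracket t)
  rw [Real.rpow_neg h0.le, ← div_eq_mul_inv, le_div_iff₀ (by positivity)]
  calc Real.exp (-(b * t)) * bracket t ^ a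
      ≤ (Real.exp b * Real.exp (-(b * bracket t))) * bracket t ^ a := by
        gcongr
        rw [← Real.exp_add, Real.exp_le_exp]
        nlinarith [bracket_le ht]
    _ = Real.exp b * (bracket t ^ a * Real.exp (-(b * bracket t))) := by ring
    _ ≤ _ := by gcongr

variable {k₀ : ℤ} {C c c' : ℝ} {n : ℤ → ℝ → ℝ}

/-- `N` is bounded below along a sequence of frequencies tending to `0` with bounded gaps. -/
def HasLowerSequence (N : ℤ → ℝ) : Prop :=
  ∃ M₀ : ℝ, 0 < M₀ ∧ ∃ M : ℝ, 0 < M ∧ ∃ j : ℕ → ℤ, Tendsto j atTop atBot ∧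
    (∀ k, |(j k : ℝ) - (j (k + 1) : ℝ)| ≤ M) ∧ ∀ k, M₀ ≤ N (j k)

/-- Characterization of the decay of a quantity that agrees with a weighted sum of dyadic blocks
up to an exponentially decaying error. -/
theorem DyadicDecay.decay_characterization (h : DyadicDecay k₀ C c c' n) (hC : 0 < C) (hc : 0 < c)
    (hc' : 0 < c') {σ σ₁ tL : ℝ} (hσ : σ₁ < σ) (htL : 0 ≤ tL) {F : ℝ → ℝ≥0∞} {B b : ℝ}
    (hB : 0 ≤ B) (hb : 0 < b) (hlow : ∀ t, tL < t → dyadicSum σ n t ≤ F t)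
    (hup : ∀ t, tL < t → F t ≤ dyadicSum σ n t + ENNReal.ofReal (B * Real.exp (-(b * t)))) :
    (UpperDecay F ((σ - σ₁) / 2) tL ↔ ∃ Q, ∀ k : ℤ, 2 ^ (σ₁ * k) * n k 0 ≤ Q) ∧
    (LowerDecay F ((σ - σ₁) / 2) tL → UpperDecay F ((σ - σ₁) / 2) tL →
      HasLowerSequence fun k => 2 ^ (σ₁ * (k : ℝ)) * n k 0) ∧
    ((HasLowerSequence fun k => 2 ^ (σ₁ * (k : ℝ)) * n k 0) → LowerDecay F ((σ - σ₁) / 2) tL) := by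
  have hupper : UpperDecay F ((σ - σ₁) / 2) tL → ∃ Q, ∀ k : ℤ, 2 ^ (σ₁ * k) * n k 0 ≤ Q := by
    rintro ⟨A, hA, hF⟩
    exact h.exists_bound_of_upperDecay hC hσ ⟨A, hA, fun t ht => (hlow t ht).trans (hF t ht)⟩
  refine ⟨⟨hupper, ?_⟩, ?_, ?_⟩
  · rintro ⟨Q, hQ⟩
    obtain ⟨A, hA, hu⟩ := h.upperDecay hC hc hσ hQ
    obtain ⟨D, hD, he⟩ := exists_exp_le_bracket ((σ - σ₁) / 2) hb
    refine ⟨A + B * D, by positivity, fun t ht => (hup t ht).trans ?_⟩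
    have ht0 : 0 ≤ t := htL.trans ht.le
    have hbr : 0 ≤ bracket t ^ (-((σ - σ₁) / 2)) := Real.rpow_nonneg (bracket_pos t).le _
    rw [add_mul, ENNReal.ofReal_add (by positivity) (by positivity), mul_assoc B]
    exact add_le_add (hu t ht0) (ENNReal.ofReal_le_ofReal (by gcongr; exact he t ht0))
  · rintro ⟨A, hA, hl⟩ hu
    obtain ⟨Q, hQ⟩ := hupper hu
    -- One additional power of `⟨t⟩` makes the error at most half of the assumed lower bound once `t
    -- > 2BD/A`. Enlarging `tL` is harmless, as the conclusion does not involve it.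
    obtain ⟨D, hD, he⟩ := exists_exp_le_bracket ((σ - σ₁) / 2 + 1) hb
    refine h.exists_lower_sequence hC hc hσ hQ (tL := max tL (2 * B * D / A))
      ⟨A / 2, by positivity, fun t ht => ?_⟩
    have ht1 : tL < t := (le_max_left _ _).trans_lt ht
    have ht2 : 2 * B * D / A < t := (le_max_right _ _).trans_lt ht
    have ht0 : 0 ≤ t := htL.trans ht1.le
    have hb0 := bracket_pos t
    have hbr : 0 < bracket t ^ (-((σ - σ₁) / 2)) := Real.rpow_pos_of_pos hb0 _
    have h1 : B * Real.exp (-(b * t)) ≤ A / 2 * bracket t ^ (-((σ - σ₁) / 2)) := by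
      have e1 : bracket t ^ (-((σ - σ₁) / 2 + 1)) =
          bracket t ^ (-((σ - σ₁) / 2)) * (bracket t)⁻¹ := by
        rw [neg_add, Real.rpow_add hb0, Real.rpow_neg_one]
      have e2 : B * D * (bracket t)⁻¹ ≤ A / 2 := by
        rw [← div_eq_mul_inv, div_le_iff₀ hb0]
        rw [div_lt_iff₀ hA] at ht2
        nlinarith [le_bracket t]
      calc B * Real.exp (-(b * t)) ≤ B * (D * bracket t ^ (-((σ - σ₁) / 2 + 1))) := by
            gcongr; exact he t ht0
        _ = B * D * (bracket t)⁻¹ * bracket t ^ (-((σ - σ₁) / 2)) := by rw [e1]; ring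
        _ ≤ _ := by gcongr
    have h2 := (hl t ht1).trans ((hup t ht1).trans
      (add_le_add le_rfl (ENNReal.ofReal_le_ofReal h1)))
    have e3 : A * bracket t ^ (-((σ - σ₁) / 2)) = A / 2 * bracket t ^ (-((σ - σ₁) / 2)) +
        A / 2 * bracket t ^ (-((σ - σ₁) / 2)) := by ring
    rw [e3, ENNReal.ofReal_add (by positivity) (by positivity)] at h2
    exact (ENNReal.add_le_add_iff_right ENNReal.ofReal_ne_top).1 h2
  · rintro ⟨M₀, hM₀, M, hM, j, hj, hgap, hseq⟩
    obtain ⟨A, hA, hl⟩ := h.lowerDecay hC hc' hσ htL hM₀ hj hgap hseq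
    exact ⟨A, hA, fun t ht => (hl t ht).trans (hlow t ht)⟩

end Decay

/-! ### Blocks of low-frequency parts and membership in Besov classes -/

section LowBlocks

variable {d : ℕ} {χ : Sp d → ℝ} {ι κ : Type}

theorem lowCut_sumElim (χ : Sp d → ℝ) (k₀ : ℤ) (f : ι → Dist d) (g : κ → Dist d) :
    lowCut χ k₀ (Sum.elim f g) = Sum.elim (lowCut χ k₀ f) (lowCut χ k₀ g) := by
  ext i
  cases i <;> rfl

theorem block_lowCut (hχ : IsCutoff χ) (k k₀ : ℤ) (f : ι → Dist d) (i : ι) :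
    block χ k (lowCut χ k₀ f i) = mult (fun ξ => blockSym χ k ξ * lowSym χ k₀ ξ) (f i) :=
  mult_mult (isTest_blockSym hχ k).tg (isTest_lowSym hχ k₀).tg (f i)

variable [Fintype ι] [Fintype κ]

theorem blockNorm_lowCut_velocity (hχ : IsCutoff χ) (k k₀ : ℤ) (p : ℝ≥0∞) (u : Fin d → Dist d) :
    blockNorm χ p k (lowCut χ k₀ u) =
      velNorm p (fun ξ => blockSym χ k ξ * lowSym χ k₀ ξ) u := by
  simp only [blockNorm, block_lowCut hχ]
  rfl

theorem blockNorm_lowCut_entries (hχ : IsCutoff χ) (k k₀ : ℤ) (p : ℝ≥0∞)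
    (τ : Fin d → Fin d → Dist d) : blockNorm χ p k (lowCut χ k₀ (entries τ)) =
      stressNorm p (fun ξ => blockSym χ k ξ * lowSym χ k₀ ξ) τ := by
  simp only [blockNorm, block_lowCut hχ]
  rw [Fintype.sum_prod_type]
  rfl

theorem blockNorm_lowCut_sumElim (χ : Sp d → ℝ) (k k₀ : ℤ) (p : ℝ≥0∞) (f : ι → Dist d)
    (g : κ → Dist d) : blockNorm χ p k (lowCut χ k₀ (Sum.elim f g)) =
      blockNorm χ p k (lowCut χ k₀ f) + blockNorm χ p k (lowCut χ k₀ g) := by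
  rw [lowCut_sumElim, blockNorm_sumElim]

theorem blockNorm_lowCut_eq_zero (hχ : IsCutoff χ) {k k₀ : ℤ} (h : k₀ < k) (p : ℝ≥0∞)
    (f : ι → Dist d) : blockNorm χ p k (lowCut χ k₀ f) = 0 := by
  refine Finset.sum_eq_zero fun i _ => ?_
  simp only [block_lowCut hχ, blockSym_mul_lowSym_eq_zero hχ h, mult_zero_symbol, distLp_zero]

theorem blockNorm_lowCut_le (hχ : IsCutoff χ) (k k₀ : ℤ) (f : ι → Dist d) :
    blockNorm χ 2 k (lowCut χ k₀ f) ≤ blockNorm χ 2 k f := by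
  refine Finset.sum_le_sum fun i _ => ?_
  have h := lpB_two one_pos (isTest_lowSym hχ k₀).tg (norm_lowSym_le hχ k₀) (block χ k (f i))
  rw [ENNReal.ofReal_one, one_mul] at h
  refine le_trans (le_of_eq ?_) h
  rw [block_lowCut hχ]
  have e := mult_mult (isTest_lowSym hχ k₀).tg (isTest_blockSym hχ k).tg (f i)
  refine congrArg _ (Eq.trans ?_ e.symm)
  congr 1
  ext ξ
  exact mul_comm _ _

theorem blockNorm_lt_top {S : Set ℤ} {s : ℝ} {p : ℝ≥0∞} {f : ι → Dist d}
    (h : besovOne χ S s p f < ⊤) {k : ℤ} (hk : k ∈ S) : blockNorm χ p k f < ⊤ := by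
  have h1 := (ENNReal.le_tsum (f := fun k : S => (2 : ℝ≥0∞) ^ (s * ((k : ℤ) : ℝ)) *
    blockNorm χ p k f) ⟨k, hk⟩).trans_lt h
  have h2 : (2 : ℝ≥0∞) ^ (s * (k : ℝ)) ≠ 0 := by
    simp [ENNReal.rpow_eq_zero_iff]
  exact (ENNReal.lt_top_of_mul_ne_top_right h1.ne h2)

theorem two_rpow_mul_eq_ofReal (x : ℝ) {N : ℝ≥0∞} (hN : N < ⊤) :
    (2 : ℝ≥0∞) ^ x * N = ENNReal.ofReal (2 ^ x * N.toReal) := by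
  rw [ENNReal.ofReal_mul (by positivity), ENNReal.ofReal_toReal hN.ne,
    ← ENNReal.ofReal_rpow_of_pos two_pos, ENNReal.ofReal_ofNat]

theorem memBesovSup_iff {s : ℝ} {f : ι → Dist d} (hsh : ∀ i, IsSh (f i))
    (hfin : ∀ k, blockNorm χ 2 k f < ⊤) : MemBesovSup χ s f ↔
      ∃ Q : ℝ, ∀ k : ℤ, 2 ^ (s * (k : ℝ)) * (blockNorm χ 2 k f).toReal ≤ Q := by
  simp only [MemBesovSup, two_rpow_mul_eq_ofReal _ (hfin _)]
  constructor
  · rintro ⟨-, h⟩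
    refine ⟨_, fun k => (ENNReal.ofReal_le_iff_le_toReal h.ne).1
      (le_iSup (fun k : ℤ => ENNReal.ofReal (2 ^ (s * (k : ℝ)) * (blockNorm χ 2 k f).toReal)) k)⟩
  · rintro ⟨Q, hQ⟩
    exact ⟨hsh, (iSup_le fun k => ENNReal.ofReal_le_ofReal (hQ k)).trans_lt ENNReal.ofReal_lt_top⟩

theorem memBesovBold_iff {s : ℝ} {f : ι → Dist d} (hfin : ∀ k, blockNorm χ 2 k f < ⊤) :
    MemBesovBold χ s f ↔ MemBesovSup χ s f ∧
      HasLowerSequence fun k => 2 ^ (s * (k : ℝ)) * (blockNorm χ 2 k f).toReal := by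
  have e : ∀ k : ℤ, 0 ≤ (2 : ℝ) ^ (s * (k : ℝ)) * (blockNorm χ 2 k f).toReal := fun k => by
    positivity
  simp only [MemBesovBold, HasLowerSequence, two_rpow_mul_eq_ofReal _ (hfin _),
    ENNReal.ofReal_le_ofReal_iff (e _)]

theorem HasLowerSequence.of_le {N N' : ℤ → ℝ} {A : ℝ} (hA : 0 < A) (h : HasLowerSequence N)
    (hN : ∀ k, N k ≤ A * N' k) : HasLowerSequence N' := by
  obtain ⟨M₀, hM₀, M, hM, j, hj, hgap, hseq⟩ := h
  refine ⟨M₀ / A, by positivity, M, hM, j, hj, hgap, fun k => ?_⟩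
  rw [div_le_iff₀' hA]
  exact (hseq k).trans (hN _)

theorem MemBesovSup.sumElim {s : ℝ} {f : ι → Dist d} {g : κ → Dist d} (hf : MemBesovSup χ s f)
    (hg : MemBesovSup χ s g) : MemBesovSup χ s (Sum.elim f g) := by
  refine ⟨fun i => by cases i; exacts [hf.1 _, hg.1 _], ?_⟩
  refine (iSup_le fun k => ?_).trans_lt (ENNReal.add_lt_top.2 ⟨hf.2, hg.2⟩)
  rw [blockNorm_sumElim, mul_add]
  exact add_le_add (le_iSup (fun k : ℤ => (2 : ℝ≥0∞) ^ (s * (k : ℝ)) * blockNorm χ 2 k f) k)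
    (le_iSup (fun k : ℤ => (2 : ℝ≥0∞) ^ (s * (k : ℝ)) * blockNorm χ 2 k g) k)

theorem MemBesovSup.of_sumElim {s : ℝ} {f : ι → Dist d} {g : κ → Dist d}
    (h : MemBesovSup χ s (Sum.elim f g)) : MemBesovSup χ s f := by
  refine ⟨fun i => h.1 (Sum.inl i), lt_of_le_of_lt (iSup_mono fun k => ?_) h.2⟩
  rw [blockNorm_sumElim]
  exact mul_le_mul_right le_self_add _

end LowBlocks

/-! ### Decay characterization for solutions -/

section SolutionDecay

variable {d : ℕ} {χ : Sp d → ℝ}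

/-- The `L²` norms of the dyadic blocks of the low frequencies of `(u, τ)`. -/
noncomputable def lowBlocks (χ : Sp d → ℝ) (k₀ : ℤ) (u : ℝ → Fin d → Dist d)
    (τ : ℝ → Fin d → Fin d → Dist d) (k : ℤ) (t : ℝ) : ℝ :=
  (blockNorm χ 2 k (lowCut χ k₀ (pair (u t) (τ t)))).toReal

/-- Cutting off at `k₀` only changes the localizing symbol of a block, to which the same estimates
apply; blocks above `k₀` vanish. Finiteness propagates from the data and permits real-valued norms.
-/
theorem exists_dyadicDecay (hχ : IsCutoff χ) {ν₁ ν₂ η : ℝ} (hν₁ : 0 < ν₁) (hν₂ : 0 < ν₂)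
    (hη : 0 < η) (k₀ : ℤ) : ∃ C, 0 < C ∧ ∃ c, 0 < c ∧ ∃ c', 0 < c' ∧
      ∀ {u₀ : Fin d → Dist d} {τ₀ : Fin d → Fin d → Dist d}
        {u : ℝ → Fin d → Dist d} {τ : ℝ → Fin d → Fin d → Dist d},
        IsSolution ν₁ ν₂ η u₀ τ₀ u τ → (∀ k ≤ k₀, blockNorm χ 2 k (pair u₀ τ₀) < ⊤) →
          DyadicDecay k₀ C c c' (lowBlocks χ k₀ u τ) ∧
          ∀ t, 0 ≤ t → ∀ k, blockNorm χ 2 k (lowCut χ k₀ (pair (u t) (τ t))) < ⊤ := by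
  obtain ⟨C, hC, c, hc, c', hc', H⟩ := exists_low_block hχ hν₁ hν₂ hη k₀
  refine ⟨C, hC, c, hc, c', hc', fun {u₀ τ₀ u τ} hs h0 => ?_⟩
  have e : ∀ k v T, blockNorm χ 2 k (lowCut χ k₀ (pair v T)) =
      velNorm 2 (fun ξ => blockSym χ k ξ * lowSym χ k₀ ξ) v +
        stressNorm 2 (fun ξ => blockSym χ k ξ * lowSym χ k₀ ξ) T := fun k v T => by
    rw [pair, blockNorm_lowCut_sumElim, blockNorm_lowCut_velocity hχ, blockNorm_lowCut_entries hχ]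
  have H' : ∀ k ≤ k₀, ∀ t, 0 ≤ t → blockNorm χ 2 k (lowCut χ k₀ (pair (u t) (τ t))) ≤
      ENNReal.ofReal (C * Real.exp (-(c * 4 ^ k * t))) *
        blockNorm χ 2 k (lowCut χ k₀ (pair u₀ τ₀)) ∧
      blockNorm χ 2 k (lowCut χ k₀ (pair u₀ τ₀)) ≤ ENNReal.ofReal (C * Real.exp (c' * 4 ^ k * t)) *
        blockNorm χ 2 k (lowCut χ k₀ (pair (u t) (τ t))) := fun k hk t ht => by
    simp only [e]
    exact H hs k hk _ (isLocalized_blockSym_mul_lowSym hχ k k₀) t ht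
  have hfin : ∀ t, 0 ≤ t → ∀ k, blockNorm χ 2 k (lowCut χ k₀ (pair (u t) (τ t))) < ⊤ := by
    intro t ht k
    rcases le_or_gt k k₀ with hk | hk
    · exact (H' k hk t ht).1.trans_lt (ENNReal.mul_lt_top ENNReal.ofReal_lt_top
        ((blockNorm_lowCut_le hχ k k₀ _).trans_lt (h0 k hk)))
    · rw [blockNorm_lowCut_eq_zero hχ hk]
      exact ENNReal.zero_lt_top
  have toR : ∀ {x y : ℝ≥0∞} {a : ℝ}, 0 ≤ a → y < ⊤ → x ≤ ENNReal.ofReal a * y →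
      x.toReal ≤ a * y.toReal := fun {x y a} ha hy hxy => by
    have := ENNReal.toReal_mono (ENNReal.mul_lt_top ENNReal.ofReal_lt_top hy).ne hxy
    rwa [ENNReal.toReal_mul, ENNReal.toReal_ofReal ha] at this
  have hu := hs.init_u
  have hτ := hs.init_τ
  refine ⟨⟨fun k t => ENNReal.toReal_nonneg, fun k t hk => ?_, fun k t hk ht => ?_,
    fun k t hk ht => ?_⟩, hfin⟩
  · rw [lowBlocks, blockNorm_lowCut_eq_zero hχ hk, ENNReal.toReal_zero]
  · refine toR (by positivity) (hfin 0 le_rfl k) ?_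
    rw [hu, hτ]
    exact (H' k hk t ht).1
  · refine toR (by positivity) (hfin t ht k) ?_
    rw [hu, hτ]
    exact (H' k hk t ht).2

theorem lowNorm_eq_dyadicSum {k₀ : ℤ} {u : ℝ → Fin d → Dist d} {τ : ℝ → Fin d → Fin d → Dist d}
    {t : ℝ} (h : ∀ k, blockNorm χ 2 k (lowCut χ k₀ (pair (u t) (τ t))) < ⊤) (σ : ℝ) :
    lowNorm χ k₀ σ (u t) (τ t) = dyadicSum σ (lowBlocks χ k₀ u τ) t := by
  rw [lowNorm, besovOne, tsum_univ (fun k : ℤ => (2 : ℝ≥0∞) ^ (σ * (k : ℝ)) *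
    blockNorm χ 2 k (lowCut χ k₀ (pair (u t) (τ t))))]
  exact tsum_congr fun k => two_rpow_mul_eq_ofReal _ (h k)

/-- Characterization of the decay of a functional of the solution that agrees with the norm of the
low frequencies up to an exponentially decaying error. -/
theorem decay_characterization (hχ : IsCutoff χ) {ν₁ ν₂ η : ℝ} (hν₁ : 0 < ν₁) (hν₂ : 0 < ν₂)
    (hη : 0 < η) {k₀ : ℤ} {u₀ : Fin d → Dist d} {τ₀ : Fin d → Fin d → Dist d}
    {u : ℝ → Fin d → Dist d} {τ : ℝ → Fin d → Fin d → Dist d} (hs : IsSolution ν₁ ν₂ η u₀ τ₀ u τ)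
    (h0 : ∀ k ≤ k₀, blockNorm χ 2 k (pair u₀ τ₀) < ⊤) {σ σ₁ tL : ℝ} (hσ : σ₁ < σ) (htL : 0 ≤ tL)
    {F : ℝ → ℝ≥0∞} {B b : ℝ} (hB : 0 ≤ B) (hb : 0 < b)
    (hlow : ∀ t, tL < t → lowNorm χ k₀ σ (u t) (τ t) ≤ F t)
    (hup : ∀ t, tL < t → F t ≤
      lowNorm χ k₀ σ (u t) (τ t) + ENNReal.ofReal (B * Real.exp (-(b * t)))) :
    (UpperDecay F ((σ - σ₁) / 2) tL ↔ MemBesovSup χ σ₁ (lowCut χ k₀ (pair u₀ τ₀))) ∧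
    (LowerDecay F ((σ - σ₁) / 2) tL → UpperDecay F ((σ - σ₁) / 2) tL →
      MemBesovBold χ σ₁ (lowCut χ k₀ (pair u₀ τ₀))) ∧
    (∀ Z₀ : Fin d → Dist d, IsLerayRieszDiv τ₀ Z₀ →
      MemBesovBold χ σ₁ (lowCut χ k₀ (Sum.elim u₀ Z₀)) →
      MemBesovSup χ σ₁ (lowCut χ k₀ (entries τ₀)) →
        LowerDecay F ((σ - σ₁) / 2) tL ∧ UpperDecay F ((σ - σ₁) / 2) tL) := by
  obtain ⟨C, hC, c, hc, c', hc', H⟩ := exists_dyadicDecay hχ hν₁ hν₂ hη k₀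
  obtain ⟨hD, hfin⟩ := H hs h0
  have hfin0 : ∀ k, blockNorm χ 2 k (lowCut χ k₀ (pair u₀ τ₀)) < ⊤ := fun k => by
    simpa only [hs.init_u, hs.init_τ] using hfin 0 le_rfl k
  have hn0 : ∀ k, lowBlocks χ k₀ u τ k 0 =
      (blockNorm χ 2 k (lowCut χ k₀ (pair u₀ τ₀))).toReal := fun k => by
    rw [lowBlocks, hs.init_u, hs.init_τ]
  have hsh : ∀ i, IsSh (lowCut χ k₀ (pair u₀ τ₀) i) := by
    rintro (i | ⟨i, j⟩)
    · have := hs.sh_u 0 le_rfl i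
      rw [hs.init_u] at this
      exact this.lowCut hχ k₀
    · have := hs.sh_τ 0 le_rfl i j
      rw [hs.init_τ] at this
      exact this.lowCut hχ k₀
  have hlow' : ∀ t, tL < t → dyadicSum σ (lowBlocks χ k₀ u τ) t ≤ F t := fun t ht => by
    rw [← lowNorm_eq_dyadicSum (hfin t (htL.trans ht.le))]
    exact hlow t ht
  have hup' : ∀ t, tL < t → F t ≤ dyadicSum σ (lowBlocks χ k₀ u τ) t +
      ENNReal.ofReal (B * Real.exp (-(b * t))) := fun t ht => by
    rw [← lowNorm_eq_dyadicSum (hfin t (htL.trans ht.le))]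
    exact hup t ht
  obtain ⟨g1, g2, g3⟩ := hD.decay_characterization hC hc hc' hσ htL hB hb hlow' hup'
  simp only [hn0] at g1 g2 g3
  rw [← memBesovSup_iff hsh hfin0] at g1
  refine ⟨g1, fun hl hu => (memBesovBold_iff hfin0).2 ⟨g1.1 hu, g2 hl hu⟩, ?_⟩
  intro Z₀ hZ hbold hsup
  obtain ⟨D, hDpos, hR⟩ := exists_lerayRieszDiv_le hχ
  have e2 : ENNReal.ofReal 2 = 2 := by simp
  -- Blocks of `Z₀` are controlled by blocks of `τ₀`, so a lower sequence for `(u₀, Z₀)` is, up to a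
  -- constant, one for `(u₀, τ₀)`.
  have hle : ∀ k, blockNorm χ 2 k (lowCut χ k₀ (Sum.elim u₀ Z₀)) ≤
      ENNReal.ofReal (1 + D) * blockNorm χ 2 k (lowCut χ k₀ (pair u₀ τ₀)) := by
    intro k
    have hloc := isLocalized_blockSym_mul_lowSym hχ k k₀
    have h1 := hR k 2 one_lt_two _ hloc.1 hloc.2 τ₀ Z₀ hZ
    rw [e2] at h1
    rw [pair, blockNorm_lowCut_sumElim, blockNorm_lowCut_sumElim, blockNorm_lowCut_velocity hχ k k₀ 2 Z₀,
      blockNorm_lowCut_entries hχ, mul_add]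
    refine add_le_add (le_mul_of_one_le_left' ?_) (h1.trans (mul_le_mul_left ?_ _))
    · rw [ENNReal.one_le_ofReal]; linarith
    · exact ENNReal.ofReal_le_ofReal (by linarith)
  have hfinZ : ∀ k, blockNorm χ 2 k (lowCut χ k₀ (Sum.elim u₀ Z₀)) < ⊤ := fun k =>
    (hle k).trans_lt (ENNReal.mul_lt_top ENNReal.ofReal_lt_top (hfin0 k))
  obtain ⟨hZsup, hZseq⟩ := (memBesovBold_iff hfinZ).1 hbold
  refine ⟨g3 (hZseq.of_le (A := 1 + D) (by positivity) fun k => ?_), g1.2 ?_⟩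
  · have h1 := ENNReal.toReal_mono
      (ENNReal.mul_lt_top ENNReal.ofReal_lt_top (hfin0 k)).ne (hle k)
    rw [ENNReal.toReal_mul, ENNReal.toReal_ofReal (by positivity)] at h1
    calc _ ≤ (2 : ℝ) ^ (σ₁ * (k : ℝ)) * ((1 + D) *
          (blockNorm χ 2 k (lowCut χ k₀ (pair u₀ τ₀))).toReal) := by gcongr
      _ = _ := by ring
  · rw [lowCut_sumElim] at hZsup
    rw [pair, lowCut_sumElim]
    exact hZsup.of_sumElim.sumElim hsup

end SolutionDecay

end OldroydB

/-! ### The proposition -/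

open OldroydB in
theorem proposition2p2 (d : ℕ) (hd : 2 ≤ d) (p : ℝ) (hp : Admissible d p)
    (ν₁ ν₂ η : ℝ) (hν₁ : 0 < ν₁) (hν₂ : 0 < ν₂) (hη : 0 < η)
    (χ : Sp d → ℝ) (hχ : IsCutoff χ) :
    ∃ K : ℤ, ∀ k₀ : ℤ, K ≤ k₀ →
      -- uniform critical energy bound
      (∃ C : ℝ, 0 < C ∧ ∃ A : ℝ, 0 < A ∧
        ∀ (u₀ : Fin d → Dist d) (τ₀ : Fin d → Fin d → Dist d)
          (u : ℝ → Fin d → Dist d) (τ : ℝ → Fin d → Fin d → Dist d),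
          IsSolution ν₁ ν₂ η u₀ τ₀ u τ → ∀ t : ℝ, 0 < t →
            linearEnergy χ k₀ p C u τ t ≤ ENNReal.ofReal A * initialEnergy χ k₀ p u₀ τ₀) ∧
      -- decay of the low frequencies
      (∀ (u₀ : Fin d → Dist d) (τ₀ : Fin d → Fin d → Dist d)
          (u : ℝ → Fin d → Dist d) (τ : ℝ → Fin d → Fin d → Dist d),
          IsSolution ν₁ ν₂ η u₀ τ₀ u τ → initialEnergy χ k₀ p u₀ τ₀ < ⊤ →
          ∀ σ σ₁ tL : ℝ, (d : ℝ) / 2 - 2 * d / p ≤ σ₁ → σ₁ < (d : ℝ) / 2 - 1 → σ₁ < σ → 0 ≤ tL →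
            (UpperDecay (fun t => lowNorm χ k₀ σ (u t) (τ t)) ((σ - σ₁) / 2) tL ↔
              MemBesovSup χ σ₁ (lowCut χ k₀ (pair u₀ τ₀))) ∧
            (LowerDecay (fun t => lowNorm χ k₀ σ (u t) (τ t)) ((σ - σ₁) / 2) tL →
              UpperDecay (fun t => lowNorm χ k₀ σ (u t) (τ t)) ((σ - σ₁) / 2) tL →
                MemBesovBold χ σ₁ (lowCut χ k₀ (pair u₀ τ₀))) ∧
            (∀ Z₀ : Fin d → Dist d, IsLerayRieszDiv τ₀ Z₀ →
              MemBesovBold χ σ₁ (lowCut χ k₀ (Sum.elim u₀ Z₀)) →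
              MemBesovSup χ σ₁ (lowCut χ k₀ (entries τ₀)) →
                LowerDecay (fun t => lowNorm χ k₀ σ (u t) (τ t)) ((σ - σ₁) / 2) tL ∧
                UpperDecay (fun t => lowNorm χ k₀ σ (u t) (τ t)) ((σ - σ₁) / 2) tL)) ∧
      -- decay of the hybrid norm
      (∀ (u₀ : Fin d → Dist d) (τ₀ : Fin d → Fin d → Dist d)
          (u : ℝ → Fin d → Dist d) (τ : ℝ → Fin d → Fin d → Dist d),
          IsSolution ν₁ ν₂ η u₀ τ₀ u τ →
          ∀ σ σ₁ tL : ℝ, σ₁ < σ → 0 ≤ tL →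
            besovOne χ (Set.Iic k₀) σ 2 (pair u₀ τ₀) < ⊤ →
            besovOne χ (Set.Ici (k₀ - 1)) ((d : ℝ) / p + 1) (ENNReal.ofReal p) u₀ < ⊤ →
            besovOne χ (Set.Ici (k₀ - 1)) ((d : ℝ) / p) (ENNReal.ofReal p) (entries τ₀) < ⊤ →
            (tL = 0 →
              besovOne χ (Set.Ici (k₀ - 1)) ((d : ℝ) / p + 1) (ENNReal.ofReal p) (entries τ₀) < ⊤) →
            (UpperDecay (fun t => hybridNorm χ k₀ p σ (u t) (τ t)) ((σ - σ₁) / 2) tL ↔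
              MemBesovSup χ σ₁ (lowCut χ k₀ (pair u₀ τ₀))) ∧
            (LowerDecay (fun t => hybridNorm χ k₀ p σ (u t) (τ t)) ((σ - σ₁) / 2) tL →
              UpperDecay (fun t => hybridNorm χ k₀ p σ (u t) (τ t)) ((σ - σ₁) / 2) tL →
                MemBesovBold χ σ₁ (lowCut χ k₀ (pair u₀ τ₀))) ∧
            (∀ Z₀ : Fin d → Dist d, IsLerayRieszDiv τ₀ Z₀ →
              MemBesovBold χ σ₁ (lowCut χ k₀ (Sum.elim u₀ Z₀)) →
              MemBesovSup χ σ₁ (lowCut χ k₀ (entries τ₀)) →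
                LowerDecay (fun t => hybridNorm χ k₀ p σ (u t) (τ t)) ((σ - σ₁) / 2) tL ∧
                UpperDecay (fun t => hybridNorm χ k₀ p σ (u t) (τ t)) ((σ - σ₁) / 2) tL)) := by
  obtain ⟨K₁, C, hC, A₁, hA₁, hhigh⟩ := exists_high_energy hχ hν₁ hν₂ hη
  obtain ⟨K₂, b, hb, hdecay⟩ := exists_high_decay hχ hν₁ hν₂ hη
  have hp1 : 1 < p := one_lt_two.trans_le hp.1
  -- The high-frequency norms start at `k₀ - 1`, hence the threshold is one larger.
  refine ⟨max K₁ K₂ + 1, fun k₀ hk₀ => ⟨?_, ?_, ?_⟩⟩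
  · obtain ⟨A₂, hA₂, hlow⟩ := exists_low_energy hχ hν₁ hν₂ hη k₀
    refine ⟨C, hC, A₁ + A₂, by positivity, fun u₀ τ₀ u τ hs t _ => ?_⟩
    have h1 := hlow hs ((d : ℝ) / 2 - 1) t
    rw [show (d : ℝ) / 2 - 1 + 2 = d / 2 + 1 by ring] at h1
    have h2 := hhigh hs (k₀ - 1) (by have := le_max_left K₁ K₂; omega) p hp1 ((d : ℝ) / p) t
    rw [linearEnergy, initialEnergy, add_assoc (_ + _), add_assoc (_ + _),
      ← add_assoc (cheminLerner _ _ _ _ _ _ _ _), add_assoc (besovOne _ _ _ _ _), mul_add]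
    refine add_le_add (h1.trans ?_) (h2.trans ?_)
    · gcongr; linarith
    · gcongr; linarith
  · intro u₀ τ₀ u τ hs hE σ σ₁ tL _ _ hσ htL
    have hE' := (ENNReal.add_lt_top.1 (ENNReal.add_lt_top.1 hE).1).1
    -- The functional is the low-frequency norm itself: error constant `B = 0`, with an arbitrary
    -- rate.
    exact decay_characterization hχ hν₁ hν₂ hη hs (fun k hk => blockNorm_lt_top hE' hk) hσ htL
      le_rfl one_pos (fun _ _ => le_rfl) fun _ _ => le_self_add
  · intro u₀ τ₀ u τ hs σ σ₁ tL hσ htL hl hu hτ h0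
    -- The high-frequency part of the hybrid norm is the exponentially decaying error.
    obtain ⟨B, hB, hBd⟩ := hdecay hs (k₀ - 1) (by have := le_max_right K₁ K₂; omega) p hp1
      ((d : ℝ) / p) tL htL hu hτ h0
    exact decay_characterization hχ hν₁ hν₂ hη hs (fun k hk => blockNorm_lt_top hl hk) hσ htL
      hB hb (fun _ _ => le_self_add) fun t ht => add_le_add le_rfl (hBd t ht)
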